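/- **Theorem (Composition).** All Hilbert spaces are complex and separable. A *Banach operator ideal* $\mathscr I$ assigns to any two Hilbert spaces $E,F$ a set $\mathscr I(E,F)\subset\mathscr L(E,F)$, complete in a norm $\|\cdot\|_{\mathscr I}$, containing all finite rank operators, closed under sums, with $GAH\in\mathscr I$ and $\|GAH\|_{\mathscr I}\le\|G\|\,\|A\|_{\mathscr I}\,\|H\|$ for $A\in\mathscr I$ and bounded $G,H$, and $\|e'\otimes f\|_{\mathscr I}=\|e'\|\,\|f\|$. A *strongly continuous group action* on $E$ is a representation $\varrho\mapsto\kappa_\varrho$ of $(\mathbb R_+,\cdot)$ in $\mathscr L(E)$ that is strongly continuous. Write $\langle\eta\rangle=(1+|\eta|^2)^{1/2}$ and $D=-i\partial$, and fix $0\le\delta<\varrho\le1$. For $\vec\mu=(\mu_1,\mu_2)\in\mathbb R^2$ let $S^{\vec\mu}_{\varrho,\delta}(\mathbb R^q\times\mathbb R^q;(E,\kappa),(F,\kappa'))_{\mathscr I}$ be the space of all $a\in C^\infty(\mathbb R^q\times\mathbb R^q,\mathscr I(E,F))$ such that for all $\alpha,\beta\in\mathbb N_0^q$ there is a constant $C_{\alpha,\beta}$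 with $$\|\kappa'^{-1}_{\langle\eta\rangle}[D_y^\beta\partial_\eta^\alpha a(y,\eta)]\kappa_{\langle\eta\rangle}\|_{\mathscr I(E,F)}\le C_{\alpha,\beta}\langle y\rangle^{\mu_2}\langle\eta\rangle^{\mu_1-\varrho|\alpha|+\delta|\beta|}$$ for all $y,\eta$, with the topology given by the best constants as seminorms. For $\tau\in\mathbb R$ and $u\in\mathscr S(\mathbb R^q,E)$ put $$\mathrm{Op}_\tau(a)u(y)=(2\pi)^{-q}\int_{\mathbb R^q}\int_{\mathbb R^q}e^{i(y-y')\eta}a(\tau y'+(1-\tau)y,\eta)u(y')\,dy'\,d\eta .$$ Let $\Psi^{\vec\mu}_{\varrho,\delta}(\mathbb R^q;(E,\kappa),(F,\kappa'))_{\mathscr I}$ be the space of all operators $\mathrm{Op}_\tau(a):\mathscr S(\mathbb R^q,E)\to\mathscr S(\mathbb R^q,F)$ with $a$ in this symbol space, with the topology transferred from the symbols by $a\mapsto\mathrm{Op}_\tau(a)$. Let $\mathscr I_1,\mathscr I_2,\mathscr I_3$ be Banach operator ideals such that composition of operators is continuous $\mathscr I_1\times\mathscr I_2\to\mathscr I_3$,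 let $E,\tilde E,\hat E$ be Hilbert spaces with strongly continuous group actions $\kappa,\tilde\kappa,\hat\kappa$, and let $\vec\mu_1,\vec\mu_2\in\mathbb R^2$. Consider the three classes $\Psi^{\vec\mu_1}_{\varrho,\delta}(\mathbb R^q;(\tilde E,\tilde\kappa),(\hat E,\hat\kappa))_{\mathscr I_1}$, $\Psi^{\vec\mu_2}_{\varrho,\delta}(\mathbb R^q;(E,\kappa),(\tilde E,\tilde\kappa))_{\mathscr I_2}$ and $\Psi^{\vec\mu_1+\vec\mu_2}_{\varrho,\delta}(\mathbb R^q;(E,\kappa),(\hat E,\hat\kappa))_{\mathscr I_3}$. 1. For these three classes and each $\tau\in\mathbb R$, the integral defining $\mathrm{Op}_\tau(a)u(y)$ converges (as an iterated integral) and $a\mapsto\mathrm{Op}_\tau(a)$ is a well-defined bijection of the symbol space onto the operator space, whose elements are continuous operators between the Schwartz spaces. 2. If $A\in\Psi^{\vec\mu_1}_{\varrho,\delta}(\mathbb R^q;(\tilde E,\tilde\kappa),(\hat E,\hat\kappa))_{\mathscr I_1}$ and $B\in\Psi^{\vec\mu_2}_{\varrho,\delta}(\mathbb R^q;(E,\kappa),(\tilde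 E,\tilde\kappa))_{\mathscr I_2}$, then $A\circ B\in\Psi^{\vec\mu_1+\vec\mu_2}_{\varrho,\delta}(\mathbb R^q;(E,\kappa),(\hat E,\hat\kappa))_{\mathscr I_3}$, and the map $(A,B)\mapsto A\circ B$ is bilinear and continuous in the operator space topologies. This holds whichever quantization parameters $\tau_1,\tau_2,\tau_3\in\mathbb R$ are used to form the three operator spaces. 3. If $A=\mathrm{Op}_0(a)$ and $B=\mathrm{Op}_0(b)$ with symbols $a,b$ of these classes, then $A\circ B=\mathrm{Op}_0(a\#b)$ with a symbol $a\#b\in S^{\vec\mu_1+\vec\mu_2}_{\varrho,\delta}(\mathbb R^q\times\mathbb R^q;(E,\kappa),(\hat E,\hat\kappa))_{\mathscr I_3}$ that has the asymptotic expansion $a\#b\sim\sum_{\alpha}\frac1{\alpha!}(\partial_\eta^\alpha a)(D_y^\alpha b)$, i.e. for every $N\in\mathbb N_0$ $$a\#b-\sum_{|\alpha|<N}\frac1{\alpha!}(\partial_\eta^\alpha a)(D_y^\alpha b)\in S^{\vec\mu_1+\vec\mu_2-((\varrho-\delta)N,0)}_{\varrho,\delta}(\mathbb R^q\times\mathbb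 R^q;(E,\kappa),(\hat E,\hat\kappa))_{\mathscr I_3}.$$ -/

import Mathlib

open MeasureTheory
open scoped SchwartzMap ContDiff

universe u

noncomputable section

namespace EdgeCalculus

/-! ### Banach operator ideals in the category of complex separable Hilbert spaces -/

/-- A Banach operator ideal: for any two complex separable Hilbert spaces `E`, `F` a set
`carrier E F` of bounded operators, with a norm `nrm` on it (the values of `nrm` outside of the
carrier are irrelevant), subject to the usual axioms. -/
structure BanachOperatorIdeal where
  carrier : ∀ (E F : Type u)
    [NormedAddCommGroup E] [InnerProductSpace ℂ E] [CompleteSpace E]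
    [TopologicalSpace.SeparableSpace E]
    [NormedAddCommGroup F] [InnerProductSpace ℂ F] [CompleteSpace F]
    [TopologicalSpace.SeparableSpace F], Set (E →L[ℂ] F)
  nrm : ∀ (E F : Type u)
    [NormedAddCommGroup E] [InnerProductSpace ℂ E] [CompleteSpace E]
    [TopologicalSpace.SeparableSpace E]
    [NormedAddCommGroup F] [InnerProductSpace ℂ F] [CompleteSpace F]
    [TopologicalSpace.SeparableSpace F], (E →L[ℂ] F) → ℝ
  finiteRank_mem : ∀ {E F : Type u}
    [NormedAddCommGroup E] [InnerProductSpace ℂ E] [CompleteSpace E]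
    [TopologicalSpace.SeparableSpace E]
    [NormedAddCommGroup F] [InnerProductSpace ℂ F] [CompleteSpace F]
    [TopologicalSpace.SeparableSpace F] (A : E →L[ℂ] F),
    FiniteDimensional ℂ (LinearMap.range (A : E →ₗ[ℂ] F)) → A ∈ carrier E F
  add_mem : ∀ {E F : Type u}
    [NormedAddCommGroup E] [InnerProductSpace ℂ E] [CompleteSpace E]
    [TopologicalSpace.SeparableSpace E]
    [NormedAddCommGroup F] [InnerProductSpace ℂ F] [CompleteSpace F]
    [TopologicalSpace.SeparableSpace F] {A B : E →L[ℂ] F},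
    A ∈ carrier E F → B ∈ carrier E F → A + B ∈ carrier E F
  comp_mem : ∀ {E₀ E F E₁ : Type u}
    [NormedAddCommGroup E₀] [InnerProductSpace ℂ E₀] [CompleteSpace E₀]
    [TopologicalSpace.SeparableSpace E₀]
    [NormedAddCommGroup E] [InnerProductSpace ℂ E] [CompleteSpace E]
    [TopologicalSpace.SeparableSpace E]
    [NormedAddCommGroup F] [InnerProductSpace ℂ F] [CompleteSpace F]
    [TopologicalSpace.SeparableSpace F]
    [NormedAddCommGroup E₁] [InnerProductSpace ℂ E₁] [CompleteSpace E₁]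
    [TopologicalSpace.SeparableSpace E₁]
    (G : F →L[ℂ] E₁) {A : E →L[ℂ] F} (H : E₀ →L[ℂ] E),
    A ∈ carrier E F → G ∘L A ∘L H ∈ carrier E₀ E₁
  nrm_nonneg : ∀ {E F : Type u}
    [NormedAddCommGroup E] [InnerProductSpace ℂ E] [CompleteSpace E]
    [TopologicalSpace.SeparableSpace E]
    [NormedAddCommGroup F] [InnerProductSpace ℂ F] [CompleteSpace F]
    [TopologicalSpace.SeparableSpace F] {A : E →L[ℂ] F},
    A ∈ carrier E F → 0 ≤ nrm E F A
  eq_zero_of_nrm : ∀ {E F : Type u}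
    [NormedAddCommGroup E] [InnerProductSpace ℂ E] [CompleteSpace E]
    [TopologicalSpace.SeparableSpace E]
    [NormedAddCommGroup F] [InnerProductSpace ℂ F] [CompleteSpace F]
    [TopologicalSpace.SeparableSpace F] {A : E →L[ℂ] F},
    A ∈ carrier E F → nrm E F A = 0 → A = 0
  nrm_smul : ∀ {E F : Type u}
    [NormedAddCommGroup E] [InnerProductSpace ℂ E] [CompleteSpace E]
    [TopologicalSpace.SeparableSpace E]
    [NormedAddCommGroup F] [InnerProductSpace ℂ F] [CompleteSpace F]
    [TopologicalSpace.SeparableSpace F] (c : ℂ) {A : E →L[ℂ] F},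
    A ∈ carrier E F → nrm E F (c • A) = ‖c‖ * nrm E F A
  nrm_add_le : ∀ {E F : Type u}
    [NormedAddCommGroup E] [InnerProductSpace ℂ E] [CompleteSpace E]
    [TopologicalSpace.SeparableSpace E]
    [NormedAddCommGroup F] [InnerProductSpace ℂ F] [CompleteSpace F]
    [TopologicalSpace.SeparableSpace F] {A B : E →L[ℂ] F},
    A ∈ carrier E F → B ∈ carrier E F → nrm E F (A + B) ≤ nrm E F A + nrm E F B
  nrm_rankOne : ∀ {E F : Type u}
    [NormedAddCommGroup E] [InnerProductSpace ℂ E] [CompleteSpace E]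
    [TopologicalSpace.SeparableSpace E]
    [NormedAddCommGroup F] [InnerProductSpace ℂ F] [CompleteSpace F]
    [TopologicalSpace.SeparableSpace F] (e : E →L[ℂ] ℂ) (f : F),
    nrm E F (e.smulRight f) = ‖e‖ * ‖f‖
  nrm_comp_le : ∀ {E₀ E F E₁ : Type u}
    [NormedAddCommGroup E₀] [InnerProductSpace ℂ E₀] [CompleteSpace E₀]
    [TopologicalSpace.SeparableSpace E₀]
    [NormedAddCommGroup E] [InnerProductSpace ℂ E] [CompleteSpace E]
    [TopologicalSpace.SeparableSpace E]
    [NormedAddCommGroup F] [InnerProductSpace ℂ F] [CompleteSpace F]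
    [TopologicalSpace.SeparableSpace F]
    [NormedAddCommGroup E₁] [InnerProductSpace ℂ E₁] [CompleteSpace E₁]
    [TopologicalSpace.SeparableSpace E₁]
    (G : F →L[ℂ] E₁) {A : E →L[ℂ] F} (H : E₀ →L[ℂ] E),
    A ∈ carrier E F → nrm E₀ E₁ (G ∘L A ∘L H) ≤ ‖G‖ * nrm E F A * ‖H‖
  /-- Completeness of `carrier E F` in the norm `nrm E F`. -/
  complete : ∀ {E F : Type u}
    [NormedAddCommGroup E] [InnerProductSpace ℂ E] [CompleteSpace E]
    [TopologicalSpace.SeparableSpace E]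
    [NormedAddCommGroup F] [InnerProductSpace ℂ F] [CompleteSpace F]
    [TopologicalSpace.SeparableSpace F] (A : ℕ → E →L[ℂ] F),
    (∀ n, A n ∈ carrier E F) →
    (∀ ε > 0, ∃ N, ∀ m ≥ N, ∀ n ≥ N, nrm E F (A m - A n) < ε) →
    ∃ L ∈ carrier E F, ∀ ε > 0, ∃ N, ∀ n ≥ N, nrm E F (A n - L) < ε

section Ideal

variable (I : BanachOperatorIdeal.{u}) (E F : Type u)
  [NormedAddCommGroup E] [InnerProductSpace ℂ E] [CompleteSpace E]
  [TopologicalSpace.SeparableSpace E]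
  [NormedAddCommGroup F] [InnerProductSpace ℂ F] [CompleteSpace F]
  [TopologicalSpace.SeparableSpace F]

/-- The vector space underlying `I(E, F)`. -/
def BanachOperatorIdeal.submodule : Submodule ℂ (E →L[ℂ] F) where
  carrier := I.carrier E F
  add_mem' := fun ha hb => I.add_mem ha hb
  zero_mem' := I.finiteRank_mem 0 (by
    have : LinearMap.range ((0 : E →L[ℂ] F) : E →ₗ[ℂ] F) = ⊥ := by
      simp
    rw [this]; infer_instance)
  smul_mem' := fun c A hA => by
    have h := I.comp_mem (c • ContinuousLinearMap.id ℂ F) (ContinuousLinearMap.id ℂ E) hA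
    have e : (c • ContinuousLinearMap.id ℂ F) ∘L A ∘L (ContinuousLinearMap.id ℂ E) = c • A := by
      ext x; simp
    rwa [e] at h

/-- The Banach space `I(E, F)`; its norm is the norm of the ideal, not the operator norm. -/
def BanachOperatorIdeal.Ops : Type u := I.submodule E F

instance : AddCommGroup (I.Ops E F) := inferInstanceAs (AddCommGroup (I.submodule E F))

instance : Module ℂ (I.Ops E F) := inferInstanceAs (Module ℂ (I.submodule E F))

instance : Norm (I.Ops E F) := ⟨fun A => I.nrm E F A.1⟩

theorem BanachOperatorIdeal.opsCore : NormedSpace.Core ℂ (I.Ops E F) where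
  norm_nonneg A := I.nrm_nonneg A.2
  norm_smul c A := I.nrm_smul c A.2
  norm_triangle A B := I.nrm_add_le A.2 B.2
  norm_eq_zero_iff A := by
    constructor
    · intro h
      exact Subtype.ext (I.eq_zero_of_nrm A.2 h)
    · rintro rfl
      have h := I.nrm_smul (E := E) (F := F) 0 (A := 0) (I.submodule E F).zero_mem
      have h' : I.nrm E F 0 = 0 := by simpa using h
      exact h'

instance : NormedAddCommGroup (I.Ops E F) := NormedAddCommGroup.ofCore (I.opsCore E F)

instance : NormedSpace ℂ (I.Ops E F) := NormedSpace.ofCore (I.opsCore E F)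

end Ideal

/-- Composition of operators is continuous `I₁ × I₂ → I₃`: for all Hilbert spaces `E`, `F`, `G` it
maps `I₁(F, G) × I₂(E, F)` into `I₃(E, G)`, continuously for the norms of the ideals. -/
structure ComposesContinuously (I₁ I₂ I₃ : BanachOperatorIdeal.{u}) : Prop where
  mem : ∀ {E F G : Type u}
    [NormedAddCommGroup E] [InnerProductSpace ℂ E] [CompleteSpace E]
    [TopologicalSpace.SeparableSpace E]
    [NormedAddCommGroup F] [InnerProductSpace ℂ F] [CompleteSpace F]
    [TopologicalSpace.SeparableSpace F]
    [NormedAddCommGroup G] [InnerProductSpace ℂ G] [CompleteSpace G]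
    [TopologicalSpace.SeparableSpace G] {A : F →L[ℂ] G} {B : E →L[ℂ] F},
    A ∈ I₁.submodule F G → B ∈ I₂.submodule E F → A ∘L B ∈ I₃.submodule E G
  continuous : ∀ {E F G : Type u}
    [NormedAddCommGroup E] [InnerProductSpace ℂ E] [CompleteSpace E]
    [TopologicalSpace.SeparableSpace E]
    [NormedAddCommGroup F] [InnerProductSpace ℂ F] [CompleteSpace F]
    [TopologicalSpace.SeparableSpace F]
    [NormedAddCommGroup G] [InnerProductSpace ℂ G] [CompleteSpace G]
    [TopologicalSpace.SeparableSpace G],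
    Continuous (fun p : I₁.Ops F G × I₂.Ops E F =>
      (⟨p.1.1 ∘L p.2.1, mem p.1.2 p.2.2⟩ : I₃.Ops E G))

/-- The composition `I₁(F, G) × I₂(E, F) → I₃(E, G)`. -/
def ComposesContinuously.comp {I₁ I₂ I₃ : BanachOperatorIdeal.{u}}
    (h : ComposesContinuously I₁ I₂ I₃) {E F G : Type u}
    [NormedAddCommGroup E] [InnerProductSpace ℂ E] [CompleteSpace E]
    [TopologicalSpace.SeparableSpace E]
    [NormedAddCommGroup F] [InnerProductSpace ℂ F] [CompleteSpace F]
    [TopologicalSpace.SeparableSpace F]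
    [NormedAddCommGroup G] [InnerProductSpace ℂ G] [CompleteSpace G]
    [TopologicalSpace.SeparableSpace G] (A : I₁.Ops F G) (B : I₂.Ops E F) : I₃.Ops E G :=
  ⟨A.1 ∘L B.1, h.mem A.2 B.2⟩

/-! ### Strongly continuous group actions -/

/-- A strongly continuous group action `(κ_ϱ)_{ϱ > 0}` on `E`: a representation of the
multiplicative group of positive reals by bounded operators, continuous in the strong operator
topology. -/
structure GroupAction (E : Type u) [NormedAddCommGroup E] [InnerProductSpace ℂ E] where
  toHom : {r : ℝ // 0 < r} →* (E →L[ℂ] E)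
  continuous_apply : ∀ e : E, Continuous fun r => toHom r e

/-! ### Partial derivatives -/

/-- `ℝ^q` with the Euclidean norm. -/
abbrev Rq (q : ℕ) : Type := EuclideanSpace ℝ (Fin q)

/-- `⟨η⟩ = (1 + |η|²)^{1/2}`, as a positive real number. -/
def bracket {q : ℕ} (η : Rq q) : {r : ℝ // 0 < r} := ⟨√(1 + ‖η‖ ^ 2), by positivity⟩

/-- Length `|α|` of a multi-index. -/
def mlen {q : ℕ} (α : Fin q → ℕ) : ℕ := ∑ i, α i

/-- `α!` of a multi-index. -/
def mfact {q : ℕ} (α : Fin q → ℕ) : ℕ := ∏ i, (α i).factorial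

section Derivatives

variable {V W : Type*} [NormedAddCommGroup V] [NormedSpace ℝ V] [NormedAddCommGroup W]
  [NormedSpace ℂ W]

/-- The derivative in direction `v`. -/
def dirDeriv (v : V) (f : V → W) : V → W := fun x => fderiv ℝ f x v

/-- The derivative of multi-order `α` in the directions `e 0, …, e (q - 1)`. -/
def multiDeriv {q : ℕ} (e : Fin q → V) (α : Fin q → ℕ) (f : V → W) : V → W :=
  (List.finRange q).foldr (fun i g => (dirDeriv (e i))^[α i] g) f

theorem dirDeriv_smooth (v : V) {f : V → W} (hf : ContDiff ℝ ∞ f) :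
    ContDiff ℝ ∞ (dirDeriv v f) :=
  (hf.fderiv_right (m := ∞) (by simp)).clm_apply contDiff_const

theorem dirDeriv_add (v : V) {f g : V → W} (hf : ContDiff ℝ ∞ f) (hg : ContDiff ℝ ∞ g) :
    dirDeriv v (f + g) = dirDeriv v f + dirDeriv v g := by
  funext x
  have h := fderiv_add (hf.differentiable (by simp) x) (hg.differentiable (by simp) x)
  simp [dirDeriv, h]

theorem dirDeriv_smul (v : V) (c : ℂ) {f : V → W} (hf : ContDiff ℝ ∞ f) :
    dirDeriv v (c • f) = c • dirDeriv v f := by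
  funext x
  have h := fderiv_const_smul (hf.differentiable (by simp) x) c
  simp [dirDeriv, h]

theorem iterate_dirDeriv (v : V) (n : ℕ) :
    (∀ f : V → W, ContDiff ℝ ∞ f → ContDiff ℝ ∞ ((dirDeriv v)^[n] f)) ∧
    (∀ f g : V → W, ContDiff ℝ ∞ f → ContDiff ℝ ∞ g →
      (dirDeriv v)^[n] (f + g) = (dirDeriv v)^[n] f + (dirDeriv v)^[n] g) ∧
    (∀ (c : ℂ) (f : V → W), ContDiff ℝ ∞ f →
      (dirDeriv v)^[n] (c • f) = c • (dirDeriv v)^[n] f) := by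
  induction n with
  | zero => simp
  | succ n ih =>
    obtain ⟨h1, h2, h3⟩ := ih
    refine ⟨?_, ?_, ?_⟩
    · intro f hf
      exact h1 _ (dirDeriv_smooth v hf)
    · intro f g hf hg
      simp only [Function.iterate_succ_apply]
      rw [dirDeriv_add v hf hg, h2 _ _ (dirDeriv_smooth v hf) (dirDeriv_smooth v hg)]
    · intro c f hf
      simp only [Function.iterate_succ_apply]
      rw [dirDeriv_smul v c hf, h3 _ _ (dirDeriv_smooth v hf)]

theorem multiDeriv_aux {q : ℕ} (e : Fin q → V) (α : Fin q → ℕ) (l : List (Fin q)) :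
    (∀ f : V → W, ContDiff ℝ ∞ f →
      ContDiff ℝ ∞ (l.foldr (fun i g => (dirDeriv (e i))^[α i] g) f)) ∧
    (∀ f g : V → W, ContDiff ℝ ∞ f → ContDiff ℝ ∞ g →
      l.foldr (fun i g => (dirDeriv (e i))^[α i] g) (f + g) =
        l.foldr (fun i g => (dirDeriv (e i))^[α i] g) f +
        l.foldr (fun i g => (dirDeriv (e i))^[α i] g) g) ∧
    (∀ (c : ℂ) (f : V → W), ContDiff ℝ ∞ f →
      l.foldr (fun i g => (dirDeriv (e i))^[α i] g) (c • f) =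
        c • l.foldr (fun i g => (dirDeriv (e i))^[α i] g) f) := by
  induction l with
  | nil => simp
  | cons i l ih =>
    obtain ⟨h1, h2, h3⟩ := ih
    obtain ⟨k1, k2, k3⟩ := iterate_dirDeriv (W := W) (e i) (α i)
    refine ⟨fun f hf => k1 _ (h1 f hf), fun f g hf hg => ?_, fun c f hf => ?_⟩
    · simp only [List.foldr_cons]
      rw [h2 f g hf hg, k2 _ _ (h1 f hf) (h1 g hg)]
    · simp only [List.foldr_cons]
      rw [h3 c f hf, k3 _ _ (h1 f hf)]

theorem multiDeriv_smooth {q : ℕ} (e : Fin q → V) (α : Fin q → ℕ) {f : V → W}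
    (hf : ContDiff ℝ ∞ f) : ContDiff ℝ ∞ (multiDeriv e α f) :=
  (multiDeriv_aux e α _).1 f hf

theorem multiDeriv_add {q : ℕ} (e : Fin q → V) (α : Fin q → ℕ) {f g : V → W}
    (hf : ContDiff ℝ ∞ f) (hg : ContDiff ℝ ∞ g) :
    multiDeriv e α (f + g) = multiDeriv e α f + multiDeriv e α g :=
  (multiDeriv_aux e α _).2.1 f g hf hg

theorem multiDeriv_smul {q : ℕ} (e : Fin q → V) (α : Fin q → ℕ) (c : ℂ) {f : V → W}
    (hf : ContDiff ℝ ∞ f) : multiDeriv e α (c • f) = c • multiDeriv e α f :=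
  (multiDeriv_aux e α _).2.2 c f hf

/-- `∂_η^α a` for a function `a(y, η)`. -/
def partialEta {q : ℕ} (α : Fin q → ℕ) (a : Rq q × Rq q → W) : Rq q × Rq q → W :=
  multiDeriv (fun i => ((0 : Rq q), EuclideanSpace.single i (1 : ℝ))) α a

/-- `D_y^β a = (-i)^{|β|} ∂_y^β a` for a function `a(y, η)`. -/
def DY {q : ℕ} (β : Fin q → ℕ) (a : Rq q × Rq q → W) : Rq q × Rq q → W :=
  (-Complex.I) ^ mlen β • multiDeriv (fun i => (EuclideanSpace.single i (1 : ℝ), (0 : Rq q))) β a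

theorem DY_partialEta_add {q : ℕ} (α β : Fin q → ℕ) {a b : Rq q × Rq q → W}
    (ha : ContDiff ℝ ∞ a) (hb : ContDiff ℝ ∞ b) :
    DY β (partialEta α (a + b)) = DY β (partialEta α a) + DY β (partialEta α b) := by
  unfold DY partialEta
  rw [multiDeriv_add _ _ ha hb,
    multiDeriv_add _ _ (multiDeriv_smooth _ _ ha) (multiDeriv_smooth _ _ hb), smul_add]

theorem DY_partialEta_smul {q : ℕ} (α β : Fin q → ℕ) (c : ℂ) {a : Rq q × Rq q → W}
    (ha : ContDiff ℝ ∞ a) :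
    DY β (partialEta α (c • a)) = c • DY β (partialEta α a) := by
  unfold DY partialEta
  rw [multiDeriv_smul _ _ c ha, multiDeriv_smul _ _ c (multiDeriv_smooth _ _ ha), smul_comm]

end Derivatives

/-! ### Twisted operator valued symbols -/

section Symbols

variable {q : ℕ} (I : BanachOperatorIdeal.{u}) {E F : Type u}
  [NormedAddCommGroup E] [InnerProductSpace ℂ E] [CompleteSpace E]
  [TopologicalSpace.SeparableSpace E]
  [NormedAddCommGroup F] [InnerProductSpace ℂ F] [CompleteSpace F]
  [TopologicalSpace.SeparableSpace F]
  (κE : GroupAction E) (κF : GroupAction F)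

/-- The operator `κF_ϱ⁻¹ A κE_ϱ` (where `κF_ϱ⁻¹ = κF_{1/ϱ}`), as an element of `I(E, F)`. -/
def twist (r : {r : ℝ // 0 < r}) (A : I.Ops E F) : I.Ops E F :=
  ⟨κF.toHom r⁻¹ ∘L A.1 ∘L κE.toHom r, I.comp_mem _ _ A.2⟩

/-- The symbol estimate with multi-indices `α`, `β` and constant `C`. -/
def SymbolEstimate (ϱ δ : ℝ) (μ : ℝ × ℝ) (α β : Fin q → ℕ) (a : Rq q × Rq q → I.Ops E F)
    (C : ℝ) : Prop :=
  ∀ y η : Rq q, ‖twist I κE κF (bracket η) (DY β (partialEta α a) (y, η))‖ ≤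
    C * ((bracket y : ℝ) ^ μ.2 * (bracket η : ℝ) ^ (μ.1 - ϱ * mlen α + δ * mlen β))

theorem twist_add (r : {r : ℝ // 0 < r}) (A B : I.Ops E F) :
    twist I κE κF r (A + B) = twist I κE κF r A + twist I κE κF r B := by
  apply Subtype.ext
  change κF.toHom r⁻¹ ∘L (A.1 + B.1) ∘L κE.toHom r =
    κF.toHom r⁻¹ ∘L A.1 ∘L κE.toHom r + κF.toHom r⁻¹ ∘L B.1 ∘L κE.toHom r
  ext x; simp

theorem twist_smul (r : {r : ℝ // 0 < r}) (c : ℂ) (A : I.Ops E F) :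
    twist I κE κF r (c • A) = c • twist I κE κF r A := by
  apply Subtype.ext
  change κF.toHom r⁻¹ ∘L (c • A.1) ∘L κE.toHom r = c • (κF.toHom r⁻¹ ∘L A.1 ∘L κE.toHom r)
  ext x; simp

variable {I κE κF}

theorem SymbolEstimate.add {ϱ δ : ℝ} {μ : ℝ × ℝ} {α β : Fin q → ℕ}
    {a b : Rq q × Rq q → I.Ops E F} {C D : ℝ} (ha : ContDiff ℝ ∞ a) (hb : ContDiff ℝ ∞ b)
    (h : SymbolEstimate I κE κF ϱ δ μ α β a C) (k : SymbolEstimate I κE κF ϱ δ μ α β b D) :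
    SymbolEstimate I κE κF ϱ δ μ α β (a + b) (C + D) := by
  intro y η
  rw [DY_partialEta_add α β ha hb, Pi.add_apply, twist_add, add_mul]
  exact (norm_add_le _ _).trans (add_le_add (h y η) (k y η))

theorem SymbolEstimate.smul {ϱ δ : ℝ} {μ : ℝ × ℝ} {α β : Fin q → ℕ}
    {a : Rq q × Rq q → I.Ops E F} {C : ℝ} (c : ℂ) (ha : ContDiff ℝ ∞ a)
    (h : SymbolEstimate I κE κF ϱ δ μ α β a C) :
    SymbolEstimate I κE κF ϱ δ μ α β (c • a) (‖c‖ * C) := by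
  intro y η
  rw [DY_partialEta_smul α β c ha, Pi.smul_apply, twist_smul, norm_smul, mul_assoc]
  exact mul_le_mul_of_nonneg_left (h y η) (norm_nonneg c)

theorem SymbolEstimate.zero (ϱ δ : ℝ) (μ : ℝ × ℝ) (α β : Fin q → ℕ) :
    SymbolEstimate I κE κF ϱ δ μ α β (0 : Rq q × Rq q → I.Ops E F) 0 := by
  intro y η
  have h0 : (0 : Rq q × Rq q → I.Ops E F) = (0 : ℂ) • 0 := by simp
  have hs : ContDiff ℝ ∞ (0 : Rq q × Rq q → I.Ops E F) := contDiff_const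
  rw [h0, DY_partialEta_smul α β 0 hs, Pi.smul_apply, twist_smul]
  simp

variable (I κE κF)

/-- The vector space of symbols `S^μ_{ϱ,δ}(ℝ^q × ℝ^q; (E, κE), (F, κF))_I`. -/
def symbolSubmodule (q : ℕ) (ϱ δ : ℝ) (μ : ℝ × ℝ) : Submodule ℂ (Rq q × Rq q → I.Ops E F) where
  carrier := {a | ContDiff ℝ ∞ a ∧
    ∀ α β : Fin q → ℕ, ∃ C : ℝ, 0 ≤ C ∧ SymbolEstimate I κE κF ϱ δ μ α β a C}
  add_mem' := fun {a b} ha hb => ⟨ha.1.add hb.1, fun α β => by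
    obtain ⟨C, hC, h⟩ := ha.2 α β
    obtain ⟨D, hD, k⟩ := hb.2 α β
    exact ⟨C + D, add_nonneg hC hD, h.add ha.1 hb.1 k⟩⟩
  zero_mem' := ⟨contDiff_const, fun α β => ⟨0, le_rfl, SymbolEstimate.zero ϱ δ μ α β⟩⟩
  smul_mem' := fun c a ha => ⟨contDiff_const.smul ha.1, fun α β => by
    obtain ⟨C, hC, h⟩ := ha.2 α β
    exact ⟨‖c‖ * C, mul_nonneg (norm_nonneg c) hC, h.smul c ha.1⟩⟩

/-- The symbol space, which will carry its Fréchet topology (and not the topology of pointwise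
convergence). -/
def SymbolSpace (q : ℕ) (ϱ δ : ℝ) (μ : ℝ × ℝ) : Type u := symbolSubmodule I κE κF q ϱ δ μ

variable (ϱ δ : ℝ) (μ : ℝ × ℝ)

instance : AddCommGroup (SymbolSpace I κE κF q ϱ δ μ) :=
  inferInstanceAs (AddCommGroup (symbolSubmodule I κE κF q ϱ δ μ))

instance : Module ℂ (SymbolSpace I κE κF q ϱ δ μ) :=
  inferInstanceAs (Module ℂ (symbolSubmodule I κE κF q ϱ δ μ))

/-- The best constant in the symbol estimate with multi-indices `α`, `β`. -/
def symbolSeminorm (α β : Fin q → ℕ) : Seminorm ℂ (SymbolSpace I κE κF q ϱ δ μ) :=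
  have bdd : ∀ a : SymbolSpace I κE κF q ϱ δ μ,
      BddBelow {C : ℝ | 0 ≤ C ∧ SymbolEstimate I κE κF ϱ δ μ α β a.1 C} :=
    fun _ => ⟨0, fun _ h => h.1⟩
  have att : ∀ a : SymbolSpace I κE κF q ϱ δ μ, SymbolEstimate I κE κF ϱ δ μ α β a.1
      (sInf {C : ℝ | 0 ≤ C ∧ SymbolEstimate I κE κF ϱ δ μ α β a.1 C}) := fun a y η => by
    have hpos : 0 < (bracket y : ℝ) ^ μ.2 *
        (bracket η : ℝ) ^ (μ.1 - ϱ * mlen α + δ * mlen β) :=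
      mul_pos (Real.rpow_pos_of_pos (bracket y).2 _) (Real.rpow_pos_of_pos (bracket η).2 _)
    rw [← div_le_iff₀ hpos]
    exact le_csInf (a.2.2 α β) fun C hC => (div_le_iff₀ hpos).2 (hC.2 y η)
  Seminorm.ofSMulLE
    (fun a => sInf {C : ℝ | 0 ≤ C ∧ SymbolEstimate I κE κF ϱ δ μ α β a.1 C})
    (le_antisymm (csInf_le (bdd 0) ⟨le_rfl, SymbolEstimate.zero ϱ δ μ α β⟩)
      (Real.sInf_nonneg fun _ h => h.1))
    (fun a b => csInf_le (bdd (a + b))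
      ⟨add_nonneg (Real.sInf_nonneg fun _ h => h.1) (Real.sInf_nonneg fun _ h => h.1),
        (att a).add a.2.1 b.2.1 (att b)⟩)
    (fun c a => csInf_le (bdd (c • a))
      ⟨mul_nonneg (norm_nonneg c) (Real.sInf_nonneg fun _ h => h.1), (att a).smul c a.2.1⟩)

/-- The topology of the symbol space, induced by the best constants in the symbol estimates. -/
instance : TopologicalSpace (SymbolSpace I κE κF q ϱ δ μ) :=
  SeminormFamily.moduleFilterBasis (𝕜 := ℂ)
    (fun p : (Fin q → ℕ) × (Fin q → ℕ) => symbolSeminorm I κE κF ϱ δ μ p.1 p.2) |>.topology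

end Symbols

/-! ### Pseudodifferential operators -/

section Operators

variable {q : ℕ} {I : BanachOperatorIdeal.{u}} {E F : Type u}
  [NormedAddCommGroup E] [InnerProductSpace ℂ E] [CompleteSpace E]
  [TopologicalSpace.SeparableSpace E]
  [NormedAddCommGroup F] [InnerProductSpace ℂ F] [CompleteSpace F]
  [TopologicalSpace.SeparableSpace F]

/-- The integrand `e^{i(y-y')η} a(τ y' + (1-τ) y, η) u(y')`. -/
def opIntegrand (τ : ℝ) (a : Rq q × Rq q → I.Ops E F) (u : 𝓢(Rq q, E)) (y η y' : Rq q) : F :=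
  Complex.exp (Complex.I * ((inner ℝ (y - y') η : ℝ) : ℂ)) •
    (a (τ • y' + (1 - τ) • y, η)).1 (u y')

/-- `A = Op_τ(a)`: the continuous operator `A : 𝓢(ℝ^q, E) → 𝓢(ℝ^q, F)` is given by the convergent
iterated integral
`(A u)(y) = (2π)^{-q} ∫ (∫ e^{i(y-y')η} a(τ y' + (1-τ) y, η) u(y') dy') dη`. -/
def IsOp (τ : ℝ) (a : Rq q × Rq q → I.Ops E F) (A : 𝓢(Rq q, E) →L[ℂ] 𝓢(Rq q, F)) : Prop :=
  ∀ (u : 𝓢(Rq q, E)) (y : Rq q),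
    (∀ η : Rq q, Integrable (fun y' => opIntegrand τ a u y η y')) ∧
    Integrable (fun η => ∫ y', opIntegrand τ a u y η y') ∧
    A u y = (((2 * Real.pi) ^ q)⁻¹ : ℝ) • ∫ η, ∫ y', opIntegrand τ a u y η y'

theorem IsOp.add {τ : ℝ} {a b : Rq q × Rq q → I.Ops E F} {A B : 𝓢(Rq q, E) →L[ℂ] 𝓢(Rq q, F)}
    (ha : IsOp τ a A) (hb : IsOp τ b B) : IsOp τ (a + b) (A + B) := by
  intro u y
  obtain ⟨h1, h2, h3⟩ := ha u y
  obtain ⟨k1, k2, k3⟩ := hb u y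
  have e : ∀ η y', opIntegrand τ (a + b) u y η y' =
      opIntegrand τ a u y η y' + opIntegrand τ b u y η y' := fun η y' => by
    unfold opIntegrand
    rw [← smul_add]
    rfl
  have e2 : ∀ η, ∫ y', opIntegrand τ (a + b) u y η y' =
      (∫ y', opIntegrand τ a u y η y') + ∫ y', opIntegrand τ b u y η y' := fun η => by
    simp only [e]
    exact integral_add (h1 η) (k1 η)
  refine ⟨fun η => ?_, ?_, ?_⟩
  · simp only [e]
    exact (h1 η).add (k1 η)
  · simp only [e2]
    exact h2.add k2
  · simp only [e2]
    rw [integral_add h2 k2, smul_add, ← h3, ← k3]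
    rfl

theorem IsOp.smul {τ : ℝ} {a : Rq q × Rq q → I.Ops E F} {A : 𝓢(Rq q, E) →L[ℂ] 𝓢(Rq q, F)}
    (c : ℂ) (ha : IsOp τ a A) : IsOp τ (c • a) (c • A) := by
  intro u y
  obtain ⟨h1, h2, h3⟩ := ha u y
  have e : ∀ η y', opIntegrand τ (c • a) u y η y' = c • opIntegrand τ a u y η y' :=
    fun η y' => by
      unfold opIntegrand
      rw [smul_comm]
      rfl
  have e2 : ∀ η, ∫ y', opIntegrand τ (c • a) u y η y' =
      c • ∫ y', opIntegrand τ a u y η y' := fun η => by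
    simp only [e]
    exact integral_smul _ _
  refine ⟨fun η => ?_, ?_, ?_⟩
  · simp only [e]
    exact (h1 η).smul c
  · simp only [e2]
    exact h2.smul c
  · simp only [e2]
    rw [integral_smul, smul_comm, ← h3]
    rfl

theorem IsOp.zero (τ : ℝ) :
    IsOp τ (0 : Rq q × Rq q → I.Ops E F) (0 : 𝓢(Rq q, E) →L[ℂ] 𝓢(Rq q, F)) := by
  intro u y
  have e : ∀ η y', opIntegrand τ (0 : Rq q × Rq q → I.Ops E F) u y η y' = 0 :=
    fun η y' => smul_zero _
  simp [e]

variable (I) (κE : GroupAction E) (κF : GroupAction F)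

/-- The vector space `Ψ^μ_{ϱ,δ}(ℝ^q; (E, κE), (F, κF))_I` of all operators `Op_τ(a)`, `a` a symbol
of order `μ`, formed with the `τ`-quantization. -/
def psiSubmodule (q : ℕ) (τ ϱ δ : ℝ) (μ : ℝ × ℝ) :
    Submodule ℂ (𝓢(Rq q, E) →L[ℂ] 𝓢(Rq q, F)) where
  carrier := {A | ∃ a : SymbolSpace I κE κF q ϱ δ μ, IsOp τ a.1 A}
  add_mem' := fun ⟨a, ha⟩ ⟨b, hb⟩ => ⟨a + b, ha.add hb⟩
  zero_mem' := ⟨0, IsOp.zero τ⟩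
  smul_mem' := fun c _ ⟨a, ha⟩ => ⟨c • a, ha.smul c⟩

/-- The operator space `Ψ^μ_{ϱ,δ}(ℝ^q; (E, κE), (F, κF))_I`, which will carry the topology
transferred from the symbols. -/
def Psi (q : ℕ) (τ ϱ δ : ℝ) (μ : ℝ × ℝ) : Type u := psiSubmodule I κE κF q τ ϱ δ μ

variable {I κE κF} {τ ϱ δ : ℝ} {μ : ℝ × ℝ}

instance : AddCommGroup (Psi I κE κF q τ ϱ δ μ) :=
  inferInstanceAs (AddCommGroup (psiSubmodule I κE κF q τ ϱ δ μ))

instance : Module ℂ (Psi I κE κF q τ ϱ δ μ) :=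
  inferInstanceAs (Module ℂ (psiSubmodule I κE κF q τ ϱ δ μ))

/-- The `τ`-symbol of an operator. -/
def Psi.symbol (A : Psi I κE κF q τ ϱ δ μ) : SymbolSpace I κE κF q ϱ δ μ := A.2.choose

/-- The topology of the symbol space, transferred to the operator space by `τ`-quantization. -/
instance : TopologicalSpace (Psi I κE κF q τ ϱ δ μ) :=
  TopologicalSpace.induced Psi.symbol inferInstance

variable (I κE κF τ ϱ δ μ)

/-- `a ↦ Op_τ(a)` is defined on the whole symbol space, with values in the continuous operators
between the Schwartz spaces, and is injective (so that it is a bijection onto `Ψ`; the operator is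
determined by the symbol, as it is given by a formula). -/
def QuantizationBijective (q : ℕ) : Prop :=
  (∀ a : SymbolSpace I κE κF q ϱ δ μ, ∃ A : 𝓢(Rq q, E) →L[ℂ] 𝓢(Rq q, F), IsOp τ a.1 A) ∧
  (∀ (a b : SymbolSpace I κE κF q ϱ δ μ) (A : 𝓢(Rq q, E) →L[ℂ] 𝓢(Rq q, F)),
    IsOp τ a.1 A → IsOp τ b.1 A → a = b)

end Operators

/-- The partial sum `∑_{|α| < N} (1/α!) (∂_η^α a)(D_y^α b)` of the Leibniz product expansion. -/
def leibnizSum {I₁ I₂ I₃ : BanachOperatorIdeal.{u}} (h : ComposesContinuously I₁ I₂ I₃)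
    {E F G : Type u}
    [NormedAddCommGroup E] [InnerProductSpace ℂ E] [CompleteSpace E]
    [TopologicalSpace.SeparableSpace E]
    [NormedAddCommGroup F] [InnerProductSpace ℂ F] [CompleteSpace F]
    [TopologicalSpace.SeparableSpace F]
    [NormedAddCommGroup G] [InnerProductSpace ℂ G] [CompleteSpace G]
    [TopologicalSpace.SeparableSpace G] {q : ℕ} (N : ℕ)
    (a : Rq q × Rq q → I₁.Ops F G) (b : Rq q × Rq q → I₂.Ops E F) :
    Rq q × Rq q → I₃.Ops E G := fun p =>
  ∑ k ∈ Finset.range N, ∑ α ∈ Finset.piAntidiag (Finset.univ : Finset (Fin q)) k,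
    ((mfact α : ℂ)⁻¹) • h.comp (partialEta α a p) (DY α b p)

end EdgeCalculus

end

open EdgeCalculus

/-! Everything is reduced to oscillatory integrals `(2π)^{-q} ∫∫ e^{-ixξ} P(y, η, x, ξ) dx dξ` of
amplitudes with values in a Banach space. `Op_τ(a)u(y)` is one of them, with amplitude `a(y + τx, ξ)
u(y + x)`. By Fubini's theorem (`osc_prodAmp_eq`), `Op_τ(a)` maps a Fourier integral with symbol `b`
to a Fourier integral whose symbol is the oscillatory integral of `a(y + τx, η + ξ) b(y + x, η)`.
For `τ = 0` this symbol is the Leibniz product `a # b` (`starProd`); for `b = 1` it is the symbol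
which rewrites the `τ`-quantization as the `0`-quantization (`requant`).

Growth in `x` is removed by integration by parts in `ξ`, based on `(1 + i x_j) e^{-ixξ} = (1 -
∂_{ξ_j}) e^{-ixξ}`. Decay in `ξ` comes from integration by parts in `x`: each step gains a power of
`⟨ξ⟩` and costs only a `δ`-th power, and `δ < 1`.

The expansion is a Taylor expansion in a dilation. If `x` is replaced by `tx` in `P`, the
`t`-derivative of the integral is the integral of `∑_j D_{x_j} ∂_{ξ_j} P`, dilated likewise, and at
`t = 0` the integral equals `P` at `x = ξ = 0` (`hasDerivAt_oint_scale`, `oint_scale_zero`). Every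
step lowers the order by `ϱ - δ > 0`. The direct estimate of the integral loses the fixed power
`⟨η⟩^{δ(q+1)}` (`exists_norm_act_oint_le`); expanding by sufficiently many further terms, which are
symbols of the right order, recovers this loss (`exists_symEst_remainder`). Case by case this gives
the estimates for `a # b`, its remainders, and the change of quantization.

The group actions enter only through two facts: by the uniform boundedness principle they grow
polynomially, so the twisted norms vary slowly with `η`; and inserting `κ̃ κ̃^{-1}` between two
factors makes twisting compatible with composition (`exists_norm_twist_le`,
`ComposesContinuously.compat`).

The change of quantization is formally `exp(s ∑_j D_{y_j} ∂_{η_j})`. It is invertible because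
`requant (-s) (requant s a)` has zero derivative in `s` (`requant_neg_requant`). Together with
uniqueness of the symbol for `τ = 0` (`symbol_unique`) this gives injectivity for all `τ`, and it
transports the composition theorem from `τ = 0` to arbitrary `τ₁, τ₂, τ₃`. All constants depend
linearly on finitely many seminorms of the symbols, whence the continuity. -/

noncomputable section

set_option linter.unusedSectionVars false

namespace EdgeCalculus


/-! ### Directional derivatives -/

section DirDeriv

variable {V V' W W' : Type*} [NormedAddCommGroup V] [NormedSpace ℝ V]
  [NormedAddCommGroup V'] [NormedSpace ℝ V']
  [NormedAddCommGroup W] [NormedSpace ℂ W] [NormedAddCommGroup W'] [NormedSpace ℂ W']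

theorem contDiff_differentiableAt {f : V → W} (hf : ContDiff ℝ ∞ f) (x : V) :
    DifferentiableAt ℝ f x := hf.differentiable (by simp) x

theorem dirDeriv_comm (v w : V) {f : V → W} (hf : ContDiff ℝ ∞ f) :
    dirDeriv v (dirDeriv w f) = dirDeriv w (dirDeriv v f) := by
  have hd : ∀ x, DifferentiableAt ℝ (fderiv ℝ f) x := fun x =>
    (hf.fderiv_right (m := ∞) (by simp)).differentiable (by simp) x
  have key : ∀ (a b : V) x, dirDeriv a (dirDeriv b f) x = fderiv ℝ (fderiv ℝ f) x a b := by
    intro a b x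
    have h := ((hd x).hasFDerivAt.clm_apply (hasFDerivAt_const b x)).fderiv
    change fderiv ℝ (fun y => (fderiv ℝ f y) b) x a = _
    rw [h]
    simp
  funext x
  rw [key, key]
  exact ((hf.of_le (m := 2) (by norm_cast)).contDiffAt.isSymmSndFDerivAt
    (by simp)) v w

theorem dirDeriv_iterate_smooth (v : V) (n : ℕ) {f : V → W} (hf : ContDiff ℝ ∞ f) :
    ContDiff ℝ ∞ ((dirDeriv v)^[n] f) := (iterate_dirDeriv v n).1 f hf

theorem dirDeriv_iterate_comm (v w : V) (n : ℕ) {f : V → W} (hf : ContDiff ℝ ∞ f) :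
    (dirDeriv v)^[n] (dirDeriv w f) = dirDeriv w ((dirDeriv v)^[n] f) := by
  induction n generalizing f with
  | zero => rfl
  | succ n ih =>
    rw [Function.iterate_succ_apply, Function.iterate_succ_apply, dirDeriv_comm v w hf,
      ih (dirDeriv_smooth v hf)]

theorem hasLineDerivAt_dirDeriv (v : V) {f : V → W} (hf : ContDiff ℝ ∞ f) (x : V) :
    HasLineDerivAt ℝ f (dirDeriv v f x) x v :=
  (contDiff_differentiableAt hf x).hasFDerivAt.hasLineDerivAt v

theorem dirDeriv_sum {ι : Type*} (s : Finset ι) (v : V) {f : ι → V → W}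
    (hf : ∀ i ∈ s, ContDiff ℝ ∞ (f i)) :
    dirDeriv v (∑ i ∈ s, f i) = ∑ i ∈ s, dirDeriv v (f i) := by
  classical
  induction s using Finset.induction_on with
  | empty =>
    funext x
    have : (0 : V → W) = fun _ => 0 := rfl
    simp [dirDeriv, this]
  | insert a s ha ih =>
    rw [Finset.sum_insert ha, Finset.sum_insert ha, dirDeriv_add, ih]
    · exact fun i hi => hf i (Finset.mem_insert_of_mem hi)
    · exact hf a (Finset.mem_insert_self _ _)
    · have : (∑ i ∈ s, f i) = fun x => ∑ i ∈ s, f i x := by ext x; simp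
      rw [this]
      exact ContDiff.sum fun i hi => hf i (Finset.mem_insert_of_mem hi)

theorem dirDeriv_neg (v : V) {f : V → W} (hf : ContDiff ℝ ∞ f) :
    dirDeriv v (-f) = -dirDeriv v f := by
  have := dirDeriv_smul v (-1 : ℂ) hf
  simpa using this

theorem dirDeriv_sub (v : V) {f g : V → W} (hf : ContDiff ℝ ∞ f) (hg : ContDiff ℝ ∞ g) :
    dirDeriv v (f - g) = dirDeriv v f - dirDeriv v g := by
  have hn : ContDiff ℝ ∞ (-g) := hg.neg
  rw [sub_eq_add_neg, dirDeriv_add v hf hn, dirDeriv_neg v hg, sub_eq_add_neg]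

theorem dirDeriv_clm_comp (L : W →L[ℝ] W') (v : V) {f : V → W} (hf : ContDiff ℝ ∞ f) :
    dirDeriv v (fun x => L (f x)) = fun x => L (dirDeriv v f x) := by
  funext x
  have := (L.hasFDerivAt.comp x (contDiff_differentiableAt hf x).hasFDerivAt).fderiv
  simp only [dirDeriv]
  rw [show (fun x => L (f x)) = L ∘ f from rfl, this]
  rfl

theorem dirDeriv_comp_affine (A : V →L[ℝ] V') (c : V') (v : V) {f : V' → W}
    (hf : ContDiff ℝ ∞ f) :
    dirDeriv v (fun x => f (A x + c)) = fun x => dirDeriv (A v) f (A x + c) := by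
  funext x
  have h1 : HasFDerivAt (fun x => A x + c) A x := A.hasFDerivAt.add_const c
  have := (((contDiff_differentiableAt hf (A x + c)).hasFDerivAt).comp x h1).fderiv
  simp only [dirDeriv]
  rw [show (fun x => f (A x + c)) = f ∘ (fun x => A x + c) from rfl, this]
  rfl

theorem dirDeriv_comp_linear (A : V →L[ℝ] V') (v : V) {f : V' → W} (hf : ContDiff ℝ ∞ f) :
    dirDeriv v (fun x => f (A x)) = fun x => dirDeriv (A v) f (A x) := by
  have := dirDeriv_comp_affine A 0 v hf
  simpa using this

theorem dirDeriv_bilin {W₁ W₂ : Type*} [NormedAddCommGroup W₁] [NormedSpace ℂ W₁]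
    [NormedAddCommGroup W₂] [NormedSpace ℂ W₂] (B : W₁ →L[ℝ] W₂ →L[ℝ] W) (v : V) {f : V → W₁}
    {g : V → W₂} (hf : ContDiff ℝ ∞ f) (hg : ContDiff ℝ ∞ g) :
    dirDeriv v (fun x => B (f x) (g x)) =
      fun x => B (dirDeriv v f x) (g x) + B (f x) (dirDeriv v g x) := by
  funext x
  have h := (B.hasFDerivAt_of_bilinear (contDiff_differentiableAt hf x).hasFDerivAt
    (contDiff_differentiableAt hg x).hasFDerivAt).fderiv
  simp only [dirDeriv]
  rw [h]
  simp [add_comm]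

theorem dirDeriv_smul_fun (v : V) {w : V → ℂ} {f : V → W} (hw : ContDiff ℝ ∞ w)
    (hf : ContDiff ℝ ∞ f) :
    dirDeriv v (fun x => w x • f x) =
      (fun x => dirDeriv v w x • f x) + (fun x => w x • dirDeriv v f x) :=
  dirDeriv_bilin (ContinuousLinearMap.lsmul ℝ ℂ) v hw hf

theorem dirDeriv_smul_vec (c : ℝ) (v : V) (f : V → W) :
    dirDeriv (c • v) f = (c : ℂ) • dirDeriv v f := by
  funext x; simp [dirDeriv]

theorem dirDeriv_zero_vec (f : V → W) : dirDeriv 0 f = 0 := by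
  funext x; simp [dirDeriv]

theorem dirDeriv_const (v : V) (c : W) : dirDeriv v (fun _ => c) = 0 := by
  funext x; simp [dirDeriv]

/-- Leibniz bound for iterated directional derivatives of a product, at a point. -/
theorem norm_iterate_dirDeriv_smul_le (v : V) (i : ℕ) {w : V → ℂ} {f : V → W}
    (hw : ContDiff ℝ ∞ w) (hf : ContDiff ℝ ∞ f) (x : V) {cw cf : ℝ}
    (h1 : ∀ i' ≤ i, ‖(dirDeriv v)^[i'] w x‖ ≤ cw) (h2 : ∀ i' ≤ i, ‖(dirDeriv v)^[i'] f x‖ ≤ cf) :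
    ‖(dirDeriv v)^[i] (fun x => w x • f x) x‖ ≤ 2 ^ i * (cw * cf) := by
  induction i generalizing w f with
  | zero =>
    have a := h1 0 le_rfl
    have b := h2 0 le_rfl
    simp only [Function.iterate_zero, id_eq, pow_zero, one_mul, norm_smul] at *
    exact mul_le_mul a b (norm_nonneg _) ((norm_nonneg _).trans a)
  | succ i ih =>
    have s1 : ContDiff ℝ ∞ (fun x => dirDeriv v w x • f x) := (dirDeriv_smooth v hw).smul hf
    have s2 : ContDiff ℝ ∞ (fun x => w x • dirDeriv v f x) := hw.smul (dirDeriv_smooth v hf)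
    rw [Function.iterate_succ_apply, dirDeriv_smul_fun v hw hf,
      (iterate_dirDeriv v i).2.1 _ _ s1 s2, Pi.add_apply]
    have a := ih (dirDeriv_smooth v hw) hf (fun i' hi => h1 (i' + 1) (by omega))
      (fun i' hi => h2 i' (by omega))
    have b := ih hw (dirDeriv_smooth v hf) (fun i' hi => h1 i' (by omega))
      (fun i' hi => h2 (i' + 1) (by omega))
    refine (norm_add_le _ _).trans ((add_le_add a b).trans (le_of_eq ?_))
    ring

/-- A class of functions on `ι → ℝ`-like spaces which are differentiable with derivatives given by
the directional derivatives in the class consists of smooth functions. -/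
theorem contDiff_of_class {ι : Type*} [Fintype ι] (ℓ : ι → V →L[ℝ] ℝ) (𝒦 : Set (V → W))
    (h : ∀ f ∈ 𝒦, ∃ g : ι → V → W, (∀ i, g i ∈ 𝒦) ∧
      ∀ x, HasFDerivAt f (∑ i, (ℓ i).smulRight (g i x)) x) {f : V → W} (hf : f ∈ 𝒦) :
    ContDiff ℝ ∞ f := by
  rw [contDiff_infty]
  intro n
  induction n generalizing f with
  | zero =>
    obtain ⟨g, -, hg⟩ := h f hf
    exact contDiff_zero.2 (continuous_iff_continuousAt.2 fun x => (hg x).continuousAt)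
  | succ n ih =>
    -- The induction hypothesis covers all members of the class at once, so the coefficients `g i`
    -- of the derivative are already of class `C^n`.
    obtain ⟨g, hg𝒦, hg⟩ := h f hf
    have : ((n + 1 : ℕ) : WithTop ℕ∞) = (n : WithTop ℕ∞) + 1 := by simp
    rw [this, contDiff_succ_iff_hasFDerivAt]
    · refine ⟨fun x => ∑ i, (ℓ i).smulRight (g i x), ?_, hg⟩
      refine ContDiff.sum fun i _ => ?_
      exact ((ContinuousLinearMap.smulRightL ℝ V W (ℓ i)).contDiff).comp (ih (hg𝒦 i))

end DirDeriv

/-! ### Japanese brackets -/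

section Jap

variable {q : ℕ}

/-- The real number `⟨x⟩`. -/
def jap (x : Rq q) : ℝ := bracket x

theorem jap_eq (x : Rq q) : jap x = √(1 + ‖x‖ ^ 2) := rfl

theorem one_le_jap (x : Rq q) : 1 ≤ jap x := by
  rw [jap_eq]; exact Real.one_le_sqrt.2 (by nlinarith [sq_nonneg ‖x‖])

theorem jap_pos (x : Rq q) : 0 < jap x := lt_of_lt_of_le one_pos (one_le_jap x)

theorem norm_le_jap (x : Rq q) : ‖x‖ ≤ jap x := by
  rw [jap_eq]; exact Real.le_sqrt_of_sq_le (by linarith)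

theorem jap_le_one_add (x : Rq q) : jap x ≤ 1 + ‖x‖ := by
  rw [jap_eq, Real.sqrt_le_left (by positivity)]
  nlinarith [norm_nonneg x]

/-- The additive form keeps `⟨η + ξ⟩` and `⟨η⟩` comparable up to a fixed constant where `|ξ| ≤
⟨η⟩/2`; the multiplicative form would lose a power of `⟨ξ⟩` there. -/
theorem jap_add_le (x y : Rq q) : jap (x + y) ≤ jap x + ‖y‖ := by
  have h1 : ‖x + y‖ ≤ ‖x‖ + ‖y‖ := norm_add_le _ _
  have h2 := norm_le_jap x
  have h3 : jap x ^ 2 = 1 + ‖x‖ ^ 2 := Real.sq_sqrt (by positivity)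
  rw [jap_eq (x + y), Real.sqrt_le_left (by linarith [jap_pos x, norm_nonneg y])]
  nlinarith [norm_nonneg x, norm_nonneg y, norm_nonneg (x + y), jap_pos x]

theorem jap_neg (x : Rq q) : jap (-x) = jap x := by simp [jap_eq]

theorem jap_zero : jap (0 : Rq q) = 1 := by simp [jap_eq]

theorem jap_add_le_mul (x y : Rq q) : jap (x + y) ≤ 2 * jap x * jap y := by
  have h1 := jap_add_le x y
  have h2 := norm_le_jap y
  nlinarith [one_le_jap x, one_le_jap y]

theorem jap_continuous : Continuous (jap : Rq q → ℝ) := by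
  unfold jap bracket; fun_prop

theorem jap_rpow_pos (x : Rq q) (s : ℝ) : 0 < jap x ^ s := Real.rpow_pos_of_pos (jap_pos x) s

theorem jap_rpow_continuous (s : ℝ) : Continuous fun x : Rq q => jap x ^ s :=
  jap_continuous.rpow_const fun x => Or.inl (jap_pos x).ne'

theorem jap_rpow_le_rpow (x : Rq q) {s t : ℝ} (h : s ≤ t) : jap x ^ s ≤ jap x ^ t :=
  Real.rpow_le_rpow_of_exponent_le (one_le_jap x) h

theorem one_le_jap_rpow (x : Rq q) {s : ℝ} (h : 0 ≤ s) : 1 ≤ jap x ^ s :=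
  Real.one_le_rpow (one_le_jap x) h

theorem jap_rpow_add (x : Rq q) (s t : ℝ) : jap x ^ (s + t) = jap x ^ s * jap x ^ t :=
  Real.rpow_add (jap_pos x) s t

/-- If two positive numbers are comparable up to a factor `r`, so are their powers. -/
theorem rpow_le_of_comparable {a b r s k : ℝ} (ha : 0 < a) (hb : 0 < b) (hr : 1 ≤ r)
    (h1 : a ≤ b * r) (h2 : b ≤ a * r) (hk : |s| ≤ k) : a ^ s ≤ b ^ s * r ^ k := by
  have hr0 : 0 < r := by linarith
  have key : a ^ s ≤ b ^ s * r ^ |s| := by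
    rcases le_total 0 s with hs | hs
    · rw [abs_of_nonneg hs, ← Real.mul_rpow hb.le hr0.le]
      exact Real.rpow_le_rpow ha.le h1 hs
    · rw [abs_of_nonpos hs, Real.rpow_neg hr0.le, ← div_eq_mul_inv,
        le_div_iff₀ (Real.rpow_pos_of_pos hr0 s), ← Real.mul_rpow ha.le hr0.le]
      exact Real.rpow_le_rpow_of_nonpos hb h2 hs
  exact key.trans (mul_le_mul_of_nonneg_left (Real.rpow_le_rpow_of_exponent_le hr hk)
    (Real.rpow_nonneg hb.le _))

/-- Peetre's inequality. -/
theorem jap_add_rpow_le (x y : Rq q) {s k : ℝ} (hk : |s| ≤ k) :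
    jap (x + y) ^ s ≤ jap x ^ s * (2 * jap y) ^ k := by
  refine rpow_le_of_comparable (jap_pos _) (jap_pos _) (by linarith [one_le_jap y]) ?_ ?_ hk
  · linarith [jap_add_le_mul x y]
  · have := jap_add_le_mul (x + y) (-y)
    rw [jap_neg, add_neg_cancel_right] at this
    linarith

/-- The integrable weight `⟨x⟩^{-(q+1)}`. -/
def dec (x : Rq q) : ℝ := jap x ^ (-((q : ℝ) + 1))

theorem dec_pos (x : Rq q) : 0 < dec x := jap_rpow_pos x _

theorem dec_integrable : Integrable (dec : Rq q → ℝ) := by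
  have h := integrable_rpow_neg_one_add_norm_sq (E := Rq q) (μ := volume) (r := (q : ℝ) + 1)
    (by simp)
  refine h.congr (Filter.Eventually.of_forall fun x => ?_)
  simp only [dec, jap_eq]
  rw [Real.sqrt_eq_rpow, ← Real.rpow_mul (by positivity)]
  congr 1; ring

theorem jap_rpow_le_dec (x : Rq q) {s : ℝ} (h : s ≤ -((q : ℝ) + 1)) : jap x ^ s ≤ dec x :=
  jap_rpow_le_rpow x h

variable {W : Type*} [NormedAddCommGroup W] [NormedSpace ℂ W]

theorem integrable_of_dec {f : Rq q → W} (hf : Continuous f) {C : ℝ}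
    (h : ∀ x, ‖f x‖ ≤ C * dec x) : Integrable f :=
  (dec_integrable.const_mul C).mono' hf.aestronglyMeasurable (Filter.Eventually.of_forall h)

theorem norm_integral_le_of_dec {f : Rq q → W} {C : ℝ} (h : ∀ x, ‖f x‖ ≤ C * dec x) :
    ‖∫ x, f x‖ ≤ C * ∫ x : Rq q, dec x := by
  rw [← integral_const_mul]
  exact norm_integral_le_of_norm_le (dec_integrable.const_mul C) (Filter.Eventually.of_forall h)

theorem integral_dec_nonneg : 0 ≤ ∫ x : Rq q, dec x := integral_nonneg fun x => (dec_pos x).le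

end Jap

/-! ### The oscillating kernel -/

section Kernel

variable {q : ℕ} {W : Type*} [NormedAddCommGroup W] [NormedSpace ℂ W]

/-- The standard basis vectors. -/
abbrev ev (j : Fin q) : Rq q := EuclideanSpace.single j (1 : ℝ)

/-- `e^{-i x ξ}`. -/
def ek (x ξ : Rq q) : ℂ := Complex.exp (-(Complex.I * ((inner ℝ x ξ : ℝ) : ℂ)))

theorem norm_ek (x ξ : Rq q) : ‖ek x ξ‖ = 1 := by
  rw [ek, Complex.norm_exp]; simp

theorem norm_ek_smul (x ξ : Rq q) (w : W) : ‖ek x ξ • w‖ = ‖w‖ := by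
  rw [norm_smul, norm_ek, one_mul]

theorem ek_smooth : ContDiff ℝ ∞ fun p : Rq q × Rq q => ek p.1 p.2 := by
  unfold ek
  have h1 : ContDiff ℝ ∞ fun p : Rq q × Rq q => (inner ℝ p.1 p.2 : ℝ) :=
    contDiff_fst.inner ℝ contDiff_snd
  have h2 : ContDiff ℝ ∞ fun p : Rq q × Rq q => ((inner ℝ p.1 p.2 : ℝ) : ℂ) :=
    Complex.ofRealCLM.contDiff.comp h1
  exact (contDiff_const.mul h2).neg.cexp

theorem ek_continuous : Continuous fun p : Rq q × Rq q => ek p.1 p.2 := ek_smooth.continuous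

theorem ek_comm (x ξ : Rq q) : ek x ξ = ek ξ x := by rw [ek, ek, real_inner_comm]

theorem ek_add_right (x ξ η : Rq q) : ek x (ξ + η) = ek x ξ * ek x η := by
  simp only [ek, inner_add_right, ← Complex.exp_add]; congr 1; push_cast; ring

theorem ek_add_left (x y ξ : Rq q) : ek (x + y) ξ = ek x ξ * ek y ξ := by
  simp only [ek, inner_add_left, ← Complex.exp_add]; congr 1; push_cast; ring

theorem hasFDerivAt_ek_left (x ξ : Rq q) :
    HasFDerivAt (fun x => ek x ξ)
      ((innerSL ℝ ξ).smulRight (-(Complex.I * ek x ξ))) x := by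
  unfold ek
  have h1 : HasFDerivAt (fun x : Rq q => ((inner ℝ x ξ : ℝ) : ℂ))
      (Complex.ofRealCLM.comp (innerSL ℝ ξ)) x := by
    have : HasFDerivAt (fun x : Rq q => (inner ℝ x ξ : ℝ)) (innerSL ℝ ξ) x := by
      have h := (innerSL ℝ ξ).hasFDerivAt (x := x)
      refine h.congr_of_eventuallyEq (Filter.Eventually.of_forall fun y => ?_)
      simp [real_inner_comm]
    exact Complex.ofRealCLM.hasFDerivAt.comp x this
  have h2 := ((h1.const_mul Complex.I).neg).cexp
  refine HasFDerivAt.congr_fderiv h2 ?_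
  ext v
  simp
  ring

theorem hasLineDerivAt_ek_left (x ξ : Rq q) (j : Fin q) :
    HasLineDerivAt ℝ (fun x => ek x ξ) (-(Complex.I * ξ j) * ek x ξ) x (ev j) := by
  have := (hasFDerivAt_ek_left x ξ).hasLineDerivAt (ev j)
  have e : -(Complex.I * ξ j) * ek x ξ =
      ((innerSL ℝ ξ).smulRight (-(Complex.I * ek x ξ))) (ev j) := by
    have : (inner ℝ ξ (ev j) : ℝ) = ξ j := by simp [ev, EuclideanSpace.inner_single_right]
    rw [ContinuousLinearMap.smulRight_apply, innerSL_apply_apply, this]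
    rw [Complex.real_smul]
    ring
  rw [e]
  exact this

theorem ek_continuous_left (ξ : Rq q) : Continuous fun x : Rq q => ek x ξ :=
  continuous_iff_continuousAt.2 fun x => (hasFDerivAt_ek_left x ξ).continuousAt

/-- Integration by parts with `∂_{x_j} e^{-ixξ} = -iξ_j e^{-ixξ}`; the integrable majorants make the
boundary terms vanish. -/
theorem integral_ek_dirDeriv {g : Rq q → W} (hg : ContDiff ℝ ∞ g) (j : Fin q) {C C' : ℝ}
    (h : ∀ x, ‖g x‖ ≤ C * dec x) (h' : ∀ x, ‖dirDeriv (ev j) g x‖ ≤ C' * dec x) (ξ : Rq q) :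
    ∫ x, ek x ξ • dirDeriv (ev j) g x = (Complex.I * ξ j) • ∫ x, ek x ξ • g x := by
  have he := ek_continuous_left ξ
  have hgc := hg.continuous
  have hgc' := (dirDeriv_smooth (ev j) hg).continuous
  have i1 : Integrable fun x => ek x ξ • g x :=
    integrable_of_dec (he.smul hgc) fun x => by rw [norm_ek_smul]; exact h x
  have i2 : Integrable fun x => ek x ξ • dirDeriv (ev j) g x :=
    integrable_of_dec (he.smul hgc') fun x => by rw [norm_ek_smul]; exact h' x
  have i3 : Integrable fun x => (-(Complex.I * ξ j) * ek x ξ) • g x := by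
    simp only [mul_smul]; exact i1.smul (-(Complex.I * ξ j))
  have := integral_bilinear_hasLineDerivAt_right_eq_neg_left_of_integrable
    (B := ContinuousLinearMap.lsmul ℝ ℂ) (μ := volume) (f := fun x => ek x ξ)
    (f' := fun x => -(Complex.I * ξ j) * ek x ξ) (g := g) (g' := dirDeriv (ev j) g) (v := ev j)
    i3 i2 i1 (fun x _ => hasLineDerivAt_ek_left x ξ j) (fun x _ => hasLineDerivAt_dirDeriv _ hg x)
  simp only [ContinuousLinearMap.lsmul_apply] at this
  rw [this]
  simp only [mul_smul, neg_smul, integral_neg, neg_neg]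
  rw [integral_smul, integral_smul]

theorem integral_ek_dirDeriv_iterate {g : Rq q → W} (hg : ContDiff ℝ ∞ g) (j : Fin q) (n : ℕ)
    {C : ℝ} (h : ∀ i ≤ n, ∀ x, ‖(dirDeriv (ev j))^[i] g x‖ ≤ C * dec x) (ξ : Rq q) :
    ∫ x, ek x ξ • (dirDeriv (ev j))^[n] g x = (Complex.I * ξ j) ^ n • ∫ x, ek x ξ • g x := by
  induction n with
  | zero => simp
  | succ n ih =>
    have hs := h (n + 1) le_rfl
    simp only [Function.iterate_succ_apply'] at hs ⊢
    rw [integral_ek_dirDeriv (dirDeriv_iterate_smooth _ n hg) j (h n (by omega)) hs,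
      ih (fun i hi => h i (by omega)), smul_smul, pow_succ']

/-- Decay of oscillating integrals by integration by parts. -/
theorem norm_integral_ek_le {g : Rq q → W} (hg : ContDiff ℝ ∞ g) (n : ℕ) {C : ℝ}
    (h : ∀ j, ∀ i ≤ n, ∀ x, ‖(dirDeriv (ev j))^[i] g x‖ ≤ C * dec x)
    (h0 : ∀ x, ‖g x‖ ≤ C * dec x) (ξ : Rq q) :
    ‖∫ x, ek x ξ • g x‖ ≤
      (2 ^ n * (1 + q ^ n)) * (C * ∫ x : Rq q, dec x) * jap ξ ^ (-(n : ℝ)) := by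
  set J := ∫ x, ek x ξ • g x
  set K := C * ∫ x : Rq q, dec x
  -- The separate hypothesis `h0` on `g` itself matters for `q = 0`, where `h` is vacuous.
  have b0 : ‖J‖ ≤ K := norm_integral_le_of_dec fun x => by rw [norm_ek_smul]; exact h0 x
  have b1 : ∀ j, |ξ j| ^ n * ‖J‖ ≤ K := fun j => by
    have e := integral_ek_dirDeriv_iterate hg j n (h j) ξ
    have : ‖(Complex.I * ξ j) ^ n • J‖ ≤ K := by
      rw [← e]
      exact norm_integral_le_of_dec fun x => by rw [norm_ek_smul]; exact h j n le_rfl x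
    simpa [norm_smul] using this
  have hK : 0 ≤ K := (norm_nonneg _).trans b0
  -- It suffices to integrate by parts in the direction of the largest coordinate of `ξ`, which
  -- bounds `|ξ|` up to the factor `q`.
  have b2 : ‖ξ‖ ^ n * ‖J‖ ≤ q ^ n * K := by
    rcases Nat.eq_zero_or_pos q with hq | hq
    · subst hq
      have : ‖ξ‖ = 0 := by simp [EuclideanSpace.norm_eq]
      rw [this]
      rcases Nat.eq_zero_or_pos n with hn | hn
      · subst hn; simpa using b0
      · rw [zero_pow hn.ne', zero_mul]; positivity
    · obtain ⟨j, -, hj⟩ := Finset.exists_max_image Finset.univ (fun j => |ξ j|)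
        ⟨⟨0, hq⟩, Finset.mem_univ _⟩
      have hn : ‖ξ‖ ≤ q * |ξ j| := by
        have : ‖ξ‖ ≤ ∑ i, |ξ i| := by
          have e : ξ = ∑ i, ξ i • ev i := by
            ext k; simp [ev, Finset.sum_apply, Pi.single_apply]
          calc ‖ξ‖ = ‖∑ i, ξ i • ev i‖ := by rw [← e]
            _ ≤ ∑ i, ‖ξ i • ev i‖ := norm_sum_le _ _
            _ = ∑ i, |ξ i| := by simp [norm_smul, ev]
        refine this.trans ((Finset.sum_le_card_nsmul _ _ _ fun i hi => hj i hi).trans ?_)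
        simp
      calc ‖ξ‖ ^ n * ‖J‖ ≤ (q * |ξ j|) ^ n * ‖J‖ := by gcongr
        _ = q ^ n * (|ξ j| ^ n * ‖J‖) := by ring
        _ ≤ q ^ n * K := by gcongr; exact b1 j
  have hj : jap ξ ^ n ≤ 2 ^ n * (1 + ‖ξ‖ ^ n) := by
    calc jap ξ ^ n ≤ (1 + ‖ξ‖) ^ n := by gcongr; exacts [(jap_pos ξ).le, jap_le_one_add ξ]
      _ ≤ 2 ^ n * (1 + ‖ξ‖ ^ n) := by
        rcases le_total ‖ξ‖ 1 with h | h
        · calc (1 + ‖ξ‖) ^ n ≤ 2 ^ n := by gcongr; linarith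
            _ ≤ _ := le_mul_of_one_le_right (by positivity) (by simp)
        · calc (1 + ‖ξ‖) ^ n ≤ (2 * ‖ξ‖) ^ n := by gcongr; linarith
            _ = 2 ^ n * ‖ξ‖ ^ n := by ring
            _ ≤ _ := by gcongr; simp
  rw [Real.rpow_neg (jap_pos ξ).le, Real.rpow_natCast, ← div_eq_mul_inv,
    le_div_iff₀ (pow_pos (jap_pos ξ) n)]
  calc ‖J‖ * jap ξ ^ n ≤ ‖J‖ * (2 ^ n * (1 + ‖ξ‖ ^ n)) := by gcongr
    _ = 2 ^ n * (‖J‖ + ‖ξ‖ ^ n * ‖J‖) := by ring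
    _ ≤ 2 ^ n * (K + q ^ n * K) := by gcongr
    _ = _ := by ring

end Kernel


/-! ### Amplitudes -/

section Amplitudes

/-- Indices of the coordinate directions `(y, η)`. -/
abbrev SDir (q : ℕ) := Fin q ⊕ Fin q

/-- The coordinate directions in `(y, η)`. -/
def svec {q : ℕ} : SDir q → Rq q × Rq q := Sum.elim (fun j => (ev j, 0)) (fun j => (0, ev j))

/-- The coordinate functionals in `(y, η)`. -/
def scoord {q : ℕ} : SDir q → (Rq q × Rq q) →L[ℝ] ℝ :=
  Sum.elim (fun j => (EuclideanSpace.proj j).comp (ContinuousLinearMap.fst ℝ _ _))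
    (fun j => (EuclideanSpace.proj j).comp (ContinuousLinearMap.snd ℝ _ _))

/-- Indices of the coordinate directions `((y, η), (x, ξ))`. -/
abbrev ADir (q : ℕ) := SDir q ⊕ SDir q

/-- The variables `((y, η), (x, ξ))` of an amplitude. -/
abbrev Amp (q : ℕ) := (Rq q × Rq q) × (Rq q × Rq q)

/-- The coordinate directions in `((y, η), (x, ξ))`. -/
def avec {q : ℕ} : ADir q → Amp q := Sum.elim (fun l => (svec l, 0)) (fun l => (0, svec l))

/-- The direction `x_j`. -/
def dX {q : ℕ} (j : Fin q) : Amp q := avec (Sum.inr (Sum.inl j))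

/-- The direction `ξ_j`. -/
def dXi {q : ℕ} (j : Fin q) : Amp q := avec (Sum.inr (Sum.inr j))

variable {q : ℕ} {W : Type*} [NormedAddCommGroup W] [NormedSpace ℂ W]

theorem ev_sum (x : Rq q) : x = ∑ j, x j • ev j := by
  ext k; simp [ev, Finset.sum_apply, Pi.single_apply]

theorem svec_sum (v : Rq q × Rq q) : v = ∑ l, scoord l v • svec l := by
  rw [Fintype.sum_sum_type]
  simp only [scoord, svec, Sum.elim_inl, Sum.elim_inr]
  apply Prod.ext
  · simp only [Prod.fst_add, Prod.fst_sum, Prod.smul_fst, smul_zero, Finset.sum_const_zero,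
      add_zero]
    exact ev_sum v.1
  · simp only [Prod.snd_add, Prod.snd_sum, Prod.smul_snd, smul_zero, Finset.sum_const_zero,
      zero_add]
    exact ev_sum v.2

/-- Iterated derivatives of an amplitude. -/
def wd (v : List (ADir q)) (P : Amp q → W) : Amp q → W :=
  v.foldr (fun l g => dirDeriv (avec l) g) P

theorem wd_smooth (v : List (ADir q)) {P : Amp q → W} (hP : ContDiff ℝ ∞ P) :
    ContDiff ℝ ∞ (wd v P) := by
  induction v with
  | nil => exact hP
  | cons l v ih => exact dirDeriv_smooth _ ih

theorem wd_add (v : List (ADir q)) {P P' : Amp q → W} (hP : ContDiff ℝ ∞ P)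
    (hP' : ContDiff ℝ ∞ P') : wd v (P + P') = wd v P + wd v P' := by
  induction v with
  | nil => rfl
  | cons l v ih =>
    change dirDeriv _ (wd v (P + P')) = _
    rw [ih, dirDeriv_add _ (wd_smooth v hP) (wd_smooth v hP')]
    rfl

theorem wd_smul (v : List (ADir q)) (c : ℂ) {P : Amp q → W} (hP : ContDiff ℝ ∞ P) :
    wd v (c • P) = c • wd v P := by
  induction v with
  | nil => rfl
  | cons l v ih =>
    change dirDeriv _ (wd v (c • P)) = _
    rw [ih, dirDeriv_smul _ c (wd_smooth v hP)]
    rfl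

theorem wd_dirDeriv (v : List (ADir q)) (l : ADir q) (P : Amp q → W) :
    wd v (dirDeriv (avec l) P) = wd (v ++ [l]) P := by
  simp [wd, List.foldr_append]

/-- Polynomial bounds for functions on the space of amplitude variables. -/
def PolyBound (k s : ℝ) (f : Amp q → W) : Prop :=
  ∃ C ≥ (0 : ℝ), ∃ N : ℕ, ∀ θ x ξ, ‖f (θ, (x, ξ))‖ ≤ C * (1 + ‖θ‖) ^ N * (jap x ^ k * jap ξ ^ s)

theorem PolyBound.mono {k s s' : ℝ} {f : Amp q → W} (h : PolyBound k s f) (hs : s ≤ s') :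
    PolyBound k s' f := by
  obtain ⟨C, hC, N, h⟩ := h
  refine ⟨C, hC, N, fun θ x ξ => (h θ x ξ).trans ?_⟩
  gcongr ?_ * (?_ * ?_)
  · exact (jap_rpow_pos _ _).le
  · exact jap_rpow_le_rpow ξ hs

theorem PolyBound.add {k s : ℝ} {f g : Amp q → W} (hf : PolyBound k s f) (hg : PolyBound k s g) :
    PolyBound k s (f + g) := by
  obtain ⟨C, hC, N, h⟩ := hf
  obtain ⟨C', hC', N', h'⟩ := hg
  refine ⟨C + C', by positivity, max N N', fun θ x ξ => ?_⟩
  have e1 : (1 + ‖θ‖) ^ N ≤ (1 + ‖θ‖) ^ max N N' :=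
    pow_le_pow_right₀ (by simp) (le_max_left _ _)
  have e2 : (1 + ‖θ‖) ^ N' ≤ (1 + ‖θ‖) ^ max N N' :=
    pow_le_pow_right₀ (by simp) (le_max_right _ _)
  have p : 0 ≤ jap x ^ k * jap ξ ^ s := (mul_pos (jap_rpow_pos _ _) (jap_rpow_pos _ _)).le
  calc ‖(f + g) (θ, (x, ξ))‖ ≤ ‖f (θ, (x, ξ))‖ + ‖g (θ, (x, ξ))‖ := norm_add_le _ _
    _ ≤ _ := add_le_add (h θ x ξ) (h' θ x ξ)
    _ ≤ C * (1 + ‖θ‖) ^ max N N' * (jap x ^ k * jap ξ ^ s) +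
        C' * (1 + ‖θ‖) ^ max N N' * (jap x ^ k * jap ξ ^ s) := by gcongr
    _ = _ := by ring

theorem PolyBound.smul {k s : ℝ} {f : Amp q → W} (hf : PolyBound k s f) (c : ℂ) :
    PolyBound k s (c • f) := by
  obtain ⟨C, hC, N, h⟩ := hf
  refine ⟨‖c‖ * C, by positivity, N, fun θ x ξ => ?_⟩
  rw [Pi.smul_apply, norm_smul, mul_assoc, mul_assoc, ← mul_assoc C]
  gcongr
  exact h θ x ξ

/-- Amplitudes whose derivatives have polynomial bounds, such that each derivative in `x` costs
only `δ` powers of `⟨ξ⟩`. -/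
structure Tame (δ k : ℝ) (P : Amp q → W) : Prop where
  smooth : ContDiff ℝ ∞ P
  bound : ∀ v, ∃ K ≥ (0 : ℝ), PolyBound k K (wd v P) ∧
    ∀ (i : ℕ) (j : Fin q), PolyBound k (K + δ * i) ((dirDeriv (dX j))^[i] (wd v P))

/-- The bounds are required for all words of derivatives, so differentiation merely lengthens the
word. -/
theorem Tame.deriv {δ k : ℝ} {P : Amp q → W} (h : Tame δ k P) (l : ADir q) :
    Tame δ k (dirDeriv (avec l) P) :=
  ⟨dirDeriv_smooth _ h.smooth, fun v => by rw [wd_dirDeriv]; exact h.bound _⟩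

theorem Tame.add {δ k : ℝ} {P P' : Amp q → W} (h : Tame δ k P) (h' : Tame δ k P') :
    Tame δ k (P + P') := by
  refine ⟨h.smooth.add h'.smooth, fun v => ?_⟩
  obtain ⟨K, hK, h1, h2⟩ := h.bound v
  obtain ⟨K', hK', h1', h2'⟩ := h'.bound v
  refine ⟨max K K', hK.trans (le_max_left _ _), ?_, fun i j => ?_⟩
  · rw [wd_add v h.smooth h'.smooth]
    exact (h1.mono (le_max_left _ _)).add (h1'.mono (le_max_right _ _))
  · rw [wd_add v h.smooth h'.smooth,
      (iterate_dirDeriv _ i).2.1 _ _ (wd_smooth v h.smooth) (wd_smooth v h'.smooth)]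
    exact ((h2 i j).mono (by gcongr; exact le_max_left _ _)).add
      ((h2' i j).mono (by gcongr; exact le_max_right _ _))

theorem Tame.smul {δ k : ℝ} {P : Amp q → W} (h : Tame δ k P) (c : ℂ) : Tame δ k (c • P) := by
  refine ⟨contDiff_const.smul h.smooth, fun v => ?_⟩
  obtain ⟨K, hK, h1, h2⟩ := h.bound v
  refine ⟨K, hK, ?_, fun i j => ?_⟩
  · rw [wd_smul v c h.smooth]
    exact h1.smul c
  · rw [wd_smul v c h.smooth, (iterate_dirDeriv _ i).2.2 c _ (wd_smooth v h.smooth)]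
    exact (h2 i j).smul c

theorem Tame.zero (δ k : ℝ) : Tame δ k (0 : Amp q → W) := by
  have hz : ∀ s, PolyBound k s (0 : Amp q → W) := fun s =>
    ⟨0, le_rfl, 0, fun θ x ξ => by simp⟩
  have hc : ContDiff ℝ ∞ (0 : Amp q → W) := contDiff_const
  have hw : ∀ v, wd v (0 : Amp q → W) = 0 := fun v => by
    have := wd_smul v 0 hc
    simpa using this
  refine ⟨hc, fun v => ⟨0, le_rfl, ?_, fun i j => ?_⟩⟩
  · rw [hw]; exact hz _
  · have := (iterate_dirDeriv (W := W) (dX j) i).2.2 0 0 hc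
    rw [hw]
    simp only [zero_smul] at this
    rw [this]
    exact hz _

theorem Tame.sum {δ k : ℝ} {ι : Type*} (s : Finset ι) {P : ι → Amp q → W}
    (h : ∀ i ∈ s, Tame δ k (P i)) : Tame δ k (∑ i ∈ s, P i) := by
  classical
  induction s using Finset.induction_on with
  | empty => exact Tame.zero δ k
  | insert a s ha ih =>
    rw [Finset.sum_insert ha]
    exact (h a (Finset.mem_insert_self _ _)).add
      (ih fun i hi => h i (Finset.mem_insert_of_mem hi))

theorem Tame.polyBound {δ k : ℝ} {P : Amp q → W} (h : Tame δ k P) :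
    ∃ K ≥ (0 : ℝ), PolyBound k K P := by
  obtain ⟨K, hK, h1, -⟩ := h.bound []
  exact ⟨K, hK, h1⟩

/-! Dilations in `x`. -/

/-- The linear map `(θ, (x, ξ)) ↦ (θ, (t x, ξ))`. -/
def scaleMap (q : ℕ) (t : ℝ) : Amp q →L[ℝ] Amp q :=
  (ContinuousLinearMap.fst ℝ _ _).prod
    ((t • (ContinuousLinearMap.fst ℝ _ _).comp (ContinuousLinearMap.snd ℝ _ _)).prod
      ((ContinuousLinearMap.snd ℝ _ _).comp (ContinuousLinearMap.snd ℝ _ _)))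

/-- The amplitude `P(θ, (t x, ξ))`. -/
def scale (t : ℝ) (P : Amp q → W) : Amp q → W := fun z => P (scaleMap q t z)

theorem scale_apply (t : ℝ) (P : Amp q → W) (θ : Rq q × Rq q) (x ξ : Rq q) :
    scale t P (θ, (x, ξ)) = P (θ, (t • x, ξ)) := rfl

theorem scale_smooth (t : ℝ) {P : Amp q → W} (hP : ContDiff ℝ ∞ P) : ContDiff ℝ ∞ (scale t P) :=
  hP.comp (scaleMap q t).contDiff

theorem scale_one (P : Amp q → W) : scale 1 P = P := by
  funext ⟨θ, x, ξ⟩; simp [scale_apply]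

theorem scale_smul (t : ℝ) (c : ℂ) (P : Amp q → W) : scale t (c • P) = c • scale t P := rfl

theorem scale_sum {ι : Type*} (s : Finset ι) (t : ℝ) (P : ι → Amp q → W) :
    scale t (∑ i ∈ s, P i) = ∑ i ∈ s, scale t (P i) := by
  funext z; simp [scale]

theorem dirDeriv_scale (t : ℝ) (v : Amp q) {P : Amp q → W} (hP : ContDiff ℝ ∞ P) :
    dirDeriv v (scale t P) = scale t (dirDeriv (scaleMap q t v) P) :=
  dirDeriv_comp_linear (scaleMap q t) v hP

theorem dirDeriv_dX_scale (t : ℝ) (j : Fin q) {P : Amp q → W} (hP : ContDiff ℝ ∞ P) :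
    dirDeriv (dX j) (scale t P) = (t : ℂ) • scale t (dirDeriv (dX j) P) := by
  have : scaleMap q t (dX j) = t • dX j := by
    simp [scaleMap, dX, avec, svec]
  rw [dirDeriv_scale t _ hP, this, dirDeriv_smul_vec, scale_smul]

theorem dirDeriv_dXi_scale (t : ℝ) (j : Fin q) {P : Amp q → W} (hP : ContDiff ℝ ∞ P) :
    dirDeriv (dXi j) (scale t P) = scale t (dirDeriv (dXi j) P) := by
  have : scaleMap q t (dXi j) = dXi j := by
    simp [scaleMap, dXi, avec, svec]
  rw [dirDeriv_scale t _ hP, this]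

theorem dirDeriv_inl_scale (t : ℝ) (l : SDir q) {P : Amp q → W} (hP : ContDiff ℝ ∞ P) :
    dirDeriv (avec (Sum.inl l)) (scale t P) = scale t (dirDeriv (avec (Sum.inl l)) P) := by
  have : scaleMap q t (avec (Sum.inl l)) = avec (Sum.inl l) := by
    simp [scaleMap, avec]
  rw [dirDeriv_scale t _ hP, this]

theorem iterate_dX_scale (t : ℝ) (j : Fin q) (i : ℕ) {P : Amp q → W} (hP : ContDiff ℝ ∞ P) :
    (dirDeriv (dX j))^[i] (scale t P) = ((t : ℂ) ^ i) • scale t ((dirDeriv (dX j))^[i] P) := by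
  induction i with
  | zero => simp
  | succ i ih =>
    rw [Function.iterate_succ_apply', ih, dirDeriv_smul _ _
      (scale_smooth t (dirDeriv_iterate_smooth _ _ hP)),
      dirDeriv_dX_scale _ _ (dirDeriv_iterate_smooth _ _ hP), smul_smul,
      Function.iterate_succ_apply', pow_succ]

/-- Dilation acts diagonally on the coordinate directions: every `x`-derivative contributes a factor
`t`. For tameness the value of the scalar is irrelevant. -/
theorem wd_scale (t : ℝ) (v : List (ADir q)) {P : Amp q → W} (hP : ContDiff ℝ ∞ P) :
    ∃ c : ℂ, wd v (scale t P) = c • scale t (wd v P) := by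
  induction v with
  | nil => exact ⟨1, by simp [wd]⟩
  | cons l v ih =>
    obtain ⟨c, hc⟩ := ih
    have h1 := wd_smooth v hP
    have e : wd (l :: v) (scale t P) = c • dirDeriv (avec l) (scale t (wd v P)) := by
      change dirDeriv _ (wd v (scale t P)) = _
      rw [hc, dirDeriv_smul _ _ (scale_smooth t h1)]
    rw [e]
    rcases l with l | l | j
    · exact ⟨c, by rw [dirDeriv_inl_scale t l h1]; rfl⟩
    · exact ⟨c * t, by rw [← dX, dirDeriv_dX_scale t l h1, smul_smul]; rfl⟩
    · exact ⟨c, by rw [← dXi, dirDeriv_dXi_scale t j h1]; rfl⟩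

theorem jap_smul_rpow_le (t : ℝ) (x : Rq q) {k : ℝ} (hk : 0 ≤ k) :
    jap (t • x) ^ k ≤ (1 + |t|) ^ k * jap x ^ k := by
  rw [← Real.mul_rpow (by positivity) (jap_pos x).le]
  refine Real.rpow_le_rpow (jap_pos _).le ?_ hk
  have h3 : jap x ^ 2 = 1 + ‖x‖ ^ 2 := Real.sq_sqrt (by positivity)
  have h4 := jap_pos x
  rw [jap_eq (t • x), Real.sqrt_le_left (by positivity), norm_smul, Real.norm_eq_abs, mul_pow,
    mul_pow, h3]
  have := abs_nonneg t
  nlinarith [sq_nonneg ‖x‖, mul_nonneg this (sq_nonneg ‖x‖)]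

theorem PolyBound.scaled {k s : ℝ} (hk : 0 ≤ k) {f : Amp q → W} (hf : PolyBound k s f) (t : ℝ) :
    PolyBound k s (scale t f) := by
  obtain ⟨C, hC, N, h⟩ := hf
  refine ⟨C * (1 + |t|) ^ k, by positivity, N, fun θ x ξ => (h θ (t • x) ξ).trans ?_⟩
  calc C * (1 + ‖θ‖) ^ N * (jap (t • x) ^ k * jap ξ ^ s)
      ≤ C * (1 + ‖θ‖) ^ N * (((1 + |t|) ^ k * jap x ^ k) * jap ξ ^ s) := by
        gcongr
        · exact (jap_rpow_pos _ _).le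
        · exact jap_smul_rpow_le t x hk
    _ = _ := by ring

theorem Tame.scaled {δ k : ℝ} (hk : 0 ≤ k) {P : Amp q → W} (h : Tame δ k P) (t : ℝ) :
    Tame δ k (scale t P) := by
  refine ⟨scale_smooth t h.smooth, fun v => ?_⟩
  obtain ⟨K, hK, h1, h2⟩ := h.bound v
  obtain ⟨c, hc⟩ := wd_scale t v h.smooth
  refine ⟨K, hK, ?_, fun i j => ?_⟩
  · rw [hc]; exact (h1.scaled hk t).smul c
  · have hw := wd_smooth v h.smooth
    rw [hc, (iterate_dirDeriv _ i).2.2 c _ (scale_smooth t hw), iterate_dX_scale t j i hw]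
    exact (((h2 i j).scaled hk t).smul _).smul _

/-! Weights. -/

/-- Smooth functions of `x` which decay, with all pure derivatives, like `⟨x⟩^{-l}`. -/
def IsWeight (l : ℝ) (w : Rq q → ℂ) : Prop :=
  ContDiff ℝ ∞ w ∧ (∃ C : ℝ, ∀ x, ‖w x‖ ≤ C * jap x ^ (-l)) ∧
    ∀ (j : Fin q) (i : ℕ), ∃ C : ℝ, ∀ x,
      ‖(dirDeriv (ev j))^[i] w x‖ ≤ C * jap x ^ (-l)

/-- Smooth functions all of whose pure derivatives are bounded by the function. -/
def IsSlow (w : Rq q → ℂ) : Prop :=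
  ContDiff ℝ ∞ w ∧ ∀ (j : Fin q) (i : ℕ), ∃ C : ℝ, 0 ≤ C ∧ ∀ x,
    ‖(dirDeriv (ev j))^[i] w x‖ ≤ C * ‖w x‖

theorem exists_uniform_of_le (n : ℕ) {β : Type*} (f : ℕ → β → ℝ) (g : β → ℝ) (hg : ∀ b, 0 ≤ g b)
    (h : ∀ i, ∃ C : ℝ, ∀ b, f i b ≤ C * g b) :
    ∃ C : ℝ, 0 ≤ C ∧ ∀ i ≤ n, ∀ b, f i b ≤ C * g b := by
  choose C hC using h
  refine ⟨∑ i ∈ Finset.range (n + 1), |C i|, Finset.sum_nonneg fun _ _ => abs_nonneg _,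
    fun i hi b => (hC i b).trans (mul_le_mul_of_nonneg_right ?_ (hg b))⟩
  exact (le_abs_self _).trans (Finset.single_le_sum (f := fun i => |C i|)
    (fun _ _ => abs_nonneg _) (Finset.mem_range.2 (by omega)))

/-- Bounds relative to the function itself multiply under the Leibniz rule, so products with many
factors need no bookkeeping of decay rates. -/
theorem IsSlow.mul {w w' : Rq q → ℂ} (h : IsSlow w) (h' : IsSlow w') :
    IsSlow fun x => w x * w' x := by
  refine ⟨h.1.mul h'.1, fun j i => ?_⟩
  obtain ⟨C, hC, hc⟩ := exists_uniform_of_le i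
    (fun i x => ‖(dirDeriv (ev j))^[i] w x‖) (fun x => ‖w x‖)
    (fun x => norm_nonneg _) fun i => (h.2 j i).imp fun C hC => hC.2
  obtain ⟨C', hC', hc'⟩ := exists_uniform_of_le i
    (fun i x => ‖(dirDeriv (ev j))^[i] w' x‖) (fun x => ‖w' x‖)
    (fun x => norm_nonneg _) fun i => (h'.2 j i).imp fun C hC => hC.2
  refine ⟨2 ^ i * (C * C'), by positivity, fun x => ?_⟩
  have := norm_iterate_dirDeriv_smul_le (ev j) i h.1 h'.1 x (fun i' hi => hc i' hi x)
    (fun i' hi => hc' i' hi x)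
  simp only [smul_eq_mul] at this
  rw [norm_mul]
  refine this.trans (le_of_eq ?_)
  ring

/-- All derivatives inherit the decay of `w`, hence a pointwise bound of `w` alone is enough. -/
theorem IsSlow.isWeight {w : Rq q → ℂ} (h : IsSlow w) {l : ℝ} (hl : ∀ x, ‖w x‖ ≤ jap x ^ (-l)) :
    IsWeight l w :=
  ⟨h.1, ⟨1, fun x => by rw [one_mul]; exact hl x⟩, fun j i => by
    obtain ⟨C, hC, hc⟩ := h.2 j i
    exact ⟨C, fun x => (hc x).trans (mul_le_mul_of_nonneg_left (hl x) hC)⟩⟩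

theorem IsWeight.mul {l l' : ℝ} {w w' : Rq q → ℂ} (h : IsWeight l w) (h' : IsWeight l' w') :
    IsWeight (l + l') fun x => w x * w' x := by
  refine ⟨h.1.mul h'.1, ?_, fun j i => ?_⟩
  · obtain ⟨C, hC⟩ := h.2.1
    obtain ⟨C', hC'⟩ := h'.2.1
    refine ⟨C * C', fun x => ?_⟩
    rw [norm_mul, neg_add, jap_rpow_add]
    calc ‖w x‖ * ‖w' x‖ ≤ (C * jap x ^ (-l)) * (C' * jap x ^ (-l')) :=
          mul_le_mul (hC x) (hC' x) (norm_nonneg _) ((norm_nonneg _).trans (hC x))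
      _ = _ := by ring
  obtain ⟨C, hC, hc⟩ := exists_uniform_of_le i
    (fun i x => ‖(dirDeriv (ev j))^[i] w x‖) (fun x => jap x ^ (-l))
    (fun x => (jap_rpow_pos _ _).le) fun i => h.2.2 j i
  obtain ⟨C', hC', hc'⟩ := exists_uniform_of_le i
    (fun i x => ‖(dirDeriv (ev j))^[i] w' x‖) (fun x => jap x ^ (-l'))
    (fun x => (jap_rpow_pos _ _).le) fun i => h'.2.2 j i
  refine ⟨2 ^ i * (C * C'), fun x => ?_⟩
  have := norm_iterate_dirDeriv_smul_le (ev j) i h.1 h'.1 x (fun i' hi => hc i' hi x)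
    (fun i' hi => hc' i' hi x)
  simp only [smul_eq_mul] at this
  rw [neg_add, jap_rpow_add]
  refine this.trans (le_of_eq ?_)
  ring

/-! ### Coordinate functions and the weights `∏ (1 + i x_j)⁻¹`. -/

theorem dirDeriv_coord (j j' : Fin q) :
    dirDeriv (ev j') (fun x : Rq q => ((x j : ℝ) : ℂ)) = fun _ => if j = j' then 1 else 0 := by
  funext x
  have h : HasFDerivAt (fun x : Rq q => ((x j : ℝ) : ℂ))
      (Complex.ofRealCLM.comp (EuclideanSpace.proj j)) x :=
    (Complex.ofRealCLM.comp (EuclideanSpace.proj j : Rq q →L[ℝ] ℝ)).hasFDerivAt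
  simp only [dirDeriv]
  rw [h.fderiv]
  have : (EuclideanSpace.proj j : Rq q →L[ℝ] ℝ) (ev j') = if j = j' then 1 else 0 := by
    simp [ev]
  rw [ContinuousLinearMap.comp_apply, this]
  split_ifs <;> simp

theorem coord_smooth (j : Fin q) : ContDiff ℝ ∞ (fun x : Rq q => ((x j : ℝ) : ℂ)) :=
  (Complex.ofRealCLM.comp (EuclideanSpace.proj j : Rq q →L[ℝ] ℝ)).contDiff

theorem abs_coord_le (x : Rq q) (j : Fin q) : |x j| ≤ ‖x‖ := by
  simpa using PiLp.norm_apply_le x j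

theorem isWeight_coord (j : Fin q) : IsWeight (-1) (fun x : Rq q => ((x j : ℝ) : ℂ)) := by
  refine ⟨coord_smooth j, ⟨1, fun x => ?_⟩, fun j' i => ⟨1, fun x => ?_⟩⟩
  · simpa using (abs_coord_le x j).trans (norm_le_jap x)
  rw [neg_neg, Real.rpow_one, one_mul]
  rcases i with _ | i
  · simpa using (abs_coord_le x j).trans (norm_le_jap x)
  · rw [Function.iterate_succ_apply, dirDeriv_coord]
    rcases i with _ | i
    · simp only [Function.iterate_zero, id_eq]
      split_ifs
      · simpa using one_le_jap x
      · simpa using (jap_pos x).le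
    · rw [Function.iterate_succ_apply, dirDeriv_const]
      have : (dirDeriv (ev j'))^[i] (0 : Rq q → ℂ) = 0 := by
        have := (iterate_dirDeriv (W := ℂ) (ev j') i).2.2 0 0 contDiff_const
        simpa using this
      rw [this]
      simpa using (jap_pos x).le

/-- The weight `∏_{j ∈ L} (1 + i x_j)⁻¹`. -/
def wt (L : List (Fin q)) (x : Rq q) : ℂ := (L.map fun j => (1 + Complex.I * x j)⁻¹).prod

theorem one_add_I_mul_ne_zero (t : ℝ) : (1 + Complex.I * t : ℂ) ≠ 0 := by
  intro h
  have := congrArg Complex.re h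
  simp at this

theorem sq_norm_one_add_I_mul (t : ℝ) : ‖(1 + Complex.I * t : ℂ)‖ ^ 2 = 1 + t ^ 2 := by
  rw [← Complex.normSq_eq_norm_sq, Complex.normSq_apply]; simp; ring

theorem one_le_norm_one_add_I_mul (t : ℝ) : 1 ≤ ‖(1 + Complex.I * t : ℂ)‖ := by
  have := sq_norm_one_add_I_mul t
  nlinarith [norm_nonneg (1 + Complex.I * t : ℂ), sq_nonneg t]

theorem wtFactor_smooth (j : Fin q) :
    ContDiff ℝ ∞ fun x : Rq q => ((1 + Complex.I * x j)⁻¹ : ℂ) :=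
  (contDiff_const.add (contDiff_const.mul (coord_smooth j))).inv fun _ => one_add_I_mul_ne_zero _

theorem dirDeriv_wtFactor_pow (j j' : Fin q) (m : ℕ) :
    ∃ c : ℂ, dirDeriv (ev j') (fun x : Rq q => ((1 + Complex.I * x j)⁻¹ : ℂ) ^ m) =
      c • fun x : Rq q => ((1 + Complex.I * x j)⁻¹ : ℂ) ^ (m + 1) := by
  refine ⟨-(m * Complex.I * if j = j' then 1 else 0), funext fun x => ?_⟩
  have h0 : HasFDerivAt (fun x : Rq q => (1 + Complex.I * x j : ℂ)) _ x :=
    (((contDiff_differentiableAt (coord_smooth j) x).hasFDerivAt).const_mul Complex.I).const_add 1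
  have h1 := ((hasDerivAt_inv (one_add_I_mul_ne_zero (x j))).pow m).comp_hasFDerivAt x h0
  have e := congrFun (dirDeriv_coord j j') x
  simp only [dirDeriv] at e ⊢
  have h2 := h1.fderiv
  rw [show (fun x : Rq q => ((1 + Complex.I * x j)⁻¹ : ℂ) ^ m) =
    (Inv.inv ^ m) ∘ fun x : Rq q => (1 + Complex.I * x j : ℂ) from rfl, h2]
  simp only [_root_.smul_apply, e, Pi.smul_apply, smul_eq_mul]
  rcases m with _ | m
  · simp
  · simp only [Nat.add_sub_cancel, ← inv_pow]
    ring

theorem isSlow_wtFactor (j : Fin q) : IsSlow fun x : Rq q => ((1 + Complex.I * x j)⁻¹ : ℂ) := by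
  refine ⟨wtFactor_smooth j, fun j' i => ?_⟩
  have key : ∀ i, ∃ c : ℂ, (dirDeriv (ev j'))^[i] (fun x : Rq q => ((1 + Complex.I * x j)⁻¹ : ℂ)) =
      c • fun x : Rq q => ((1 + Complex.I * x j)⁻¹ : ℂ) ^ (i + 1) := by
    intro i
    induction i with
    | zero => exact ⟨1, by simp⟩
    | succ i ih =>
      obtain ⟨c, hc⟩ := ih
      obtain ⟨c', hc'⟩ := dirDeriv_wtFactor_pow j j' (i + 1)
      refine ⟨c * c', ?_⟩
      rw [Function.iterate_succ_apply', hc, dirDeriv_smul _ _ ((wtFactor_smooth j).pow _), hc',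
        smul_smul]
  obtain ⟨c, hc⟩ := key i
  refine ⟨‖c‖, norm_nonneg c, fun x => ?_⟩
  rw [hc, Pi.smul_apply, norm_smul, norm_pow, norm_inv]
  have h1 : ‖(1 + Complex.I * x j : ℂ)‖⁻¹ ≤ 1 := inv_le_one_of_one_le₀ (one_le_norm_one_add_I_mul _)
  gcongr
  calc ‖(1 + Complex.I * x j : ℂ)‖⁻¹ ^ (i + 1) ≤ ‖(1 + Complex.I * x j : ℂ)‖⁻¹ ^ 1 :=
        pow_le_pow_of_le_one (by positivity) h1 (by omega)
    _ = _ := pow_one _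

theorem isSlow_wt (L : List (Fin q)) : IsSlow (wt L) := by
  induction L with
  | nil =>
    have : wt ([] : List (Fin q)) = fun _ => 1 := by funext x; simp [wt]
    rw [this]
    refine ⟨contDiff_const, fun j i => ⟨1, zero_le_one, fun x => ?_⟩⟩
    rcases i with _ | i
    · simp
    · rw [Function.iterate_succ_apply, dirDeriv_const]
      have : (dirDeriv (ev j))^[i] (0 : Rq q → ℂ) = 0 := by
        have := (iterate_dirDeriv (W := ℂ) (ev j) i).2.2 0 0 contDiff_const
        simpa using this
      simp [this]
  | cons j L ih =>
    have : wt (j :: L) = fun x => (1 + Complex.I * x j)⁻¹ * wt L x := by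
      funext x; simp [wt]
    rw [this]
    exact (isSlow_wtFactor j).mul ih

theorem wt_cons (j : Fin q) (L : List (Fin q)) (x : Rq q) :
    wt L x = (1 + Complex.I * x j) * wt (j :: L) x := by
  have := one_add_I_mul_ne_zero (x j)
  simp only [wt, List.map_cons, List.prod_cons]
  field_simp

theorem norm_wt_le_one (L : List (Fin q)) (x : Rq q) : ‖wt L x‖ ≤ 1 := by
  induction L with
  | nil => simp [wt]
  | cons j L ih =>
    simp only [wt, List.map_cons, List.prod_cons, norm_mul, norm_inv] at ih ⊢
    exact mul_le_one₀ (inv_le_one_of_one_le₀ (one_le_norm_one_add_I_mul _)) (norm_nonneg _) ih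

theorem isWeight_wt_zero (L : List (Fin q)) : IsWeight 0 (wt L) :=
  (isSlow_wt L).isWeight fun x => by simpa using norm_wt_le_one L x

/-- All indices, each `M` times. -/
def fullList (q M : ℕ) : List (Fin q) := (List.replicate M (List.finRange q)).flatten

theorem one_add_sum_le_prod {ι : Type*} (s : Finset ι) {f : ι → ℝ} (hf : ∀ i, 0 ≤ f i) :
    1 + ∑ i ∈ s, f i ≤ ∏ i ∈ s, (1 + f i) := by
  classical
  induction s using Finset.induction_on with
  | empty => simp
  | insert a s ha ih =>
    rw [Finset.sum_insert ha, Finset.prod_insert ha]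
    have h1 := Finset.sum_nonneg fun i (_ : i ∈ s) => hf i
    nlinarith [hf a]

/-- One factor per coordinate decays like `⟨x⟩^{-1}`, because `∏_j (1 + x_j²) ≥ 1 + |x|²`; repeating
every index `M` times gives `⟨x⟩^{-M}`. -/
theorem isWeight_wt_fullList (M : ℕ) : IsWeight M (wt (fullList q M)) := by
  refine (isSlow_wt _).isWeight fun x => ?_
  have e : wt (fullList q M) x = (∏ j, (1 + Complex.I * x j)⁻¹) ^ M := by
    have h1 : wt (List.finRange q) x = ∏ j, (1 + Complex.I * x j)⁻¹ := by
      rw [wt, ← List.ofFn_eq_map, List.prod_ofFn]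
    rw [← h1, fullList]
    induction M with
    | zero => simp [wt]
    | succ M ih =>
      rw [List.replicate_succ, List.flatten_cons, pow_succ', ← ih]
      simp [wt]
  rw [e, norm_pow, Real.rpow_neg (jap_pos x).le, Real.rpow_natCast, ← inv_pow]
  gcongr
  rw [norm_prod]
  simp only [norm_inv]
  rw [Finset.prod_inv_distrib]
  refine inv_anti₀ (jap_pos x) ?_
  rw [jap_eq]
  refine Real.sqrt_le_iff.2 ⟨by positivity, ?_⟩
  rw [← Finset.prod_pow]
  simp only [sq_norm_one_add_I_mul]
  rw [EuclideanSpace.norm_sq_eq]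
  simp only [Real.norm_eq_abs, sq_abs]
  exact one_add_sum_le_prod _ fun i => sq_nonneg (x i)

end Amplitudes


/-! ### Oscillatory integrals -/

section Oscillatory

variable {q : ℕ} {W : Type*} [NormedAddCommGroup W] [NormedSpace ℂ W]

/-- The inner integral `∫ e^{-ixξ} w(x) P(θ, (x, ξ)) dx`. -/
def Phi (w : Rq q → ℂ) (P : Amp q → W) (θ : Rq q × Rq q) (ξ : Rq q) : W :=
  ∫ x, ek x ξ • w x • P (θ, (x, ξ))

/-- The iterated integral `∫∫ e^{-ixξ} w(x) P(θ, (x, ξ)) dx dξ`. -/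
def osc (w : Rq q → ℂ) (P : Amp q → W) (θ : Rq q × Rq q) : W := ∫ ξ, Phi w P θ ξ

theorem continuous_integral_dec {X : Type*} [TopologicalSpace X] [FirstCountableTopology X]
    {F : X → Rq q → W} (hF : Continuous fun p : X × Rq q => F p.1 p.2) {C : X → ℝ}
    (hC : Continuous C) (hb : ∀ p x, ‖F p x‖ ≤ C p * dec x) :
    Continuous fun p => ∫ x, F p x := by
  refine continuous_iff_continuousAt.2 fun p₀ => ?_
  refine continuousAt_of_dominated (bound := fun x => (C p₀ + 1) * dec x) ?_ ?_ ?_ ?_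
  · exact Filter.Eventually.of_forall fun p =>
      (hF.comp (Continuous.prodMk_right p)).aestronglyMeasurable
  · filter_upwards [hC.continuousAt.eventually (gt_mem_nhds (lt_add_one (C p₀)))] with p hp
    refine Filter.Eventually.of_forall fun x => (hb p x).trans ?_
    exact mul_le_mul_of_nonneg_right hp.le (dec_pos x).le
  · exact dec_integrable.const_mul _
  · exact Filter.Eventually.of_forall fun x =>
      (hF.comp (Continuous.prodMk_left x)).continuousAt

/-- The constant depends on the weight and on `n`, but not on `h`. This uniformity is the origin of
all later estimates that are linear in the seminorms of the symbols. -/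
theorem exists_norm_integral_ek_weight_le {l k : ℝ} {w : Rq q → ℂ} (hw : IsWeight l w)
    (hkl : k + ((q : ℝ) + 1) ≤ l) (n : ℕ) :
    ∃ C ≥ (0 : ℝ), ∀ (h : Rq q → W), ContDiff ℝ ∞ h → ∀ A, (∀ x, ‖h x‖ ≤ A * jap x ^ k) →
      (∀ j, ∀ i ≤ n, ∀ x, ‖(dirDeriv (ev j))^[i] h x‖ ≤ A * jap x ^ k) →
      ∀ ξ, ‖∫ x, ek x ξ • w x • h x‖ ≤ C * A * jap ξ ^ (-(n : ℝ)) := by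
  obtain ⟨hws, ⟨C₀, hC₀⟩, hw2⟩ := hw
  have hu : ∀ j, ∃ C : ℝ, 0 ≤ C ∧ ∀ i ≤ n, ∀ x,
      ‖(dirDeriv (ev j))^[i] w x‖ ≤ C * jap x ^ (-l) := fun j =>
    exists_uniform_of_le n (fun i x => ‖(dirDeriv (ev j))^[i] w x‖) (fun x => jap x ^ (-l))
      (fun x => (jap_rpow_pos _ _).le) fun i => hw2 j i
  choose Cj hCj hcj using hu
  set D : ℝ := |C₀| + ∑ j, Cj j with hD
  have hD0 : 0 ≤ D := add_nonneg (abs_nonneg _) (Finset.sum_nonneg fun j _ => hCj j)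
  have hD1 : ∀ j, Cj j ≤ D := fun j =>
    (Finset.single_le_sum (fun j _ => hCj j) (Finset.mem_univ j)).trans
      (le_add_of_nonneg_left (abs_nonneg _))
  have hD2 : C₀ ≤ D := (le_abs_self _).trans
    (le_add_of_nonneg_right (Finset.sum_nonneg fun j _ => hCj j))
  refine ⟨2 ^ n * (1 + q ^ n) * (2 ^ n * D * ∫ x : Rq q, dec x), ?_, ?_⟩
  · have := integral_dec_nonneg (q := q)
    positivity
  intro h hh A h0 hA ξ
  have hA0 : 0 ≤ A := by
    have := (norm_nonneg _).trans (h0 0)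
    rwa [jap_zero, Real.one_rpow, mul_one] at this
  have hmul : ∀ x, jap x ^ (-l) * jap x ^ k ≤ dec x := fun x => by
    rw [← jap_rpow_add]
    exact jap_rpow_le_dec x (by linarith)
  have key : ∀ x a, a ≤ 2 ^ n * ((D * jap x ^ (-l)) * (A * jap x ^ k)) →
      a ≤ (2 ^ n * D * A) * dec x := fun x a ha => ha.trans (by
    calc 2 ^ n * ((D * jap x ^ (-l)) * (A * jap x ^ k))
        = (2 ^ n * D * A) * (jap x ^ (-l) * jap x ^ k) := by ring
      _ ≤ _ := by gcongr; exact hmul x)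
  have b := norm_integral_ek_le (g := fun x => w x • h x) (hws.smul hh) n (C := 2 ^ n * D * A)
    (fun j i hi x => key x _ ?_) (fun x => key x _ ?_) ξ
  · refine b.trans (le_of_eq ?_); ring
  · refine (norm_iterate_dirDeriv_smul_le (ev j) i hws hh x
      (fun i' hi' => (hcj j i' (hi'.trans hi) x).trans
        (mul_le_mul_of_nonneg_right (hD1 j) (jap_rpow_pos _ _).le))
      (fun i' hi' => hA j i' (hi'.trans hi) x)).trans ?_
    have h1 := (jap_rpow_pos x (-l)).le
    have h2 := (jap_rpow_pos x k).le
    gcongr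
    · norm_num
  · have h1 := (jap_rpow_pos x (-l)).le
    have h2 := (jap_rpow_pos x k).le
    have h3 : (1 : ℝ) ≤ 2 ^ n := one_le_pow₀ (by norm_num)
    rw [norm_smul]
    calc ‖w x‖ * ‖h x‖ ≤ (D * jap x ^ (-l)) * (A * jap x ^ k) :=
          mul_le_mul ((hC₀ x).trans (mul_le_mul_of_nonneg_right hD2 h1)) (h0 x)
            (norm_nonneg _) (by positivity)
      _ ≤ _ := le_mul_of_one_le_left (by positivity) h3

theorem iterate_dX_slice (j : Fin q) (i : ℕ) {P : Amp q → W} (hP : ContDiff ℝ ∞ P)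
    (θ : Rq q × Rq q) (ξ : Rq q) :
    (dirDeriv (ev j))^[i] (fun x => P (θ, (x, ξ))) =
      fun x => (dirDeriv (dX j))^[i] P (θ, (x, ξ)) := by
  induction i with
  | zero => rfl
  | succ i ih =>
    rw [Function.iterate_succ_apply', ih, Function.iterate_succ_apply']
    have hs := dirDeriv_iterate_smooth (dX j) i hP
    let A : Rq q →L[ℝ] Amp q := (0 : Rq q →L[ℝ] Rq q × Rq q).prod
      ((ContinuousLinearMap.id ℝ (Rq q)).prod 0)
    have e := dirDeriv_comp_affine A (θ, (0, ξ)) (ev j) hs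
    have e2 : ∀ x, A x + (θ, (0, ξ)) = (θ, (x, ξ)) := fun x => by
      simp [A]
    have e3 : A (ev j) = dX j := by simp [A, dX, avec, svec]
    simpa only [e2, e3] using e

theorem slice_x_smooth {P : Amp q → W} (hP : ContDiff ℝ ∞ P) (θ : Rq q × Rq q) (ξ : Rq q) :
    ContDiff ℝ ∞ fun x => P (θ, (x, ξ)) :=
  hP.comp (contDiff_const.prodMk (contDiff_id.prodMk contDiff_const))

/-- Integrating by parts `n` times gains `⟨ξ⟩^{-n}` and costs `⟨ξ⟩^{δn}`; since `δ < 1`, a large `n`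
outweighs the initial growth `⟨ξ⟩^K` and leaves an integrable function of `ξ`. -/
theorem exists_norm_Phi_le {δ k l : ℝ} {w : Rq q → ℂ} (hw : IsWeight l w)
    (hkl : k + ((q : ℝ) + 1) ≤ l) (hδ : δ < 1) (K : ℝ) :
    ∃ n : ℕ, ∃ C ≥ (0 : ℝ), ∀ (P : Amp q → W), ContDiff ℝ ∞ P → ∀ θ A,
      (∀ x ξ, ‖P (θ, (x, ξ))‖ ≤ A * (jap x ^ k * jap ξ ^ (K + δ * n))) →
      (∀ j, ∀ i ≤ n, ∀ x ξ,
        ‖(dirDeriv (dX j))^[i] P (θ, (x, ξ))‖ ≤ A * (jap x ^ k * jap ξ ^ (K + δ * n))) →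
      ∀ ξ, ‖Phi w P θ ξ‖ ≤ C * A * dec ξ := by
  obtain ⟨n, hn⟩ := exists_nat_ge ((K + (q + 1)) / (1 - δ))
  have hn' : K + δ * n - n ≤ -((q : ℝ) + 1) := by
    rw [div_le_iff₀ (by linarith)] at hn; linarith
  obtain ⟨C, hC, h⟩ := exists_norm_integral_ek_weight_le (W := W) hw hkl n
  refine ⟨n, C, hC, fun P hP θ A h0 h1 ξ => ?_⟩
  have hA : 0 ≤ A := by
    have := (norm_nonneg _).trans (h0 0 0)
    simpa [jap_zero] using this
  refine (h _ (slice_x_smooth hP θ ξ) (A * jap ξ ^ (K + δ * n)) (fun x => ?_)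
    (fun j i hi x => ?_) ξ).trans ?_
  · exact (h0 x ξ).trans (le_of_eq (by ring))
  · rw [iterate_dX_slice j i hP]
    exact (h1 j i hi x ξ).trans (le_of_eq (by ring))
  · rw [← mul_assoc, mul_assoc (C * A), ← jap_rpow_add]
    gcongr
    exact jap_rpow_le_dec ξ (by linarith)

/-- The order of the quantifiers matters: `K` is fixed before `n`, since the required number `n` of
integrations by parts is computed from `K`. -/
theorem Tame.uniform {δ k : ℝ} (hδ : 0 ≤ δ) {P : Amp q → W} (h : Tame δ k P) :
    ∃ K ≥ (0 : ℝ), ∀ n : ℕ, ∃ C ≥ (0 : ℝ), ∃ N : ℕ, ∀ θ x ξ,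
      ‖P (θ, (x, ξ))‖ ≤ C * (1 + ‖θ‖) ^ N * (jap x ^ k * jap ξ ^ (K + δ * n)) ∧
      ∀ j, ∀ i ≤ n, ‖(dirDeriv (dX j))^[i] P (θ, (x, ξ))‖ ≤
        C * (1 + ‖θ‖) ^ N * (jap x ^ k * jap ξ ^ (K + δ * n)) := by
  obtain ⟨K, hK, h1, h2⟩ := h.bound []
  refine ⟨K, hK, fun n => ?_⟩
  obtain ⟨C₀, hC₀, N₀, h1⟩ := h1.mono (s' := K + δ * n) (le_add_of_nonneg_right (by positivity))
  choose C hC N h2 using h2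
  have hCs : 0 ≤ ∑ i ∈ Finset.range (n + 1), ∑ j, C i j :=
    Finset.sum_nonneg fun i _ => Finset.sum_nonneg fun j _ => hC i j
  refine ⟨C₀ + ∑ i ∈ Finset.range (n + 1), ∑ j, C i j, by positivity,
    N₀ + ∑ i ∈ Finset.range (n + 1), ∑ j, N i j, fun θ x ξ => ⟨?_, fun j i hi => ?_⟩⟩
  · refine (h1 θ x ξ).trans ?_
    have p := (mul_pos (jap_rpow_pos x k) (jap_rpow_pos ξ (K + δ * n))).le
    gcongr ?_ * ?_ * _
    · exact le_add_of_nonneg_right hCs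
    · exact pow_le_pow_right₀ (by simp) (Nat.le_add_right _ _)
  · have hi' : i ∈ Finset.range (n + 1) := Finset.mem_range.2 (by omega)
    have e1 : C i j ≤ C₀ + ∑ i ∈ Finset.range (n + 1), ∑ j, C i j := by
      refine le_add_of_nonneg_of_le hC₀ ?_
      refine (Finset.single_le_sum (f := fun j => C i j) (fun j _ => hC i j)
        (Finset.mem_univ j)).trans ?_
      exact Finset.single_le_sum (f := fun i => ∑ j, C i j)
        (fun i _ => Finset.sum_nonneg fun j _ => hC i j) hi'
    have e2 : N i j ≤ N₀ + ∑ i ∈ Finset.range (n + 1), ∑ j, N i j := by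
      refine le_trans ?_ (Nat.le_add_left _ _)
      refine (Finset.single_le_sum (f := fun j => N i j) (fun j _ => Nat.zero_le _)
        (Finset.mem_univ j)).trans ?_
      exact Finset.single_le_sum (f := fun i => ∑ j, N i j) (fun i _ => Nat.zero_le _) hi'
    refine (h2 i j θ x ξ).trans ?_
    have e3 : jap ξ ^ (K + δ * i) ≤ jap ξ ^ (K + δ * n) := by
      refine jap_rpow_le_rpow ξ ?_
      gcongr
    have p := (jap_rpow_pos x k).le
    have p' := (jap_rpow_pos ξ (K + δ * i)).le
    gcongr
    · simp

variable {δ k l : ℝ} {w : Rq q → ℂ}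

theorem weight_smul_le (hw : IsWeight l w) (hkl : k + ((q : ℝ) + 1) ≤ l) {P : Amp q → W}
    (hP : Tame δ k P) : ∃ C ≥ (0 : ℝ), ∃ N : ℕ, ∃ K ≥ (0 : ℝ), ∀ θ x ξ,
      ‖w x • P (θ, (x, ξ))‖ ≤ C * (1 + ‖θ‖) ^ N * jap ξ ^ K * dec x := by
  obtain ⟨K, hK, C, hC, N, h⟩ := hP.polyBound
  obtain ⟨C₀, hC₀⟩ := hw.2.1
  refine ⟨|C₀| * C, by positivity, N, K, hK, fun θ x ξ => ?_⟩
  rw [norm_smul]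
  calc ‖w x‖ * ‖P (θ, (x, ξ))‖
      ≤ (|C₀| * jap x ^ (-l)) * (C * (1 + ‖θ‖) ^ N * (jap x ^ k * jap ξ ^ K)) := by
        refine mul_le_mul ((hC₀ x).trans ?_) (h θ x ξ) (norm_nonneg _) ?_
        · exact mul_le_mul_of_nonneg_right (le_abs_self _) (jap_rpow_pos _ _).le
        · exact mul_nonneg (abs_nonneg _) (jap_rpow_pos _ _).le
    _ = |C₀| * C * (1 + ‖θ‖) ^ N * jap ξ ^ K * jap x ^ (-l + k) := by
        rw [jap_rpow_add]; ring
    _ ≤ _ := by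
        have := (jap_rpow_pos ξ K).le
        gcongr
        exact jap_rpow_le_dec x (by linarith)

theorem integrand_continuous (hw : Continuous w) {P : Amp q → W} (hP : Continuous P) :
    Continuous fun p : ((Rq q × Rq q) × Rq q) × Rq q =>
      ek p.2 p.1.2 • w p.2 • P (p.1.1, (p.2, p.1.2)) := by
  refine (ek_continuous.comp (continuous_snd.prodMk (continuous_snd.comp continuous_fst))).smul
    ((hw.comp continuous_snd).smul (hP.comp ?_))
  fun_prop

theorem Phi_continuous (hw : IsWeight l w) (hkl : k + ((q : ℝ) + 1) ≤ l) {P : Amp q → W}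
    (hP : Tame δ k P) : Continuous fun p : (Rq q × Rq q) × Rq q => Phi w P p.1 p.2 := by
  obtain ⟨C, hC, N, K, hK, h⟩ := weight_smul_le hw hkl hP
  refine continuous_integral_dec (integrand_continuous hw.1.continuous hP.smooth.continuous)
    (C := fun p => C * (1 + ‖p.1‖) ^ N * jap p.2 ^ K) ?_ fun p x => ?_
  · exact (by fun_prop : Continuous fun p : (Rq q × Rq q) × Rq q =>
      C * (1 + ‖p.1‖) ^ N).mul ((jap_rpow_continuous K).comp continuous_snd)
  · rw [norm_ek_smul]; exact h _ _ _

theorem Phi_continuous_right (hw : IsWeight l w) (hkl : k + ((q : ℝ) + 1) ≤ l) {P : Amp q → W}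
    (hP : Tame δ k P) (θ : Rq q × Rq q) : Continuous fun ξ => Phi w P θ ξ := by
  have h := (Phi_continuous hw hkl hP).comp (Continuous.prodMk_right θ)
  simpa only [Function.comp_def] using h

theorem Phi_integrand_integrable (hw : IsWeight l w) (hkl : k + ((q : ℝ) + 1) ≤ l)
    {P : Amp q → W} (hP : Tame δ k P) (θ : Rq q × Rq q) (ξ : Rq q) :
    Integrable fun x => ek x ξ • w x • P (θ, (x, ξ)) := by
  obtain ⟨C, hC, N, K, hK, h⟩ := weight_smul_le hw hkl hP
  refine integrable_of_dec (C := C * (1 + ‖θ‖) ^ N * jap ξ ^ K) ?_ fun x => ?_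
  · have h := (integrand_continuous hw.1.continuous hP.smooth.continuous).comp
      (Continuous.prodMk_right (θ, ξ))
    simpa only [Function.comp_def] using h
  · rw [norm_ek_smul]; exact h _ _ _

theorem Phi_bound (hδ : 0 ≤ δ) (hδ' : δ < 1) (hw : IsWeight l w)
    (hkl : k + ((q : ℝ) + 1) ≤ l) {P : Amp q → W} (hP : Tame δ k P) :
    ∃ C ≥ (0 : ℝ), ∃ N : ℕ, ∀ θ ξ, ‖Phi w P θ ξ‖ ≤ C * (1 + ‖θ‖) ^ N * dec ξ := by
  obtain ⟨K, hK, h⟩ := hP.uniform hδ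
  obtain ⟨n, C, hC, hn⟩ := exists_norm_Phi_le (W := W) hw hkl hδ' K
  obtain ⟨C', hC', N, h⟩ := h n
  refine ⟨C * C', by positivity, N, fun θ ξ => ?_⟩
  refine (hn P hP.smooth θ (C' * (1 + ‖θ‖) ^ N) (fun x ξ => (h θ x ξ).1)
    (fun j i hi x ξ => (h θ x ξ).2 j i hi) ξ).trans (le_of_eq ?_)
  ring

/-- A bound that is uniform for dilation parameters in a bounded set provides the majorant for
differentiation in `t` under the `ξ`-integral. -/
theorem Phi_scale_bound (hδ : 0 ≤ δ) (hδ' : δ < 1) (hk : 0 ≤ k) (hw : IsWeight l w)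
    (hkl : k + ((q : ℝ) + 1) ≤ l) {P : Amp q → W} (hP : Tame δ k P) (R : ℝ) :
    ∃ C ≥ (0 : ℝ), ∃ N : ℕ, ∀ t, |t| ≤ R → ∀ θ ξ,
      ‖Phi w (scale t P) θ ξ‖ ≤ C * (1 + ‖θ‖) ^ N * dec ξ := by
  obtain ⟨K, hK, h⟩ := hP.uniform hδ
  obtain ⟨n, C, hC, hn⟩ := exists_norm_Phi_le (W := W) hw hkl hδ' K
  obtain ⟨C', hC', N, h⟩ := h n
  refine ⟨C * ((1 + |R|) ^ n * ((1 + |R|) ^ k * C')), by positivity, N, fun t ht θ ξ => ?_⟩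
  have htR : |t| ≤ |R| := ht.trans (le_abs_self R)
  have h1R : 1 ≤ (1 + |R|) ^ n := one_le_pow₀ (by simp)
  have sc : ∀ x ξ : Rq q, C' * (1 + ‖θ‖) ^ N * (jap (t • x) ^ k * jap ξ ^ (K + δ * n)) ≤
      ((1 + |R|) ^ k * C') * (1 + ‖θ‖) ^ N * (jap x ^ k * jap ξ ^ (K + δ * n)) := fun x ξ => by
    have e1 : jap (t • x) ^ k ≤ (1 + |R|) ^ k * jap x ^ k :=
      (jap_smul_rpow_le t x hk).trans (by
        have := (jap_rpow_pos x k).le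
        gcongr)
    have := (jap_rpow_pos ξ (K + δ * n)).le
    calc C' * (1 + ‖θ‖) ^ N * (jap (t • x) ^ k * jap ξ ^ (K + δ * n))
        ≤ C' * (1 + ‖θ‖) ^ N * (((1 + |R|) ^ k * jap x ^ k) * jap ξ ^ (K + δ * n)) := by gcongr
      _ = _ := by ring
  refine (hn _ (scale_smooth t hP.smooth) θ
    ((1 + |R|) ^ n * ((1 + |R|) ^ k * C' * (1 + ‖θ‖) ^ N)) (fun x ξ => ?_)
    (fun j i hi x ξ => ?_) ξ).trans (le_of_eq (by ring))
  · rw [scale_apply, mul_assoc ((1 + |R|) ^ n)]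
    have := (mul_pos (jap_rpow_pos x k) (jap_rpow_pos ξ (K + δ * n))).le
    exact ((h θ (t • x) ξ).1.trans (sc x ξ)).trans (le_mul_of_one_le_left (by positivity) h1R)
  · rw [iterate_dX_scale t j i hP.smooth, Pi.smul_apply, norm_smul, scale_apply,
      mul_assoc ((1 + |R|) ^ n)]
    refine mul_le_mul ?_ (((h θ (t • x) ξ).2 j i hi).trans (sc x ξ)) (norm_nonneg _)
      (by positivity)
    rw [norm_pow, Complex.norm_real, Real.norm_eq_abs]
    calc |t| ^ i ≤ (1 + |R|) ^ i := by gcongr; linarith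
      _ ≤ (1 + |R|) ^ n := pow_le_pow_right₀ (by simp) hi

theorem Phi_integrable (hδ : 0 ≤ δ) (hδ' : δ < 1) (hw : IsWeight l w)
    (hkl : k + ((q : ℝ) + 1) ≤ l) {P : Amp q → W} (hP : Tame δ k P) (θ : Rq q × Rq q) :
    Integrable fun ξ => Phi w P θ ξ := by
  obtain ⟨C, hC, N, h⟩ := Phi_bound hδ hδ' hw hkl hP
  exact integrable_of_dec (Phi_continuous_right hw hkl hP θ) (fun ξ => h θ ξ)

theorem Phi_add (hw : IsWeight l w) (hkl : k + ((q : ℝ) + 1) ≤ l) {P P' : Amp q → W}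
    (hP : Tame δ k P) (hP' : Tame δ k P') (θ : Rq q × Rq q) (ξ : Rq q) :
    Phi w (P + P') θ ξ = Phi w P θ ξ + Phi w P' θ ξ := by
  simp only [Phi, Pi.add_apply, smul_add]
  exact integral_add (Phi_integrand_integrable hw hkl hP θ ξ)
    (Phi_integrand_integrable hw hkl hP' θ ξ)

theorem Phi_smul (c : ℂ) (P : Amp q → W) (θ : Rq q × Rq q) (ξ : Rq q) :
    Phi w (c • P) θ ξ = c • Phi w P θ ξ := by
  simp only [Phi, Pi.smul_apply]
  rw [← integral_smul]
  congr 1; funext x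
  rw [smul_comm (w x) c, smul_comm (ek x ξ) c]

theorem osc_add (hδ : 0 ≤ δ) (hδ' : δ < 1) (hw : IsWeight l w)
    (hkl : k + ((q : ℝ) + 1) ≤ l) {P P' : Amp q → W}
    (hP : Tame δ k P) (hP' : Tame δ k P') :
    osc w (P + P') = osc w P + osc w P' := by
  funext θ
  simp only [osc, Pi.add_apply, Phi_add hw hkl hP hP']
  exact integral_add (Phi_integrable hδ hδ' hw hkl hP θ) (Phi_integrable hδ hδ' hw hkl hP' θ)

theorem osc_smul (c : ℂ) (P : Amp q → W) : osc w (c • P) = c • osc w P := by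
  funext θ
  simp only [osc, Pi.smul_apply, Phi_smul]
  exact integral_smul _ _

theorem osc_zero : osc w (0 : Amp q → W) = 0 := by
  have := osc_smul (w := w) 0 (0 : Amp q → W)
  simpa using this

theorem osc_sum (hδ : 0 ≤ δ) (hδ' : δ < 1) (hw : IsWeight l w)
    (hkl : k + ((q : ℝ) + 1) ≤ l) {ι : Type*} (s : Finset ι) {P : ι → Amp q → W}
    (hP : ∀ i ∈ s, Tame δ k (P i)) :
    osc w (∑ i ∈ s, P i) = ∑ i ∈ s, osc w (P i) := by
  classical
  induction s using Finset.induction_on with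
  | empty => exact osc_zero
  | insert a s ha ih =>
    have h1 : ∀ i ∈ s, Tame δ k (P i) := fun i hi => hP i (Finset.mem_insert_of_mem hi)
    rw [Finset.sum_insert ha, Finset.sum_insert ha,
      osc_add hδ hδ' hw hkl (hP a (Finset.mem_insert_self _ _)) (Tame.sum s h1), ih h1]

/-! Differentiation with respect to parameters. -/

/-- The derivative is split along fixed functionals `ℓ i`, so that its coefficients are again
integrals with values in `W` and of the same kind as the original one. -/
theorem hasFDerivAt_integral_dec [CompleteSpace W] {H ι : Type*} [NormedAddCommGroup H]
    [NormedSpace ℝ H] [Fintype ι] (ℓ : ι → H →L[ℝ] ℝ) {F : H → Rq q → W} {F' : ι → H → Rq q → W} {θ₀ : H} {r : ℝ}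
    (hr : 0 < r)
    (hd : ∀ θ x, HasFDerivAt (fun θ => F θ x) (∑ i, (ℓ i).smulRight (F' i θ x)) θ)
    (hc : ∀ θ, Continuous (F θ)) (hc' : ∀ i, Continuous (F' i θ₀)) {C : ℝ} {C' : ι → ℝ}
    (hb : ∀ x, ‖F θ₀ x‖ ≤ C * dec x)
    (hb' : ∀ i, ∀ θ ∈ Metric.ball θ₀ r, ∀ x, ‖F' i θ x‖ ≤ C' i * dec x) :
    HasFDerivAt (fun θ => ∫ x, F θ x) (∑ i, (ℓ i).smulRight (∫ x, F' i θ₀ x)) θ₀ := by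
  have hcont : Continuous fun x => ∑ i, (ℓ i).smulRight (F' i θ₀ x) :=
    continuous_finsetSum _ fun i _ =>
      (ContinuousLinearMap.smulRightL ℝ H W (ℓ i)).continuous.comp (hc' i)
  have hint : ∀ i, Integrable (F' i θ₀) := fun i =>
    integrable_of_dec (hc' i) (hb' i θ₀ (Metric.mem_ball_self hr))
  have h := hasFDerivAt_integral_of_dominated_of_fderiv_le (𝕜 := ℝ) (μ := volume) (F := F)
    (F' := fun θ x => ∑ i, (ℓ i).smulRight (F' i θ x))
    (bound := fun x => (∑ i, ‖ℓ i‖ * C' i) * dec x) (x₀ := θ₀) (Metric.ball_mem_nhds θ₀ hr)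
    (Filter.Eventually.of_forall fun θ => (hc θ).aestronglyMeasurable)
    (integrable_of_dec (hc θ₀) hb) hcont.aestronglyMeasurable
    (Filter.Eventually.of_forall fun x θ hθ => ?_) (dec_integrable.const_mul _)
    (Filter.Eventually.of_forall fun x θ _ => hd θ x)
  · refine h.congr_fderiv ?_
    rw [integral_finsetSum]
    · refine Finset.sum_congr rfl fun i _ => ?_
      exact (ContinuousLinearMap.smulRightL ℝ H W (ℓ i)).integral_comp_comm (hint i)
    · intro i _
      exact (ContinuousLinearMap.smulRightL ℝ H W (ℓ i)).integrable_comp (hint i)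
  · refine (norm_sum_le _ _).trans ?_
    rw [Finset.sum_mul]
    refine Finset.sum_le_sum fun i _ => ?_
    rw [ContinuousLinearMap.norm_smulRight_apply, mul_assoc]
    exact mul_le_mul_of_nonneg_left (hb' i θ hθ x) (norm_nonneg _)

end Oscillatory



/-! ### Differentiation and integration by parts for oscillatory integrals -/

section Parts

variable {q : ℕ} {W : Type*} [NormedAddCommGroup W] [NormedSpace ℂ W]

theorem hasFDerivAt_svec {f : Rq q × Rq q → W} (hf : ContDiff ℝ ∞ f) (θ : Rq q × Rq q) :
    HasFDerivAt f (∑ l, (scoord l).smulRight (dirDeriv (svec l) f θ)) θ := by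
  refine (contDiff_differentiableAt hf θ).hasFDerivAt.congr_fderiv ?_
  ext v
  · simp only [ContinuousLinearMap.comp_apply, _root_.sum_apply, ContinuousLinearMap.smulRight_apply]
    conv_lhs => rw [svec_sum (ContinuousLinearMap.inl ℝ _ _ v)]
    simp [dirDeriv]
  · simp only [ContinuousLinearMap.comp_apply, _root_.sum_apply, ContinuousLinearMap.smulRight_apply]
    conv_lhs => rw [svec_sum (ContinuousLinearMap.inr ℝ _ _ v)]
    simp [dirDeriv]

theorem scoord_svec (l l' : SDir q) : scoord l (svec l') = if l = l' then 1 else 0 := by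
  rcases l with l | l <;> rcases l' with l' | l' <;> simp [scoord, svec]

theorem dirDeriv_of_hasFDerivAt {f : Rq q × Rq q → W} {g : SDir q → W} {θ : Rq q × Rq q}
    (h : HasFDerivAt f (∑ l, (scoord l).smulRight (g l)) θ) (l : SDir q) :
    dirDeriv (svec l) f θ = g l := by
  rw [dirDeriv, h.fderiv]
  simp only [_root_.sum_apply, ContinuousLinearMap.smulRight_apply, scoord_svec, ite_smul,
    one_smul, zero_smul, Finset.sum_ite_eq', Finset.mem_univ, if_true]

theorem dirDeriv_slice (l : SDir q) {P : Amp q → W} (hP : ContDiff ℝ ∞ P) (z : Rq q × Rq q) :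
    dirDeriv (svec l) (fun θ => P (θ, z)) = fun θ => dirDeriv (avec (Sum.inl l)) P (θ, z) := by
  have e := dirDeriv_comp_affine (ContinuousLinearMap.inl ℝ (Rq q × Rq q) (Rq q × Rq q)) (0, z)
    (svec l) hP
  simpa [avec] using e

variable {δ k l : ℝ} {w : Rq q → ℂ}

theorem one_add_norm_pow_le {θ θ₀ : Rq q × Rq q} (h : θ ∈ Metric.ball θ₀ 1) (N : ℕ) :
    (1 + ‖θ‖) ^ N ≤ (2 + ‖θ₀‖) ^ N := by
  have h1 : ‖θ - θ₀‖ < 1 := mem_ball_iff_norm.1 h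
  have h2 := norm_le_insert' θ θ₀
  exact pow_le_pow_left₀ (by positivity) (by linarith) N

theorem hasFDerivAt_Phi [CompleteSpace W] (hw : IsWeight l w) (hkl : k + ((q : ℝ) + 1) ≤ l)
    {P : Amp q → W} (hP : Tame δ k P) (θ : Rq q × Rq q) (ξ : Rq q) :
    HasFDerivAt (fun θ => Phi w P θ ξ)
      (∑ i, (scoord i).smulRight (Phi w (dirDeriv (avec (Sum.inl i)) P) θ ξ)) θ := by
  obtain ⟨C, hC, N, K, hK, h⟩ := weight_smul_le hw hkl hP
  choose C' hC' N' K' hK' h' using fun i => weight_smul_le hw hkl (hP.deriv (Sum.inl i))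
  refine hasFDerivAt_integral_dec (scoord (q := q)) (r := 1)
    (F := fun θ x => ek x ξ • w x • P (θ, (x, ξ)))
    (F' := fun i θ x => ek x ξ • w x • dirDeriv (avec (Sum.inl i)) P (θ, (x, ξ)))
    one_pos (fun θ x => ?_) (fun θ => ?_) (fun i => ?_)
    (C := C * (1 + ‖θ‖) ^ N * jap ξ ^ K) (C' := fun i => C' i * (2 + ‖θ‖) ^ N' i * jap ξ ^ K' i)
    (fun x => ?_) (fun i θ' hθ' x => ?_)
  · have h1 := hasFDerivAt_svec (f := fun θ => P (θ, (x, ξ)))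
      (hP.smooth.comp (contDiff_id.prodMk contDiff_const)) θ
    simp only [dirDeriv_slice _ hP.smooth] at h1
    refine ((h1.const_smul (w x)).const_smul (ek x ξ)).congr_fderiv ?_
    simp only [Finset.smul_sum]
    refine Finset.sum_congr rfl fun i _ => ?_
    refine ContinuousLinearMap.ext fun v => ?_
    simp only [_root_.smul_apply, ContinuousLinearMap.smulRight_apply]
    rw [smul_comm (w x), smul_comm (ek x ξ)]
  · have h := (integrand_continuous hw.1.continuous hP.smooth.continuous).comp
      (Continuous.prodMk_right (θ, ξ))
    simpa only [Function.comp_def] using h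
  · have h := (integrand_continuous hw.1.continuous (hP.deriv (Sum.inl i)).smooth.continuous).comp
      (Continuous.prodMk_right (θ, ξ))
    simpa only [Function.comp_def] using h
  · rw [norm_ek_smul]; exact h _ _ _
  · rw [norm_ek_smul]
    refine (h' i _ _ _).trans ?_
    have := (jap_rpow_pos ξ (K' i)).le
    have := (dec_pos x).le
    have := hC' i
    gcongr ?_ * ?_ * ?_ * ?_
    exact one_add_norm_pow_le hθ' _

theorem hasFDerivAt_osc [CompleteSpace W] (hδ : 0 ≤ δ) (hδ' : δ < 1) (hw : IsWeight l w)
    (hkl : k + ((q : ℝ) + 1) ≤ l) {P : Amp q → W} (hP : Tame δ k P) (θ : Rq q × Rq q) :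
    HasFDerivAt (osc w P)
      (∑ i, (scoord i).smulRight (osc w (dirDeriv (avec (Sum.inl i)) P) θ)) θ := by
  obtain ⟨C, hC, N, h⟩ := Phi_bound hδ hδ' hw hkl hP
  choose C' hC' N' h' using fun i => Phi_bound hδ hδ' hw hkl (hP.deriv (Sum.inl i))
  refine hasFDerivAt_integral_dec (scoord (q := q)) (r := 1)
    (F := fun θ ξ => Phi w P θ ξ)
    (F' := fun i θ ξ => Phi w (dirDeriv (avec (Sum.inl i)) P) θ ξ)
    one_pos (fun θ ξ => hasFDerivAt_Phi hw hkl hP θ ξ) (fun θ => Phi_continuous_right hw hkl hP θ)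
    (fun i => Phi_continuous_right hw hkl (hP.deriv _) θ)
    (C := C * (1 + ‖θ‖) ^ N) (C' := fun i => C' i * (2 + ‖θ‖) ^ N' i)
    (fun ξ => h θ ξ) (fun i θ' hθ' ξ => ?_)
  refine (h' i _ _).trans ?_
  have := (dec_pos ξ).le
  have := hC' i
  gcongr ?_ * ?_ * ?_
  exact one_add_norm_pow_le hθ' _

theorem dirDeriv_osc [CompleteSpace W] (hδ : 0 ≤ δ) (hδ' : δ < 1) (hw : IsWeight l w)
    (hkl : k + ((q : ℝ) + 1) ≤ l) {P : Amp q → W} (hP : Tame δ k P) (i : SDir q) :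
    dirDeriv (svec i) (osc w P) = osc w (dirDeriv (avec (Sum.inl i)) P) :=
  funext fun θ => dirDeriv_of_hasFDerivAt (hasFDerivAt_osc hδ hδ' hw hkl hP θ) i

/-- Parameter derivatives of oscillatory integrals of tame amplitudes are again such integrals, so
`contDiff_of_class` applies to the class of all of them. -/
theorem osc_smooth [CompleteSpace W] (hδ : 0 ≤ δ) (hδ' : δ < 1) (hw : IsWeight l w)
    (hkl : k + ((q : ℝ) + 1) ≤ l) {P : Amp q → W} (hP : Tame δ k P) : ContDiff ℝ ∞ (osc w P) := by
  refine contDiff_of_class (scoord (q := q)) {f | ∃ P : Amp q → W, Tame δ k P ∧ f = osc w P} ?_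
    ⟨P, hP, rfl⟩
  rintro _ ⟨P, hP, rfl⟩
  exact ⟨fun i => osc w (dirDeriv (avec (Sum.inl i)) P), fun i => ⟨_, hP.deriv _, rfl⟩,
    fun θ => hasFDerivAt_osc hδ hδ' hw hkl hP θ⟩

/-! Integration by parts in `ξ`. -/

/-- Differentiation of an integral with a dominated integrand with respect to a real parameter. -/
theorem hasDerivAt_integral_dec [CompleteSpace W] {F F' : ℝ → Rq q → W} {t₀ : ℝ} {r : ℝ}
    (hr : 0 < r) (hd : ∀ t x, HasDerivAt (fun t => F t x) (F' t x) t)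
    (hc : ∀ t, Continuous (F t)) (hc' : Continuous (F' t₀)) {C C' : ℝ}
    (hb : ∀ x, ‖F t₀ x‖ ≤ C * dec x)
    (hb' : ∀ t, |t - t₀| < r → ∀ x, ‖F' t x‖ ≤ C' * dec x) :
    HasDerivAt (fun t => ∫ x, F t x) (∫ x, F' t₀ x) t₀ := by
  exact (hasDerivAt_integral_of_dominated_loc_of_deriv_le (μ := volume) (F := F) (F' := F')
    (bound := fun x => C' * dec x) (Metric.ball_mem_nhds t₀ hr)
    (Filter.Eventually.of_forall fun t => (hc t).aestronglyMeasurable)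
    (integrable_of_dec (hc t₀) hb) hc'.aestronglyMeasurable
    (Filter.Eventually.of_forall fun x t ht => hb' t (by
      rwa [Metric.mem_ball, Real.dist_eq] at ht) x) (dec_integrable.const_mul _)
    (Filter.Eventually.of_forall fun x t _ => hd t x)).2

theorem isWeight_coord_mul (j : Fin q) (hw : IsWeight l w) :
    IsWeight (l - 1) fun x => (x j : ℂ) * w x := by
  have := (isWeight_coord j).mul hw
  rwa [show -1 + l = l - 1 by ring] at this

theorem norm_ev (j : Fin q) : ‖(ev j : Rq q)‖ = 1 := by simp [ev]

/-- Differentiating the kernel in `ξ_j` brings down `-i x_j`. This costs one power of decay of the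
weight and explains the additional `1` in `hkl`. -/
theorem hasLineDerivAt_Phi [CompleteSpace W] (hw : IsWeight l w)
    (hkl : k + ((q : ℝ) + 1) + 1 ≤ l) {P : Amp q → W} (hP : Tame δ k P) (θ : Rq q × Rq q)
    (ξ : Rq q) (j : Fin q) :
    HasLineDerivAt ℝ (fun ξ => Phi w P θ ξ)
      ((-Complex.I) • Phi (fun x => (x j : ℂ) * w x) P θ ξ + Phi w (dirDeriv (dXi j) P) θ ξ)
      ξ (ev j) := by
  have hw' := isWeight_coord_mul j hw
  have hP' : Tame δ k (dirDeriv (dXi j) P) := hP.deriv _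
  have hkl' : k + ((q : ℝ) + 1) ≤ l := by linarith
  have hkl'' : k + ((q : ℝ) + 1) ≤ l - 1 := by linarith
  obtain ⟨C₀, hC₀, N₀, K₀, hK₀, h₀⟩ := weight_smul_le hw hkl' hP
  obtain ⟨C₁, hC₁, N₁, K₁, hK₁, h₁⟩ := weight_smul_le hw' hkl'' hP
  obtain ⟨C₂, hC₂, N₂, K₂, hK₂, h₂⟩ := weight_smul_le hw hkl' hP'
  have hj : ∀ s : ℝ, |s - 0| < 1 → ∀ K : ℝ, 0 ≤ K → jap (ξ + s • ev j) ^ K ≤ (jap ξ + 1) ^ K :=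
    fun s hs K hK => by
      refine Real.rpow_le_rpow (jap_pos _).le ((jap_add_le _ _).trans ?_) hK
      rw [sub_zero] at hs
      rw [norm_smul, norm_ev, mul_one, Real.norm_eq_abs]
      linarith
  have key := hasDerivAt_integral_dec (t₀ := 0) (r := 1)
    (F := fun s x => ek x (ξ + s • ev j) • w x • P (θ, (x, ξ + s • ev j)))
    (F' := fun s x => (-Complex.I) • ek x (ξ + s • ev j) • ((x j : ℂ) * w x) •
        P (θ, (x, ξ + s • ev j)) +
      ek x (ξ + s • ev j) • w x • dirDeriv (dXi j) P (θ, (x, ξ + s • ev j)))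
    one_pos (C := C₀ * (1 + ‖θ‖) ^ N₀ * jap ξ ^ K₀)
    (C' := C₁ * (1 + ‖θ‖) ^ N₁ * (jap ξ + 1) ^ K₁ + C₂ * (1 + ‖θ‖) ^ N₂ * (jap ξ + 1) ^ K₂)
    (fun s x => ?_) (fun s => ?_) ?_ (fun x => ?_) (fun s hs x => ?_)
  · have e := integral_add
      ((Phi_integrand_integrable hw' hkl'' hP θ ξ).smul (-Complex.I))
      (Phi_integrand_integrable hw hkl' hP' θ ξ)
    simp only [zero_smul, add_zero] at key
    simp only [Pi.smul_apply] at e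
    rw [e, integral_smul] at key
    exact key
  · have hs : HasDerivAt (fun s : ℝ => ξ + s • (ev j : Rq q)) (ev j) s := by
      have := ((hasDerivAt_id s).smul_const (ev j : Rq q)).const_add ξ
      simpa using this
    have e1 := (hasFDerivAt_ek_left (ξ + s • ev j) x).comp_hasDerivAt s hs
    have hz : HasDerivAt (fun s : ℝ => (θ, (x, ξ + s • (ev j : Rq q)))) (dXi j) s := by
      have := (hasDerivAt_const s θ).prodMk ((hasDerivAt_const s x).prodMk hs)
      simpa [dXi, avec, svec] using this
    have e2 := ((contDiff_differentiableAt hP.smooth _).hasFDerivAt.comp_hasDerivAt s hz)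
    have e3 := e1.smul (e2.const_smul (w x))
    have i1 : (inner ℝ x (ev j) : ℝ) = x j := by simp [EuclideanSpace.inner_single_right]
    simp only [Function.comp_def, ContinuousLinearMap.smulRight_apply, innerSL_apply_apply, i1,
      Complex.real_smul] at e3
    simp only [ek_comm x]
    refine e3.congr_deriv ?_
    rw [add_comm]
    congr 1
    change _ • w x • P (θ, (x, ξ + s • ev j)) = _
    simp only [smul_smul]
    congr 1
    ring
  · have h := (integrand_continuous hw.1.continuous hP.smooth.continuous).comp
      (Continuous.prodMk_right (θ, ξ + s • ev j))
    simpa only [Function.comp_def] using h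
  · have h := (integrand_continuous hw'.1.continuous hP.smooth.continuous).comp
      (Continuous.prodMk_right (θ, ξ + (0 : ℝ) • ev j))
    have h' := (integrand_continuous hw.1.continuous hP'.smooth.continuous).comp
      (Continuous.prodMk_right (θ, ξ + (0 : ℝ) • ev j))
    exact (h.const_smul (-Complex.I)).add h'
  · rw [norm_ek_smul]
    simpa using h₀ θ x ξ
  · refine (norm_add_le _ _).trans ?_
    rw [norm_smul, norm_neg, Complex.norm_I, one_mul, norm_ek_smul, norm_ek_smul, add_mul]
    have := (dec_pos x).le
    refine add_le_add ((h₁ _ _ _).trans ?_) ((h₂ _ _ _).trans ?_)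
    · gcongr ?_ * ?_ * _
      exact hj s hs _ hK₁
    · gcongr ?_ * ?_ * _
      exact hj s hs _ hK₂

/-- The `ξ`-integral of `∂_{ξ_j} Phi` vanishes; by `hasLineDerivAt_Phi` it consists of one term with
the factor `-i x_j` and one with `∂_{ξ_j} P`. -/
theorem osc_coord_mul [CompleteSpace W] (hδ : 0 ≤ δ) (hδ' : δ < 1) (hw : IsWeight l w)
    (hkl : k + ((q : ℝ) + 1) + 1 ≤ l) {P : Amp q → W} (hP : Tame δ k P) (j : Fin q) :
    osc (fun x => (x j : ℂ) * w x) P = (-Complex.I) • osc w (dirDeriv (dXi j) P) := by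
  funext θ
  have hw' := isWeight_coord_mul j hw
  have hP' : Tame δ k (dirDeriv (dXi j) P) := hP.deriv _
  have hkl' : k + ((q : ℝ) + 1) ≤ l := by linarith
  have hkl'' : k + ((q : ℝ) + 1) ≤ l - 1 := by linarith
  have i0 := Phi_integrable hδ hδ' hw hkl' hP θ
  have i1 : Integrable fun ξ => (-Complex.I) • Phi (fun x => (x j : ℂ) * w x) P θ ξ :=
    (Phi_integrable hδ hδ' hw' hkl'' hP θ).smul (-Complex.I)
  have i2 := Phi_integrable hδ hδ' hw hkl' hP' θ
  -- Integration by parts against the constant function `1`: the integral of a derivative is zero.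
  have key := integral_bilinear_hasLineDerivAt_right_eq_neg_left_of_integrable
    (B := ContinuousLinearMap.lsmul ℝ ℂ) (μ := volume) (f := fun _ : Rq q => (1 : ℂ))
    (f' := fun _ => 0) (g := fun ξ => Phi w P θ ξ) (v := ev j)
    (g' := fun ξ => (-Complex.I) • Phi (fun x => (x j : ℂ) * w x) P θ ξ +
      Phi w (dirDeriv (dXi j) P) θ ξ)
    (by simp) (by simp only [ContinuousLinearMap.lsmul_apply, one_smul]; exact i1.add i2) (by simpa using i0)
    (fun ξ _ => by simpa using (hasFDerivAt_const (1 : ℂ) ξ).hasLineDerivAt (𝕜 := ℝ) (ev j))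
    (fun ξ _ => hasLineDerivAt_Phi hw hkl hP θ ξ j)
  simp only [ContinuousLinearMap.lsmul_apply, one_smul, zero_smul, integral_zero, neg_zero] at key
  rw [integral_add i1 i2, integral_smul] at key
  change (-Complex.I) • osc (fun x => (x j : ℂ) * w x) P θ + osc w (dirDeriv (dXi j) P) θ = 0 at key
  have e := congrArg (fun v => Complex.I • v) (eq_neg_of_add_eq_zero_left key)
  simp only [smul_smul, mul_neg, Complex.I_mul_I, neg_neg, one_smul, smul_neg] at e
  rw [e]
  simp

theorem Phi_add_weight {w' : Rq q → ℂ} (hw : IsWeight l w) (hw' : IsWeight l w')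
    (hkl : k + ((q : ℝ) + 1) ≤ l) {P : Amp q → W} (hP : Tame δ k P) (c : ℂ) (θ : Rq q × Rq q)
    (ξ : Rq q) :
    Phi (fun x => w x + c * w' x) P θ ξ = Phi w P θ ξ + c • Phi w' P θ ξ := by
  have i2 : Integrable fun x => c • ek x ξ • w' x • P (θ, (x, ξ)) :=
    (Phi_integrand_integrable hw' hkl hP θ ξ).smul c
  simp only [Phi]
  rw [← integral_smul, ← integral_add (Phi_integrand_integrable hw hkl hP θ ξ) i2]
  congr 1; funext x
  rw [add_smul, smul_add, mul_smul, smul_comm c (ek x ξ)]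

theorem IsWeight.mono {l' : ℝ} (hw : IsWeight l w) (h : l' ≤ l) : IsWeight l' w := by
  have key : ∀ {f : Rq q → ℝ}, (∃ C : ℝ, ∀ x, f x ≤ C * jap x ^ (-l)) →
      ∃ C : ℝ, ∀ x, f x ≤ C * jap x ^ (-l') := by
    rintro f ⟨C, hC⟩
    refine ⟨|C|, fun x => (hC x).trans ?_⟩
    have := (jap_rpow_pos x (-l)).le
    have h1 := jap_rpow_le_rpow x (neg_le_neg h)
    exact mul_le_mul (le_abs_self C) h1 this (abs_nonneg _)
  exact ⟨hw.1, key hw.2.1, fun j i => key (hw.2.2 j i)⟩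

theorem isWeight_wt_cons {L : List (Fin q)} (hw : IsWeight l (wt L)) (j : Fin q) :
    IsWeight l (wt (j :: L)) := by
  have h1 : wt (j :: L) = fun x => wt [j] x * wt L x := by funext x; simp [wt]
  have := (isWeight_wt_zero [j]).mul hw
  rw [h1]
  rwa [zero_add] at this

/-- One round of regularization: `wt L = (1 + i x_j) wt (j :: L)`, and under the integral `i x_j`
acts as `∂_{ξ_j}` on the amplitude. -/
theorem osc_wt_cons [CompleteSpace W] (hδ : 0 ≤ δ) (hδ' : δ < 1) {L : List (Fin q)}
    (hw : IsWeight l (wt L)) (hkl : k + ((q : ℝ) + 1) + 1 ≤ l) {P : Amp q → W} (hP : Tame δ k P)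
    (j : Fin q) :
    osc (wt (j :: L)) (P + dirDeriv (dXi j) P) = osc (wt L) P := by
  have hw1 := isWeight_wt_cons hw j
  have hw2 := isWeight_coord_mul j hw1
  have hP' : Tame δ k (dirDeriv (dXi j) P) := hP.deriv _
  have hkl' : k + ((q : ℝ) + 1) ≤ l := by linarith
  have hkl'' : k + ((q : ℝ) + 1) ≤ l - 1 := by linarith
  rw [osc_add hδ hδ' hw1 hkl' hP hP']
  have e := osc_coord_mul hδ hδ' hw1 hkl hP j
  have e1 : osc (wt (j :: L)) (dirDeriv (dXi j) P) =
      Complex.I • osc (fun x => (x j : ℂ) * wt (j :: L) x) P := by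
    rw [e, smul_smul]; simp
  rw [e1]
  funext θ
  have e2 : wt L = fun x => wt (j :: L) x + Complex.I * ((x j : ℂ) * wt (j :: L) x) := by
    funext x; rw [wt_cons j L x]; ring
  rw [e2]
  simp only [osc, Pi.add_apply, Pi.smul_apply]
  simp only [Phi_add_weight (hw1.mono (by linarith : l - 1 ≤ l)) hw2 hkl'' hP]
  have i2 : Integrable fun ξ => Complex.I • Phi (fun x => (x j : ℂ) * wt (j :: L) x) P θ ξ :=
    (Phi_integrable hδ hδ' hw2 hkl'' hP θ).smul _
  rw [integral_add (Phi_integrable hδ hδ' hw1 hkl' hP θ) i2, integral_smul]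

/-! Dilations. -/

theorem weight_smul_scale_le (hk : 0 ≤ k) (hw : IsWeight l w) (hkl : k + ((q : ℝ) + 1) ≤ l)
    {P : Amp q → W} (hP : Tame δ k P) (R : ℝ) : ∃ C ≥ (0 : ℝ), ∃ N : ℕ, ∃ K ≥ (0 : ℝ),
      ∀ t, |t| ≤ R → ∀ θ x ξ,
      ‖w x • scale t P (θ, (x, ξ))‖ ≤ C * (1 + ‖θ‖) ^ N * jap ξ ^ K * dec x := by
  obtain ⟨K, hK, C, hC, N, h⟩ := hP.polyBound
  obtain ⟨C₀, hC₀⟩ := hw.2.1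
  refine ⟨|C₀| * ((1 + |R|) ^ k * C), by positivity, N, K, hK, fun t ht θ x ξ => ?_⟩
  rw [norm_smul, scale_apply]
  have hp := (jap_rpow_pos ξ K).le
  have hx := (jap_rpow_pos x k).le
  have hx' := (jap_rpow_pos x (-l)).le
  have e1 : jap (t • x) ^ k ≤ (1 + |R|) ^ k * jap x ^ k :=
    (jap_smul_rpow_le t x hk).trans (by
      have := ht.trans (le_abs_self R)
      gcongr)
  calc ‖w x‖ * ‖P (θ, (t • x, ξ))‖
      ≤ (|C₀| * jap x ^ (-l)) * (C * (1 + ‖θ‖) ^ N * (jap (t • x) ^ k * jap ξ ^ K)) := by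
        refine mul_le_mul ((hC₀ x).trans ?_) (h θ _ ξ) (norm_nonneg _) (by positivity)
        exact mul_le_mul_of_nonneg_right (le_abs_self _) hx'
    _ ≤ (|C₀| * jap x ^ (-l)) * (C * (1 + ‖θ‖) ^ N * (((1 + |R|) ^ k * jap x ^ k) * jap ξ ^ K)) := by
        gcongr
    _ = |C₀| * ((1 + |R|) ^ k * C) * (1 + ‖θ‖) ^ N * jap ξ ^ K * jap x ^ (-l + k) := by
        rw [jap_rpow_add]; ring
    _ ≤ _ := by
        gcongr
        exact jap_rpow_le_dec x (by linarith)

/-- The operator `∑_j D_{x_j} ∂_{ξ_j}`. -/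
def mixed (P : Amp q → W) : Amp q → W :=
  ∑ j, (-Complex.I) • dirDeriv (dXi j) (dirDeriv (dX j) P)

theorem hasDerivAt_Phi_scale [CompleteSpace W] (hk : 0 ≤ k) (hw : IsWeight l w)
    (hkl : k + ((q : ℝ) + 1) + 1 ≤ l) {P : Amp q → W} (hP : Tame δ k P) (θ : Rq q × Rq q)
    (ξ : Rq q) (t : ℝ) :
    HasDerivAt (fun t => Phi w (scale t P) θ ξ)
      (∑ j, Phi (fun x => (x j : ℂ) * w x) (scale t (dirDeriv (dX j) P)) θ ξ) t := by
  have hw' := fun j => isWeight_coord_mul j hw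
  have hP' : ∀ j, Tame δ k (dirDeriv (dX j) P) := fun j => hP.deriv _
  have hkl' : k + ((q : ℝ) + 1) ≤ l := by linarith
  have hkl'' : k + ((q : ℝ) + 1) ≤ l - 1 := by linarith
  obtain ⟨C₀, hC₀, N₀, K₀, hK₀, h₀⟩ := weight_smul_le hw hkl' (hP.scaled hk t)
  choose C hC N K hK h using fun j : Fin q =>
    weight_smul_scale_le hk (isWeight_coord_mul j hw) hkl'' (hP' j) (|t| + 1)
  have key := hasDerivAt_integral_dec (t₀ := t) (r := 1)
    (F := fun t x => ek x ξ • w x • scale t P (θ, (x, ξ)))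
    (F' := fun t x => ∑ j, ek x ξ • ((x j : ℂ) * w x) • scale t (dirDeriv (dX j) P) (θ, (x, ξ)))
    one_pos (C := C₀ * (1 + ‖θ‖) ^ N₀ * jap ξ ^ K₀)
    (C' := ∑ j, C j * (1 + ‖θ‖) ^ N j * jap ξ ^ K j)
    (fun s x => ?_) (fun s => ?_) ?_ (fun x => ?_) (fun s hs x => ?_)
  · rw [integral_finsetSum _ fun j _ =>
      Phi_integrand_integrable (hw' j) hkl'' ((hP' j).scaled hk t) θ ξ] at key
    exact key
  · have hs : HasDerivAt (fun s : ℝ => s • x) x s := by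
      simpa using (hasDerivAt_id s).smul_const x
    have hz : HasDerivAt (fun s : ℝ => (θ, (s • x, ξ))) (∑ j, (x j) • dX j) s := by
      have := (hasDerivAt_const s θ).prodMk (hs.prodMk (hasDerivAt_const s ξ))
      refine this.congr_deriv ?_
      let A : Rq q →L[ℝ] Amp q := (0 : Rq q →L[ℝ] Rq q × Rq q).prod
        ((ContinuousLinearMap.id ℝ (Rq q)).prod 0)
      have e : ∑ j, (x j) • (dX j : Amp q) = A (∑ j, x j • ev j) := by
        simp [A, map_sum, dX, avec, svec]
      rw [e, ← ev_sum]
      rfl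
    have e2 := ((contDiff_differentiableAt hP.smooth _).hasFDerivAt.comp_hasDerivAt s hz)
    refine ((e2.const_smul (w x)).const_smul (ek x ξ)).congr_deriv ?_
    rw [map_sum, Finset.smul_sum, Finset.smul_sum]
    refine Finset.sum_congr rfl fun j _ => ?_
    rw [map_smul, mul_comm, mul_smul, ← Complex.coe_smul]
    rfl
  · have h := (integrand_continuous hw.1.continuous (hP.scaled hk s).smooth.continuous).comp
      (Continuous.prodMk_right (θ, ξ))
    simpa only [Function.comp_def] using h
  · refine continuous_finsetSum _ fun j _ => ?_
    have h := (integrand_continuous (hw' j).1.continuous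
      ((hP' j).scaled hk t).smooth.continuous).comp (Continuous.prodMk_right (θ, ξ))
    simpa only [Function.comp_def] using h
  · rw [norm_ek_smul]
    exact h₀ θ x ξ
  · refine (norm_sum_le _ _).trans ?_
    rw [Finset.sum_mul]
    refine Finset.sum_le_sum fun j _ => ?_
    rw [norm_ek_smul]
    refine h j s ?_ θ x ξ
    have := abs_sub_abs_le_abs_sub s t
    linarith

/-- The `t`-derivative of `P(θ, tx, ξ)` is `∑_j x_j (∂_{x_j} P)(θ, tx, ξ)`, and `osc_coord_mul`
exchanges each `x_j` for `-i ∂_{ξ_j}`. Thus `mixed` generates the dilations, as far as the integral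
can see. -/
theorem hasDerivAt_osc_scale [CompleteSpace W] (hδ : 0 ≤ δ) (hδ' : δ < 1) (hk : 0 ≤ k)
    (hw : IsWeight l w) (hkl : k + ((q : ℝ) + 1) + 1 ≤ l) {P : Amp q → W} (hP : Tame δ k P)
    (θ : Rq q × Rq q) (t : ℝ) :
    HasDerivAt (fun t => osc w (scale t P) θ) (osc w (scale t (mixed P)) θ) t := by
  have hw' := fun j => isWeight_coord_mul j hw
  have hP' : ∀ j, Tame δ k (dirDeriv (dX j) P) := fun j => hP.deriv _
  have hkl' : k + ((q : ℝ) + 1) ≤ l := by linarith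
  have hkl'' : k + ((q : ℝ) + 1) ≤ l - 1 := by linarith
  obtain ⟨C₀, hC₀, N₀, h₀⟩ := Phi_bound hδ hδ' hw hkl' (hP.scaled hk t)
  choose C hC N h using fun j => Phi_scale_bound hδ hδ' hk (hw' j) hkl'' (hP' j) (|t| + 1)
  have key := hasDerivAt_integral_dec (t₀ := t) (r := 1)
    (F := fun t ξ => Phi w (scale t P) θ ξ)
    (F' := fun t ξ => ∑ j, Phi (fun x => (x j : ℂ) * w x) (scale t (dirDeriv (dX j) P)) θ ξ)
    one_pos (C := C₀ * (1 + ‖θ‖) ^ N₀) (C' := ∑ j, C j * (1 + ‖θ‖) ^ N j)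
    (fun s ξ => hasDerivAt_Phi_scale hk hw hkl hP θ ξ s)
    (fun s => Phi_continuous_right hw hkl' (hP.scaled hk s) θ)
    (continuous_finsetSum _ fun j _ =>
      Phi_continuous_right (hw' j) hkl'' ((hP' j).scaled hk t) θ)
    (fun ξ => h₀ θ ξ) (fun s hs ξ => ?_)
  · rw [integral_finsetSum _ fun j _ =>
      Phi_integrable hδ hδ' (hw' j) hkl'' ((hP' j).scaled hk t) θ] at key
    refine key.congr_deriv ?_
    have hT : ∀ j ∈ Finset.univ, Tame δ k
        (scale t ((-Complex.I) • dirDeriv (dXi j) (dirDeriv (dX j) P))) := fun j _ =>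
      (((hP' j).deriv _).smul _).scaled hk t
    rw [mixed, scale_sum, osc_sum hδ hδ' hw hkl' _ hT, Finset.sum_apply]
    refine Finset.sum_congr rfl fun j _ => ?_
    have e := congrFun (osc_coord_mul hδ hδ' hw hkl ((hP' j).scaled hk t) j) θ
    rw [dirDeriv_dXi_scale t j (hP' j).smooth] at e
    rw [scale_smul, osc_smul]
    exact e
  · refine (norm_sum_le _ _).trans ?_
    rw [Finset.sum_mul]
    refine Finset.sum_le_sum fun j _ => ?_
    refine h j s ?_ θ ξ
    have := abs_sub_abs_le_abs_sub s t
    linarith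

/-! ### The regularized oscillatory integral -/

/-- The operator `∏_{j ∈ L} (1 + ∂_{ξ_j})`. -/
def reg (L : List (Fin q)) (P : Amp q → W) : Amp q → W :=
  L.foldr (fun j P => P + dirDeriv (dXi j) P) P

theorem reg_cons (j : Fin q) (L : List (Fin q)) (P : Amp q → W) :
    reg (j :: L) P = reg L P + dirDeriv (dXi j) (reg L P) := rfl

theorem Tame.reg (L : List (Fin q)) {P : Amp q → W} (hP : Tame δ k P) : Tame δ k (reg L P) := by
  induction L with
  | nil => exact hP
  | cons j L ih => exact ih.add (ih.deriv _)

theorem reg_smooth (L : List (Fin q)) {P : Amp q → W} (hP : ContDiff ℝ ∞ P) :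
    ContDiff ℝ ∞ (reg L P) := by
  induction L with
  | nil => exact hP
  | cons j L ih => exact ih.add (dirDeriv_smooth _ ih)

theorem reg_add (L : List (Fin q)) {P P' : Amp q → W} (hP : ContDiff ℝ ∞ P)
    (hP' : ContDiff ℝ ∞ P') : reg L (P + P') = reg L P + reg L P' := by
  induction L with
  | nil => rfl
  | cons j L ih =>
    rw [reg_cons, ih, dirDeriv_add _ (reg_smooth L hP) (reg_smooth L hP'), reg_cons, reg_cons]
    abel

theorem reg_smul (L : List (Fin q)) (c : ℂ) {P : Amp q → W} (hP : ContDiff ℝ ∞ P) :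
    reg L (c • P) = c • reg L P := by
  induction L with
  | nil => rfl
  | cons j L ih => rw [reg_cons, ih, dirDeriv_smul _ _ (reg_smooth L hP), reg_cons, smul_add]

theorem reg_dirDeriv (L : List (Fin q)) (v : Amp q) {P : Amp q → W} (hP : ContDiff ℝ ∞ P) :
    reg L (dirDeriv v P) = dirDeriv v (reg L P) := by
  induction L with
  | nil => rfl
  | cons j L ih =>
    rw [reg_cons, ih, dirDeriv_comm _ _ (reg_smooth L hP), reg_cons,
      dirDeriv_add _ (reg_smooth L hP) (dirDeriv_smooth _ (reg_smooth L hP))]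

theorem reg_scale (L : List (Fin q)) (t : ℝ) {P : Amp q → W} (hP : ContDiff ℝ ∞ P) :
    reg L (scale t P) = scale t (reg L P) := by
  induction L with
  | nil => rfl
  | cons j L ih => rw [reg_cons, ih, dirDeriv_dXi_scale _ _ (reg_smooth L hP), reg_cons]; rfl

theorem mixed_smooth {P : Amp q → W} (hP : ContDiff ℝ ∞ P) : ContDiff ℝ ∞ (mixed P) := by
  unfold mixed
  have := ContDiff.sum (s := Finset.univ) (f := fun j => (-Complex.I) •
    dirDeriv (dXi j) (dirDeriv (dX j) P)) (n := ∞) (𝕜 := ℝ) fun j _ =>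
    contDiff_const.smul (dirDeriv_smooth _ (dirDeriv_smooth _ hP))
  convert this using 1
  funext x; simp

theorem mixed_add {P P' : Amp q → W} (hP : ContDiff ℝ ∞ P) (hP' : ContDiff ℝ ∞ P') :
    mixed (P + P') = mixed P + mixed P' := by
  unfold mixed
  rw [← Finset.sum_add_distrib]
  refine Finset.sum_congr rfl fun j _ => ?_
  rw [dirDeriv_add _ hP hP', dirDeriv_add _ (dirDeriv_smooth _ hP) (dirDeriv_smooth _ hP'),
    smul_add]

theorem mixed_smul (c : ℂ) {P : Amp q → W} (hP : ContDiff ℝ ∞ P) : mixed (c • P) = c • mixed P := by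
  unfold mixed
  rw [Finset.smul_sum]
  refine Finset.sum_congr rfl fun j _ => ?_
  rw [dirDeriv_smul _ _ hP, dirDeriv_smul _ _ (dirDeriv_smooth _ hP), smul_comm]

theorem mixed_dirDeriv (v : Amp q) {P : Amp q → W} (hP : ContDiff ℝ ∞ P) :
    mixed (dirDeriv v P) = dirDeriv v (mixed P) := by
  unfold mixed
  have h : ∀ j ∈ Finset.univ, ContDiff ℝ ∞
      ((-Complex.I) • dirDeriv (dXi j) (dirDeriv (dX j) P)) := fun j _ =>
    contDiff_const.smul (dirDeriv_smooth _ (dirDeriv_smooth _ hP))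
  rw [dirDeriv_sum _ _ h]
  refine Finset.sum_congr rfl fun j _ => ?_
  rw [dirDeriv_comm _ v hP, dirDeriv_comm _ v (dirDeriv_smooth _ hP),
    dirDeriv_smul _ _ (dirDeriv_smooth _ (dirDeriv_smooth _ hP))]

theorem reg_mixed (L : List (Fin q)) {P : Amp q → W} (hP : ContDiff ℝ ∞ P) :
    reg L (mixed P) = mixed (reg L P) := by
  induction L with
  | nil => rfl
  | cons j L ih =>
    rw [reg_cons, ih, reg_cons, mixed_add (reg_smooth L hP) (dirDeriv_smooth _ (reg_smooth L hP)),
      mixed_dirDeriv _ (reg_smooth L hP)]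

/-- The weight of `L` is sufficient for the regularization of oscillatory integrals of
amplitudes which grow like `⟨x⟩^k`. -/
structure Adm (δ k : ℝ) (L : List (Fin q)) : Prop where
  nonneg : 0 ≤ δ
  lt_one : δ < 1
  -- The summand `q + 1` makes the `x`-integral converge. The last `1` pays for one multiplication
  -- by a coordinate, which arises in integration by parts in `ξ` and in differentiating a dilation.
  weight : IsWeight (k + ((q : ℝ) + 1) + 1) (wt L)

/-- More regularization than necessary does not change the value. In particular an amplitude which
already decays in `x` may be treated with `[]` or with any longer list. -/
theorem osc_append [CompleteSpace W] {L : List (Fin q)} (hL : Adm δ k L) {P : Amp q → W}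
    (hP : Tame δ k P) (L' : List (Fin q)) :
    osc (wt (L' ++ L)) (reg (L' ++ L) P) = osc (wt L) (reg L P) := by
  have hw : ∀ L' : List (Fin q), IsWeight (k + ((q : ℝ) + 1) + 1) (wt (L' ++ L)) := fun L' => by
    induction L' with
    | nil => exact hL.weight
    | cons j L' ih => exact isWeight_wt_cons ih j
  induction L' with
  | nil => rfl
  | cons j L' ih =>
    rw [← ih]
    exact osc_wt_cons hL.nonneg hL.lt_one (hw L') le_rfl (hP.reg _) j

/-- The regularized oscillatory integral `(2π)^{-q} ∫∫ e^{-ixξ} P(θ, (x, ξ)) dx dξ`. -/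
def oint (L : List (Fin q)) (P : Amp q → W) : Rq q × Rq q → W :=
  ((((2 * Real.pi) ^ q)⁻¹ : ℝ) : ℂ) • osc (wt L) (reg L P)

section oint

variable {L : List (Fin q)} {P P' : Amp q → W}

theorem oint_smooth [CompleteSpace W] (hL : Adm δ k L) (hP : Tame δ k P) : ContDiff ℝ ∞ (oint L P) :=
  contDiff_const.smul (osc_smooth hL.nonneg hL.lt_one hL.weight (by linarith) (hP.reg L))

theorem dirDeriv_oint [CompleteSpace W] (hL : Adm δ k L) (hP : Tame δ k P) (i : SDir q) :
    dirDeriv (svec i) (oint L P) = oint L (dirDeriv (avec (Sum.inl i)) P) := by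
  rw [oint, dirDeriv_smul _ _
    (osc_smooth hL.nonneg hL.lt_one hL.weight (by linarith) (hP.reg L)),
    dirDeriv_osc hL.nonneg hL.lt_one hL.weight (by linarith) (hP.reg L), oint,
    reg_dirDeriv _ _ hP.smooth]

theorem hasDerivAt_oint_scale [CompleteSpace W] (hL : Adm δ k L) (hk : 0 ≤ k) (hP : Tame δ k P)
    (θ : Rq q × Rq q) (t : ℝ) :
    HasDerivAt (fun t => oint L (scale t P) θ) (oint L (scale t (mixed P)) θ) t := by
  have := (hasDerivAt_osc_scale hL.nonneg hL.lt_one hk hL.weight le_rfl (hP.reg L) θ t).const_smul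
    ((((2 * Real.pi) ^ q)⁻¹ : ℝ) : ℂ)
  simp only [oint, reg_scale L _ hP.smooth, reg_scale L _ (mixed_smooth hP.smooth),
    reg_mixed L hP.smooth]
  exact this

theorem oint_add (hL : Adm δ k L) (hP : Tame δ k P) (hP' : Tame δ k P') :
    oint L (P + P') = oint L P + oint L P' := by
  rw [oint, reg_add L hP.smooth hP'.smooth,
    osc_add hL.nonneg hL.lt_one hL.weight (by linarith) (hP.reg L) (hP'.reg L), smul_add]
  rfl

theorem oint_smul (c : ℂ) (hP : Tame δ k P) : oint L (c • P) = c • oint L P := by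
  rw [oint, reg_smul L _ hP.smooth, osc_smul, smul_comm]
  rfl

end oint

end Parts



/-! ### Fourier transform and Fubini's theorem for oscillatory integrals -/

section Fubini

variable {q : ℕ} {W U F : Type*} [NormedAddCommGroup W] [NormedSpace ℂ W]
  [NormedAddCommGroup U] [NormedSpace ℂ U] [NormedAddCommGroup F] [NormedSpace ℂ F]

/-- Functions which decay faster than every power. -/
def RapidDecay (f : Rq q → U) : Prop := ∀ s : ℝ, ∃ C ≥ (0 : ℝ), ∀ η, ‖f η‖ ≤ C * jap η ^ s

theorem norm_pair_pow_le (y η : Rq q) (N : ℕ) :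
    (1 + ‖(y, η)‖) ^ N ≤ (2 * (1 + ‖y‖)) ^ N * jap η ^ (N : ℝ) := by
  rw [Real.rpow_natCast, ← mul_pow]
  refine pow_le_pow_left₀ (by positivity) ?_ N
  have h1 := one_le_jap η
  have h2 := norm_le_jap η
  have h3 := norm_nonneg y
  have h4 : ‖(y, η)‖ ≤ ‖y‖ + ‖η‖ := by
    rw [Prod.norm_mk]
    exact max_le (by linarith [norm_nonneg η]) (by linarith)
  nlinarith

theorem jap_sub_rpow_le (ζ η : Rq q) {K : ℝ} (hK : 0 ≤ K) :
    jap (ζ - η) ^ K ≤ jap ζ ^ K * (2 ^ K * jap η ^ K) := by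
  have := jap_add_rpow_le ζ (-η) (s := K) (k := K) (by rw [abs_of_nonneg hK])
  rwa [jap_neg, Real.mul_rpow (by norm_num) (jap_pos η).le, ← sub_eq_add_neg] at this

theorem integrable_dec_mul_dec : Integrable (fun p : Rq q × Rq q => dec p.1 * dec p.2)
    (volume.prod volume) := dec_integrable.mul_prod dec_integrable

theorem integrable_dec_sub_mul_dec : Integrable (fun p : Rq q × Rq q => dec p.2 * dec (p.1 - p.2))
    (volume.prod volume) :=
  dec_integrable.convolution_integrand (ContinuousLinearMap.mul ℝ ℝ) dec_integrable

theorem continuous_bilin (β : W →L[ℂ] U →L[ℂ] F) {X : Type*} [TopologicalSpace X] {f : X → W}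
    {g : X → U} (hf : Continuous f) (hg : Continuous g) : Continuous fun p => β (f p) (g p) :=
  (β.continuous.comp hf).clm_apply hg

variable {δ k l : ℝ} {w : Rq q → ℂ}

/-- For fixed `ζ` the double integral over `x` and `η` converges absolutely: the weight decays in
`x`, and the rapid decay of `u` absorbs all polynomial growth in `η`. -/
theorem fubini_inner [CompleteSpace W] [CompleteSpace F] (β : W →L[ℂ] U →L[ℂ] F)
    (hw : IsWeight l w) (hkl : k + ((q : ℝ) + 1) ≤ l) {P : Amp q → W} (hP : Tame δ k P)
    {u : Rq q → U} (hu : Continuous u) (hd : RapidDecay u) (y ζ : Rq q) :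
    ∫ x, ek x ζ • w x • ∫ η, ek (-(y + x)) η • β (P ((y, η), (x, ζ - η))) (u η) =
      ∫ η, ek (-y) η • β (Phi w P (y, η) (ζ - η)) (u η) := by
  obtain ⟨C, hC, N, K, hK, h⟩ := weight_smul_le hw hkl hP
  -- The exponent `q + 1` is for integrability in `η`, `K` for the growth of `⟨ζ - η⟩^K` via
  -- Peetre's inequality, `N` for the growth in the parameter `(y, η)`.
  obtain ⟨D, hD, hd⟩ := hd (-((q : ℝ) + 1) + -K + -N)
  have hint : Integrable (Function.uncurry fun x η =>
      ek x ζ • w x • ek (-(y + x)) η • β (P ((y, η), (x, ζ - η))) (u η))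
      ((volume : Measure (Rq q)).prod (volume : Measure (Rq q))) := by
    refine (integrable_dec_mul_dec.const_mul
      (‖β‖ * (C * (2 * (1 + ‖y‖)) ^ N * (jap ζ ^ K * 2 ^ K)) * D)).mono'
      (Continuous.aestronglyMeasurable ?_) (Filter.Eventually.of_forall ?_)
    · have f1 : Continuous fun p : Rq q × Rq q => (p.1, ζ) := by fun_prop
      have f2 : Continuous fun p : Rq q × Rq q => (-(y + p.1), p.2) := by fun_prop
      have f3 : Continuous fun p : Rq q × Rq q => (((y, p.2), (p.1, ζ - p.2)) : Amp q) := by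
        fun_prop
      have e1 := ek_continuous.comp f1
      have e2 := ek_continuous.comp f2
      have e3 := hP.smooth.continuous.comp f3
      have e4 : Continuous fun p : Rq q × Rq q => w p.1 := hw.1.continuous.comp continuous_fst
      have e5 := continuous_bilin β e3 (hu.comp (continuous_snd (X := Rq q)))
      exact e1.fun_smul (e4.fun_smul (e2.fun_smul e5))
    · rintro ⟨x, η⟩
      simp only [Function.uncurry_apply_pair]
      rw [norm_ek_smul, smul_comm, norm_ek_smul]
      have e : w x • β (P ((y, η), (x, ζ - η))) (u η) =
          β (w x • P ((y, η), (x, ζ - η))) (u η) := by simp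
      rw [e]
      have p1 := (jap_rpow_pos (ζ - η) K).le
      have p2 := (dec_pos x).le
      have p3 := (jap_rpow_pos ζ K).le
      have p4 := (jap_rpow_pos η K).le
      have p5 := (jap_rpow_pos η N).le
      have p6 : jap η ^ (-((q : ℝ) + 1) + -K + -N) = dec η * (jap η ^ K)⁻¹ * (jap η ^ (N : ℝ))⁻¹ := by
        rw [jap_rpow_add, jap_rpow_add, Real.rpow_neg (jap_pos η).le K,
            Real.rpow_neg (jap_pos η).le (N : ℝ)]
        rfl
      have p7 := (jap_rpow_pos η K).ne'
      have p8 := (jap_rpow_pos η (N : ℝ)).ne'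
      have p9 := (jap_rpow_pos η (-((q : ℝ) + 1) + -K + -N)).le
      calc _ ≤ ‖β‖ * ‖w x • P ((y, η), (x, ζ - η))‖ * ‖u η‖ := β.le_opNorm₂ _ _
        _ ≤ ‖β‖ * (C * ((2 * (1 + ‖y‖)) ^ N * jap η ^ (N : ℝ)) *
              (jap ζ ^ K * (2 ^ K * jap η ^ K)) * dec x) *
            (D * jap η ^ (-((q : ℝ) + 1) + -K + -N)) := by
          gcongr
          · refine (h (y, η) x (ζ - η)).trans ?_
            gcongr
            · exact norm_pair_pow_le y η N
            · exact jap_sub_rpow_le ζ η hK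
          · exact hd η
        _ = _ := by rw [p6]; field_simp
  have e1 : ∀ x, ek x ζ • w x • ∫ η, ek (-(y + x)) η • β (P ((y, η), (x, ζ - η))) (u η) =
      ∫ η, ek x ζ • w x • ek (-(y + x)) η • β (P ((y, η), (x, ζ - η))) (u η) := fun x => by
    rw [← integral_smul, ← integral_smul]
  simp only [e1]
  rw [integral_integral_swap hint]
  refine integral_congr_ae (Filter.Eventually.of_forall fun η => ?_)
  have i1 := Phi_integrand_integrable hw hkl hP (y, η) (ζ - η)
  have e2 := ((β.flip (u η)).restrictScalars ℝ).integral_comp_comm i1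
  simp only [ContinuousLinearMap.coe_restrictScalars', ContinuousLinearMap.flip_apply] at e2
  change _ = ek (-y) η • β (∫ x, ek x (ζ - η) • w x • P ((y, η), (x, ζ - η))) (u η)
  rw [← e2, ← integral_smul]
  refine integral_congr_ae (Filter.Eventually.of_forall fun x => ?_)
  simp only [map_smul, _root_.smul_apply]
  -- The phases combine as `-xζ + (y + x)η = yη - x(ζ - η)`.
  have key : ek x ζ * ek (-(y + x)) η = ek (-y) η * ek x (ζ - η) := by
    have e : ek (-x) η = ek x (-η) := by simp [ek]
    rw [neg_add, ek_add_left, sub_eq_add_neg, ek_add_right, e]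
    ring
  rw [smul_comm (w x), ← mul_smul, key, mul_smul]

/-- Fubini's theorem for oscillatory integrals: the composition of an operator with an operator
given by a Fourier integral. -/
theorem fubini_osc [CompleteSpace W] [CompleteSpace F] (β : W →L[ℂ] U →L[ℂ] F)
    (hδ : 0 ≤ δ) (hδ' : δ < 1)
    (hw : IsWeight l w) (hkl : k + ((q : ℝ) + 1) ≤ l) {P : Amp q → W} (hP : Tame δ k P)
    {u : Rq q → U} (hu : Continuous u) (hd : RapidDecay u) (y : Rq q) {A : Rq q → Rq q → F}
    (hA : ∀ x ζ, A x ζ = ∫ η, ek (-(y + x)) η • β (P ((y, η), (x, ζ - η))) (u η)) :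
    ∫ ζ, ∫ x, ek x ζ • w x • A x ζ = ∫ η, ek (-y) η • β (osc w P (y, η)) (u η) := by
  simp only [hA, fubini_inner β hw hkl hP hu hd]
  obtain ⟨C, hC, N, h⟩ := Phi_bound hδ hδ' hw hkl hP
  obtain ⟨D, hD, hd⟩ := hd (-((q : ℝ) + 1) + -N)
  have hcont : Continuous fun p : Rq q × Rq q => Phi w P (y, p.2) (p.1 - p.2) :=
    (Phi_continuous hw hkl hP).comp (g := fun p : (Rq q × Rq q) × Rq q => Phi w P p.1 p.2)
      (f := fun p : Rq q × Rq q => ((y, p.2), p.1 - p.2)) (by fun_prop)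
  -- The `x`-integral has produced decay in `ζ - η`, and `u` decays in `η`; so the remaining
  -- interchange is governed by the majorant `dec η * dec (ζ - η)`.
  have hint : Integrable (Function.uncurry fun ζ η =>
      ek (-y) η • β (Phi w P (y, η) (ζ - η)) (u η))
      ((volume : Measure (Rq q)).prod (volume : Measure (Rq q))) := by
    refine (integrable_dec_sub_mul_dec.const_mul (‖β‖ * (C * (2 * (1 + ‖y‖)) ^ N) * D)).mono'
      (Continuous.aestronglyMeasurable ?_) (Filter.Eventually.of_forall ?_)
    · have f1 : Continuous fun p : Rq q × Rq q => (-y, p.2) := by fun_prop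
      have e1 := ek_continuous.comp f1
      have e2 := continuous_bilin β hcont (hu.comp (continuous_snd (X := Rq q)))
      exact e1.fun_smul e2
    · rintro ⟨ζ, η⟩
      simp only [Function.uncurry_apply_pair]
      rw [norm_ek_smul]
      have p1 := (dec_pos (ζ - η)).le
      have p6 : jap η ^ (-((q : ℝ) + 1) + -N) = dec η * (jap η ^ (N : ℝ))⁻¹ := by
        rw [jap_rpow_add, Real.rpow_neg (jap_pos η).le (N : ℝ)]
        rfl
      have p5 := (jap_rpow_pos η N).le
      have p8 := (jap_rpow_pos η (N : ℝ)).ne'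
      calc _ ≤ ‖β‖ * ‖Phi w P (y, η) (ζ - η)‖ * ‖u η‖ := β.le_opNorm₂ _ _
        _ ≤ ‖β‖ * (C * ((2 * (1 + ‖y‖)) ^ N * jap η ^ (N : ℝ)) * dec (ζ - η)) *
            (D * jap η ^ (-((q : ℝ) + 1) + -N)) := by
          gcongr
          · refine (h (y, η) (ζ - η)).trans ?_
            gcongr
            exact norm_pair_pow_le y η N
          · exact hd η
        _ = _ := by rw [p6]; field_simp
  rw [integral_integral_swap hint]
  refine integral_congr_ae (Filter.Eventually.of_forall fun η => ?_)
  have i1 := Phi_integrable hδ hδ' hw hkl hP (y, η)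
  have e2 := ((β.flip (u η)).restrictScalars ℝ).integral_comp_comm (i1.comp_sub_right η)
  simp only [ContinuousLinearMap.coe_restrictScalars', ContinuousLinearMap.flip_apply] at e2
  -- The translation `ξ = ζ - η` makes the inner integral the oscillatory integral at the parameter
  -- `(y, η)`.
  rw [integral_sub_right_eq_self (fun ζ => Phi w P (y, η) ζ) η] at e2
  simp only
  rw [integral_smul, e2]
  rfl

/-! Fourier transform of Schwartz functions. -/

/-- The Fourier transform `∫ e^{-ixξ} u(x) dx`. -/
def ft (u : Rq q → U) (ξ : Rq q) : U := ∫ x, ek x ξ • u x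

open scoped FourierTransform

/-- The two normalizations differ by a dilation with the factor `2π`, through which rapid decay and
inversion are transferred. -/
theorem ft_eq_fourier [CompleteSpace U] (u : 𝓢(Rq q, U)) (ξ : Rq q) :
    ft u ξ = 𝓕 u ((2 * Real.pi)⁻¹ • ξ) := by
  rw [SchwartzMap.fourier_coe, Real.fourier_eq', ft]
  congr 1; funext x
  congr 1
  rw [ek, real_inner_smul_right]
  congr 1
  push_cast
  have := Real.pi_ne_zero
  have : (Real.pi : ℂ) ≠ 0 := by exact_mod_cast this
  field_simp

theorem rapidDecay_schwartz (u : 𝓢(Rq q, U)) : RapidDecay u := by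
  intro s
  obtain ⟨n, hn⟩ := exists_nat_ge (-s)
  refine ⟨2 ^ n * (SchwartzMap.seminorm ℝ 0 0 u + SchwartzMap.seminorm ℝ n 0 u), by positivity,
    fun η => ?_⟩
  have h0 := SchwartzMap.norm_le_seminorm ℝ u η
  have hn' := SchwartzMap.norm_pow_mul_le_seminorm ℝ u n η
  have h1 : jap η ^ n ≤ 2 ^ n * (1 + ‖η‖ ^ n) := by
    have := add_pow_le (zero_le_one (α := ℝ)) (norm_nonneg η) n
    calc jap η ^ n ≤ (1 + ‖η‖) ^ n := by gcongr; exacts [(jap_pos η).le, jap_le_one_add η]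
      _ ≤ 2 ^ (n - 1) * (1 ^ n + ‖η‖ ^ n) := this
      _ ≤ _ := by rw [one_pow]; gcongr; · norm_num
                  · omega
  have h2 : ‖u η‖ * jap η ^ n ≤
      2 ^ n * (SchwartzMap.seminorm ℝ 0 0 u + SchwartzMap.seminorm ℝ n 0 u) := by
    calc ‖u η‖ * jap η ^ n ≤ ‖u η‖ * (2 ^ n * (1 + ‖η‖ ^ n)) := by gcongr
      _ = 2 ^ n * (‖u η‖ + ‖η‖ ^ n * ‖u η‖) := by ring
      _ ≤ _ := by gcongr
  have h3 : jap η ^ (-(n : ℝ)) ≤ jap η ^ s := jap_rpow_le_rpow η (by linarith)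
  rw [Real.rpow_neg (jap_pos η).le, Real.rpow_natCast] at h3
  have hp := pow_pos (jap_pos η) n
  calc ‖u η‖ = (‖u η‖ * jap η ^ n) * (jap η ^ n)⁻¹ := by field_simp
    _ ≤ _ := by gcongr

theorem ft_continuous [CompleteSpace U] (u : 𝓢(Rq q, U)) : Continuous (ft u) := by
  have : ft (u : Rq q → U) = fun ξ => 𝓕 u ((2 * Real.pi)⁻¹ • ξ) := funext (ft_eq_fourier u)
  rw [this]
  exact (𝓕 u).continuous.comp (by fun_prop)

theorem ft_rapidDecay [CompleteSpace U] (u : 𝓢(Rq q, U)) : RapidDecay (ft u) := by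
  intro s
  obtain ⟨C, hC, h⟩ := rapidDecay_schwartz (𝓕 u) (-|s|)
  refine ⟨C * (1 + |2 * Real.pi|) ^ |s|, by positivity, fun ξ => ?_⟩
  rw [ft_eq_fourier]
  refine (h _).trans ?_
  have e := jap_smul_rpow_le (2 * Real.pi) ((2 * Real.pi)⁻¹ • ξ) (abs_nonneg s)
  rw [smul_inv_smul₀ (by positivity)] at e
  have e2 : jap ξ ^ (-|s|) ≤ jap ξ ^ s := jap_rpow_le_rpow ξ (neg_abs_le s)
  rw [mul_assoc]
  refine mul_le_mul_of_nonneg_left (le_trans ?_ (mul_le_mul_of_nonneg_left e2 (by positivity))) hC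
  rw [Real.rpow_neg (jap_pos _).le, Real.rpow_neg (jap_pos _).le, ← div_eq_mul_inv,
    le_div_iff₀ (jap_rpow_pos _ _), inv_mul_le_iff₀ (jap_rpow_pos _ _), mul_comm]
  exact e

/-- Fourier inversion. -/
theorem ft_inversion [CompleteSpace U] (u : 𝓢(Rq q, U)) (y : Rq q) :
    u y = ((((2 * Real.pi) ^ q)⁻¹ : ℝ) : ℂ) • ∫ η, ek (-y) η • ft u η := by
  have h1 : 𝓕⁻ (𝓕 u) y = u y := by rw [FourierTransform.fourierInv_fourier_eq]
  -- The substitution `v ↦ v / (2π)` in the inversion formula produces the factor `(2π)^q`.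
  have h3 := Measure.integral_comp_inv_smul_of_nonneg (volume : Measure (Rq q))
    (fun v => Complex.exp ((((2 * Real.pi * inner ℝ v y : ℝ)) : ℂ) * Complex.I) • 𝓕 u v)
    (R := 2 * Real.pi) (by positivity)
  rw [← h1, SchwartzMap.fourierInv_coe, Real.fourierInv_eq']
  simp only [finrank_euclideanSpace, Fintype.card_fin] at h3
  have h4 : ∀ v : Rq q, Complex.exp ((((2 * Real.pi * inner ℝ ((2 * Real.pi)⁻¹ • v) y : ℝ)) : ℂ) *
      Complex.I) • 𝓕 u ((2 * Real.pi)⁻¹ • v) = ek (-y) v • ft u v := fun v => by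
    rw [ft_eq_fourier, ek, real_inner_smul_left, ← mul_assoc,
      mul_inv_cancel₀ (by positivity : (2 * Real.pi : ℝ) ≠ 0), one_mul, inner_neg_left,
      real_inner_comm]
    congr 2
    push_cast; ring
  simp only [h4] at h3
  rw [h3, Complex.coe_smul, smul_smul, inv_mul_cancel₀ (by positivity), one_smul]

end Fubini



/-! ### Twisted symbol and amplitude estimates -/

section Estimates

variable {q : ℕ}

/-- A tempered family of bounded operators, such as `A ↦ κ'_{⟨η⟩}⁻¹ A κ_{⟨η⟩}`. -/
structure Twist (q : ℕ) (W : Type*) [NormedAddCommGroup W] [NormedSpace ℂ W] where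
  act : Rq q → W →L[ℂ] W
  c : ℝ
  κ : ℝ
  c_nonneg : 0 ≤ c
  κ_nonneg : 0 ≤ κ
  act_zero : ∀ w, act 0 w = w
  -- Slow variation: at points with brackets comparable up to `R`, the twisted norms differ at most
  -- by a power of `R`. Together with `act_zero`, this is all that the estimates use of the group
  -- actions.
  le : ∀ (η η' : Rq q) (R : ℝ), 1 ≤ R → jap η ≤ jap η' * R → jap η' ≤ jap η * R → ∀ w,
    ‖act η w‖ ≤ c * R ^ κ * ‖act η' w‖

/-- The trivial family. -/
def Twist.triv (q : ℕ) (W : Type*) [NormedAddCommGroup W] [NormedSpace ℂ W] : Twist q W where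
  act _ := ContinuousLinearMap.id ℂ W
  c := 1
  κ := 0
  c_nonneg := zero_le_one
  κ_nonneg := le_rfl
  act_zero _ := rfl
  le _ _ R _ _ _ w := by simp

/-- A weight controlling the quotient of `⟨η + ξ⟩` and `⟨η⟩`. -/
def rho (η ξ : Rq q) : ℝ := if ‖ξ‖ ≤ jap η / 2 then 4 else 4 * jap ξ

theorem rho_of_le {η ξ : Rq q} (h : ‖ξ‖ ≤ jap η / 2) : rho η ξ = 4 := if_pos h

theorem four_le_rho (η ξ : Rq q) : 4 ≤ rho η ξ := by
  unfold rho
  split_ifs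
  · rfl
  · linarith [one_le_jap ξ]

theorem one_le_rho (η ξ : Rq q) : 1 ≤ rho η ξ := by linarith [four_le_rho η ξ]

theorem rho_pos (η ξ : Rq q) : 0 < rho η ξ := by linarith [four_le_rho η ξ]

theorem rho_le (η ξ : Rq q) : rho η ξ ≤ 4 * jap ξ := by
  unfold rho
  split_ifs
  · linarith [one_le_jap ξ]
  · rfl

/-- Together with `jap_le_rho`: `rho` controls the quotient of `⟨η + ξ⟩` and `⟨η⟩` in both
directions. It is constant where `|ξ| ≤ ⟨η⟩/2`, so its powers are harmless there; elsewhere it is a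
multiple of `⟨ξ⟩`, so its powers can be removed by integration by parts. -/
theorem jap_add_le_rho (η ξ : Rq q) : jap (η + ξ) ≤ jap η * rho η ξ := by
  have h1 := jap_add_le η ξ
  have h2 := jap_add_le_mul η ξ
  have h3 := jap_pos η
  have h4 := mul_pos (jap_pos η) (jap_pos ξ)
  unfold rho
  split_ifs with h
  · linarith
  · linarith

theorem jap_le_rho (η ξ : Rq q) : jap η ≤ jap (η + ξ) * rho η ξ := by
  have h1 := jap_add_le (η + ξ) (-ξ)
  have h2 := jap_add_le_mul (η + ξ) (-ξ)
  rw [add_neg_cancel_right] at h1 h2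
  rw [norm_neg] at h1
  rw [jap_neg] at h2
  have h3 := jap_pos (η + ξ)
  have h4 := mul_pos (jap_pos (η + ξ)) (jap_pos ξ)
  unfold rho
  split_ifs with h
  · linarith
  · linarith

theorem jap_add_norm_le_rho (η ξ : Rq q) : jap η + ‖ξ‖ ≤ jap η * rho η ξ := by
  have h1 := norm_le_jap ξ
  have h2 := one_le_jap ξ
  have h3 := one_le_jap η
  unfold rho
  split_ifs with h
  · linarith
  · nlinarith

theorem jap_add_norm_pos (η ξ : Rq q) : 0 < jap η + ‖ξ‖ :=
  add_pos_of_pos_of_nonneg (jap_pos η) (norm_nonneg ξ)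

theorem one_le_jap_add_norm (η ξ : Rq q) : 1 ≤ jap η + ‖ξ‖ := by
  linarith [one_le_jap η, norm_nonneg ξ]

/-- The change of the order of a symbol under differentiation. -/
def ordS (ϱ δ : ℝ) : SDir q → ℝ := Sum.elim (fun _ => δ) (fun _ => -ϱ)

/-- The part of the change of order which is due to derivatives in `η`. -/
def ordH (ϱ : ℝ) : SDir q → ℝ := Sum.elim (fun _ => 0) (fun _ => -ϱ)

/-- The part of the change of order which is due to derivatives in `y`. -/
def ordY (δ : ℝ) : SDir q → ℝ := Sum.elim (fun _ => δ) (fun _ => 0)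

/-- Counts derivatives in `η`. -/
def cntH : SDir q → ℝ := Sum.elim (fun _ => 0) (fun _ => 1)

/-- The direction `y_j` or `η_j` corresponding to a direction of the amplitude variables. -/
def flat : ADir q → SDir q := Sum.elim id id

variable {W : Type*} [NormedAddCommGroup W] [NormedSpace ℂ W]

/-- The twisted symbol estimates for derivatives up to order `n`, with a common constant. -/
def SymEst (Θ : Twist q W) (ϱ δ m₂ : ℝ) : ℕ → ℝ → ℝ → (Rq q × Rq q → W) → Prop
  | 0, m, Λ, a => ∀ y η, ‖Θ.act η (a (y, η))‖ ≤ Λ * (jap y ^ m₂ * jap η ^ m)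
  | n + 1, m, Λ, a => (∀ y η, ‖Θ.act η (a (y, η))‖ ≤ Λ * (jap y ^ m₂ * jap η ^ m)) ∧
      ∀ l, SymEst Θ ϱ δ m₂ n (m + ordS ϱ δ l) Λ (dirDeriv (svec l) a)

/-- The twisted amplitude estimates for derivatives up to order `n`, with a common constant. -/
def AmpEst (Θ : Twist q W) (ϱ δ m₂ k : ℝ) : ℕ → ℝ → ℝ → ℝ → ℝ → (Amp q → W) → Prop
  | 0, m, d, K, Λ, P => ∀ y η x ξ, ‖Θ.act η (P ((y, η), (x, ξ)))‖ ≤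
      Λ * (jap y ^ m₂ * jap x ^ k * (jap η ^ m * (jap η + ‖ξ‖) ^ d * rho η ξ ^ K))
  -- Derivatives in `η` and `ξ` gain `⟨η + ξ⟩^{-ϱ}` or `⟨η⟩^{-ϱ}`; replacing the former by
  -- `⟨η⟩^{-ϱ}` costs a power of `rho`, counted by `cntH`. Derivatives in `y` and `x` cost at most
  -- `(⟨η⟩ + |ξ|)^δ`, counted by `ordY`.
  | n + 1, m, d, K, Λ, P => (∀ y η x ξ, ‖Θ.act η (P ((y, η), (x, ξ)))‖ ≤
      Λ * (jap y ^ m₂ * jap x ^ k * (jap η ^ m * (jap η + ‖ξ‖) ^ d * rho η ξ ^ K))) ∧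
      ∀ l, AmpEst Θ ϱ δ m₂ k n (m + ordH ϱ (flat l)) (d + ordY δ (flat l)) (K + cntH (flat l)) Λ
        (dirDeriv (avec l) P)

variable {Θ : Twist q W} {ϱ δ m₂ k : ℝ}

theorem SymEst.base {n : ℕ} {m Λ : ℝ} {a : Rq q × Rq q → W} (h : SymEst Θ ϱ δ m₂ n m Λ a) :
    ∀ y η, ‖Θ.act η (a (y, η))‖ ≤ Λ * (jap y ^ m₂ * jap η ^ m) := by
  cases n with
  | zero => exact h
  | succ n => exact h.1

theorem SymEst.nonneg {n : ℕ} {m Λ : ℝ} {a : Rq q × Rq q → W} (h : SymEst Θ ϱ δ m₂ n m Λ a) :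
    0 ≤ Λ := by
  have := (norm_nonneg _).trans (h.base 0 0)
  simpa [jap_zero] using this

theorem SymEst.mono {n : ℕ} {m m' Λ Λ' : ℝ} {a : Rq q × Rq q → W} (h : SymEst Θ ϱ δ m₂ n m Λ a)
    (hm : m ≤ m') (hΛ : Λ ≤ Λ') : SymEst Θ ϱ δ m₂ n m' Λ' a := by
  have hb : ∀ y η, ‖Θ.act η (a (y, η))‖ ≤ Λ' * (jap y ^ m₂ * jap η ^ m') := fun y η => by
    refine (h.base y η).trans ?_
    have h0 := h.nonneg
    have h1 := (jap_rpow_pos y m₂).le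
    have h2 := (jap_rpow_pos η m).le
    exact mul_le_mul hΛ (mul_le_mul_of_nonneg_left (jap_rpow_le_rpow η hm) h1) (by positivity)
      (h0.trans hΛ)
  induction n generalizing m m' a with
  | zero => exact hb
  | succ n ih =>
    refine ⟨hb, fun l => ?_⟩
    have hm' : m + ordS ϱ δ l ≤ m' + ordS ϱ δ l := by linarith
    refine ih (h.2 l) hm' fun y η => ?_
    refine ((h.2 l).base y η).trans ?_
    have h0 := h.nonneg
    have h1 := (jap_rpow_pos y m₂).le
    have h2 := (jap_rpow_pos η (m + ordS ϱ δ l)).le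
    exact mul_le_mul hΛ (mul_le_mul_of_nonneg_left (jap_rpow_le_rpow η hm') h1) (by positivity)
      (h0.trans hΛ)

theorem SymEst.of_le {n n' : ℕ} {m Λ : ℝ} {a : Rq q × Rq q → W} (h : SymEst Θ ϱ δ m₂ n m Λ a)
    (hn : n' ≤ n) : SymEst Θ ϱ δ m₂ n' m Λ a := by
  induction n' generalizing n m a with
  | zero => exact h.base
  | succ n' ih =>
    obtain ⟨n, rfl⟩ : ∃ i, n = i + 1 := ⟨n - 1, by omega⟩
    exact ⟨h.base, fun l => ih (h.2 l) (by omega)⟩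

theorem SymEst.add {n : ℕ} {m Λ Λ' : ℝ} {a b : Rq q × Rq q → W} (ha : ContDiff ℝ ∞ a)
    (hb : ContDiff ℝ ∞ b) (h : SymEst Θ ϱ δ m₂ n m Λ a) (h' : SymEst Θ ϱ δ m₂ n m Λ' b) :
    SymEst Θ ϱ δ m₂ n m (Λ + Λ') (a + b) := by
  have base : ∀ {m : ℝ} {a b : Rq q × Rq q → W} {n : ℕ}, SymEst Θ ϱ δ m₂ n m Λ a →
      SymEst Θ ϱ δ m₂ n m Λ' b → ∀ y η, ‖Θ.act η ((a + b) (y, η))‖ ≤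
        (Λ + Λ') * (jap y ^ m₂ * jap η ^ m) := fun h h' y η => by
    rw [Pi.add_apply, map_add, add_mul]
    exact (norm_add_le _ _).trans (add_le_add (h.base y η) (h'.base y η))
  induction n generalizing m a b with
  | zero => exact base h h'
  | succ n ih =>
    refine ⟨base h h', fun l => ?_⟩
    rw [dirDeriv_add _ ha hb]
    exact ih (dirDeriv_smooth _ ha) (dirDeriv_smooth _ hb) (h.2 l) (h'.2 l)

theorem SymEst.smul {n : ℕ} {m Λ : ℝ} {a : Rq q × Rq q → W} (ha : ContDiff ℝ ∞ a)
    (h : SymEst Θ ϱ δ m₂ n m Λ a) (c : ℂ) : SymEst Θ ϱ δ m₂ n m (‖c‖ * Λ) (c • a) := by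
  have base : ∀ {m : ℝ} {a : Rq q × Rq q → W} {n : ℕ}, SymEst Θ ϱ δ m₂ n m Λ a →
      ∀ y η, ‖Θ.act η ((c • a) (y, η))‖ ≤ (‖c‖ * Λ) * (jap y ^ m₂ * jap η ^ m) := fun h y η => by
    rw [Pi.smul_apply, map_smul, norm_smul, mul_assoc]
    exact mul_le_mul_of_nonneg_left (h.base y η) (norm_nonneg c)
  induction n generalizing m a with
  | zero => exact base h
  | succ n ih =>
    refine ⟨base h, fun l => ?_⟩
    rw [dirDeriv_smul _ c ha]
    exact ih (dirDeriv_smooth _ ha) (h.2 l)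

theorem SymEst.zero (n : ℕ) (m : ℝ) : SymEst Θ ϱ δ m₂ n m 0 (0 : Rq q × Rq q → W) := by
  induction n generalizing m with
  | zero => intro y η; simp
  | succ n ih =>
    refine ⟨fun y η => by simp, fun l => ?_⟩
    have : dirDeriv (svec l) (0 : Rq q × Rq q → W) = 0 := dirDeriv_const _ 0
    rw [this]
    exact ih _

theorem SymEst.sum {ι : Type*} (s : Finset ι) {n : ℕ} {m : ℝ} {Λ : ι → ℝ}
    {a : ι → Rq q × Rq q → W} (ha : ∀ i ∈ s, ContDiff ℝ ∞ (a i))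
    (h : ∀ i ∈ s, SymEst Θ ϱ δ m₂ n m (Λ i) (a i)) :
    SymEst Θ ϱ δ m₂ n m (∑ i ∈ s, Λ i) (∑ i ∈ s, a i) := by
  classical
  induction s using Finset.induction_on with
  | empty => exact SymEst.zero n m
  | insert i s hi ih =>
    rw [Finset.sum_insert hi, Finset.sum_insert hi]
    have h1 : ∀ j ∈ s, ContDiff ℝ ∞ (a j) := fun j hj => ha j (Finset.mem_insert_of_mem hj)
    refine SymEst.add (ha i (Finset.mem_insert_self _ _)) ?_ (h i (Finset.mem_insert_self _ _))
      (ih h1 fun j hj => h j (Finset.mem_insert_of_mem hj))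
    have := ContDiff.sum h1
    convert this using 1
    funext x; simp

/-- The factor in the amplitude estimates. -/
def ampW (m₂ k m d K : ℝ) (y η x ξ : Rq q) : ℝ :=
  jap y ^ m₂ * jap x ^ k * (jap η ^ m * (jap η + ‖ξ‖) ^ d * rho η ξ ^ K)

theorem ampW_pos (m₂ k m d K : ℝ) (y η x ξ : Rq q) : 0 < ampW m₂ k m d K y η x ξ := by
  have h1 := jap_rpow_pos y m₂
  have h2 := jap_rpow_pos x k
  have h3 := jap_rpow_pos η m
  have h4 := Real.rpow_pos_of_pos (jap_add_norm_pos η ξ) d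
  have h5 := Real.rpow_pos_of_pos (rho_pos η ξ) K
  unfold ampW
  positivity

theorem ampW_mono {m m' d d' K K' : ℝ} (hm : m ≤ m') (hd : d ≤ d') (hK : K ≤ K')
    (y η x ξ : Rq q) : ampW m₂ k m d K y η x ξ ≤ ampW m₂ k m' d' K' y η x ξ := by
  have h1 := jap_rpow_pos y m₂
  have h2 := jap_rpow_pos x k
  have h3 := jap_rpow_pos η m
  have h3' := jap_rpow_pos η m'
  have h4 := Real.rpow_pos_of_pos (jap_add_norm_pos η ξ) d
  have h4' := Real.rpow_pos_of_pos (jap_add_norm_pos η ξ) d'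
  have h5 := Real.rpow_pos_of_pos (rho_pos η ξ) K
  unfold ampW
  have e1 := jap_rpow_le_rpow η hm
  have e2 := Real.rpow_le_rpow_of_exponent_le (one_le_jap_add_norm η ξ) hd
  have e3 := Real.rpow_le_rpow_of_exponent_le (one_le_rho η ξ) hK
  gcongr

/-- Powers of `⟨η⟩ + |ξ|` can be absorbed into powers of `⟨η⟩` and `rho`. -/
theorem ampW_absorb {m d d' K : ℝ} (hd : 0 ≤ d) (y η x ξ : Rq q) :
    ampW m₂ k m (d' + d) K y η x ξ ≤ ampW m₂ k (m + d) d' (K + d) y η x ξ := by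
  have h1 := jap_rpow_pos y m₂
  have h2 := jap_rpow_pos x k
  have h3 := jap_rpow_pos η m
  have h4 := Real.rpow_pos_of_pos (jap_add_norm_pos η ξ) d'
  have h5 := Real.rpow_pos_of_pos (rho_pos η ξ) K
  unfold ampW
  rw [Real.rpow_add (jap_add_norm_pos η ξ), jap_rpow_add, Real.rpow_add (rho_pos η ξ)]
  have e : (jap η + ‖ξ‖) ^ d ≤ jap η ^ d * rho η ξ ^ d := by
    rw [← Real.mul_rpow (jap_pos η).le (rho_pos η ξ).le]
    exact Real.rpow_le_rpow (jap_add_norm_pos η ξ).le (jap_add_norm_le_rho η ξ) hd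
  calc _ ≤ jap y ^ m₂ * jap x ^ k * (jap η ^ m * ((jap η + ‖ξ‖) ^ d' * (jap η ^ d * rho η ξ ^ d)) *
        rho η ξ ^ K) := by gcongr
    _ = _ := by ring

theorem AmpEst.base {n : ℕ} {m d K Λ : ℝ} {P : Amp q → W} (h : AmpEst Θ ϱ δ m₂ k n m d K Λ P) :
    ∀ y η x ξ, ‖Θ.act η (P ((y, η), (x, ξ)))‖ ≤ Λ * ampW m₂ k m d K y η x ξ := by
  cases n with
  | zero => exact h
  | succ n => exact h.1

theorem AmpEst.nonneg {n : ℕ} {m d K Λ : ℝ} {P : Amp q → W}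
    (h : AmpEst Θ ϱ δ m₂ k n m d K Λ P) : 0 ≤ Λ :=
  nonneg_of_mul_nonneg_left ((norm_nonneg _).trans (h.base 0 0 0 0)) (ampW_pos _ _ _ _ _ _ _ _ _)

/-- Weaker estimates with respect to another family of weights which behaves in the same way
under differentiation. -/
theorem AmpEst.imp {Θ' : Twist q W} {k' m₂' : ℝ} {n : ℕ} {m d K m' d' K' Λ Λ' : ℝ}
    (H : ∀ i j : ℝ, 0 ≤ i → 0 ≤ j → ∀ w y η x ξ,
      ‖Θ.act η w‖ ≤ Λ * ampW m₂ k (m - ϱ * i) (d + δ * j) (K + i) y η x ξ →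
      ‖Θ'.act η w‖ ≤ Λ' * ampW m₂' k' (m' - ϱ * i) (d' + δ * j) (K' + i) y η x ξ)
    {P : Amp q → W} (h : AmpEst Θ ϱ δ m₂ k n m d K Λ P) : AmpEst Θ' ϱ δ m₂' k' n m' d' K' Λ' P := by
  have hb : ∀ {P : Amp q → W} {n : ℕ}, AmpEst Θ ϱ δ m₂ k n m d K Λ P → ∀ y η x ξ,
      ‖Θ'.act η (P ((y, η), (x, ξ)))‖ ≤ Λ' * ampW m₂' k' m' d' K' y η x ξ := fun h y η x ξ => by
    have := H 0 0 le_rfl le_rfl _ y η x ξ (by simpa using h.base y η x ξ)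
    simpa using this
  induction n generalizing m d K m' d' K' P with
  | zero => exact hb h
  | succ n ih =>
    refine ⟨hb h, fun l => ?_⟩
    -- The numbers `i` and `j` count the derivatives of type `η` and of type `y` taken so far; one
    -- of them increases by one according to the direction `l`.
    have key := ih (m := m + ordH ϱ (flat l)) (d := d + ordY δ (flat l)) (K := K + cntH (flat l))
      (m' := m' + ordH ϱ (flat l)) (d' := d' + ordY δ (flat l)) (K' := K' + cntH (flat l))
      (P := dirDeriv (avec l) P) ?_ (h.2 l) ?_
    · exact key
    · intro i j hi hj w y η x ξ hw
      rcases hl : flat l with l' | l'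
      · rw [hl] at hw
        simp only [ordH, ordY, cntH, Sum.elim_inl, add_zero] at hw ⊢
        have := H i (1 + j) hi (by linarith) w y η x ξ (by
          rwa [mul_add, mul_one, ← add_assoc])
        rwa [mul_add, mul_one, ← add_assoc] at this
      · rw [hl] at hw
        simp only [ordH, ordY, cntH, Sum.elim_inr, add_zero] at hw ⊢
        have := H (1 + i) j (by linarith) hj w y η x ξ (by
          rwa [show m - ϱ * (1 + i) = m + -ϱ - ϱ * i by ring, ← add_assoc])
        rwa [show m' - ϱ * (1 + i) = m' + -ϱ - ϱ * i by ring, ← add_assoc] at this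
    · intro P' n' h' y η x ξ
      rcases hl : flat l with l' | l'
      · have e := h'.base y η x ξ
        rw [hl] at e
        simp only [ordH, ordY, cntH, Sum.elim_inl, add_zero] at e ⊢
        have := H 0 1 le_rfl zero_le_one _ y η x ξ (by simpa using e)
        simpa using this
      · have e := h'.base y η x ξ
        rw [hl] at e
        simp only [ordH, ordY, cntH, Sum.elim_inr, add_zero] at e ⊢
        have := H 1 0 zero_le_one le_rfl _ y η x ξ (by simpa [sub_eq_add_neg] using e)
        simpa [sub_eq_add_neg] using this

theorem AmpEst.mono {n : ℕ} {m m' d d' K K' Λ Λ' : ℝ} {P : Amp q → W}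
    (h : AmpEst Θ ϱ δ m₂ k n m d K Λ P) (hm : m ≤ m') (hd : d ≤ d') (hK : K ≤ K') (hΛ : Λ ≤ Λ') :
    AmpEst Θ ϱ δ m₂ k n m' d' K' Λ' P := by
  have h0 := h.nonneg
  refine h.imp fun i j hi hj w y η x ξ hw => hw.trans ?_
  exact mul_le_mul hΛ (ampW_mono (by linarith) (by linarith) (by linarith) y η x ξ)
    (ampW_pos _ _ _ _ _ _ _ _ _).le (h0.trans hΛ)

theorem AmpEst.absorb {n : ℕ} {m d d' K Λ : ℝ} {P : Amp q → W}
    (h : AmpEst Θ ϱ δ m₂ k n m (d' + d) K Λ P) (hd : 0 ≤ d) :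
    AmpEst Θ ϱ δ m₂ k n (m + d) d' (K + d) Λ P := by
  have h0 := h.nonneg
  refine h.imp fun i j hi hj w y η x ξ hw => hw.trans ?_
  have := ampW_absorb (m₂ := m₂) (k := k) (m := m - ϱ * i) (d' := d' + δ * j) (K := K + i) hd
    y η x ξ
  rw [show d' + δ * j + d = d' + d + δ * j by ring, show m - ϱ * i + d = m + d - ϱ * i by ring,
    show K + i + d = K + d + i by ring] at this
  exact mul_le_mul_of_nonneg_left this h0

theorem AmpEst.of_le {n n' : ℕ} {m d K Λ : ℝ} {P : Amp q → W}
    (h : AmpEst Θ ϱ δ m₂ k n m d K Λ P) (hn : n' ≤ n) : AmpEst Θ ϱ δ m₂ k n' m d K Λ P := by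
  induction n' generalizing n m d K P with
  | zero => exact h.base
  | succ n' ih =>
    obtain ⟨n, rfl⟩ : ∃ i, n = i + 1 := ⟨n - 1, by omega⟩
    exact ⟨h.base, fun l => ih (h.2 l) (by omega)⟩

theorem AmpEst.add {n : ℕ} {m d K Λ Λ' : ℝ} {P P' : Amp q → W} (hP : ContDiff ℝ ∞ P)
    (hP' : ContDiff ℝ ∞ P') (h : AmpEst Θ ϱ δ m₂ k n m d K Λ P)
    (h' : AmpEst Θ ϱ δ m₂ k n m d K Λ' P') : AmpEst Θ ϱ δ m₂ k n m d K (Λ + Λ') (P + P') := by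
  have base : ∀ {m d K : ℝ} {P P' : Amp q → W} {n : ℕ}, AmpEst Θ ϱ δ m₂ k n m d K Λ P →
      AmpEst Θ ϱ δ m₂ k n m d K Λ' P' → ∀ y η x ξ, ‖Θ.act η ((P + P') ((y, η), (x, ξ)))‖ ≤
        (Λ + Λ') * ampW m₂ k m d K y η x ξ := fun h h' y η x ξ => by
    rw [Pi.add_apply, map_add, add_mul]
    exact (norm_add_le _ _).trans (add_le_add (h.base y η x ξ) (h'.base y η x ξ))
  induction n generalizing m d K P P' with
  | zero => exact base h h'
  | succ n ih =>
    refine ⟨base h h', fun l => ?_⟩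
    rw [dirDeriv_add _ hP hP']
    exact ih (dirDeriv_smooth _ hP) (dirDeriv_smooth _ hP') (h.2 l) (h'.2 l)

theorem AmpEst.smul {n : ℕ} {m d K Λ : ℝ} {P : Amp q → W} (hP : ContDiff ℝ ∞ P)
    (h : AmpEst Θ ϱ δ m₂ k n m d K Λ P) (c : ℂ) :
    AmpEst Θ ϱ δ m₂ k n m d K (‖c‖ * Λ) (c • P) := by
  have base : ∀ {m d K : ℝ} {P : Amp q → W} {n : ℕ}, AmpEst Θ ϱ δ m₂ k n m d K Λ P →
      ∀ y η x ξ, ‖Θ.act η ((c • P) ((y, η), (x, ξ)))‖ ≤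
        (‖c‖ * Λ) * ampW m₂ k m d K y η x ξ := fun h y η x ξ => by
    rw [Pi.smul_apply, map_smul, norm_smul, mul_assoc]
    exact mul_le_mul_of_nonneg_left (h.base y η x ξ) (norm_nonneg c)
  induction n generalizing m d K P with
  | zero => exact base h
  | succ n ih =>
    refine ⟨base h, fun l => ?_⟩
    rw [dirDeriv_smul _ c hP]
    exact ih (dirDeriv_smooth _ hP) (h.2 l)

theorem AmpEst.sum {n : ℕ} {m d K Λ : ℝ} {ι : Type*} [Fintype ι] {P : ι → Amp q → W}
    (hP : ∀ i, ContDiff ℝ ∞ (P i)) (h : ∀ i, AmpEst Θ ϱ δ m₂ k n m d K Λ (P i)) :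
    AmpEst Θ ϱ δ m₂ k n m d K (Fintype.card ι * Λ) (∑ i, P i) := by
  classical
  have key : ∀ s : Finset ι, AmpEst Θ ϱ δ m₂ k n m d K (s.card * Λ) (∑ i ∈ s, P i) := by
    intro s
    have hs : ∀ s : Finset ι, ContDiff ℝ ∞ (∑ i ∈ s, P i) := fun s => by
      have := ContDiff.sum (s := s) fun i _ => hP i
      convert this using 1
      funext x; simp
    induction s using Finset.induction_on with
    | empty =>
      rcases isEmpty_or_nonempty ι with hι | ⟨⟨i⟩⟩
      · have e : ∀ (n : ℕ) (m d K : ℝ), AmpEst Θ ϱ δ m₂ k n m d K 0 (0 : Amp q → W) := by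
          intro n
          induction n with
          | zero => intro m d K y η x ξ; simp
          | succ n ih =>
            intro m d K
            refine ⟨fun y η x ξ => by simp, fun l => ?_⟩
            have : dirDeriv (avec l) (0 : Amp q → W) = 0 := dirDeriv_const _ 0
            rw [this]; exact ih _ _ _
        simpa using e n m d K
      · have := (h i).smul (hP i) 0
        simpa using this
    | insert i s hi ih =>
      rw [Finset.sum_insert hi, Finset.card_insert_of_notMem hi]
      have := (h i).add (hP i) (hs s) ih
      refine this.mono le_rfl le_rfl le_rfl (le_of_eq ?_)
      push_cast; ring
  exact key Finset.univ

/-- Each factor `1 + ∂_{ξ_j}` costs a factor `2` and one power of `rho`; the gain `⟨η⟩^{-ϱ}` of the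
differentiated term is given away. -/
theorem AmpEst.reg (hϱ : 0 ≤ ϱ) (L : List (Fin q)) {n : ℕ} {m d K Λ : ℝ} {P : Amp q → W}
    (hP : ContDiff ℝ ∞ P) (h : AmpEst Θ ϱ δ m₂ k (n + L.length) m d K Λ P) :
    AmpEst Θ ϱ δ m₂ k n m d (K + L.length) (2 ^ L.length * Λ) (reg L P) := by
  induction L generalizing n with
  | nil =>
    have e : EdgeCalculus.reg [] P = P := rfl
    simpa [e] using h
  | cons j L ih =>
    have h1 := ih (n := n + 1) (h.of_le (by simp; omega))
    have hs := reg_smooth L hP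
    have h2 : AmpEst Θ ϱ δ m₂ k n m d (K + L.length + 1) (2 ^ L.length * Λ)
        (dirDeriv (dXi j) (EdgeCalculus.reg L P)) := by
      have := h1.2 (Sum.inr (Sum.inr j))
      simp only [flat, ordH, ordY, cntH, Sum.elim_inr, id_eq, add_zero] at this
      exact this.mono (by linarith) le_rfl le_rfl le_rfl
    have h3 := (h1.of_le (Nat.le_succ n)).mono (K' := K + L.length + 1) le_rfl le_rfl (by linarith)
      le_rfl
    rw [reg_cons]
    refine (h3.add hs (dirDeriv_smooth _ hs) h2).mono le_rfl le_rfl (le_of_eq ?_) (le_of_eq ?_)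
    · simp only [List.length_cons]; push_cast; ring
    · simp only [List.length_cons, pow_succ]; ring

/-- For `|t| ≤ 1` the weight `⟨tx⟩^k` does not exceed `⟨x⟩^k`, and the factors `t` from
`x`-derivatives only help. Hence the constant is unchanged along the whole segment `[0, 1]` on which
the Taylor remainder is estimated. -/
theorem AmpEst.scale (hk : 0 ≤ k) {t : ℝ} (ht : |t| ≤ 1) {n : ℕ} {m d K Λ : ℝ} {P : Amp q → W}
    (hP : ContDiff ℝ ∞ P) (h : AmpEst Θ ϱ δ m₂ k n m d K Λ P) :
    AmpEst Θ ϱ δ m₂ k n m d K Λ (scale t P) := by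
  have hj : ∀ x : Rq q, jap (t • x) ^ k ≤ jap x ^ k := fun x => by
    refine Real.rpow_le_rpow (jap_pos _).le ?_ hk
    rw [jap_eq, jap_eq]
    refine Real.sqrt_le_sqrt ?_
    rw [norm_smul, Real.norm_eq_abs]
    have : |t| * ‖x‖ ≤ ‖x‖ := mul_le_of_le_one_left (norm_nonneg x) ht
    have h0 : 0 ≤ |t| * ‖x‖ := by positivity
    gcongr
  have base : ∀ {m d K : ℝ} {P : Amp q → W} {n : ℕ}, AmpEst Θ ϱ δ m₂ k n m d K Λ P →
      ∀ y η x ξ, ‖Θ.act η (EdgeCalculus.scale t P ((y, η), (x, ξ)))‖ ≤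
        Λ * ampW m₂ k m d K y η x ξ := fun {m d K P n} h y η x ξ => by
    rw [scale_apply]
    refine (h.base y η (t • x) ξ).trans ?_
    have h0 := h.nonneg
    have h1 := jap_rpow_pos y m₂
    have h3 := jap_rpow_pos η m
    have h4 := Real.rpow_pos_of_pos (jap_add_norm_pos η ξ) d
    have h5 := Real.rpow_pos_of_pos (rho_pos η ξ) K
    unfold ampW
    gcongr ?_ * (_ * ?_ * _)
    exact hj x
  induction n generalizing m d K P with
  | zero => exact base h
  | succ n ih =>
    refine ⟨base h, fun l => ?_⟩
    have e := ih (dirDeriv_smooth _ hP) (h.2 l)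
    rcases l with l | l | j
    · rw [dirDeriv_inl_scale t l hP]; exact e
    · rw [← dX, dirDeriv_dX_scale t l hP]
      have := e.smul (scale_smooth t (dirDeriv_smooth _ hP)) (t : ℂ)
      refine this.mono le_rfl le_rfl le_rfl ?_
      rw [Complex.norm_real, Real.norm_eq_abs]
      exact mul_le_of_le_one_left h.nonneg ht
    · rw [← dXi, dirDeriv_dXi_scale t j hP]; exact e

theorem AmpEst.mixed {n : ℕ} {m d K Λ : ℝ} {P : Amp q → W} (hP : ContDiff ℝ ∞ P)
    (h : AmpEst Θ ϱ δ m₂ k (n + 2) m d K Λ P) :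
    AmpEst Θ ϱ δ m₂ k n (m - ϱ) (d + δ) (K + 1) (q * Λ) (mixed P) := by
  have hj : ∀ j : Fin q, AmpEst Θ ϱ δ m₂ k n (m - ϱ) (d + δ) (K + 1) Λ
      ((-Complex.I) • dirDeriv (dXi j) (dirDeriv (dX j) P)) := fun j => by
    have h1 := (h.2 (Sum.inr (Sum.inl j))).2 (Sum.inr (Sum.inr j))
    have := h1.smul (dirDeriv_smooth _ (dirDeriv_smooth _ hP)) (-Complex.I)
    simp only [flat, ordH, ordY, cntH, Sum.elim_inr, Sum.elim_inl, id_eq, norm_neg,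
      Complex.norm_I, one_mul, add_zero, ← sub_eq_add_neg] at this
    exact this
  have hs : ∀ j : Fin q, ContDiff ℝ ∞ ((-Complex.I) • dirDeriv (dXi j) (dirDeriv (dX j) P)) :=
    fun j => contDiff_const.smul (dirDeriv_smooth _ (dirDeriv_smooth _ hP))
  have := AmpEst.sum hs hj
  rwa [Fintype.card_fin] at this

/-- The estimates for the restriction of an amplitude to `x = ξ = 0`. -/
theorem AmpEst.restrict {n : ℕ} {m d K Λ : ℝ} {P : Amp q → W} (hP : ContDiff ℝ ∞ P)
    (h : AmpEst Θ ϱ δ m₂ k n m d K Λ P) {K' : ℝ} (hK : K + n ≤ K') :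
    SymEst Θ ϱ δ m₂ n (m + d) (4 ^ K' * Λ) (fun θ => P (θ, 0)) := by
  have base : ∀ {m d K : ℝ} {P : Amp q → W} {n : ℕ}, K ≤ K' → AmpEst Θ ϱ δ m₂ k n m d K Λ P →
      ∀ y η, ‖Θ.act η (P ((y, η), 0))‖ ≤ (4 ^ K' * Λ) * (jap y ^ m₂ * jap η ^ (m + d)) :=
    fun {m d K P n} hK h y η => by
      refine (h.base y η 0 0).trans ?_
      have h0 := h.nonneg
      have h1 := jap_rpow_pos y m₂
      have h3 := jap_rpow_pos η m
      have h4 := jap_rpow_pos η d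
      have hr : rho η (0 : Rq q) = 4 := rho_of_le (by
        rw [norm_zero]; linarith [jap_pos η])
      have h5 : (4 : ℝ) ^ K ≤ 4 ^ K' := Real.rpow_le_rpow_of_exponent_le (by norm_num) hK
      unfold ampW
      rw [hr, jap_zero, Real.one_rpow, norm_zero, add_zero, jap_rpow_add]
      calc _ = 4 ^ K * (Λ * (jap y ^ m₂ * (jap η ^ m * jap η ^ d))) := by ring
        _ ≤ 4 ^ K' * (Λ * (jap y ^ m₂ * (jap η ^ m * jap η ^ d))) := by gcongr
        _ = _ := by ring
  induction n generalizing m d K P with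
  | zero => exact base (by simpa using hK) h
  | succ n ih =>
    push_cast at hK
    refine ⟨base (by linarith [(Nat.cast_nonneg n : (0 : ℝ) ≤ n)]) h, fun l => ?_⟩
    rw [dirDeriv_slice l hP 0]
    have h1 := h.2 (Sum.inl l)
    have hc : K + cntH (flat (Sum.inl l)) + n ≤ K' := by
      have : cntH l ≤ 1 := by rcases l with l | l <;> simp [cntH]
      simp only [flat, Sum.elim_inl, id_eq]
      linarith
    have := ih (dirDeriv_smooth _ hP) h1 hc
    refine this.mono (le_of_eq ?_) le_rfl
    rcases l with l | l <;> simp [flat, ordH, ordY, ordS] <;> ring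

/-! Qualitative consequences. -/

/-- Smooth amplitudes satisfying the estimates of all orders. -/
def AmpClass (Θ : Twist q W) (ϱ δ m₂ k m d K : ℝ) (P : Amp q → W) : Prop :=
  ContDiff ℝ ∞ P ∧ ∀ n, ∃ Λ, AmpEst Θ ϱ δ m₂ k n m d K Λ P

theorem AmpClass.deriv {m d K : ℝ} {P : Amp q → W} (h : AmpClass Θ ϱ δ m₂ k m d K P)
    (l : ADir q) : AmpClass Θ ϱ δ m₂ k (m + ordH ϱ (flat l)) (d + ordY δ (flat l))
      (K + cntH (flat l)) (dirDeriv (avec l) P) :=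
  ⟨dirDeriv_smooth _ h.1, fun n => (h.2 (n + 1)).imp fun _ h => h.2 l⟩

theorem AmpClass.word (hδ : 0 ≤ δ) {m d K : ℝ} (hd : 0 ≤ d) (hK : 0 ≤ K) {P : Amp q → W}
    (h : AmpClass Θ ϱ δ m₂ k m d K P) (v : List (ADir q)) :
    ∃ m' d' K' : ℝ, 0 ≤ d' ∧ 0 ≤ K' ∧ AmpClass Θ ϱ δ m₂ k m' d' K' (wd v P) := by
  induction v with
  | nil => exact ⟨m, d, K, hd, hK, h⟩
  | cons l v ih =>
    obtain ⟨m', d', K', hd', hK', h'⟩ := ih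
    refine ⟨_, _, _, ?_, ?_, h'.deriv l⟩
    · refine add_nonneg hd' ?_
      rcases flat l with j | j <;> simp [ordY, hδ]
    · refine add_nonneg hK' ?_
      rcases flat l with j | j <;> simp [cntH]

theorem AmpEst.iterate_dX {m d K Λ : ℝ} {P : Amp q → W} (j : Fin q) (i : ℕ)
    (h : AmpEst Θ ϱ δ m₂ k i m d K Λ P) :
    AmpEst Θ ϱ δ m₂ k 0 m (d + δ * i) K Λ ((dirDeriv (dX j))^[i] P) := by
  induction i generalizing d P with
  | zero => simpa using h
  | succ i ih =>
    have := h.2 (Sum.inr (Sum.inl j))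
    simp only [flat, ordH, ordY, cntH, Sum.elim_inr, Sum.elim_inl, id_eq, add_zero] at this
    have := ih this
    rw [Function.iterate_succ_apply]
    refine this.mono le_rfl (le_of_eq ?_) le_rfl le_rfl
    push_cast; ring

theorem jap_rpow_le_pow {y : Rq q} {T : ℝ} (hT : ‖y‖ ≤ T) {s : ℝ} {N : ℕ} (hs : s ≤ N) :
    jap y ^ s ≤ (1 + T) ^ N := by
  refine (jap_rpow_le_rpow y hs).trans ?_
  rw [Real.rpow_natCast]
  exact pow_le_pow_left₀ (jap_pos y).le ((jap_le_one_add y).trans (by linarith)) N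

/-- Comparison of the twist at `η` with the trivial one at `0` passes to the norm of `W` at the
price `⟨η⟩^κ`, which is part of the polynomial growth permitted in the parameters. -/
theorem AmpEst.polyBound {n : ℕ} {m d K Λ : ℝ} (hd : 0 ≤ d) (hK : 0 ≤ K) {P : Amp q → W}
    (h : AmpEst Θ ϱ δ m₂ k n m d K Λ P) : PolyBound k (d + K) P := by
  obtain ⟨N₁, hN₁⟩ := exists_nat_ge m₂
  obtain ⟨N₂, hN₂⟩ := exists_nat_ge (Θ.κ + m + d)
  have h0 := h.nonneg
  have hc := Θ.c_nonneg
  refine ⟨Θ.c * Λ * (2 ^ d * 4 ^ K), by positivity, N₁ + N₂, fun θ x ξ => ?_⟩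
  obtain ⟨y, η⟩ := θ
  have e1 : ‖P ((y, η), (x, ξ))‖ ≤ Θ.c * jap η ^ Θ.κ * ‖Θ.act η (P ((y, η), (x, ξ)))‖ := by
    have := Θ.le 0 η (jap η) (one_le_jap η) (by
      rw [jap_zero]; nlinarith [one_le_jap η]) (by rw [jap_zero, one_mul]) (P ((y, η), (x, ξ)))
    rwa [Θ.act_zero] at this
  have hy : ‖y‖ ≤ ‖(y, η)‖ := by rw [Prod.norm_mk]; exact le_max_left _ _
  have hη : ‖η‖ ≤ ‖(y, η)‖ := by rw [Prod.norm_mk]; exact le_max_right _ _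
  have f1 := jap_rpow_le_pow hy hN₁
  have f2 := jap_rpow_le_pow hη hN₂
  have f3 : (jap η + ‖ξ‖) ^ d ≤ 2 ^ d * jap η ^ d * jap ξ ^ d := by
    rw [← Real.mul_rpow (by norm_num) (jap_pos η).le,
      ← Real.mul_rpow (by linarith [jap_pos η]) (jap_pos ξ).le]
    refine Real.rpow_le_rpow (jap_add_norm_pos η ξ).le ?_ hd
    nlinarith [one_le_jap η, one_le_jap ξ, norm_le_jap ξ]
  have f4 : rho η ξ ^ K ≤ 4 ^ K * jap ξ ^ K := by
    rw [← Real.mul_rpow (by norm_num) (jap_pos ξ).le]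
    exact Real.rpow_le_rpow (rho_pos η ξ).le (rho_le η ξ) hK
  have p1 := (jap_rpow_pos y m₂).le
  have p2 := (jap_rpow_pos x k).le
  have p3 := (jap_rpow_pos η m).le
  have p4 := (jap_rpow_pos η Θ.κ).le
  have p5 := (jap_rpow_pos η d).le
  have p6 := (jap_rpow_pos ξ d).le
  have p7 := (jap_rpow_pos ξ K).le
  have p8 := Real.rpow_nonneg (jap_add_norm_pos η ξ).le d
  have p9 := Real.rpow_nonneg (rho_pos η ξ).le K
  calc ‖P ((y, η), (x, ξ))‖ ≤ Θ.c * jap η ^ Θ.κ * (Λ * ampW m₂ k m d K y η x ξ) :=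
        e1.trans (mul_le_mul_of_nonneg_left (h.base y η x ξ) (by positivity))
    _ ≤ Θ.c * jap η ^ Θ.κ * (Λ * (jap y ^ m₂ * jap x ^ k * (jap η ^ m *
        (2 ^ d * jap η ^ d * jap ξ ^ d) * (4 ^ K * jap ξ ^ K)))) := by
        unfold ampW
        gcongr
    _ = Θ.c * Λ * (2 ^ d * 4 ^ K) * (jap y ^ m₂ * (jap η ^ (Θ.κ + m + d))) *
        (jap x ^ k * jap ξ ^ (d + K)) := by
        rw [jap_rpow_add, jap_rpow_add, jap_rpow_add]; ring
    _ ≤ _ := by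
        rw [pow_add]
        have := (jap_rpow_pos η (Θ.κ + m + d)).le
        have := (jap_rpow_pos ξ (d + K)).le
        gcongr

/-- The exponent of `⟨ξ⟩` is at most `d' + K'`, and an `x`-derivative raises `d'` by `δ`, which is
precisely the growth that tameness admits. -/
theorem AmpClass.tame (hδ : 0 ≤ δ) {m d K : ℝ} (hd : 0 ≤ d) (hK : 0 ≤ K) {P : Amp q → W}
    (h : AmpClass Θ ϱ δ m₂ k m d K P) : Tame δ k P := by
  refine ⟨h.1, fun v => ?_⟩
  obtain ⟨m', d', K', hd', hK', h'⟩ := h.word hδ hd hK v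
  refine ⟨d' + K', add_nonneg hd' hK', ?_, fun i j => ?_⟩
  · obtain ⟨Λ, hΛ⟩ := h'.2 0
    exact hΛ.polyBound hd' hK'
  · obtain ⟨Λ, hΛ⟩ := h'.2 i
    have := (hΛ.iterate_dX j i).polyBound (by positivity) hK'
    rwa [show d' + δ * i + K' = d' + K' + δ * i by ring] at this

end Estimates



/-! ### Amplitudes of compositions -/

section Products

variable {q : ℕ} {W₁ W₂ W₃ : Type*} [NormedAddCommGroup W₁] [NormedSpace ℂ W₁]
  [NormedAddCommGroup W₂] [NormedSpace ℂ W₂] [NormedAddCommGroup W₃] [NormedSpace ℂ W₃]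

/-- The amplitude `a(y + s x, η + ξ) b(y + x, η)`. -/
def prodAmp (s : ℝ) (B : W₁ →L[ℂ] W₂ →L[ℂ] W₃) (a : Rq q × Rq q → W₁) (b : Rq q × Rq q → W₂) :
    Amp q → W₃ :=
  fun z => B (a (z.1.1 + s • z.2.1, z.1.2 + z.2.2)) (b (z.1.1 + z.2.1, z.1.2))

/-- The linear map `((y, η), (x, ξ)) ↦ (y + s x, η + ξ)`. -/
def leftMap (q : ℕ) (s : ℝ) : Amp q →L[ℝ] Rq q × Rq q :=
  let p := ContinuousLinearMap.fst ℝ (Rq q × Rq q) (Rq q × Rq q)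
  let r := ContinuousLinearMap.snd ℝ (Rq q × Rq q) (Rq q × Rq q)
  let f := ContinuousLinearMap.fst ℝ (Rq q) (Rq q)
  let g := ContinuousLinearMap.snd ℝ (Rq q) (Rq q)
  (f.comp p + s • f.comp r).prod (g.comp p + g.comp r)

/-- The linear map `((y, η), (x, ξ)) ↦ (y + x, η)`. -/
def rightMap (q : ℕ) : Amp q →L[ℝ] Rq q × Rq q :=
  let p := ContinuousLinearMap.fst ℝ (Rq q × Rq q) (Rq q × Rq q)
  let r := ContinuousLinearMap.snd ℝ (Rq q × Rq q) (Rq q × Rq q)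
  let f := ContinuousLinearMap.fst ℝ (Rq q) (Rq q)
  let g := ContinuousLinearMap.snd ℝ (Rq q) (Rq q)
  (f.comp p + f.comp r).prod (g.comp p)

theorem prodAmp_eq (s : ℝ) (B : W₁ →L[ℂ] W₂ →L[ℂ] W₃) (a : Rq q × Rq q → W₁)
    (b : Rq q × Rq q → W₂) :
    prodAmp s B a b = fun z => B.bilinearRestrictScalars ℝ (a (leftMap q s z)) (b (rightMap q z)) :=
  rfl

theorem prodAmp_apply (s : ℝ) (B : W₁ →L[ℂ] W₂ →L[ℂ] W₃) (a : Rq q × Rq q → W₁)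
    (b : Rq q × Rq q → W₂) (y η x ξ : Rq q) :
    prodAmp s B a b ((y, η), (x, ξ)) = B (a (y + s • x, η + ξ)) (b (y + x, η)) := rfl

/-- The coefficients of the derivatives of the left factor. -/
def coefL (s : ℝ) : ADir q → ℝ := Sum.elim (fun _ => 1) (Sum.elim (fun _ => s) (fun _ => 1))

/-- The coefficients of the derivatives of the right factor. -/
def coefR : ADir q → ℝ := Sum.elim (fun _ => 1) (Sum.elim (fun _ => 1) (fun _ => 0))

theorem leftMap_avec (s : ℝ) (l : ADir q) : leftMap q s (avec l) = coefL s l • svec (flat l) := by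
  rcases l with (l | l) | (l | l) <;> simp [leftMap, avec, svec, coefL, flat]

theorem rightMap_avec (l : ADir q) : rightMap q (avec l) = coefR l • svec (flat l) := by
  rcases l with (l | l) | (l | l) <;> simp [rightMap, avec, svec, coefR, flat]

variable {s : ℝ} {B : W₁ →L[ℂ] W₂ →L[ℂ] W₃} {a : Rq q × Rq q → W₁} {b : Rq q × Rq q → W₂}

theorem prodAmp_smooth (ha : ContDiff ℝ ∞ a) (hb : ContDiff ℝ ∞ b) :
    ContDiff ℝ ∞ (prodAmp s B a b) := by
  rw [prodAmp_eq]
  exact ((B.bilinearRestrictScalars ℝ).contDiff.comp (ha.comp (leftMap q s).contDiff)).clm_apply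
    (hb.comp (rightMap q).contDiff)

theorem dirDeriv_prodAmp (ha : ContDiff ℝ ∞ a) (hb : ContDiff ℝ ∞ b) (l : ADir q) :
    dirDeriv (avec l) (prodAmp s B a b) =
      (coefL s l : ℂ) • prodAmp s B (dirDeriv (svec (flat l)) a) b +
      (coefR l : ℂ) • prodAmp s B a (dirDeriv (svec (flat l)) b) := by
  have h := dirDeriv_bilin (B.bilinearRestrictScalars ℝ) (avec l)
    (ha.comp (leftMap q s).contDiff) (hb.comp (rightMap q).contDiff)
  have e1 := dirDeriv_comp_linear (leftMap q s) (avec l) ha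
  have e2 := dirDeriv_comp_linear (rightMap q) (avec l) hb
  rw [leftMap_avec, dirDeriv_smul_vec] at e1
  rw [rightMap_avec, dirDeriv_smul_vec] at e2
  simp only [Function.comp_def] at h
  rw [e1, e2] at h
  rw [prodAmp_eq, h]
  funext z
  simp [prodAmp]
  rfl

theorem prodAmp_add_left (a' : Rq q × Rq q → W₁) :
    prodAmp s B (a + a') b = prodAmp s B a b + prodAmp s B a' b := by
  funext z; simp [prodAmp]

theorem prodAmp_smul_left (c : ℂ) : prodAmp s B (c • a) b = c • prodAmp s B a b := by
  funext z; simp [prodAmp]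

theorem prodAmp_add_right (b' : Rq q × Rq q → W₂) :
    prodAmp s B a (b + b') = prodAmp s B a b + prodAmp s B a b' := by
  funext z; simp [prodAmp]

theorem prodAmp_smul_right (c : ℂ) : prodAmp s B a (c • b) = c • prodAmp s B a b := by
  funext z; simp [prodAmp]

/-- The operator `∏_{j ∈ L} (1 + ∂_{η_j})` for symbols. -/
def regS (L : List (Fin q)) (a : Rq q × Rq q → W₁) : Rq q × Rq q → W₁ :=
  L.foldr (fun j a => a + dirDeriv (svec (Sum.inr j)) a) a

theorem regS_smooth (L : List (Fin q)) (ha : ContDiff ℝ ∞ a) : ContDiff ℝ ∞ (regS L a) := by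
  induction L with
  | nil => exact ha
  | cons j L ih => exact ih.add (dirDeriv_smooth _ ih)

/-- The right factor `b(y + x, η)` does not contain `ξ`, so the regularization acts on the left
symbol alone. -/
theorem reg_prodAmp (L : List (Fin q)) (ha : ContDiff ℝ ∞ a) (hb : ContDiff ℝ ∞ b) :
    reg L (prodAmp s B a b) = prodAmp s B (regS L a) b := by
  induction L with
  | nil => rfl
  | cons j L ih =>
    have e : regS (j :: L) a = regS L a + dirDeriv (svec (Sum.inr j)) (regS L a) := rfl
    rw [reg_cons, ih, dXi, dirDeriv_prodAmp (regS_smooth L ha) hb, e, prodAmp_add_left]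
    simp [coefL, coefR, flat]

/-- The bilinear map is bounded with respect to the twisted norms. -/
def Compat (Θ₁ : Twist q W₁) (Θ₂ : Twist q W₂) (Θ₃ : Twist q W₃) (B : W₁ →L[ℂ] W₂ →L[ℂ] W₃)
    (C : ℝ) : Prop :=
  0 ≤ C ∧ ∀ η w v, ‖Θ₃.act η (B w v)‖ ≤ C * ‖Θ₁.act η w‖ * ‖Θ₂.act η v‖

theorem compat_triv (B : W₁ →L[ℂ] W₂ →L[ℂ] W₃) :
    Compat (Twist.triv q W₁) (Twist.triv q W₂) (Twist.triv q W₃) B ‖B‖ :=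
  ⟨norm_nonneg B, fun _ w v => B.le_opNorm₂ w v⟩

variable {Θ₁ : Twist q W₁} {Θ₂ : Twist q W₂} {Θ₃ : Twist q W₃} {ϱ δ p₁ p₂ m₂ k CB D : ℝ}

/-- The left factor is evaluated at `η + ξ`. Moving its twist there costs `rho ^ κ`, replacing `⟨η +
ξ⟩^{m₁}` by `⟨η⟩^{m₁}` costs `rho ^ |m₁|`; hence the condition on `K`. The parts `d₁`, `d₂` of the
orders, which collect the losses from `y`-derivatives, are kept as powers of `⟨η⟩ + |ξ|`. -/
theorem prodAmp_base (hB : Compat Θ₁ Θ₂ Θ₃ B CB)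
    (hw : ∀ y x : Rq q, jap (y + s • x) ^ p₁ * jap (y + x) ^ p₂ ≤ D * (jap y ^ m₂ * jap x ^ k))
    {n : ℕ} {m₁ d₁ mb d₂ K Λ₁ Λ₂ : ℝ} (hK : |m₁| + Θ₁.κ ≤ K) (hd₁ : 0 ≤ d₁) (hd₂ : 0 ≤ d₂)
    (h₁ : SymEst Θ₁ ϱ δ p₁ n (m₁ + d₁) Λ₁ a) (h₂ : SymEst Θ₂ ϱ δ p₂ n (mb + d₂) Λ₂ b)
    (y η x ξ : Rq q) :
    ‖Θ₃.act η (prodAmp s B a b ((y, η), (x, ξ)))‖ ≤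
      (CB * Θ₁.c * D * (Λ₁ * Λ₂)) * ampW m₂ k (m₁ + mb) (d₁ + d₂) K y η x ξ := by
  have hr := one_le_rho η ξ
  have hr0 := rho_pos η ξ
  have hCB := hB.1
  have hc := Θ₁.c_nonneg
  have hΛ₁ := h₁.nonneg
  have hΛ₂ := h₂.nonneg
  have e1 := Θ₁.le η (η + ξ) (rho η ξ) hr (jap_le_rho η ξ) (jap_add_le_rho η ξ)
    (a (y + s • x, η + ξ))
  have e2 := h₁.base (y + s • x) (η + ξ)
  have e3 := h₂.base (y + x) η
  have f1 : jap (η + ξ) ^ (m₁ + d₁) ≤ (jap η ^ m₁ * rho η ξ ^ |m₁|) * (jap η + ‖ξ‖) ^ d₁ := by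
    rw [jap_rpow_add]
    have g1 := rpow_le_of_comparable (jap_pos (η + ξ)) (jap_pos η) hr (jap_add_le_rho η ξ)
      (jap_le_rho η ξ) (le_refl |m₁|)
    have g2 : jap (η + ξ) ^ d₁ ≤ (jap η + ‖ξ‖) ^ d₁ :=
      Real.rpow_le_rpow (jap_pos _).le (jap_add_le η ξ) hd₁
    have g3 := (jap_rpow_pos η m₁).le
    have g4 := Real.rpow_nonneg hr0.le |m₁|
    have g5 := (jap_rpow_pos (η + ξ) d₁).le
    gcongr
  have f2 : jap η ^ (mb + d₂) ≤ jap η ^ mb * (jap η + ‖ξ‖) ^ d₂ := by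
    rw [jap_rpow_add]
    have g2 : jap η ^ d₂ ≤ (jap η + ‖ξ‖) ^ d₂ :=
      Real.rpow_le_rpow (jap_pos _).le (by linarith [norm_nonneg ξ]) hd₂
    have g3 := (jap_rpow_pos η mb).le
    gcongr
  have f3 : rho η ξ ^ Θ₁.κ * rho η ξ ^ |m₁| ≤ rho η ξ ^ K := by
    rw [← Real.rpow_add hr0]
    exact Real.rpow_le_rpow_of_exponent_le hr (by linarith)
  have f4 := hw y x
  have q1 := (jap_rpow_pos (y + s • x) p₁).le
  have q2 := (jap_rpow_pos (y + x) p₂).le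
  have q3 := (jap_rpow_pos η m₁).le
  have q4 := (jap_rpow_pos η mb).le
  have q5 := Real.rpow_nonneg hr0.le |m₁|
  have q6 := Real.rpow_nonneg hr0.le Θ₁.κ
  have q7 := Real.rpow_nonneg (jap_add_norm_pos η ξ).le d₁
  have q8 := Real.rpow_nonneg (jap_add_norm_pos η ξ).le d₂
  have q9 := (jap_rpow_pos (η + ξ) (m₁ + d₁)).le
  have q10 := (jap_rpow_pos η (mb + d₂)).le
  have q11 : 0 ≤ D * (jap y ^ m₂ * jap x ^ k) := le_trans (by positivity) f4
  rw [prodAmp_apply]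
  calc _ ≤ CB * ‖Θ₁.act η (a (y + s • x, η + ξ))‖ * ‖Θ₂.act η (b (y + x, η))‖ := hB.2 _ _ _
    _ ≤ CB * (Θ₁.c * rho η ξ ^ Θ₁.κ * (Λ₁ * (jap (y + s • x) ^ p₁ *
          ((jap η ^ m₁ * rho η ξ ^ |m₁|) * (jap η + ‖ξ‖) ^ d₁)))) *
        (Λ₂ * (jap (y + x) ^ p₂ * (jap η ^ mb * (jap η + ‖ξ‖) ^ d₂))) := by
      gcongr
      · refine e1.trans (mul_le_mul_of_nonneg_left (e2.trans ?_) (by positivity))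
        gcongr
      · refine e3.trans ?_
        gcongr
    _ = CB * Θ₁.c * (Λ₁ * Λ₂) * (jap (y + s • x) ^ p₁ * jap (y + x) ^ p₂) *
        (jap η ^ m₁ * jap η ^ mb * ((jap η + ‖ξ‖) ^ d₁ * (jap η + ‖ξ‖) ^ d₂) *
          (rho η ξ ^ Θ₁.κ * rho η ξ ^ |m₁|)) := by ring
    _ ≤ CB * Θ₁.c * (Λ₁ * Λ₂) * (D * (jap y ^ m₂ * jap x ^ k)) *
        (jap η ^ m₁ * jap η ^ mb * ((jap η + ‖ξ‖) ^ d₁ * (jap η + ‖ξ‖) ^ d₂) * rho η ξ ^ K) := by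
      gcongr
    _ = _ := by
      unfold ampW
      rw [jap_rpow_add, Real.rpow_add (jap_add_norm_pos η ξ)]
      ring

/-- The product of two symbols satisfies the amplitude estimates. -/
theorem prodAmp_est (hϱ : |ϱ| ≤ 1) (hδ : 0 ≤ δ) (hB : Compat Θ₁ Θ₂ Θ₃ B CB)
    (hw : ∀ y x : Rq q, jap (y + s • x) ^ p₁ * jap (y + x) ^ p₂ ≤ D * (jap y ^ m₂ * jap x ^ k))
    {T : ℝ} (hT : |s| ≤ T) (n : ℕ) {m₁ d₁ mb d₂ K Λ₁ Λ₂ : ℝ} (hK : |m₁| + Θ₁.κ ≤ K)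
    (hd₁ : 0 ≤ d₁) (hd₂ : 0 ≤ d₂) (ha : ContDiff ℝ ∞ a) (hb : ContDiff ℝ ∞ b)
    (h₁ : SymEst Θ₁ ϱ δ p₁ n (m₁ + d₁) Λ₁ a) (h₂ : SymEst Θ₂ ϱ δ p₂ n (mb + d₂) Λ₂ b) :
    AmpEst Θ₃ ϱ δ m₂ k n (m₁ + mb) (d₁ + d₂) K ((2 + T) ^ n * (CB * Θ₁.c * D * (Λ₁ * Λ₂)))
      (prodAmp s B a b) := by
  have hT0 : 0 ≤ T := (abs_nonneg s).trans hT
  have hD : 0 ≤ D := by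
    have := hw 0 0
    simp only [smul_zero, add_zero, jap_zero, Real.one_rpow, mul_one] at this
    linarith
  have hCB := hB.1
  have hc := Θ₁.c_nonneg
  have base : ∀ {n : ℕ} {m₁ d₁ mb d₂ K : ℝ} {a : Rq q × Rq q → W₁} {b : Rq q × Rq q → W₂},
      |m₁| + Θ₁.κ ≤ K → 0 ≤ d₁ → 0 ≤ d₂ → SymEst Θ₁ ϱ δ p₁ n (m₁ + d₁) Λ₁ a →
      SymEst Θ₂ ϱ δ p₂ n (mb + d₂) Λ₂ b → ∀ y η x ξ,
      ‖Θ₃.act η (prodAmp s B a b ((y, η), (x, ξ)))‖ ≤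
        ((2 + T) ^ n * (CB * Θ₁.c * D * (Λ₁ * Λ₂))) *
          ampW m₂ k (m₁ + mb) (d₁ + d₂) K y η x ξ := by
    intro n m₁ d₁ mb d₂ K a b hK hd₁ hd₂ h₁ h₂ y η x ξ
    have hΛ₁ := h₁.nonneg
    have hΛ₂ := h₂.nonneg
    exact (prodAmp_base hB hw hK hd₁ hd₂ h₁ h₂ y η x ξ).trans (mul_le_mul_of_nonneg_right
      (le_mul_of_one_le_left (by positivity) (one_le_pow₀ (by linarith))) (ampW_pos _ _ _ _ _ _ _ _ _).le)
  induction n generalizing m₁ d₁ mb d₂ K a b with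
  | zero => exact base hK hd₁ hd₂ h₁ h₂
  | succ n ih =>
    refine ⟨base hK hd₁ hd₂ h₁ h₂, fun l => ?_⟩
    rw [dirDeriv_prodAmp ha hb]
    have g1 := h₁.2 (flat l)
    have g2 := h₂.2 (flat l)
    have k1 := h₁.of_le (Nat.le_succ n)
    have k2 := h₂.of_le (Nat.le_succ n)
    have sa := dirDeriv_smooth (svec (flat l)) ha
    have sb := dirDeriv_smooth (svec (flat l)) hb
    have hϱ' := abs_le.1 hϱ
    have hL : AmpEst Θ₃ ϱ δ m₂ k n (m₁ + mb + ordH ϱ (flat l)) (d₁ + d₂ + ordY δ (flat l))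
        (K + cntH (flat l)) ((2 + T) ^ n * (CB * Θ₁.c * D * (Λ₁ * Λ₂)))
        (prodAmp s B (dirDeriv (svec (flat l)) a) b) := by
      have key := ih (m₁ := m₁ + ordH ϱ (flat l)) (d₁ := d₁ + ordY δ (flat l)) (mb := mb)
        (d₂ := d₂) (K := K + cntH (flat l)) (a := dirDeriv (svec (flat l)) a) (b := b)
        ?_ ?_ hd₂ sa hb ?_ k2
      · refine key.mono (le_of_eq (by ring)) (le_of_eq (by ring)) le_rfl le_rfl
      · rcases flat l with j | j
        · simpa [ordH, cntH] using hK
        · simp only [ordH, cntH, Sum.elim_inr]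
          -- An `η`-derivative replaces `m₁` by `m₁ - ϱ`; since `|ϱ| ≤ 1`, the required exponent of
          -- `rho` grows at most by the `1` which `cntH` provides.
          have := abs_add_le m₁ (-ϱ)
          rw [abs_neg] at this
          linarith
      · rcases flat l with j | j <;> simp [ordY] <;> linarith
      · refine g1.mono (le_of_eq ?_) le_rfl
        rcases flat l with j | j <;> simp [ordH, ordY, ordS] <;> ring
    have hR : AmpEst Θ₃ ϱ δ m₂ k n (m₁ + mb + ordH ϱ (flat l)) (d₁ + d₂ + ordY δ (flat l))
        (K + cntH (flat l)) ((2 + T) ^ n * (CB * Θ₁.c * D * (Λ₁ * Λ₂)))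
        (prodAmp s B a (dirDeriv (svec (flat l)) b)) := by
      have key := ih (m₁ := m₁) (d₁ := d₁) (mb := mb + ordH ϱ (flat l))
        (d₂ := d₂ + ordY δ (flat l)) (K := K + cntH (flat l)) (a := a)
        (b := dirDeriv (svec (flat l)) b)
        ?_ hd₁ ?_ ha sb k1 ?_
      · refine key.mono (le_of_eq (by ring)) (le_of_eq (by ring)) le_rfl le_rfl
      · rcases flat l with j | j
        · simpa [cntH] using hK
        · simp only [cntH, Sum.elim_inr]
          linarith
      · rcases flat l with j | j <;> simp [ordY] <;> linarith
      · refine g2.mono (le_of_eq ?_) le_rfl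
        rcases flat l with j | j <;> simp [ordH, ordY, ordS] <;> ring
    have cL : ‖(coefL s l : ℂ)‖ ≤ 1 + T := by
      rw [Complex.norm_real, Real.norm_eq_abs]
      rcases l with l | l | l <;> simp [coefL] <;> linarith
    have cR : ‖(coefR l : ℂ)‖ ≤ 1 := by
      rw [Complex.norm_real, Real.norm_eq_abs]
      rcases l with l | l | l <;> simp [coefR]
    have sL := prodAmp_smooth (s := s) (B := B) sa hb
    have sR := prodAmp_smooth (s := s) (B := B) ha sb
    refine ((hL.smul sL _).add (contDiff_const.smul sL) (contDiff_const.smul sR)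
      (hR.smul sR _)).mono le_rfl le_rfl le_rfl ?_
    have h0 := hL.nonneg
    -- The factor `2 + T` per derivative is the sum of the bounds `1 + T` and `1` for the
    -- coefficients of the two terms of the product rule.
    have : (2 + T) ^ (n + 1) * (CB * Θ₁.c * D * (Λ₁ * Λ₂)) =
        (1 + T) * ((2 + T) ^ n * (CB * Θ₁.c * D * (Λ₁ * Λ₂))) +
        1 * ((2 + T) ^ n * (CB * Θ₁.c * D * (Λ₁ * Λ₂))) := by ring
    rw [this]
    gcongr

/-- Smooth symbols satisfying the estimates of all orders. -/
def SymClass (Θ : Twist q W₁) (ϱ δ m₂ m : ℝ) (a : Rq q × Rq q → W₁) : Prop :=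
  ContDiff ℝ ∞ a ∧ ∀ n, ∃ Λ, SymEst Θ ϱ δ m₂ n m Λ a

theorem SymClass.prodAmp {m₁ mb : ℝ} (ha : SymClass Θ₁ ϱ δ p₁ m₁ a) (hb : SymClass Θ₂ ϱ δ p₂ mb b)
    (hϱ : |ϱ| ≤ 1) (hδ : 0 ≤ δ) (hB : Compat Θ₁ Θ₂ Θ₃ B CB)
    (hw : ∀ y x : Rq q, jap (y + s • x) ^ p₁ * jap (y + x) ^ p₂ ≤ D * (jap y ^ m₂ * jap x ^ k)) :
    AmpClass Θ₃ ϱ δ m₂ k (m₁ + mb) 0 (|m₁| + Θ₁.κ) (prodAmp s B a b) := by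
  refine ⟨prodAmp_smooth ha.1 hb.1, fun n => ?_⟩
  obtain ⟨Λ₁, h₁⟩ := ha.2 n
  obtain ⟨Λ₂, h₂⟩ := hb.2 n
  have := prodAmp_est hϱ hδ hB hw le_rfl n le_rfl (d₁ := 0) (d₂ := 0) le_rfl le_rfl ha.1 hb.1
    (by rwa [add_zero]) (by rwa [add_zero]) (m₁ := m₁) (mb := mb) (Λ₁ := Λ₁) (Λ₂ := Λ₂)
  rw [add_zero] at this
  exact ⟨_, this⟩

theorem SymClass.tame_prodAmp {m₁ mb : ℝ} (ha : SymClass Θ₁ ϱ δ p₁ m₁ a)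
    (hb : SymClass Θ₂ ϱ δ p₂ mb b)
    (hϱ : |ϱ| ≤ 1) (hδ : 0 ≤ δ) (hB : Compat Θ₁ Θ₂ Θ₃ B CB)
    (hw : ∀ y x : Rq q, jap (y + s • x) ^ p₁ * jap (y + x) ^ p₂ ≤ D * (jap y ^ m₂ * jap x ^ k)) :
    Tame δ k (EdgeCalculus.prodAmp s B a b) :=
  (ha.prodAmp hb hϱ hδ hB hw).tame hδ le_rfl (add_nonneg (abs_nonneg _) Θ₁.κ_nonneg)

/-! Weights in `y`. -/

theorem jap_add_smul_rpow_le (y x : Rq q) {s T : ℝ} (hs : |s| ≤ T) (p : ℝ) :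
    jap (y + s • x) ^ p ≤ (2 * (1 + T)) ^ |p| * (jap y ^ p * jap x ^ |p|) := by
  have h1 := jap_add_rpow_le y (s • x) (le_refl |p|)
  have h2 := jap_smul_rpow_le s x (abs_nonneg p)
  have h3 := (jap_rpow_pos y p).le
  have h4 := (jap_rpow_pos x |p|).le
  have hT : 0 ≤ T := (abs_nonneg s).trans hs
  rw [Real.mul_rpow (by norm_num) (jap_pos _).le] at h1
  rw [Real.mul_rpow (by norm_num) (by linarith)]
  calc jap (y + s • x) ^ p ≤ jap y ^ p * (2 ^ |p| * ((1 + |s|) ^ |p| * jap x ^ |p|)) :=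
        h1.trans (by gcongr)
    _ ≤ jap y ^ p * (2 ^ |p| * ((1 + T) ^ |p| * jap x ^ |p|)) := by gcongr
    _ = _ := by ring

theorem weights_le (p₁ p₂ : ℝ) {s T : ℝ} (hs : |s| ≤ T) (y x : Rq q) :
    jap (y + s • x) ^ p₁ * jap (y + x) ^ p₂ ≤
      ((2 * (1 + T)) ^ |p₁| * 4 ^ |p₂|) * (jap y ^ (p₁ + p₂) * jap x ^ (|p₁| + |p₂|)) := by
  have h1 := jap_add_smul_rpow_le y x hs p₁
  have h2 := jap_add_smul_rpow_le y x (s := 1) (T := 1) (by simp) p₂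
  rw [one_smul, show (2 : ℝ) * (1 + 1) = 4 by norm_num] at h2
  have hT : 0 ≤ T := (abs_nonneg s).trans hs
  have q1 := (jap_rpow_pos y p₁).le
  have q2 := (jap_rpow_pos x |p₁|).le
  refine (mul_le_mul h1 h2 (jap_rpow_pos _ _).le (by positivity)).trans (le_of_eq ?_)
  rw [jap_rpow_add, jap_rpow_add]
  ring

/-- Decay of the right factor in `y + x` is converted by Peetre's inequality into decay in `x`.
Therefore the amplitude of an operator applied to a Schwartz function needs no regularization. -/
theorem weights_decay_le (p N : ℝ) (hN : 0 ≤ N) (s : ℝ) (y x : Rq q) :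
    jap (y + s • x) ^ p * jap (y + x) ^ (-N) ≤
      ((2 * (1 + |s|)) ^ |p| * 2 ^ N) * (jap y ^ (p + N) * jap x ^ (|p| - N)) := by
  have h1 := jap_add_smul_rpow_le y x (le_refl |s|) p
  have h2 := jap_add_rpow_le x y (s := -N) (k := N) (by rw [abs_neg, abs_of_nonneg hN])
  rw [add_comm x y, Real.mul_rpow (by norm_num) (jap_pos _).le] at h2
  have q1 := (jap_rpow_pos y p).le
  have q2 := (jap_rpow_pos x |p|).le
  refine (mul_le_mul h1 h2 (jap_rpow_pos _ _).le (by positivity)).trans (le_of_eq ?_)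
  rw [jap_rpow_add, sub_eq_add_neg, jap_rpow_add]
  ring

end Products



/-! ### Operators with smooth symbols -/

section Quantization

open scoped FourierTransform

variable {q : ℕ} {W W₁ W₂ W₃ U V F : Type*} [NormedAddCommGroup W] [NormedSpace ℂ W]
  [NormedAddCommGroup W₁] [NormedSpace ℂ W₁] [NormedAddCommGroup W₂] [NormedSpace ℂ W₂]
  [NormedAddCommGroup W₃] [NormedSpace ℂ W₃] [NormedAddCommGroup U] [NormedSpace ℂ U]
  [NormedAddCommGroup V] [NormedSpace ℂ V] [NormedAddCommGroup F] [NormedSpace ℂ F]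
  {ϱ δ p m : ℝ}

/-- At the price of raising the order by `κ`, qualitative statements (convergence, Fubini,
uniqueness of symbols) can be proved in the ordinary norm. -/
theorem SymEst.untwist {Θ : Twist q W} {n : ℕ} {Λ : ℝ} {a : Rq q × Rq q → W}
    (h : SymEst Θ ϱ δ p n m Λ a) :
    SymEst (Twist.triv q W) ϱ δ p n (m + Θ.κ) (Θ.c * Λ) a := by
  have base : ∀ {n : ℕ} {m : ℝ} {a : Rq q × Rq q → W}, SymEst Θ ϱ δ p n m Λ a → ∀ y η,
      ‖a (y, η)‖ ≤ (Θ.c * Λ) * (jap y ^ p * jap η ^ (m + Θ.κ)) := by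
    intro n m a h y η
    have e1 := Θ.le 0 η (jap η) (one_le_jap η) (by
      rw [jap_zero]; nlinarith [one_le_jap η]) (by rw [jap_zero, one_mul]) (a (y, η))
    rw [Θ.act_zero] at e1
    have hc := Θ.c_nonneg
    have p4 := (jap_rpow_pos η Θ.κ).le
    refine e1.trans ((mul_le_mul_of_nonneg_left (h.base y η) (by positivity)).trans (le_of_eq ?_))
    rw [jap_rpow_add]; ring
  induction n generalizing m a with
  | zero => exact base h
  | succ n ih =>
    refine ⟨base h, fun l => ?_⟩
    rw [add_right_comm]
    exact ih (h.2 l)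

theorem SymClass.untwist {Θ : Twist q W} {a : Rq q × Rq q → W} (h : SymClass Θ ϱ δ p m a) :
    SymClass (Twist.triv q W) ϱ δ p (m + Θ.κ) a :=
  ⟨h.1, fun n => by
    obtain ⟨Λ, hΛ⟩ := h.2 n
    exact ⟨_, hΛ.untwist⟩⟩

theorem SymClass.bound {a : Rq q × Rq q → W} (h : SymClass (Twist.triv q W) ϱ δ p m a) :
    ∃ C ≥ (0 : ℝ), ∀ y η, ‖a (y, η)‖ ≤ C * (jap y ^ p * jap η ^ m) := by
  obtain ⟨Λ, hΛ⟩ := h.2 0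
  exact ⟨Λ, hΛ.nonneg, hΛ.base⟩

/-- The constant function `1` as a symbol. -/
theorem symEst_one (n : ℕ) :
    SymEst (Twist.triv q ℂ) ϱ δ 0 n 0 1 (fun _ => 1) := by
  have base : ∀ y η : Rq q, ‖(Twist.triv q ℂ).act η ((fun _ : Rq q × Rq q => (1 : ℂ)) (y, η))‖ ≤
      1 * (jap y ^ (0 : ℝ) * jap η ^ (0 : ℝ)) := fun y η => by
    simp [Twist.triv]
  cases n with
  | zero => exact base
  | succ n =>
    refine ⟨base, fun l => ?_⟩
    rw [dirDeriv_const]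
    exact (SymEst.zero n _).mono le_rfl zero_le_one

theorem symClass_one : SymClass (Twist.triv q ℂ) ϱ δ 0 0 (fun _ => 1) :=
  ⟨contDiff_const, fun n => ⟨1, symEst_one n⟩⟩

/-! Schwartz functions as symbols. -/

/-- A Schwartz function of `y` as a function of `(y, η)`. -/
def liftY (u : 𝓢(Rq q, U)) : Rq q × Rq q → U := fun θ => u θ.1

theorem liftY_smooth (u : 𝓢(Rq q, U)) : ContDiff ℝ ∞ (liftY u) :=
  (u.smooth ⊤).comp contDiff_fst

theorem dirDeriv_inl_liftY (u : 𝓢(Rq q, U)) (j : Fin q) :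
    dirDeriv (svec (Sum.inl j)) (liftY u) =
      liftY (LineDeriv.lineDerivOpCLM ℂ 𝓢(Rq q, U) (ev j : Rq q) u) := by
  have := dirDeriv_comp_linear (ContinuousLinearMap.fst ℝ (Rq q) (Rq q)) (svec (Sum.inl j))
    (u.smooth ⊤)
  funext θ
  have e := congrFun this θ
  simp only [svec, Sum.elim_inl, ContinuousLinearMap.coe_fst'] at e
  exact e

theorem dirDeriv_inr_liftY (u : 𝓢(Rq q, U)) (j : Fin q) :
    dirDeriv (svec (Sum.inr j)) (liftY u) = 0 := by
  have := dirDeriv_comp_linear (ContinuousLinearMap.fst ℝ (Rq q) (Rq q)) (svec (Sum.inr j))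
    (u.smooth ⊤)
  funext θ
  have e := congrFun this θ
  simp only [svec, Sum.elim_inr, ContinuousLinearMap.coe_fst', dirDeriv_zero_vec] at e
  exact e

/-- The constant is a continuous seminorm of `u`; this is what makes the quantized operators
continuous between Schwartz spaces. -/
theorem exists_seminorm_symEst_liftY (hδ : 0 ≤ δ) (N n : ℕ) :
    ∃ s : Seminorm ℂ 𝓢(Rq q, U), Continuous s ∧
      ∀ u, SymEst (Twist.triv q U) ϱ δ (-(N : ℝ)) n 0 (s u) (liftY u) := by
  have base : ∃ s : Seminorm ℂ 𝓢(Rq q, U), Continuous s ∧ ∀ u (y η : Rq q),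
      ‖liftY u (y, η)‖ ≤ s u * (jap y ^ (-(N : ℝ)) * jap η ^ (0 : ℝ)) := by
    refine ⟨(2 ^ N : NNReal) • (SchwartzMap.seminorm ℂ 0 0 + SchwartzMap.seminorm ℂ N 0), ?_,
      fun u y η => ?_⟩
    · have h := fun i => (schwartz_withSeminorms ℂ (Rq q) U).continuous_seminorm i
      have := ((h (0, 0)).add (h (N, 0))).const_smul (2 ^ N : NNReal)
      exact this
    · have h0 := SchwartzMap.norm_le_seminorm ℂ u y
      have hn' := SchwartzMap.norm_pow_mul_le_seminorm ℂ u N y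
      have h1 : jap y ^ N ≤ 2 ^ N * (1 + ‖y‖ ^ N) := by
        have := add_pow_le (zero_le_one (α := ℝ)) (norm_nonneg y) N
        calc jap y ^ N ≤ (1 + ‖y‖) ^ N := by gcongr; exacts [(jap_pos y).le, jap_le_one_add y]
          _ ≤ 2 ^ (N - 1) * (1 ^ N + ‖y‖ ^ N) := this
          _ ≤ 2 ^ N * (1 + ‖y‖ ^ N) := by
            rw [one_pow]
            gcongr
            · norm_num
            · omega
      rw [Real.rpow_zero, mul_one, Real.rpow_neg (jap_pos y).le, Real.rpow_natCast,
        ← div_eq_mul_inv, le_div_iff₀ (pow_pos (jap_pos y) N)]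
      change ‖u y‖ * jap y ^ N ≤ 2 ^ N * (SchwartzMap.seminorm ℂ 0 0 u + SchwartzMap.seminorm ℂ N 0 u)
      calc ‖u y‖ * jap y ^ N ≤ ‖u y‖ * (2 ^ N * (1 + ‖y‖ ^ N)) := by gcongr
        _ = 2 ^ N * (‖u y‖ + ‖y‖ ^ N * ‖u y‖) := by ring
        _ ≤ _ := by gcongr
  obtain ⟨s₀, hs₀, h₀⟩ := base
  induction n with
  | zero => exact ⟨s₀, hs₀, h₀⟩
  | succ n ih =>
    obtain ⟨s, hs, h⟩ := ih
    let D : Fin q → 𝓢(Rq q, U) →L[ℂ] 𝓢(Rq q, U) := fun j =>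
      LineDeriv.lineDerivOpCLM ℂ 𝓢(Rq q, U) (ev j : Rq q)
    have e : ∀ u, (s₀ + ∑ j, s.comp (D j : 𝓢(Rq q, U) →ₗ[ℂ] 𝓢(Rq q, U))) u =
        s₀ u + ∑ j, s (D j u) := fun u => by
      rw [add_apply, _root_.sum_apply]; rfl
    have hnn : ∀ u, 0 ≤ ∑ j, s (D j u) := fun u => Finset.sum_nonneg fun j _ => apply_nonneg _ _
    refine ⟨s₀ + ∑ j, s.comp (D j : 𝓢(Rq q, U) →ₗ[ℂ] 𝓢(Rq q, U)), ?_, fun u => ⟨?_, fun l => ?_⟩⟩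
    · have : Continuous fun u => s₀ u + ∑ j, s (D j u) :=
        hs₀.add (continuous_finsetSum _ fun j _ => hs.comp (D j).continuous)
      exact this.congr fun u => (e u).symm
    · intro y η
      rw [e]
      refine (h₀ u y η).trans (mul_le_mul_of_nonneg_right (by linarith [hnn u]) ?_)
      exact mul_nonneg (jap_rpow_pos _ _).le (jap_rpow_pos _ _).le
    · rw [e]
      rcases l with j | j
      · rw [dirDeriv_inl_liftY]
        refine (h _).mono (by simp [ordS, hδ]) ?_
        have := Finset.single_le_sum (f := fun j => s (D j u)) (fun j _ => apply_nonneg s _)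
          (Finset.mem_univ j)
        have h2 := apply_nonneg s₀ u
        exact this.trans (by linarith)
      · rw [dirDeriv_inr_liftY]
        exact (SymEst.zero n _).mono le_rfl (add_nonneg (apply_nonneg _ _) (hnn u))

theorem symClass_liftY (hδ : 0 ≤ δ) (N : ℕ) (u : 𝓢(Rq q, U)) :
    SymClass (Twist.triv q U) ϱ δ (-(N : ℝ)) 0 (liftY u) :=
  ⟨liftY_smooth u, fun n => by
    obtain ⟨s, -, h⟩ := exists_seminorm_symEst_liftY (U := U) (ϱ := ϱ) hδ N n
    exact ⟨_, h u⟩⟩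

/-! Composition of operators with smooth symbols. -/

/-- The exponent `-(q + 2)` is the one for which the constant weight `1` is just admissible. -/
theorem adm_nil (hδ : 0 ≤ δ) (hδ' : δ < 1) : Adm (q := q) δ (-((q : ℝ) + 2)) [] :=
  ⟨hδ, hδ', by
    have := isWeight_wt_zero ([] : List (Fin q))
    rwa [show -((q : ℝ) + 2) + (q + 1) + 1 = 0 by ring]⟩

theorem tame_prodAmp_liftY (hϱ : |ϱ| ≤ 1) (hδ : 0 ≤ δ) {τ : ℝ} (β : W →L[ℂ] V →L[ℂ] F)
    {a : Rq q × Rq q → W} (ha : SymClass (Twist.triv q W) ϱ δ p m a) (v : 𝓢(Rq q, V)) :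
    Tame δ (-((q : ℝ) + 2)) (prodAmp τ β a (liftY v)) := by
  obtain ⟨N, hN⟩ := exists_nat_ge (|p| + (q + 2))
  have ht := ha.tame_prodAmp (symClass_liftY (ϱ := ϱ) hδ N v) hϱ hδ (compat_triv β)
    (s := τ) (k := -((q : ℝ) + 2)) (m₂ := p + N)
    (D := (2 * (1 + |τ|)) ^ |p| * 2 ^ (N : ℝ)) fun y x => by
      refine (weights_decay_le p N (by positivity) τ y x).trans ?_
      have h1 := (jap_rpow_pos y (p + N)).le
      have h2 := jap_rpow_le_rpow x (s := |p| - N) (t := -((q : ℝ) + 2)) (by linarith)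
      gcongr
  exact ht

theorem SymClass.integrable_ek {b : Rq q × Rq q → W} (hb : SymClass (Twist.triv q W) ϱ δ p m b)
    (β : W →L[ℂ] U →L[ℂ] V) {f : Rq q → U} (hf : Continuous f) (hd : RapidDecay f) (y : Rq q) :
    Integrable fun η => ek (-y) η • β (b (y, η)) (f η) := by
  obtain ⟨C, hC, hb'⟩ := hb.bound
  obtain ⟨D, hD, hd⟩ := hd (-((q : ℝ) + 1) + -m)
  have hcont : Continuous fun η => ek (-y) η • β (b (y, η)) (f η) := by
    have h1 : Continuous fun η : Rq q => ek (-y) η := by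
      have f1 : Continuous fun η : Rq q => (-y, η) := by fun_prop
      have := ek_continuous.comp f1
      exact this
    have h2 : Continuous fun η : Rq q => b (y, η) := by
      have f1 : Continuous fun η : Rq q => (y, η) := by fun_prop
      exact hb.1.continuous.comp f1
    exact h1.fun_smul (continuous_bilin β h2 hf)
  refine integrable_of_dec (C := ‖β‖ * (C * jap y ^ p) * D) hcont fun η => ?_
  rw [norm_ek_smul]
  have h1 := (jap_rpow_pos y p).le
  have h2 := (jap_rpow_pos η m).le
  refine (β.le_opNorm₂ _ _).trans ?_
  calc ‖β‖ * ‖b (y, η)‖ * ‖f η‖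
      ≤ ‖β‖ * (C * (jap y ^ p * jap η ^ m)) * (D * jap η ^ (-((q : ℝ) + 1) + -m)) := by
        gcongr
        · exact hb' y η
        · exact hd η
    _ = ‖β‖ * (C * jap y ^ p) * D * (jap η ^ m * jap η ^ (-((q : ℝ) + 1) + -m)) := by ring
    _ = _ := by
        rw [← jap_rpow_add, dec]
        congr 2; ring

variable {p₁ p₂ m₁ mb : ℝ} {a : Rq q × Rq q → W₁} {b : Rq q × Rq q → W₂}

/-- The composition formula. The Fourier representation of `v` is inserted into the amplitude `a(y +
τx, ζ) v(y + x)`; after interchanging the integrals and writing `ζ = η + ξ`, the inner integral is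
that of `a(y + τx, η + ξ) b(y + x, η)`. Regularizing the left side with the same `L` beforehand
justifies the interchange. -/
theorem osc_prodAmp_eq [CompleteSpace V] [CompleteSpace W₃] [CompleteSpace F]
    (hϱ : |ϱ| ≤ 1) {L : List (Fin q)} (hL : Adm δ (|p₁| + |p₂|) L) {τ : ℝ}
    (ha : SymClass (Twist.triv q W₁) ϱ δ p₁ m₁ a) (hb : SymClass (Twist.triv q W₂) ϱ δ p₂ mb b)
    (B : W₁ →L[ℂ] W₂ →L[ℂ] W₃) (β₁ : W₁ →L[ℂ] V →L[ℂ] F) (β₂ : W₂ →L[ℂ] U →L[ℂ] V)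
    (β₃ : W₃ →L[ℂ] U →L[ℂ] F) (hβ : ∀ a b u, β₃ (B a b) u = β₁ a (β₂ b u))
    (v : 𝓢(Rq q, V)) {f : Rq q → U} (hf : Continuous f) (hd : RapidDecay f)
    (hv : ∀ y, v y = ((((2 * Real.pi) ^ q)⁻¹ : ℝ) : ℂ) • ∫ η, ek (-y) η • β₂ (b (y, η)) (f η))
    (y : Rq q) :
    osc (wt []) (prodAmp τ β₁ a (liftY v)) (y, 0) =
      ∫ η, ek (-y) η • β₃ (oint L (prodAmp τ B a b) (y, η)) (f η) := by
  have hδ := hL.nonneg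
  have hδ' := hL.lt_one
  set c : ℂ := ((((2 * Real.pi) ^ q)⁻¹ : ℝ) : ℂ)
  have ht := tame_prodAmp_liftY hϱ hδ (τ := τ) β₁ ha v
  have e1 := osc_append (adm_nil hδ hδ') ht L
  have e2 : reg [] (prodAmp τ β₁ a (liftY v)) = prodAmp τ β₁ a (liftY v) := rfl
  rw [List.append_nil, reg_prodAmp L ha.1 (liftY_smooth v), e2] at e1
  have hP := ((ha.tame_prodAmp hb hϱ hδ (compat_triv B)
    (fun y x => weights_le p₁ p₂ (le_refl |τ|) y x)).reg L).smul c
  rw [reg_prodAmp L ha.1 hb.1] at hP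
  have key := fubini_osc β₃ hδ hδ' hL.weight (by linarith) hP hf hd y
    (A := fun x ζ => prodAmp τ β₁ (regS L a) (liftY v) ((y, 0), (x, ζ))) fun x ζ => by
      simp only [Pi.smul_apply, prodAmp_apply, liftY, zero_add, add_sub_cancel, map_smul,
        hv, smul_apply, hβ]
      rw [← ContinuousLinearMap.integral_comp_comm _ (hb.integrable_ek β₂ hf hd (y + x)),
        ← integral_smul]
      congr 1; funext η
      rw [map_smul, smul_comm]
  rw [← e1, oint, reg_prodAmp L ha.1 hb.1, ← osc_smul]
  exact key

/-- For `τ = 0` only `v(y + x)` depends on `x`, so the `x`-integral is a translated Fourier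
transform. -/
theorem osc_prodAmp_zero [CompleteSpace V] [CompleteSpace F] (β : W →L[ℂ] V →L[ℂ] F)
    (a : Rq q × Rq q → W) (v : 𝓢(Rq q, V)) (y : Rq q) :
    osc (wt []) (prodAmp 0 β a (liftY v)) (y, 0) =
      ∫ η, ek (-y) η • β (a (y, η)) (ft v η) := by
  unfold osc
  congr 1; funext ζ
  simp only [Phi, wt, List.map_nil, List.prod_nil, one_smul, prodAmp_apply, liftY, zero_smul,
    add_zero, zero_add]
  have hint : Integrable fun x => ek x ζ • v x := by
    have := v.integrable (μ := volume)
    refine this.norm.mono' ?_ ?_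
    · exact ((ek_continuous_left ζ).fun_smul v.continuous).aestronglyMeasurable
    · exact Filter.Eventually.of_forall fun x => (norm_ek_smul _ _ _).le
  rw [ft, ← ContinuousLinearMap.integral_comp_comm _ hint, ← integral_smul]
  rw [← integral_add_left_eq_self (μ := volume)
    (fun x => ek (-y) ζ • (β (a (y, ζ))) (ek x ζ • v x)) y]
  congr 1; funext x
  rw [map_smul, smul_smul, ← ek_add_left, neg_add_cancel_left]

/-- A continuous symbol is determined by its operator. -/
theorem symbol_unique [CompleteSpace U] [CompleteSpace F] (β : W →L[ℂ] U →L[ℂ] F)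
    (hβ : ∀ w, (∀ u, β w u = 0) → w = 0) {c₁ c₂ : Rq q × Rq q → W} (h₁ : Continuous c₁)
    (h₂ : Continuous c₂)
    (h : ∀ (u : 𝓢(Rq q, U)) y, ∫ η, ek (-y) η • β (c₁ (y, η)) (ft u η) =
      ∫ η, ek (-y) η • β (c₂ (y, η)) (ft u η)) : c₁ = c₂ := by
  have hcont : ∀ {c : Rq q × Rq q → W}, Continuous c → ∀ y u,
      Continuous fun η => ek (-y) η • β (c (y, η)) u := fun {c} hc y u => by
    have f1 : Continuous fun η : Rq q => (-y, η) := by fun_prop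
    have f2 : Continuous fun η : Rq q => (y, η) := by fun_prop
    have g1 := ek_continuous.comp f1
    exact g1.fun_smul (continuous_bilin β (hc.comp f2) continuous_const)
  funext ⟨y, η⟩
  rw [← sub_eq_zero]
  refine hβ _ fun u₀ => ?_
  have key : ∀ᵐ η, ek (-y) η • β (c₁ (y, η)) u₀ = ek (-y) η • β (c₂ (y, η)) u₀ := by
    refine ae_eq_of_integral_contDiff_smul_eq (hcont h₁ y u₀).locallyIntegrable
      (hcont h₂ y u₀).locallyIntegrable fun g hg hgs => ?_
    -- The Schwartz function with `ft u = g • u₀` is used as a test function; the dilation by `2π`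
    -- compensates the normalization of `ft`.
    let G : Rq q → U := fun ζ => ((g ((2 * Real.pi) • ζ) : ℝ) : ℂ) • u₀
    have hpi : (2 * Real.pi) ≠ 0 := by positivity
    have hGs : HasCompactSupport G := by
      have e1 : HasCompactSupport fun ζ => g ((2 * Real.pi) • ζ) :=
        hgs.comp_homeomorph (Homeomorph.smulOfNeZero (2 * Real.pi) hpi)
      refine e1.mono' ?_
      intro ζ hζ
      refine subset_tsupport _ ?_
      rw [Function.mem_support] at hζ ⊢
      intro h0
      exact hζ (by simp [G, h0])
    have hG : ContDiff ℝ ∞ G := by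
      have : ContDiff ℝ ∞ fun ζ : Rq q => ((g ((2 * Real.pi) • ζ) : ℝ) : ℂ) :=
        Complex.ofRealCLM.contDiff.comp (hg.comp (contDiff_const_smul _))
      exact this.smul contDiff_const
    let u : 𝓢(Rq q, U) := 𝓕⁻ (hGs.toSchwartzMap hG)
    have hu : ∀ η, ft u η = ((g η : ℝ) : ℂ) • u₀ := fun η => by
      rw [ft_eq_fourier, FourierTransform.fourier_fourierInv_eq]
      change G _ = _
      simp only [G]
      rw [smul_inv_smul₀ hpi]
    have := h u y
    simp only [hu, map_smul] at this
    simpa only [smul_comm (ek _ _), Complex.coe_smul] using this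
  -- Testing gives equality almost everywhere, and continuity in `η` gives it everywhere.
  have key2 := Continuous.ae_eq_iff_eq (μ := volume) (hcont h₁ y u₀) (hcont h₂ y u₀) |>.1 key
  have e := congrFun key2 η
  have hek : ek (-y) η ≠ 0 := by
    intro h0
    have := norm_ek (-y) η
    rw [h0] at this; simp at this
  have := smul_right_injective _ hek e
  rw [map_sub, sub_apply, this, sub_self]

/-- The pairing of a Banach space with the scalars. -/
def scalarPairing (W : Type*) [NormedAddCommGroup W] [NormedSpace ℂ W] : W →L[ℂ] ℂ →L[ℂ] W :=
  (ContinuousLinearMap.lsmul ℂ ℂ).flip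

theorem scalarPairing_apply (w : W) (c : ℂ) : scalarPairing W w c = c • w := rfl

theorem Adm.mono {k k' : ℝ} {L : List (Fin q)} (h : Adm δ k L) (hk : k' ≤ k) : Adm δ k' L :=
  ⟨h.nonneg, h.lt_one, h.weight.mono (by linarith)⟩

/-- A disguised Fourier inversion formula: both sides are continuous symbols which give the same
operator by `osc_prodAmp_eq` with `b = 1`, so `symbol_unique` identifies them without any limiting
argument. -/
theorem oint_prodAmp_zero_one [CompleteSpace W] (hϱ : |ϱ| ≤ 1) {L : List (Fin q)}
    {a : Rq q × Rq q → W} (ha : SymClass (Twist.triv q W) ϱ δ p m a) (hL : Adm δ |p| L) :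
    oint L (prodAmp 0 (scalarPairing W) a (fun _ => 1)) = a := by
  have hδ := hL.nonneg
  have hL' : Adm δ (|p| + |(0 : ℝ)|) L := by simpa using hL
  have hb := symClass_one (q := q) (ϱ := ϱ) (δ := δ)
  have hs := oint_smooth hL' (ha.tame_prodAmp hb hϱ hδ (compat_triv (scalarPairing W))
    (fun y x => weights_le p 0 (le_refl |0|) y x))
  refine symbol_unique (scalarPairing W) (fun w hw => by simpa [scalarPairing_apply] using hw 1)
    hs.continuous ha.1.continuous fun u y => ?_
  refine Eq.trans ?_ (osc_prodAmp_zero (scalarPairing W) a u y)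
  exact (osc_prodAmp_eq hϱ hL' ha hb (scalarPairing W) (scalarPairing W) (scalarPairing ℂ)
    (scalarPairing W) (fun a b u => by simp [scalarPairing_apply, smul_smul, mul_comm]) u (ft_continuous u) (ft_rapidDecay u)
    (fun y => by simpa [scalarPairing_apply] using ft_inversion u y) y).symm

/-- The oscillatory integral of an amplitude which does not depend on `x`. -/
theorem oint_scale_zero [CompleteSpace W] {Θ : Twist q W} {m₂ k d K : ℝ}
    (hk : 0 ≤ k) (hd : 0 ≤ d)
    (hK : 0 ≤ K) {L : List (Fin q)} (hL : Adm δ k L) {P : Amp q → W}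
    (hP : AmpClass Θ ϱ δ m₂ k m d K P) (θ : Rq q × Rq q) : oint L (scale 0 P) θ = P (θ, 0) := by
  have hδ := hL.nonneg
  -- For fixed `θ` the function `ξ ↦ P(θ, (0, ξ))` is regarded as a symbol independent of its first
  -- variable, and `oint_prodAmp_zero_one` is evaluated at the origin.
  let slice : (Amp q → W) → Rq q × Rq q → W := fun P z => P (θ, (0, z.2))
  let A : Rq q × Rq q →L[ℝ] Amp q := (0 : Rq q × Rq q →L[ℝ] Rq q × Rq q).prod
    ((0 : Rq q × Rq q →L[ℝ] Rq q).prod (ContinuousLinearMap.snd ℝ (Rq q) (Rq q)))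
  have hslice : ∀ {P : Amp q → W}, ContDiff ℝ ∞ P → ∀ v : Rq q × Rq q,
      dirDeriv v (slice P) = slice (dirDeriv (A v) P) := fun {P} hP v => by
    have := dirDeriv_comp_affine A (θ, 0) v hP
    simpa [A, slice] using this
  have A1 : ∀ j : Fin q, A (svec (Sum.inl j)) = 0 := fun j => by simp [A, svec]
  have A2 : ∀ j : Fin q, A (svec (Sum.inr j)) = dXi j := fun j => by simp [A, svec, dXi, avec]
  have smooth : ∀ {P : Amp q → W}, ContDiff ℝ ∞ P → ContDiff ℝ ∞ (slice P) := fun hP =>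
    hP.comp (contDiff_const.prodMk (contDiff_const.prodMk contDiff_snd))
  -- A `ξ`-derivative may raise the growth in `ξ` by one power, so the slice is only a symbol of
  -- type `ϱ = -1`. This is why the preceding results assume merely `|ϱ| ≤ 1`.
  have est : ∀ (n : ℕ) {m d K Λ : ℝ} {P : Amp q → W}, 0 ≤ d → 0 ≤ K → ContDiff ℝ ∞ P →
      AmpEst Θ ϱ δ m₂ k n m d K Λ P →
      ∃ Λ', SymEst (Twist.triv q W) (-1) δ 0 n (d + K) Λ' (slice P) := by
    intro n
    have base : ∀ {n : ℕ} {m d K Λ : ℝ} {P : Amp q → W}, 0 ≤ d → 0 ≤ K →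
        AmpEst Θ ϱ δ m₂ k n m d K Λ P →
        ∃ C ≥ (0 : ℝ), ∀ y η, ‖slice P (y, η)‖ ≤ C * (jap y ^ (0 : ℝ) * jap η ^ (d + K)) := by
      intro n m d K Λ P hd hK h
      obtain ⟨C, hC, N, h⟩ := h.polyBound hd hK
      refine ⟨C * (1 + ‖θ‖) ^ N, by positivity, fun y η => ?_⟩
      simpa [jap_zero, slice] using h θ 0 η
    induction n with
    | zero =>
      intro m d K Λ P hd hK hP h
      obtain ⟨C, -, hC⟩ := base hd hK h
      exact ⟨C, hC⟩
    | succ n ih =>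
      intro m d K Λ P hd hK hP h
      obtain ⟨C, hC0, hC⟩ := base hd hK h
      have hj : ∀ j : Fin q, ∃ Λ', SymEst (Twist.triv q W) (-1) δ 0 n (d + (K + 1)) Λ'
          (slice (dirDeriv (dXi j) P)) := fun j => by
        have h2 := h.2 (Sum.inr (Sum.inr j))
        simp only [flat, ordH, ordY, cntH, Sum.elim_inr, id_eq, add_zero] at h2
        exact ih hd (by linarith) (dirDeriv_smooth _ hP) h2
      choose Λ' hΛ' using hj
      have hnn : ∀ j, 0 ≤ Λ' j := fun j => (hΛ' j).nonneg
      have hs : 0 ≤ ∑ j, Λ' j := Finset.sum_nonneg fun j _ => hnn j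
      refine ⟨C + ∑ j, Λ' j, fun y η => (hC y η).trans ?_, fun l => ?_⟩
      · refine mul_le_mul_of_nonneg_right (by linarith) ?_
        exact mul_nonneg (jap_rpow_pos _ _).le (jap_rpow_pos _ _).le
      · rw [hslice hP]
        rcases l with j | j
        · rw [A1, dirDeriv_zero_vec]
          exact (SymEst.zero n _).mono le_rfl (add_nonneg hC0 hs)
        · rw [A2]
          have := Finset.single_le_sum (f := Λ') (fun j _ => hnn j) (Finset.mem_univ j)
          refine (hΛ' j).mono (le_of_eq ?_) (by linarith)
          simp [ordS]; ring
  have hclass : SymClass (Twist.triv q W) (-1) δ 0 (d + K) (slice P) :=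
    ⟨smooth hP.1, fun n => by
      obtain ⟨Λ, hΛ⟩ := hP.2 n
      exact est n hd hK hP.1 hΛ⟩
  have key := oint_prodAmp_zero_one (by simp) hclass (hL.mono (by simpa using hk))
  have hreg : ∀ L : List (Fin q), regS L (slice P) = slice (reg L P) := fun L => by
    induction L with
    | nil => rfl
    | cons j L ih =>
      have e : regS (j :: L) (slice P) =
        regS L (slice P) + dirDeriv (svec (Sum.inr j)) (regS L (slice P)) := rfl
      rw [e, ih, hslice (reg_smooth L hP.1), A2]
      rfl
  have e := congrFun key (0, 0)
  have e2 : slice P (0, 0) = P (θ, 0) := rfl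
  rw [← e2, ← e, oint, oint, reg_prodAmp L hclass.1 contDiff_const, hreg, reg_scale L 0 hP.1]
  simp only [Pi.smul_apply, osc, Phi, scale_apply, prodAmp_apply, scalarPairing_apply, one_smul,
    zero_smul, zero_add, slice]

end Quantization



/-! ### Estimates for oscillatory integrals -/

section OscillatoryEstimates

variable {q : ℕ} {W : Type*} [NormedAddCommGroup W] [NormedSpace ℂ W] {Θ : Twist q W}
  {ϱ δ m₂ k m d K : ℝ} {L : List (Fin q)} {P : Amp q → W}

theorem AmpClass.absorb (hd : 0 ≤ d) (h : AmpClass Θ ϱ δ m₂ k m d K P) :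
    AmpClass Θ ϱ δ m₂ k (m + d) 0 (K + d) P :=
  ⟨h.1, fun n => (h.2 n).imp fun Λ hΛ => AmpEst.absorb (d' := 0) (by rwa [zero_add]) hd⟩

/-- Amplitudes of some order. -/
def AmpReg (Θ : Twist q W) (ϱ δ m₂ k : ℝ) (P : Amp q → W) : Prop :=
  ∃ m K : ℝ, 0 ≤ K ∧ AmpClass Θ ϱ δ m₂ k m 0 K P

theorem AmpReg.smooth (h : AmpReg Θ ϱ δ m₂ k P) : ContDiff ℝ ∞ P := by
  obtain ⟨m, K, hK, h⟩ := h
  exact h.1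

theorem AmpReg.tame (hδ : 0 ≤ δ) (h : AmpReg Θ ϱ δ m₂ k P) : Tame δ k P := by
  obtain ⟨m, K, hK, h⟩ := h
  exact h.tame hδ le_rfl hK

theorem ordY_nonneg (hδ : 0 ≤ δ) (l : SDir q) : 0 ≤ ordY δ l := by
  rcases l with l | l <;> simp [ordY, hδ]

theorem cntH_nonneg (l : SDir q) : 0 ≤ cntH l := by
  rcases l with l | l <;> simp [cntH]

theorem ordH_add_ordY (l : SDir q) : ordH ϱ l + ordY δ l = ordS ϱ δ l := by
  rcases l with l | l <;> simp [ordH, ordY, ordS]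

theorem AmpReg.deriv (hδ : 0 ≤ δ) (h : AmpReg Θ ϱ δ m₂ k P) (l : ADir q) :
    AmpReg Θ ϱ δ m₂ k (dirDeriv (avec l) P) := by
  obtain ⟨m, K, hK, h⟩ := h
  have hY := ordY_nonneg hδ (flat l)
  exact ⟨_, _, by linarith [cntH_nonneg (flat l)], (h.deriv l).absorb (by linarith)⟩

theorem AmpEst.deriv_inl (hδ : 0 ≤ δ) {n : ℕ} {Λ : ℝ} (h : AmpEst Θ ϱ δ m₂ k (n + 1) m 0 K Λ P)
    (hδ' : δ ≤ 1) (l : SDir q) : AmpEst Θ ϱ δ m₂ k n (m + ordS ϱ δ l) 0 (K + 1) Λ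
      (dirDeriv (avec (Sum.inl l)) P) := by
  have h1 := h.2 (Sum.inl l)
  simp only [flat, Sum.elim_inl, id_eq] at h1
  refine (h1.absorb (ordY_nonneg hδ l)).mono (le_of_eq ?_) le_rfl ?_ le_rfl
  · rw [add_assoc, ordH_add_ordY]
  · rcases l with l | l <;> simp [cntH, ordY, hδ']

/-- The `ξ`-derivative lowers `m` by `ϱ`, the `x`-derivative raises `d` by `δ`; absorbing `d` into
`m` leaves the net gain `ϱ - δ`, the source of the asymptotic expansion. -/
theorem AmpEst.mixed_absorb (hδ : 0 ≤ δ) (hδ' : δ ≤ 1) {n : ℕ} {Λ : ℝ} (hP : ContDiff ℝ ∞ P)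
    (h : AmpEst Θ ϱ δ m₂ k (n + 2) m 0 K Λ P) :
    AmpEst Θ ϱ δ m₂ k n (m - (ϱ - δ)) 0 (K + 2) (q * Λ) (EdgeCalculus.mixed P) :=
  ((h.mixed hP).absorb hδ).mono (by linarith) le_rfl (by linarith) le_rfl

theorem AmpReg.mixed (hδ : 0 ≤ δ) (hδ' : δ ≤ 1) (h : AmpReg Θ ϱ δ m₂ k P) :
    AmpReg Θ ϱ δ m₂ k (EdgeCalculus.mixed P) := by
  obtain ⟨m, K, hK, h⟩ := h
  refine ⟨m - (ϱ - δ), K + 2, by linarith, mixed_smooth h.1, fun n => ?_⟩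
  obtain ⟨Λ, hΛ⟩ := h.2 (n + 2)
  exact ⟨_, hΛ.mixed_absorb hδ hδ' h.1⟩

theorem AmpReg.scale (hk : 0 ≤ k) {t : ℝ} (ht : |t| ≤ 1) (h : AmpReg Θ ϱ δ m₂ k P) :
    AmpReg Θ ϱ δ m₂ k (EdgeCalculus.scale t P) := by
  obtain ⟨m, K, hK, h⟩ := h
  refine ⟨m, K, hK, scale_smooth t h.1, fun n => ?_⟩
  obtain ⟨Λ, hΛ⟩ := h.2 n
  exact ⟨_, hΛ.scale hk ht h.1⟩

theorem iterate_dirDeriv_clm_comp {W' V : Type*} [NormedAddCommGroup V] [NormedSpace ℝ V]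
    [NormedAddCommGroup W'] [NormedSpace ℂ W'] (T : W →L[ℝ] W') (v : V) (i : ℕ)
    {f : V → W} (hf : ContDiff ℝ ∞ f) :
    (dirDeriv v)^[i] (fun x => T (f x)) = fun x => T ((dirDeriv v)^[i] f x) := by
  induction i with
  | zero => rfl
  | succ i ih =>
    rw [Function.iterate_succ_apply', ih,
      dirDeriv_clm_comp T v (dirDeriv_iterate_smooth v i hf), Function.iterate_succ_apply']

/-- The twist at fixed `η` commutes with the `x`-integral and with `x`-derivatives, so the
integrations by parts can be carried out on the twisted amplitude. -/
theorem exists_norm_act_Phi_le [CompleteSpace W] {l : ℝ} {w : Rq q → ℂ} (hw : IsWeight l w)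
    (hkl : k + ((q : ℝ) + 1) ≤ l) (hδ : 0 ≤ δ) (Θ : Twist q W) (ϱ m₂ K : ℝ) (N : ℕ) :
    ∃ C ≥ (0 : ℝ), ∀ m Λ (P : Amp q → W), Tame δ k P → AmpEst Θ ϱ δ m₂ k N m 0 K Λ P →
      ∀ y η ξ, ‖Θ.act η (Phi w P (y, η) ξ)‖ ≤ C * (Λ * (jap y ^ m₂ * (jap η ^ m *
        (jap η + ‖ξ‖) ^ (δ * N) * rho η ξ ^ K))) * jap ξ ^ (-(N : ℝ)) := by
  obtain ⟨C, hC, h⟩ := exists_norm_integral_ek_weight_le (W := W) hw hkl N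
  refine ⟨C, hC, fun m Λ P hP hΛ y η ξ => ?_⟩
  let T := (Θ.act η).restrictScalars ℝ
  have hs := slice_x_smooth hP.smooth (y, η) ξ
  have e1 : Θ.act η (Phi w P (y, η) ξ) = ∫ x, ek x ξ • w x • T (P ((y, η), (x, ξ))) := by
    rw [Phi, ← ContinuousLinearMap.integral_comp_comm _ (Phi_integrand_integrable hw hkl hP _ _)]
    congr 1; funext x
    rw [map_smul, map_smul]; rfl
  have bd : ∀ j, ∀ i ≤ N, ∀ x, ‖(dirDeriv (ev j))^[i] (fun x => T (P ((y, η), (x, ξ)))) x‖ ≤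
      (Λ * (jap y ^ m₂ * (jap η ^ m * (jap η + ‖ξ‖) ^ (δ * N) * rho η ξ ^ K))) * jap x ^ k := by
    intro j i hi x
    rw [iterate_dirDeriv_clm_comp T (ev j) i hs, iterate_dX_slice j i hP.smooth]
    have := ((hΛ.of_le hi).iterate_dX j).base y η x ξ
    refine this.trans ?_
    rw [zero_add]
    have hiN : δ * (i : ℝ) ≤ δ * N := mul_le_mul_of_nonneg_left (by exact_mod_cast hi) hδ
    refine (mul_le_mul_of_nonneg_left (ampW_mono le_rfl hiN le_rfl y η x ξ) hΛ.nonneg).trans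
      (le_of_eq ?_)
    unfold ampW; ring
  rw [e1]
  refine h _ (T.contDiff.comp hs) _ (fun x => ?_) bd ξ
  rcases isEmpty_or_nonempty (Fin q) with hq | ⟨⟨j⟩⟩
  · refine (hΛ.base y η x ξ).trans ?_
    refine (mul_le_mul_of_nonneg_left (ampW_mono le_rfl (d' := δ * N) (by positivity) le_rfl y η x ξ)
      hΛ.nonneg).trans (le_of_eq ?_)
    unfold ampW; ring
  · exact bd j 0 (Nat.zero_le _) x

/-- The `ξ`-integral is split. Where `|ξ| ≤ ⟨η⟩/2`, `rho` is constant and `q + 1` integrations by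
parts give convergence at the price `⟨η⟩^{δ(q+1)}`. Where `|ξ| > ⟨η⟩/2`, the powers of `⟨η⟩ + |ξ|`
and `rho` are bounded by powers of `⟨ξ⟩` and are absorbed by `N` integrations by parts. The loss
`δ(q + 1)` is recovered in `exists_symEst_remainder`. -/
theorem exists_norm_act_oint_le [CompleteSpace W] (hϱ : 0 ≤ ϱ) (hL : Adm δ k L) (Θ : Twist q W)
    (m₂ : ℝ) {K : ℝ} (hK : 0 ≤ K) :
    ∃ n : ℕ, ∃ C ≥ (0 : ℝ), ∀ m Λ (P : Amp q → W), Tame δ k P → AmpEst Θ ϱ δ m₂ k n m 0 K Λ P →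
      ∀ y η, ‖Θ.act η (oint L P (y, η))‖ ≤
        C * Λ * (jap y ^ m₂ * jap η ^ (m + δ * ((q : ℝ) + 1))) := by
  have hδ := hL.nonneg
  have hδ' := hL.lt_one
  set K' : ℝ := K + L.length
  have hK' : 0 ≤ K' := by positivity
  -- This makes `⟨ξ⟩^{δN + K' - N}` integrable, which is possible because `δ < 1`.
  obtain ⟨N, hN⟩ := exists_nat_ge ((K' + (q + 1)) / (1 - δ))
  have hN' : δ * N + K' + -(N : ℝ) ≤ -((q : ℝ) + 1) := by
    rw [div_le_iff₀ (by linarith)] at hN; linarith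
  have hkl : k + ((q : ℝ) + 1) ≤ k + ((q : ℝ) + 1) + 1 := by linarith
  obtain ⟨C₁, hC₁, h₁⟩ := exists_norm_act_Phi_le hL.weight hkl hδ Θ ϱ m₂ K' (q + 1)
  obtain ⟨C₂, hC₂, h₂⟩ := exists_norm_act_Phi_le hL.weight hkl hδ Θ ϱ m₂ K' N
  set A₁ : ℝ := C₁ * (2 ^ (δ * ((q : ℝ) + 1)) * 4 ^ K')
  set A₂ : ℝ := C₂ * (3 ^ (δ * N) * 4 ^ K')
  have hA₁ : 0 ≤ A₁ := by positivity
  have hA₂ : 0 ≤ A₂ := by positivity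
  refine ⟨max (q + 1) N + L.length, ‖((((2 * Real.pi) ^ q)⁻¹ : ℝ) : ℂ)‖ *
    (((A₁ + A₂) * 2 ^ L.length) * ∫ x : Rq q, dec x), ?_, fun m Λ P hP hΛ y η => ?_⟩
  · have := integral_dec_nonneg (q := q)
    positivity
  have hΛ0 := hΛ.nonneg
  have hreg := hΛ.reg hϱ L hP.smooth
  have hregt := hP.reg L
  set Λ' : ℝ := 2 ^ L.length * Λ
  have hΛ'0 : 0 ≤ Λ' := by positivity
  have p1 := (jap_rpow_pos y m₂).le
  have p2 := (jap_rpow_pos η m).le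
  have p3 : 0 ≤ jap η ^ (δ * ((q : ℝ) + 1)) := (jap_rpow_pos η _).le
  have hj := one_le_jap η
  have bd : ∀ ξ, ‖Θ.act η (Phi (wt L) (reg L P) (y, η) ξ)‖ ≤
      ((A₁ + A₂) * Λ' * (jap y ^ m₂ * jap η ^ (m + δ * ((q : ℝ) + 1)))) * dec ξ := by
    intro ξ
    have p4 := (dec_pos ξ).le
    rw [jap_rpow_add]
    rcases le_or_gt ‖ξ‖ (jap η / 2) with hξ | hξ
    · refine (h₁ m Λ' _ hregt (hreg.of_le (le_max_left _ _)) y η ξ).trans ?_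
      rw [rho_of_le hξ]
      have e1 : (jap η + ‖ξ‖) ^ (δ * ((q + 1 : ℕ) : ℝ)) ≤
          2 ^ (δ * ((q : ℝ) + 1)) * jap η ^ (δ * ((q : ℝ) + 1)) := by
        push_cast
        rw [← Real.mul_rpow (by norm_num) (jap_pos η).le]
        exact Real.rpow_le_rpow (jap_add_norm_pos η ξ).le (by linarith) (by positivity)
      have e2 : jap ξ ^ (-((q + 1 : ℕ) : ℝ)) = dec ξ := by rw [dec]; push_cast; rfl
      rw [e2]
      calc _ ≤ C₁ * (Λ' * (jap y ^ m₂ * (jap η ^ m *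
            (2 ^ (δ * ((q : ℝ) + 1)) * jap η ^ (δ * ((q : ℝ) + 1))) * 4 ^ K'))) * dec ξ := by
            gcongr
        _ = A₁ * Λ' * (jap y ^ m₂ * (jap η ^ m * jap η ^ (δ * ((q : ℝ) + 1)))) * dec ξ := by
            simp only [A₁]; ring
        _ ≤ _ := by
            gcongr
            linarith
    · refine (h₂ m Λ' _ hregt (hreg.of_le (le_max_right _ _)) y η ξ).trans ?_
      have e1 : (jap η + ‖ξ‖) ^ (δ * (N : ℝ)) ≤ 3 ^ (δ * (N : ℝ)) * jap ξ ^ (δ * (N : ℝ)) := by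
        rw [← Real.mul_rpow (by norm_num) (jap_pos ξ).le]
        refine Real.rpow_le_rpow (jap_add_norm_pos η ξ).le ?_ (by positivity)
        linarith [norm_le_jap ξ]
      have e2 : rho η ξ ^ K' ≤ 4 ^ K' * jap ξ ^ K' := by
        rw [← Real.mul_rpow (by norm_num) (jap_pos ξ).le]
        exact Real.rpow_le_rpow (rho_pos η ξ).le (rho_le η ξ) hK'
      have e3 : jap ξ ^ (δ * N + K' + -(N : ℝ)) ≤ dec ξ := jap_rpow_le_dec ξ hN'
      have p5 := (jap_rpow_pos ξ (δ * (N : ℝ))).le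
      have p6 := (jap_rpow_pos ξ K').le
      have p7 := (jap_rpow_pos ξ (-(N : ℝ))).le
      have p8 := Real.rpow_nonneg (rho_pos η ξ).le K'
      have p9 : 1 ≤ jap η ^ (δ * ((q : ℝ) + 1)) := one_le_jap_rpow η (by positivity)
      calc _ ≤ C₂ * (Λ' * (jap y ^ m₂ * (jap η ^ m *
            (3 ^ (δ * (N : ℝ)) * jap ξ ^ (δ * (N : ℝ))) * (4 ^ K' * jap ξ ^ K')))) *
              jap ξ ^ (-(N : ℝ)) := by gcongr
        _ = A₂ * Λ' * (jap y ^ m₂ * (jap η ^ m * 1)) * jap ξ ^ (δ * N + K' + -(N : ℝ)) := by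
            rw [jap_rpow_add ξ (δ * N + K'), jap_rpow_add ξ (δ * N) K']
            simp only [A₂]; ring
        _ ≤ (A₁ + A₂) * Λ' * (jap y ^ m₂ * (jap η ^ m * jap η ^ (δ * ((q : ℝ) + 1)))) * dec ξ := by
            have p10 := (jap_rpow_pos ξ (δ * N + K' + -(N : ℝ))).le
            gcongr
            linarith
  have e : Θ.act η (oint L P (y, η)) = ((((2 * Real.pi) ^ q)⁻¹ : ℝ) : ℂ) •
      ∫ ξ, Θ.act η (Phi (wt L) (reg L P) (y, η) ξ) := by
    rw [oint, Pi.smul_apply, map_smul, osc, ContinuousLinearMap.integral_comp_comm]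
    exact Phi_integrable hδ hδ' hL.weight hkl hregt (y, η)
  rw [e, norm_smul]
  calc _ ≤ ‖((((2 * Real.pi) ^ q)⁻¹ : ℝ) : ℂ)‖ *
        (((A₁ + A₂) * Λ' * (jap y ^ m₂ * jap η ^ (m + δ * ((q : ℝ) + 1)))) * ∫ x : Rq q, dec x) :=
        mul_le_mul_of_nonneg_left (norm_integral_le_of_dec bd) (norm_nonneg _)
    _ = _ := by simp only [Λ']; ring

/-! The expansion. -/

/-- The Taylor polynomial `∑_{i < N} (1/i!) (∑_j D_{x_j} ∂_{ξ_j})^i P (θ, 0)`. -/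
def taylor (N : ℕ) (P : Amp q → W) (θ : Rq q × Rq q) : W :=
  ∑ i ∈ Finset.range N, ((i.factorial : ℂ)⁻¹) • (mixed^[i] P) (θ, 0)

/-- The remainder of the expansion of the oscillatory integral. -/
def remainder (L : List (Fin q)) (N : ℕ) (P : Amp q → W) : Rq q × Rq q → W :=
  oint L P - taylor N P

theorem iterate_mixed_smooth (hP : ContDiff ℝ ∞ P) (i : ℕ) : ContDiff ℝ ∞ (mixed^[i] P) := by
  induction i with
  | zero => exact hP
  | succ i ih =>
    rw [Function.iterate_succ_apply']
    exact mixed_smooth ih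

theorem iterate_mixed_dirDeriv (v : Amp q) (hP : ContDiff ℝ ∞ P) (i : ℕ) :
    mixed^[i] (dirDeriv v P) = dirDeriv v (mixed^[i] P) := by
  induction i with
  | zero => rfl
  | succ i ih =>
    rw [Function.iterate_succ_apply', ih, mixed_dirDeriv v (iterate_mixed_smooth hP i),
      Function.iterate_succ_apply']

theorem mixed_scale (t : ℝ) (hP : ContDiff ℝ ∞ P) :
    mixed (scale t P) = (t : ℂ) • scale t (mixed P) := by
  unfold mixed
  rw [scale_sum, Finset.smul_sum]
  refine Finset.sum_congr rfl fun j _ => ?_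
  rw [dirDeriv_dX_scale t j hP, dirDeriv_smul _ _ (scale_smooth t (dirDeriv_smooth _ hP)),
    dirDeriv_dXi_scale t j (dirDeriv_smooth _ hP), scale_smul, smul_comm]

theorem iterate_mixed_scale (t : ℝ) (hP : ContDiff ℝ ∞ P) (i : ℕ) :
    mixed^[i] (scale t P) = ((t : ℂ) ^ i) • scale t (mixed^[i] P) := by
  induction i with
  | zero => simp
  | succ i ih =>
    rw [Function.iterate_succ_apply', ih, mixed_smul _ (scale_smooth t (iterate_mixed_smooth hP i)),
      mixed_scale t (iterate_mixed_smooth hP i), Function.iterate_succ_apply', smul_smul, pow_succ]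

theorem taylor_scale (N : ℕ) (t : ℝ) (hP : ContDiff ℝ ∞ P) (θ : Rq q × Rq q) :
    taylor N (scale t P) θ =
      ∑ i ∈ Finset.range N, ((i.factorial : ℂ)⁻¹ * (t : ℂ) ^ i) • (mixed^[i] P) (θ, 0) := by
  refine Finset.sum_congr rfl fun i _ => ?_
  rw [iterate_mixed_scale t hP, mul_smul]
  have : scale t (mixed^[i] P) (θ, 0) = (mixed^[i] P) (θ, 0) := by
    change (mixed^[i] P) (θ, (t • 0, 0)) = _
    rw [smul_zero]; rfl
  rw [Pi.smul_apply, this]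

/-- The `i`-th term carries `t^i / i!`, so differentiation shifts the index by one. This matches
`hasDerivAt_oint_scale`, and the remainder obeys the same recursion as the integral. -/
theorem hasDerivAt_taylor_scale (N : ℕ) (t : ℝ) (hP : ContDiff ℝ ∞ P) (θ : Rq q × Rq q) :
    HasDerivAt (fun t => taylor (N + 1) (scale t P) θ) (taylor N (scale t (mixed P)) θ) t := by
  have e : (fun t : ℝ => taylor (N + 1) (scale t P) θ) = fun t : ℝ =>
      (∑ i ∈ Finset.range N, (((i + 1).factorial : ℂ)⁻¹ * (t : ℂ) ^ (i + 1)) •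
        (mixed^[i + 1] P) (θ, 0)) + P (θ, 0) := by
    funext t
    rw [taylor_scale _ t hP, Finset.sum_range_succ']
    simp
  rw [e, taylor_scale _ t (mixed_smooth hP)]
  refine HasDerivAt.add_const _ (HasDerivAt.fun_sum fun i _ => ?_)
  have h1 : HasDerivAt (fun t : ℝ => ((t : ℂ)) ^ (i + 1)) (((i + 1 : ℕ) : ℂ) * (t : ℂ) ^ i) t := by
    have := (Complex.ofRealCLM.hasDerivAt (x := t)).fun_pow (i + 1)
    simpa using this
  have h2 := (h1.const_mul (((i + 1).factorial : ℂ)⁻¹)).smul_const ((mixed^[i + 1] P) (θ, 0))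
  refine h2.congr_deriv ?_
  rw [Function.iterate_succ_apply]
  congr 1
  rw [Nat.factorial_succ]
  have h3 : ((i + 1 : ℕ) : ℂ) ≠ 0 := by exact_mod_cast Nat.succ_ne_zero i
  have h4 : (i.factorial : ℂ) ≠ 0 := by exact_mod_cast Nat.factorial_ne_zero i
  push_cast at h3 ⊢
  field_simp

theorem taylor_smooth (N : ℕ) (hP : ContDiff ℝ ∞ P) : ContDiff ℝ ∞ (taylor N P) := by
  unfold taylor
  refine ContDiff.sum fun i _ => contDiff_const.smul ?_
  exact (iterate_mixed_smooth hP i).comp (contDiff_id.prodMk contDiff_const)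

theorem dirDeriv_taylor (N : ℕ) (hP : ContDiff ℝ ∞ P) (l : SDir q) :
    dirDeriv (svec l) (taylor N P) = taylor N (dirDeriv (avec (Sum.inl l)) P) := by
  have hs : ∀ i : ℕ, ContDiff ℝ ∞ fun θ => (mixed^[i] P) (θ, 0) := fun i =>
    (iterate_mixed_smooth hP i).comp (contDiff_id.prodMk contDiff_const)
  have e : taylor N P = ∑ i ∈ Finset.range N, ((i.factorial : ℂ)⁻¹) •
      fun θ => (mixed^[i] P) (θ, 0) := by
    funext θ; simp [taylor]
  have hs' : ∀ i ∈ Finset.range N, ContDiff ℝ ∞ (((i.factorial : ℂ)⁻¹) •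
      fun θ => (mixed^[i] P) (θ, 0)) := fun i _ => contDiff_const.smul (hs i)
  rw [e, dirDeriv_sum _ _ hs']
  funext θ
  rw [Finset.sum_apply, taylor]
  refine Finset.sum_congr rfl fun i _ => ?_
  rw [dirDeriv_smul _ _ (hs i), dirDeriv_slice l (iterate_mixed_smooth hP i),
    iterate_mixed_dirDeriv _ hP]
  rfl

theorem remainder_smooth [CompleteSpace W] (hL : Adm δ k L) (hP : Tame δ k P) (N : ℕ) :
    ContDiff ℝ ∞ (remainder L N P) :=
  (oint_smooth hL hP).sub (taylor_smooth N hP.smooth)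

theorem dirDeriv_remainder [CompleteSpace W] (hL : Adm δ k L) (hP : Tame δ k P) (N : ℕ)
    (l : SDir q) :
    dirDeriv (svec l) (remainder L N P) = remainder L N (dirDeriv (avec (Sum.inl l)) P) := by
  rw [remainder, dirDeriv_sub _ (oint_smooth hL hP) (taylor_smooth N hP.smooth),
    dirDeriv_oint hL hP, dirDeriv_taylor N hP.smooth, remainder]

theorem hasDerivAt_remainder_scale [CompleteSpace W] (hL : Adm δ k L) (hk : 0 ≤ k)
    (hP : Tame δ k P) (N : ℕ) (θ : Rq q × Rq q) (t : ℝ) :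
    HasDerivAt (fun t => remainder L (N + 1) (scale t P) θ)
      (remainder L N (scale t (mixed P)) θ) t :=
  (hasDerivAt_oint_scale hL hk hP θ t).sub (hasDerivAt_taylor_scale N t hP.smooth θ)

/-- At `t = 0` the amplitude does not depend on `x`, and of the Taylor polynomial only the term `i =
0` survives. -/
theorem remainder_scale_zero [CompleteSpace W] (hL : Adm δ k L) (hk : 0 ≤ k)
    (hP : AmpReg Θ ϱ δ m₂ k P) (N : ℕ) (θ : Rq q × Rq q) :
    remainder L (N + 1) (scale 0 P) θ = 0 := by
  obtain ⟨m, K, hK, h⟩ := hP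
  rw [remainder, Pi.sub_apply, oint_scale_zero hk le_rfl hK hL h, taylor_scale _ 0 h.1,
    Finset.sum_range_succ']
  simp

/-- Induction on `N`: along `t ∈ [0, 1]` the remainder of order `N + 1` starts at zero, and its
derivative is the remainder of order `N` of `mixed P`, whose order is lower by `ϱ - δ`. The mean
value inequality concludes. -/
theorem exists_norm_act_remainder_le [CompleteSpace W] (hϱ : 0 ≤ ϱ) (hL : Adm δ k L) (hk : 0 ≤ k)
    (Θ : Twist q W) (m₂ : ℝ) (N : ℕ) {K : ℝ} (hK : 0 ≤ K) :
    ∃ n : ℕ, ∃ C ≥ (0 : ℝ), ∀ m Λ (P : Amp q → W), AmpReg Θ ϱ δ m₂ k P →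
      AmpEst Θ ϱ δ m₂ k n m 0 K Λ P → ∀ y η, ‖Θ.act η (remainder L N P (y, η))‖ ≤
        C * Λ * (jap y ^ m₂ * jap η ^ (m + δ * ((q : ℝ) + 1) - (ϱ - δ) * N)) := by
  have hδ := hL.nonneg
  have hδ' := hL.lt_one
  induction N generalizing K with
  | zero =>
    obtain ⟨n, C, hC, h⟩ := exists_norm_act_oint_le hϱ hL Θ m₂ hK
    refine ⟨n, C, hC, fun m Λ P hP hΛ y η => ?_⟩
    have e : remainder L 0 P = oint L P := by
      funext θ; simp [remainder, taylor]
    rw [e]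
    simpa using h m Λ P (hP.tame hδ) hΛ y η
  | succ N ih =>
    obtain ⟨n, C, hC, h⟩ := ih (K := K + 2) (by linarith)
    refine ⟨n + 2, C * q, by positivity, fun m Λ P hP hΛ y η => ?_⟩
    have hm := hΛ.mixed_absorb hδ hδ'.le hP.smooth
    have hmP := hP.mixed hδ hδ'.le
    let T := (Θ.act η).restrictScalars ℝ
    have hd : ∀ t : ℝ, HasDerivAt (fun t => T (remainder L (N + 1) (scale t P) (y, η)))
        (T (remainder L N (scale t (mixed P)) (y, η))) t := fun t =>
      T.hasFDerivAt.comp_hasDerivAt t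
        (hasDerivAt_remainder_scale hL hk (hP.tame hδ) N (y, η) t)
    have bd : ∀ t ∈ Set.Ico (0 : ℝ) 1, ‖T (remainder L N (scale t (mixed P)) (y, η))‖ ≤
        C * q * Λ * (jap y ^ m₂ * jap η ^ (m + δ * ((q : ℝ) + 1) - (ϱ - δ) * (N + 1 : ℕ))) := by
      intro t ht
      have ht' : |t| ≤ 1 := by rw [abs_of_nonneg ht.1]; exact ht.2.le
      refine (h _ _ _ (hmP.scale hk ht') (hm.scale hk ht' hmP.smooth) y η).trans (le_of_eq ?_)
      push_cast
      rw [show m - (ϱ - δ) + δ * ((q : ℝ) + 1) - (ϱ - δ) * N =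
        m + δ * ((q : ℝ) + 1) - (ϱ - δ) * (N + 1) by ring]
      ring
    have := norm_image_sub_le_of_norm_deriv_le_segment_01'
      (fun t _ => (hd t).hasDerivWithinAt) bd
    rw [remainder_scale_zero hL hk hP, map_zero, sub_zero, scale_one] at this
    exact this

/-- Derivatives in `(y, η)` commute with forming the remainder, so the bound for the function
itself, applied to differentiated amplitudes, bounds the derivatives. -/
theorem exists_symEst_remainder_weak [CompleteSpace W] (hϱ : 0 ≤ ϱ) (hL : Adm δ k L) (hk : 0 ≤ k)
    (Θ : Twist q W) (m₂ : ℝ) (N n : ℕ) {K : ℝ} (hK : 0 ≤ K) :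
    ∃ n' : ℕ, ∃ C ≥ (0 : ℝ), ∀ m Λ (P : Amp q → W), AmpReg Θ ϱ δ m₂ k P →
      AmpEst Θ ϱ δ m₂ k n' m 0 K Λ P →
      SymEst Θ ϱ δ m₂ n (m + δ * ((q : ℝ) + 1) - (ϱ - δ) * N) (C * Λ) (remainder L N P) := by
  have hδ := hL.nonneg
  have hδ' := hL.lt_one
  induction n generalizing K with
  | zero =>
    obtain ⟨n', C, hC, h⟩ := exists_norm_act_remainder_le hϱ hL hk Θ m₂ N hK
    exact ⟨n', C, hC, h⟩
  | succ n ih =>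
    obtain ⟨n₁, C₁, hC₁, h₁⟩ := exists_norm_act_remainder_le hϱ hL hk Θ m₂ N hK
    obtain ⟨n₂, C₂, hC₂, h₂⟩ := ih (K := K + 1) (by linarith)
    refine ⟨max n₁ (n₂ + 1), C₁ + C₂, by positivity, fun m Λ P hP hΛ => ⟨fun y η => ?_, fun l => ?_⟩⟩
    · refine (h₁ m Λ P hP (hΛ.of_le (le_max_left _ _)) y η).trans ?_
      have hΛ0 := hΛ.nonneg
      have p1 := (jap_rpow_pos y m₂).le
      have p2 := (jap_rpow_pos η (m + δ * ((q : ℝ) + 1) - (ϱ - δ) * N)).le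
      gcongr
      linarith
    · rw [dirDeriv_remainder hL (hP.tame hδ)]
      have := h₂ _ Λ _ (hP.deriv hδ (Sum.inl l))
        ((hΛ.of_le (le_max_right _ _)).deriv_inl hδ hδ'.le l)
      refine this.mono (le_of_eq (by ring)) ?_
      have hΛ0 := hΛ.nonneg
      gcongr
      linarith

theorem AmpEst.iterate_mixed (hδ : 0 ≤ δ) (hδ' : δ ≤ 1) (i : ℕ) {n : ℕ} {Λ : ℝ}
    (hP : ContDiff ℝ ∞ P) (h : AmpEst Θ ϱ δ m₂ k (n + 2 * i) m 0 K Λ P) :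
    AmpEst Θ ϱ δ m₂ k n (m - (ϱ - δ) * i) 0 (K + 2 * i) (q ^ i * Λ) (EdgeCalculus.mixed^[i] P) := by
  induction i generalizing n with
  | zero => simpa using h
  | succ i ih =>
    have := (ih (n := n + 2) (by convert h using 1; ring)).mixed_absorb hδ hδ'
      (iterate_mixed_smooth hP i)
    rw [Function.iterate_succ_apply']
    refine this.mono (le_of_eq ?_) le_rfl (le_of_eq ?_) (le_of_eq ?_) <;> push_cast <;> ring

/-- The main estimate for oscillatory integrals. -/
theorem exists_symEst_remainder [CompleteSpace W] (hδϱ : δ < ϱ) (hL : Adm δ k L) (hk : 0 ≤ k)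
    (Θ : Twist q W) (m₂ : ℝ) (N n : ℕ) {K : ℝ} (hK : 0 ≤ K) :
    ∃ n' : ℕ, ∃ C ≥ (0 : ℝ), ∀ m Λ (P : Amp q → W), AmpReg Θ ϱ δ m₂ k P →
      AmpEst Θ ϱ δ m₂ k n' m 0 K Λ P →
      SymEst Θ ϱ δ m₂ n (m - (ϱ - δ) * N) (C * Λ) (remainder L N P) := by
  have hδ := hL.nonneg
  have hδ' := hL.lt_one
  -- With `(ϱ - δ) M ≥ δ(q + 1)`, expanding up to `N + M` compensates the loss of the weak estimate.
  -- The additional terms `N ≤ i < N + M` are restrictions to `x = ξ = 0`, hence symbols of order `m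
  -- - (ϱ - δ) i` without any loss.
  obtain ⟨M, hM⟩ := exists_nat_ge (δ * ((q : ℝ) + 1) / (ϱ - δ))
  rw [div_le_iff₀ (by linarith)] at hM
  obtain ⟨n', C, hC, h⟩ := exists_symEst_remainder_weak (hδ.trans hδϱ.le) hL hk Θ m₂ (N + M) n hK
  set D : ℕ → ℝ := fun i => ‖((i.factorial : ℂ)⁻¹)‖ * (4 ^ (K + 2 * i + n) * q ^ i) with hD
  refine ⟨max n' (n + 2 * (N + M)), C + ∑ i ∈ Finset.Ico N (N + M), D i, ?_,
    fun m Λ P hP hΛ => ?_⟩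
  · have : 0 ≤ ∑ i ∈ Finset.Ico N (N + M), D i := Finset.sum_nonneg fun i _ => by
      simp only [hD]; positivity
    linarith
  have hs : ∀ i : ℕ, ContDiff ℝ ∞ fun θ => (mixed^[i] P) (θ, 0) := fun i =>
    (iterate_mixed_smooth hP.smooth i).comp (contDiff_id.prodMk contDiff_const)
  have e : remainder L N P = remainder L (N + M) P +
      ∑ i ∈ Finset.Ico N (N + M), ((i.factorial : ℂ)⁻¹) • fun θ => (mixed^[i] P) (θ, 0) := by
    funext θ
    have : taylor (N + M) P θ = taylor N P θ +
        ∑ i ∈ Finset.Ico N (N + M), ((i.factorial : ℂ)⁻¹) • (mixed^[i] P) (θ, 0) := by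
      rw [taylor, taylor, Finset.sum_range_add_sum_Ico _ (Nat.le_add_right N M)]
    simp only [remainder, Pi.add_apply, Pi.sub_apply, this, Finset.sum_apply, Pi.smul_apply]
    abel
  have h1 := (h m Λ P hP (hΛ.of_le (le_max_left _ _))).mono (m' := m - (ϱ - δ) * N)
    (by push_cast; linarith) le_rfl
  have h2 : ∀ i ∈ Finset.Ico N (N + M), SymEst Θ ϱ δ m₂ n (m - (ϱ - δ) * N) (D i * Λ)
      (((i.factorial : ℂ)⁻¹) • fun θ => (mixed^[i] P) (θ, 0)) := fun i hi => by
    rw [Finset.mem_Ico] at hi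
    have h3 := (hΛ.of_le (n' := n + 2 * i) (le_max_of_le_right (by omega))).iterate_mixed hδ hδ'.le
      i hP.smooth
    have h4 := (h3.restrict (iterate_mixed_smooth hP.smooth i) le_rfl).smul (hs i)
      ((i.factorial : ℂ)⁻¹)
    refine h4.mono ?_ (le_of_eq ?_)
    · have : (N : ℝ) ≤ i := by exact_mod_cast hi.1
      have : (ϱ - δ) * N ≤ (ϱ - δ) * i := mul_le_mul_of_nonneg_left this (by linarith)
      linarith
    · simp only [hD]; ring
  rw [e, add_mul, Finset.sum_mul]
  refine h1.add (remainder_smooth hL (hP.tame hδ) _) ?_ (SymEst.sum _ (fun i _ =>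
    contDiff_const.smul (hs i)) h2)
  have := ContDiff.sum (s := Finset.Ico N (N + M)) (n := ∞) (𝕜 := ℝ)
    (f := fun i => ((i.factorial : ℂ)⁻¹) • fun θ => (mixed^[i] P) (θ, 0)) fun i _ =>
      contDiff_const.smul (hs i)
  convert this using 1
  funext x; simp

end OscillatoryEstimates



/-! ### Change of quantization -/

section Requantization

variable {q : ℕ} {W : Type*} [NormedAddCommGroup W] [NormedSpace ℂ W] {Θ : Twist q W}
  {ϱ δ p m : ℝ} {L : List (Fin q)} {a b : Rq q × Rq q → W}

theorem adm_fullList (hδ : 0 ≤ δ) (hδ' : δ < 1) {k : ℝ} {M : ℕ} (h : k + (q + 2) ≤ M) :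
    Adm δ k (fullList q M) :=
  ⟨hδ, hδ', (isWeight_wt_fullList M).mono (by linarith)⟩

theorem exists_symEst_oint [CompleteSpace W] (hδϱ : δ < ϱ) {k : ℝ} (hL : Adm δ k L) (hk : 0 ≤ k)
    (Θ : Twist q W) (m₂ : ℝ) (n : ℕ) {K : ℝ} (hK : 0 ≤ K) :
    ∃ n' : ℕ, ∃ C ≥ (0 : ℝ), ∀ m Λ (P : Amp q → W), AmpReg Θ ϱ δ m₂ k P →
      AmpEst Θ ϱ δ m₂ k n' m 0 K Λ P → SymEst Θ ϱ δ m₂ n m (C * Λ) (oint L P) := by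
  obtain ⟨n', C, hC, h⟩ := exists_symEst_remainder hδϱ hL hk Θ m₂ 0 n hK
  refine ⟨n', C, hC, fun m Λ P hP hΛ => ?_⟩
  have e : remainder L 0 P = oint L P := by
    funext θ; simp [remainder, taylor]
  simpa [e] using h m Λ P hP hΛ

theorem SymClass.add (ha : SymClass Θ ϱ δ p m a) (hb : SymClass Θ ϱ δ p m b) :
    SymClass Θ ϱ δ p m (a + b) :=
  ⟨ha.1.add hb.1, fun n => by
    obtain ⟨Λ, h⟩ := ha.2 n
    obtain ⟨Λ', h'⟩ := hb.2 n
    exact ⟨_, h.add ha.1 hb.1 h'⟩⟩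

theorem SymClass.smul (ha : SymClass Θ ϱ δ p m a) (c : ℂ) : SymClass Θ ϱ δ p m (c • a) :=
  ⟨contDiff_const.smul ha.1, fun n => by
    obtain ⟨Λ, h⟩ := ha.2 n
    exact ⟨_, h.smul ha.1 c⟩⟩

theorem SymClass.deriv (ha : SymClass Θ ϱ δ p m a) (l : SDir q) :
    SymClass Θ ϱ δ p (m + ordS ϱ δ l) (dirDeriv (svec l) a) :=
  ⟨dirDeriv_smooth _ ha.1, fun n => (ha.2 (n + 1)).imp fun _ h => h.2 l⟩

/-- The operator `∑_j D_{y_j} ∂_{η_j}`. -/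
def mixS (a : Rq q × Rq q → W) : Rq q × Rq q → W :=
  ∑ j, (-Complex.I) • dirDeriv (svec (Sum.inr j)) (dirDeriv (svec (Sum.inl j)) a)

theorem contDiff_finsetSum_fun {ι V : Type*} [NormedAddCommGroup V] [NormedSpace ℝ V] (s : Finset ι)
    {f : ι → V → W} (h : ∀ i ∈ s, ContDiff ℝ ∞ (f i)) : ContDiff ℝ ∞ (∑ i ∈ s, f i) := by
  have := ContDiff.sum (s := s) h
  convert this using 1
  funext x; simp

theorem mixS_term_smooth (ha : ContDiff ℝ ∞ a) (j : Fin q) : ContDiff ℝ ∞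
    ((-Complex.I) • dirDeriv (svec (Sum.inr j)) (dirDeriv (svec (Sum.inl j)) a)) :=
  contDiff_const.smul (dirDeriv_smooth _ (dirDeriv_smooth _ ha))

theorem mixS_smooth (ha : ContDiff ℝ ∞ a) : ContDiff ℝ ∞ (mixS a) :=
  contDiff_finsetSum_fun _ fun j _ => mixS_term_smooth ha j

theorem SymEst.mixS (hδϱ : δ ≤ ϱ) {n : ℕ} {Λ : ℝ} (ha : ContDiff ℝ ∞ a)
    (h : SymEst Θ ϱ δ p (n + 2) m Λ a) :
    SymEst Θ ϱ δ p n m (q * Λ) (EdgeCalculus.mixS a) := by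
  have hj : ∀ j ∈ (Finset.univ : Finset (Fin q)), SymEst Θ ϱ δ p n m Λ
      ((-Complex.I) • dirDeriv (svec (Sum.inr j)) (dirDeriv (svec (Sum.inl j)) a)) := fun j _ => by
    have h1 := ((h.2 (Sum.inl j)).2 (Sum.inr j)).smul
      (dirDeriv_smooth _ (dirDeriv_smooth _ ha)) (-Complex.I)
    refine h1.mono ?_ (le_of_eq (by simp))
    simp only [ordS, Sum.elim_inl, Sum.elim_inr]
    linarith
  have := SymEst.sum _ (fun j _ => mixS_term_smooth ha j) hj
  rwa [Finset.sum_const, Finset.card_univ, Fintype.card_fin, nsmul_eq_mul] at this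

theorem SymClass.mixS (hδϱ : δ ≤ ϱ) (ha : SymClass Θ ϱ δ p m a) :
    SymClass Θ ϱ δ p m (EdgeCalculus.mixS a) :=
  ⟨mixS_smooth ha.1, fun n => by
    obtain ⟨Λ, h⟩ := ha.2 (n + 2)
    exact ⟨_, h.mixS hδϱ ha.1⟩⟩

theorem mixS_dirDeriv (l : SDir q) (ha : ContDiff ℝ ∞ a) :
    mixS (dirDeriv (svec l) a) = dirDeriv (svec l) (mixS a) := by
  unfold mixS
  rw [dirDeriv_sum _ _ fun j _ => mixS_term_smooth ha j]
  refine Finset.sum_congr rfl fun j _ => ?_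
  rw [dirDeriv_comm _ (svec l) ha, dirDeriv_comm _ (svec l) (dirDeriv_smooth _ ha),
    dirDeriv_smul _ _ (dirDeriv_smooth _ (dirDeriv_smooth _ ha))]

/-- The amplitude `a(y + s x, η + ξ)`. -/
def shiftAmp (s : ℝ) (a : Rq q × Rq q → W) : Amp q → W :=
  prodAmp s (scalarPairing W) a fun _ => 1

theorem shiftAmp_apply (s : ℝ) (a : Rq q × Rq q → W) (y η x ξ : Rq q) :
    shiftAmp s a ((y, η), (x, ξ)) = a (y + s • x, η + ξ) := one_smul ℂ _

/-- Changing the quantization parameter amounts to a dilation in `x`, so the derivative in `s` is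
supplied by `hasDerivAt_oint_scale`. -/
theorem shiftAmp_eq_scale (s : ℝ) (a : Rq q × Rq q → W) :
    shiftAmp s a = scale s (shiftAmp 1 a) := by
  funext ⟨⟨y, η⟩, x, ξ⟩
  rw [scale_apply, shiftAmp_apply, shiftAmp_apply, one_smul]

theorem dirDeriv_shiftAmp (s : ℝ) (ha : ContDiff ℝ ∞ a) (l : ADir q) :
    dirDeriv (avec l) (shiftAmp s a) =
      (coefL s l : ℂ) • shiftAmp s (dirDeriv (svec (flat l)) a) := by
  rw [shiftAmp, dirDeriv_prodAmp ha contDiff_const, dirDeriv_const]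
  have : prodAmp s (scalarPairing W) a (0 : Rq q × Rq q → ℂ) = 0 := by
    have := prodAmp_smul_right (s := s) (B := scalarPairing W) (a := a) (b := 0) 0
    simpa using this
  rw [this, smul_zero, add_zero]
  rfl

theorem shiftAmp_add (s : ℝ) (a b : Rq q × Rq q → W) :
    shiftAmp s (a + b) = shiftAmp s a + shiftAmp s b := prodAmp_add_left _

theorem shiftAmp_smul (s : ℝ) (c : ℂ) (a : Rq q × Rq q → W) :
    shiftAmp s (c • a) = c • shiftAmp s a := prodAmp_smul_left _

theorem shiftAmp_sum {ι : Type*} (t : Finset ι) (s : ℝ) (f : ι → Rq q × Rq q → W) :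
    shiftAmp s (∑ i ∈ t, f i) = ∑ i ∈ t, shiftAmp s (f i) := by
  classical
  induction t using Finset.induction_on with
  | empty =>
    have := shiftAmp_smul s 0 (0 : Rq q × Rq q → W)
    simpa using this
  | insert i t hi ih => rw [Finset.sum_insert hi, Finset.sum_insert hi, shiftAmp_add, ih]

theorem mixed_shiftAmp (ha : ContDiff ℝ ∞ a) :
    mixed (shiftAmp 1 a) = shiftAmp 1 (mixS a) := by
  unfold mixed mixS
  rw [shiftAmp_sum]
  refine Finset.sum_congr rfl fun j _ => ?_
  have e1 := dirDeriv_shiftAmp 1 ha (Sum.inr (Sum.inl j))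
  have e2 := dirDeriv_shiftAmp 1 (dirDeriv_smooth (svec (Sum.inl j)) ha) (Sum.inr (Sum.inr j))
  simp only [coefL, flat, Sum.elim_inr, Sum.elim_inl, Complex.ofReal_one, one_smul, id_eq] at e1 e2
  rw [shiftAmp_smul, ← e2, ← e1]
  rfl

theorem compat_scalar (Θ : Twist q W) : Compat Θ (Twist.triv q ℂ) Θ (scalarPairing W) 1 :=
  ⟨zero_le_one, fun η w c => by
    rw [scalarPairing_apply, map_smul, norm_smul, one_mul, mul_comm]
    rfl⟩

theorem shift_weights_le (p : ℝ) {s T : ℝ} (hs : |s| ≤ T) (y x : Rq q) :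
    jap (y + s • x) ^ p * jap (y + x) ^ (0 : ℝ) ≤
      (2 * (1 + T)) ^ |p| * (jap y ^ p * jap x ^ |p|) := by
  rw [Real.rpow_zero, mul_one]
  exact jap_add_smul_rpow_le y x hs p

theorem SymClass.shiftAmp (hϱ : |ϱ| ≤ 1) (hδ : 0 ≤ δ) (ha : SymClass Θ ϱ δ p m a) (s : ℝ) :
    AmpReg Θ ϱ δ p |p| (EdgeCalculus.shiftAmp s a) :=
  ⟨_, _, add_nonneg (abs_nonneg _) Θ.κ_nonneg, ha.prodAmp symClass_one hϱ hδ (compat_scalar Θ)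
    (shift_weights_le p (le_refl |s|))⟩

/-- The change of quantization: `Op_s(a) = Op_0(requant L s a)`. -/
def requant (L : List (Fin q)) (s : ℝ) (a : Rq q × Rq q → W) : Rq q × Rq q → W :=
  oint L (shiftAmp s a)

section

variable [CompleteSpace W]

theorem requant_smooth (hϱ : |ϱ| ≤ 1) (hL : Adm δ |p| L) (ha : SymClass Θ ϱ δ p m a) (s : ℝ) :
    ContDiff ℝ ∞ (requant L s a) :=
  oint_smooth hL ((ha.shiftAmp hϱ hL.nonneg s).tame hL.nonneg)

theorem dirDeriv_requant (hϱ : |ϱ| ≤ 1) (hL : Adm δ |p| L) (ha : SymClass Θ ϱ δ p m a) (s : ℝ)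
    (l : SDir q) :
    dirDeriv (svec l) (requant L s a) = requant L s (dirDeriv (svec l) a) := by
  rw [requant, dirDeriv_oint hL ((ha.shiftAmp hϱ hL.nonneg s).tame hL.nonneg),
    dirDeriv_shiftAmp s ha.1]
  simp [coefL, flat, requant]

theorem requant_add (hϱ : |ϱ| ≤ 1) (hL : Adm δ |p| L) (ha : SymClass Θ ϱ δ p m a)
    (hb : SymClass Θ ϱ δ p m b) (s : ℝ) :
    requant L s (a + b) = requant L s a + requant L s b := by
  rw [requant, shiftAmp_add, oint_add hL ((ha.shiftAmp hϱ hL.nonneg s).tame hL.nonneg)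
    ((hb.shiftAmp hϱ hL.nonneg s).tame hL.nonneg)]
  rfl

theorem requant_smul (hϱ : |ϱ| ≤ 1) (hL : Adm δ |p| L) (ha : SymClass Θ ϱ δ p m a) (s : ℝ)
    (c : ℂ) : requant L s (c • a) = c • requant L s a := by
  rw [requant, shiftAmp_smul, oint_smul c ((ha.shiftAmp hϱ hL.nonneg s).tame hL.nonneg)]
  rfl

theorem requant_zero (hϱ : |ϱ| ≤ 1) (hL : Adm δ |p| L) (ha : SymClass Θ ϱ δ p m a) :
    requant L 0 a = a :=
  oint_prodAmp_zero_one hϱ ha.untwist hL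

/-- The differential equation of `exp(s ∑_j D_{y_j} ∂_{η_j})`. It serves as a substitute for
composing two oscillatory integrals directly. -/
theorem hasDerivAt_requant (hϱ : |ϱ| ≤ 1) (hL : Adm δ |p| L) (ha : SymClass Θ ϱ δ p m a)
    (θ : Rq q × Rq q) (s : ℝ) :
    HasDerivAt (fun s => requant L s a θ) (requant L s (mixS a) θ) s := by
  have := hasDerivAt_oint_scale hL (abs_nonneg p) ((ha.shiftAmp hϱ hL.nonneg 1).tame hL.nonneg) θ s
  rw [mixed_shiftAmp ha.1, ← shiftAmp_eq_scale] at this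
  simp only [← shiftAmp_eq_scale] at this
  exact this

/-- Uniformity for `|s| ≤ T` is needed when the differential equation in `s` is integrated. -/
theorem exists_symEst_requant (hδϱ : δ < ϱ) (hϱ : |ϱ| ≤ 1) (hL : Adm δ |p| L) (Θ : Twist q W)
    (m T : ℝ) (n : ℕ) :
    ∃ n' : ℕ, ∃ C ≥ (0 : ℝ), ∀ s, |s| ≤ T → ∀ Λ (a : Rq q × Rq q → W), SymClass Θ ϱ δ p m a →
      SymEst Θ ϱ δ p n' m Λ a → SymEst Θ ϱ δ p n m (C * Λ) (requant L s a) := by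
  have hδ := hL.nonneg
  have hK : 0 ≤ |m| + Θ.κ := add_nonneg (abs_nonneg _) Θ.κ_nonneg
  obtain ⟨n', C, hC, h⟩ := exists_symEst_oint hδϱ hL (abs_nonneg p) Θ p n hK
  rcases lt_or_ge T 0 with hT | hT
  · exact ⟨0, 0, le_rfl, fun s hs => absurd hs (not_le.2 (hT.trans_le (abs_nonneg s)))⟩
  have hc := Θ.c_nonneg
  refine ⟨n', C * ((2 + T) ^ n' * (1 * Θ.c * (2 * (1 + T)) ^ |p|)), by positivity,
    fun s hs Λ a ha hΛ => ?_⟩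
  have h1 := prodAmp_est hϱ hδ (compat_scalar Θ) (shift_weights_le p hs) hs n' le_rfl
    (d₁ := 0) (d₂ := 0) (m₁ := m) (mb := 0) (Λ₁ := Λ) (Λ₂ := 1) le_rfl le_rfl ha.1 contDiff_const
    (by rwa [add_zero]) (by rw [add_zero]; exact symEst_one n')
  rw [add_zero, add_zero] at h1
  refine (h m _ _ (ha.shiftAmp hϱ hδ s) h1).mono le_rfl (le_of_eq ?_)
  ring

theorem SymClass.requant (hδϱ : δ < ϱ) (hϱ : |ϱ| ≤ 1) (hL : Adm δ |p| L)
    (ha : SymClass Θ ϱ δ p m a) (s : ℝ) : SymClass Θ ϱ δ p m (EdgeCalculus.requant L s a) :=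
  ⟨requant_smooth hϱ hL ha s, fun n => by
    obtain ⟨n', C, hC, h⟩ := exists_symEst_requant hδϱ hϱ hL Θ m |s| n
    obtain ⟨Λ, hΛ⟩ := ha.2 n'
    exact ⟨_, h s le_rfl Λ a ha hΛ⟩⟩

theorem mixS_requant (hϱ : |ϱ| ≤ 1) (hL : Adm δ |p| L) (ha : SymClass Θ ϱ δ p m a) (s : ℝ) :
    mixS (requant L s a) = requant L s (mixS a) := by
  unfold mixS requant
  have ht : ∀ j : Fin q, SymClass Θ ϱ δ p _ (dirDeriv (svec (Sum.inr j))
    (dirDeriv (svec (Sum.inl j)) a)) := fun j => (ha.deriv (Sum.inl j)).deriv (Sum.inr j)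
  have hsum : ∀ t : Finset (Fin q), oint L (shiftAmp s (∑ j ∈ t, (-Complex.I) •
      dirDeriv (svec (Sum.inr j)) (dirDeriv (svec (Sum.inl j)) a))) =
      ∑ j ∈ t, oint L (shiftAmp s ((-Complex.I) •
      dirDeriv (svec (Sum.inr j)) (dirDeriv (svec (Sum.inl j)) a))) := fun t => by
    have htame : ∀ j ∈ t, Tame δ |p| (shiftAmp s ((-Complex.I) •
        dirDeriv (svec (Sum.inr j)) (dirDeriv (svec (Sum.inl j)) a))) := fun j _ =>
      (((ht j).smul (-Complex.I)).shiftAmp hϱ hL.nonneg s).tame hL.nonneg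
    rw [shiftAmp_sum]
    classical
    induction t using Finset.induction_on with
    | empty =>
      have := oint_smul (L := L) 0 (Tame.zero δ |p| (W := W) (q := q))
      simpa using this
    | insert i t hi ih =>
      rw [Finset.sum_insert hi, Finset.sum_insert hi, oint_add hL (htame i (Finset.mem_insert_self i t))
        (Tame.sum _ fun j hj => htame j (Finset.mem_insert_of_mem hj)),
        ih fun j hj => htame j (Finset.mem_insert_of_mem hj)]
  rw [hsum]
  refine Finset.sum_congr rfl fun j _ => ?_
  have e1 := dirDeriv_requant hϱ hL ha s (Sum.inl j)
  have e2 := dirDeriv_requant hϱ hL (ha.deriv (Sum.inl j)) s (Sum.inr j)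
  have e3 := requant_smul hϱ hL (ht j) s (-Complex.I)
  unfold requant at e1 e2 e3
  rw [e1, e2, e3]

/-- The remainder of the first order expansion of the change of quantization. -/
def requantRem (L : List (Fin q)) (s r : ℝ) (a : Rq q × Rq q → W) : Rq q × Rq q → W :=
  requant L r a - requant L s a - ((r - s : ℝ) : ℂ) • requant L s (mixS a)

theorem dirDeriv_requantRem (hδϱ : δ < ϱ) (hϱ : |ϱ| ≤ 1) (hL : Adm δ |p| L)
    (ha : SymClass Θ ϱ δ p m a) (s r : ℝ) (l : SDir q) :
    dirDeriv (svec l) (requantRem L s r a) = requantRem L s r (dirDeriv (svec l) a) := by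
  have h1 := requant_smooth hϱ hL ha r
  have h2 := requant_smooth hϱ hL ha s
  have h3 := requant_smooth hϱ hL (ha.mixS hδϱ.le) s
  have h4 : ContDiff ℝ ∞ (((r - s : ℝ) : ℂ) • requant L s (mixS a)) := contDiff_const.smul h3
  have h5 : ContDiff ℝ ∞ (requant L r a - requant L s a) := h1.sub h2
  rw [requantRem, dirDeriv_sub _ h5 h4, dirDeriv_sub _ h1 h2, dirDeriv_smul _ _ h3,
    dirDeriv_requant hϱ hL ha, dirDeriv_requant hϱ hL ha, dirDeriv_requant hϱ hL (ha.mixS hδϱ.le),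
    requantRem, mixS_dirDeriv l ha.1]

/-- Taylor's formula of second order in `s`: the second derivative `requant t (mixS (mixS a))` is
bounded uniformly, and the mean value inequality is used twice. -/
theorem exists_norm_act_requantRem_le (hδϱ : δ < ϱ) (hϱ : |ϱ| ≤ 1) (hL : Adm δ |p| L)
    (Θ : Twist q W) (m T : ℝ) : ∃ n : ℕ, ∃ C ≥ (0 : ℝ), ∀ s r, |s| ≤ T → |r| ≤ T → ∀ Λ a,
      SymClass Θ ϱ δ p m a → SymEst Θ ϱ δ p n m Λ a → ∀ y η,
      ‖Θ.act η (requantRem L s r a (y, η))‖ ≤ C * (r - s) ^ 2 * Λ * (jap y ^ p * jap η ^ m) := by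
  obtain ⟨n, C, hC, h⟩ := exists_symEst_requant hδϱ hϱ hL Θ m T 0
  refine ⟨n + 2 + 2, C * (q * q), by positivity, fun s r hs hr Λ a ha hΛ y η => ?_⟩
  let Φ := (Θ.act η).restrictScalars ℝ
  have ha1 := ha.mixS hδϱ.le
  have ha2 := ha1.mixS hδϱ.le
  have hΛ2 := (hΛ.mixS hδϱ.le ha.1).mixS hδϱ.le ha1.1
  set M : ℝ := C * (q * (q * Λ)) * (jap y ^ p * jap η ^ m)
  have hM : ∀ t, |t| ≤ T → ‖Φ (requant L t (mixS (mixS a)) (y, η))‖ ≤ M := fun t ht =>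
    h t ht _ _ ha2 hΛ2 y η
  have hmem : ∀ {t}, t ∈ Set.uIcc s r → |t| ≤ T := fun {t} ht => by
    rw [abs_le] at hs hr ⊢
    exact Set.uIcc_subset_Icc (a₂ := -T) (b₂ := T) hs hr ht
  have hd : ∀ {a}, SymClass Θ ϱ δ p m a → ∀ t : ℝ, HasDerivAt (fun t => Φ (requant L t a (y, η)))
      (Φ (requant L t (mixS a) (y, η))) t := fun {a} ha t =>
    Φ.hasFDerivAt.comp_hasDerivAt t (hasDerivAt_requant hϱ hL ha (y, η) t)
  have b1 : ∀ t ∈ Set.uIcc s r, ‖Φ (requant L t (mixS a) (y, η)) -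
      Φ (requant L s (mixS a) (y, η))‖ ≤ M * |r - s| := fun t ht => by
    have := (convex_uIcc s r).norm_image_sub_le_of_norm_hasDerivWithin_le
      (fun t _ => (hd ha1 t).hasDerivWithinAt) (fun t ht => hM t (hmem ht)) Set.left_mem_uIcc ht
    refine this.trans (mul_le_mul_of_nonneg_left ?_ ((norm_nonneg _).trans (hM s hs)))
    rw [Real.norm_eq_abs]
    exact Set.abs_sub_left_of_mem_uIcc ht
  -- Subtracting the linear function with slope equal to the derivative at `s` leaves a function
  -- whose derivative is bounded by `M * |r - s|`, by `b1`.
  have b2 := (convex_uIcc s r).norm_image_sub_le_of_norm_hasDerivWithin_le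
    (f := fun t => Φ (requant L t a (y, η)) - t • Φ (requant L s (mixS a) (y, η)))
    (fun t _ => (((hd ha t).sub ((hasDerivAt_id t).smul_const _))).hasDerivWithinAt)
    (fun t ht => by simpa using b1 t ht) Set.left_mem_uIcc Set.right_mem_uIcc
  have e : Θ.act η (requantRem L s r a (y, η)) =
      Φ (requant L r a (y, η)) - r • Φ (requant L s (mixS a) (y, η)) -
      (Φ (requant L s a (y, η)) - s • Φ (requant L s (mixS a) (y, η))) := by
    have : Θ.act η (requantRem L s r a (y, η)) = Φ (requant L r a (y, η)) -
        Φ (requant L s a (y, η)) - (r - s) • Φ (requant L s (mixS a) (y, η)) := by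
      simp only [requantRem, Pi.sub_apply, Pi.smul_apply, map_sub, map_smul]
      rw [Complex.coe_smul]
      rfl
    rw [this, sub_smul]
    abel
  rw [e]
  refine b2.trans (le_of_eq ?_)
  rw [Real.norm_eq_abs, ← sq_abs (r - s)]
  simp only [M]; ring

theorem exists_symEst_requantRem (hδϱ : δ < ϱ) (hϱ : |ϱ| ≤ 1) (hL : Adm δ |p| L)
    (Θ : Twist q W) (m T : ℝ) (n : ℕ) : ∃ n' : ℕ, ∃ C ≥ (0 : ℝ), ∀ s r, |s| ≤ T → |r| ≤ T →
      ∀ Λ a, SymClass Θ ϱ δ p m a → SymEst Θ ϱ δ p n' m Λ a →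
      SymEst Θ ϱ δ p n m (C * (r - s) ^ 2 * Λ) (requantRem L s r a) := by
  induction n generalizing m with
  | zero => exact exists_norm_act_requantRem_le hδϱ hϱ hL Θ m T
  | succ n ih =>
    obtain ⟨n₁, C₁, hC₁, h₁⟩ := exists_norm_act_requantRem_le hδϱ hϱ hL Θ m T
    choose n₂ C₂ hC₂ h₂ using fun l : SDir q => ih (m + ordS ϱ δ l)
    have hsum : 0 ≤ ∑ l, C₂ l := Finset.sum_nonneg fun l _ => hC₂ l
    refine ⟨n₁ + (∑ l, n₂ l) + 1, C₁ + ∑ l, C₂ l, by positivity, fun s r hs hr Λ a ha hΛ =>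
      ⟨fun y η => ?_, fun l => ?_⟩⟩
    · have hΛ0 := hΛ.nonneg
      have p1 := (jap_rpow_pos y p).le
      have p2 := (jap_rpow_pos η m).le
      refine (h₁ s r hs hr Λ a ha (hΛ.of_le (by omega)) y η).trans ?_
      gcongr
      linarith
    · have hΛ0 := hΛ.nonneg
      have hl := Finset.single_le_sum (f := n₂) (fun l _ => Nat.zero_le _) (Finset.mem_univ l)
      have hl' := Finset.single_le_sum (f := C₂) (fun l _ => hC₂ l) (Finset.mem_univ l)
      rw [dirDeriv_requantRem hδϱ hϱ hL ha]
      refine (h₂ l s r hs hr Λ _ (ha.deriv l) ((hΛ.2 l).of_le (by omega))).mono le_rfl ?_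
      gcongr
      linarith

theorem SymClass.sub (ha : SymClass Θ ϱ δ p m a) (hb : SymClass Θ ϱ δ p m b) :
    SymClass Θ ϱ δ p m (a - b) := by
  have := ha.add (hb.smul (-1))
  rwa [neg_one_smul, ← sub_eq_add_neg] at this

/-- The changes of quantization form a group. -/
theorem requant_neg_requant (hδϱ : δ < ϱ) (hϱ : |ϱ| ≤ 1) (hL : Adm δ |p| L)
    (ha : SymClass Θ ϱ δ p m a) (s : ℝ) : requant L (-s) (requant L s a) = a := by
  have ha' := ha.untwist
  generalize m + Θ.κ = m' at ha'
  funext ⟨y, η⟩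
  -- The open interval `(-T, T)` contains both `0` and `s`.
  set T : ℝ := |s| + 1
  obtain ⟨n₁, C₁, hC₁, h₁⟩ := exists_symEst_requant hδϱ hϱ hL (Twist.triv q W) m' T 0
  obtain ⟨n₂, C₂, hC₂, h₂⟩ := exists_symEst_requantRem hδϱ hϱ hL (Twist.triv q W) m' T n₁
  obtain ⟨n₃, C₃, hC₃, h₃⟩ := exists_symEst_requantRem hδϱ hϱ hL (Twist.triv q W) m' T 0
  obtain ⟨n₄, C₄, hC₄, h₄⟩ := exists_symEst_requant hδϱ hϱ hL (Twist.triv q W) m' T n₃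
  obtain ⟨Λ₂, hΛ₂⟩ := ha'.2 n₂
  obtain ⟨Λ₄, hΛ₄⟩ := ha'.2 n₄
  -- It is shown that `f` has zero derivative, hence equals its value `a (y, η)` at `s = 0`.
  let f : ℝ → W := fun s => requant L (-s) (requant L s a) (y, η)
  set D : ℝ := (C₁ * (C₂ * Λ₂) + C₃ * (C₄ * Λ₄)) * (jap y ^ p * jap η ^ m')
  have hf : ∀ s r, |s| ≤ T → |r| ≤ T → ‖f r - f s‖ ≤ D * (r - s) ^ 2 := by
    intro s r hs hr
    have cs := ha'.requant hδϱ hϱ hL s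
    have cr := ha'.requant hδϱ hϱ hL r
    have cm := ((ha'.mixS hδϱ.le).requant hδϱ hϱ hL s).smul ((r - s : ℝ) : ℂ)
    have cR : SymClass (Twist.triv q W) ϱ δ p m' (requantRem L s r a) := (cr.sub cs).sub cm
    have hs' : |-s| ≤ T := by rwa [abs_neg]
    have hr' : |-r| ≤ T := by rwa [abs_neg]
    have e1 : requant L (-r) (requant L r a) = requant L (-r) (requantRem L s r a) +
        (requant L (-r) (requant L s a) + ((r - s : ℝ) : ℂ) •
          requant L (-r) (mixS (requant L s a))) := by
      have : requant L r a = requantRem L s r a + (requant L s a + ((r - s : ℝ) : ℂ) •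
          requant L s (mixS a)) := by rw [requantRem]; abel
      rw [this, requant_add hϱ hL cR (cs.add cm), requant_add hϱ hL cs cm,
        requant_smul hϱ hL ((ha'.mixS hδϱ.le).requant hδϱ hϱ hL s), mixS_requant hϱ hL ha']
    -- Expanding the inner operator at `s` and the outer one at `-r`, the terms of first order in `r
    -- - s` cancel because `mixS` commutes with `requant`; only the two quadratic remainders
    -- survive.
    have e2 : f r - f s = requant L (-r) (requantRem L s r a) (y, η) -
        requantRem L (-r) (-s) (requant L s a) (y, η) := by
      simp only [f, e1, requantRem, Pi.add_apply, Pi.sub_apply, Pi.smul_apply]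
      rw [show (-s - -r : ℝ) = r - s by ring]
      abel
    have g1 := h₁ (-r) hr' _ _ cR (h₂ s r hs hr _ _ ha' hΛ₂) y η
    have g2 := h₃ (-r) (-s) hr' hs' _ _ cs (h₄ s hs _ _ ha' hΛ₄) y η
    rw [e2]
    refine (norm_sub_le _ _).trans ((add_le_add g1 g2).trans (le_of_eq ?_))
    rw [show (-s - -r : ℝ) = r - s by ring]
    simp only [D]; ring
  -- An increment of size `O((x - r)²)` forces the derivative at `r` to vanish.
  have hderiv : ∀ r, |r| < T → HasDerivAt f 0 r := by
    intro r hr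
    have hO : (fun x => f x - f r) =O[nhds r] fun x => ‖x - r‖ ^ 2 := by
      refine Asymptotics.IsBigO.of_bound D ?_
      have : ∀ᶠ x in nhds r, |x| < T := continuous_abs.continuousAt.eventually (gt_mem_nhds hr)
      filter_upwards [this] with x hx
      rw [norm_pow, norm_norm, Real.norm_eq_abs, sq_abs]
      exact hf r x hr.le hx.le
    have h1 : HasFDerivAt (fun x => f x - f r) (0 : ℝ →L[ℝ] W) r := hO.hasFDerivAt one_lt_two
    have h2 := h1.hasDerivAt.add_const (f r)
    simpa using h2
  have hconst := (convex_Ioo (-T) T).norm_image_sub_le_of_norm_hasDerivWithin_le (f := f)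
    (f' := fun _ => 0) (C := 0) (fun r hr => (hderiv r (abs_lt.2 hr)).hasDerivWithinAt)
    (fun r _ => by simp) (x := 0) (y := s)
    (by constructor <;> simp only [T] <;> linarith [abs_nonneg s])
    (abs_lt.1 (lt_add_one |s|))
  rw [zero_mul, norm_le_zero_iff, sub_eq_zero] at hconst
  have e0 : f 0 = a (y, η) := by
    simp only [f, neg_zero, requant_zero hϱ hL ha]
  exact hconst.trans e0

end

end Requantization



/-! ### Existence of the operators -/

section Existence

variable {q : ℕ} {W U F : Type*} [NormedAddCommGroup W] [NormedSpace ℂ W]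
  [NormedAddCommGroup U] [NormedSpace ℂ U] [NormedAddCommGroup F] [NormedSpace ℂ F]
  {ϱ δ p m τ : ℝ} {a : Rq q × Rq q → W}

/-- Translates symbol estimates into the norms of the Schwartz seminorms. The value `η = 0` is taken
because `Op_τ(a)u` is recorded at the parameter `(y, 0)`; each derivative contributes a factor `q`
from the sum over coordinates. -/
theorem norm_iteratedFDeriv_le_of_symEst {m₂ Λ : ℝ} (n : ℕ) {g : Rq q × Rq q → F}
    (hg : ContDiff ℝ ∞ g) (h : SymEst (Twist.triv q F) ϱ δ m₂ n m Λ g) (y : Rq q) :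
    ‖iteratedFDeriv ℝ n (fun y => g (y, 0)) y‖ ≤ q ^ n * Λ * jap y ^ m₂ := by
  induction n generalizing m g with
  | zero =>
    have := h y 0
    rw [jap_zero, Real.one_rpow, mul_one] at this
    rw [norm_iteratedFDeriv_zero, pow_zero, one_mul]
    exact this
  | succ n ih =>
    have hs : ∀ j : Fin q, ContDiff ℝ ∞ fun y : Rq q => dirDeriv (svec (Sum.inl j)) g (y, 0) :=
      fun j => (dirDeriv_smooth _ hg).comp (contDiff_id.prodMk contDiff_const)
    let T : Fin q → F →L[ℝ] (Rq q →L[ℝ] F) := fun j =>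
      ContinuousLinearMap.smulRightL ℝ (Rq q) F (EuclideanSpace.proj j)
    have hT : ∀ j, ‖T j‖ ≤ 1 := fun j => by
      refine ContinuousLinearMap.opNorm_le_bound _ zero_le_one fun f => ?_
      refine ContinuousLinearMap.opNorm_le_bound _ (by positivity) fun x => ?_
      change ‖x j • f‖ ≤ _
      rw [norm_smul, one_mul, mul_comm]
      exact mul_le_mul_of_nonneg_left (abs_coord_le x j) (norm_nonneg f)
    have e : fderiv ℝ (fun y => g (y, 0)) =
        fun y => ∑ j, T j (dirDeriv (svec (Sum.inl j)) g (y, 0)) := by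
      funext y
      have h0 : HasFDerivAt (fun x : Rq q => (x, (0 : Rq q))) _ y :=
        (hasFDerivAt_id (𝕜 := ℝ) y).prodMk (hasFDerivAt_const (𝕜 := ℝ) (0 : Rq q) y)
      have h1 := (hasFDerivAt_svec hg (y, 0)).comp y h0
      have h2 : HasFDerivAt (fun y => g (y, 0)) _ y := h1
      rw [h2.fderiv]
      ext x
      simp [Fintype.sum_sum_type, scoord, T]
    have hTs : ∀ j ∈ (Finset.univ : Finset (Fin q)), ContDiff ℝ n
        fun y => T j (dirDeriv (svec (Sum.inl j)) g (y, 0)) := fun j _ =>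
      (T j).contDiff.comp ((hs j).of_le (by exact_mod_cast le_top))
    rw [← norm_iteratedFDeriv_fderiv, e, iteratedFDeriv_fun_sum_apply fun j hj => (hTs j hj).contDiffAt]
    have bd : ∀ j ∈ (Finset.univ : Finset (Fin q)),
        ‖iteratedFDeriv ℝ n (fun y => T j (dirDeriv (svec (Sum.inl j)) g (y, 0))) y‖ ≤
        q ^ n * Λ * jap y ^ m₂ := fun j _ => by
      have h1 := (T j).norm_iteratedFDeriv_comp_left (N := n) (n := n)
        ((hs j).of_le (by exact_mod_cast le_top)).contDiffAt (x := y) le_rfl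
      refine h1.trans ((mul_le_of_le_one_left (norm_nonneg _) (hT j)).trans ?_)
      exact ih (dirDeriv_smooth _ hg) (h.2 (Sum.inl j))
    refine (norm_sum_le_of_le _ bd).trans (le_of_eq ?_)
    rw [Finset.sum_const, Finset.card_univ, Fintype.card_fin, nsmul_eq_mul, pow_succ]
    ring

variable [CompleteSpace F]

theorem oint_prodAmp_liftY (hδ : 0 ≤ δ) (hδ' : δ < 1) (hϱ : |ϱ| ≤ 1)
    (β : W →L[ℂ] U →L[ℂ] F) (ha : SymClass (Twist.triv q W) ϱ δ p m a) (u : 𝓢(Rq q, U))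
    (L : List (Fin q)) :
    oint L (prodAmp τ β a (liftY u)) = ((((2 * Real.pi) ^ q)⁻¹ : ℝ) : ℂ) •
      osc (wt []) (prodAmp τ β a (liftY u)) := by
  have ht := tame_prodAmp_liftY hϱ hδ (τ := τ) β ha u
  have e1 := osc_append (adm_nil hδ hδ') ht L
  rw [List.append_nil] at e1
  rw [oint, e1]
  rfl

/-- The Schwartz function `u` is treated as a symbol of order `-N` in `y` and `0` in `η`. The
estimate for oscillatory integrals then bounds every Schwartz seminorm of the result by a continuous
seminorm of `u`. -/
theorem exists_quantization (hδ : 0 ≤ δ) (hδ' : δ < 1) (hδϱ : δ < ϱ) (hϱ : |ϱ| ≤ 1)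
    (β : W →L[ℂ] U →L[ℂ] F) (ha : SymClass (Twist.triv q W) ϱ δ p m a) :
    ∃ A : 𝓢(Rq q, U) →L[ℂ] 𝓢(Rq q, F), ∀ u y, A u y = ((((2 * Real.pi) ^ q)⁻¹ : ℝ) : ℂ) •
      osc (wt []) (prodAmp τ β a (liftY u)) (y, 0) := by
  set c : ℂ := ((((2 * Real.pi) ^ q)⁻¹ : ℝ) : ℂ)
  have hA := adm_nil (q := q) hδ hδ'
  have hw := hA.weight.mono (l' := 0) (by linarith)
  have hkl : -((q : ℝ) + 2) + (q + 1) ≤ 0 := by linarith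
  have ht := fun u => tame_prodAmp_liftY hϱ hδ (τ := τ) β ha (V := U) (v := u)
  have hs : ∀ u : 𝓢(Rq q, U), ContDiff ℝ ∞ (c • osc (wt []) (prodAmp τ β a (liftY u))) := fun u =>
    contDiff_const.smul (osc_smooth hδ hδ' hw hkl (ht u))
  have lift_add : ∀ u v : 𝓢(Rq q, U), liftY (u + v) = liftY u + liftY v := fun _ _ => rfl
  have lift_smul : ∀ (z : ℂ) (u : 𝓢(Rq q, U)), liftY (z • u) = z • liftY u := fun _ _ => rfl
  refine ⟨SchwartzMap.mkCLM (fun u y => (c • osc (wt []) (prodAmp τ β a (liftY u))) (y, 0))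
    (fun u v y => ?_) (fun z u y => ?_) (fun u => (hs u).comp (contDiff_id.prodMk contDiff_const))
    (fun n => ?_), fun u y => rfl⟩
  · rw [lift_add, prodAmp_add_right, osc_add hδ hδ' hw hkl (ht u) (ht v), smul_add]
    rfl
  · rw [lift_smul, prodAmp_smul_right, osc_smul, smul_comm]
    rfl
  · obtain ⟨i, n⟩ := n
    -- With this `N`, the decay `⟨y⟩^{p - N}` of the result outweighs the factor `|y|^i` of the
    -- Schwartz seminorm.
    obtain ⟨N, hN⟩ := exists_nat_ge (p + i)
    obtain ⟨M, hM⟩ := exists_nat_ge (|p| + |(-(N : ℝ))| + (q + 2))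
    have hL : Adm δ (|p| + |(-(N : ℝ))|) (fullList q M) := adm_fullList hδ hδ' hM
    have hκ : (Twist.triv q W).κ = 0 := rfl
    have hK : |m| + (Twist.triv q W).κ ≤ |m| := by rw [hκ, add_zero]
    obtain ⟨n', C, hC, h⟩ := exists_symEst_oint hδϱ hL (by positivity) (Twist.triv q F)
      (p + -(N : ℝ)) n (abs_nonneg m)
    obtain ⟨s, hsc, hsu⟩ := exists_seminorm_symEst_liftY (q := q) (U := U) (ϱ := ϱ) hδ N n'
    obtain ⟨Λ, hΛ⟩ := ha.2 n'
    have hΛ0 := hΛ.nonneg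
    obtain ⟨t, C', -, hC'⟩ := Seminorm.bound_of_continuous (schwartz_withSeminorms ℂ (Rq q) U) s hsc
    set D : ℝ := (2 + |τ|) ^ n' * (‖β‖ * (Twist.triv q W).c *
      ((2 * (1 + |τ|)) ^ |p| * 4 ^ |(-(N : ℝ))|) * Λ)
    have hD : 0 ≤ D := by
      have := (Twist.triv q W).c_nonneg
      positivity
    refine ⟨t, q ^ n * (C * D) * C', by positivity, fun u y => ?_⟩
    have hw' := fun y x : Rq q => weights_le p (-(N : ℝ)) (le_refl |τ|) y x
    have h1 := prodAmp_est hϱ hδ (compat_triv β) hw' le_rfl n' hK (d₁ := 0) (d₂ := 0) (mb := 0)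
      (Λ₁ := Λ) (Λ₂ := s u) le_rfl le_rfl ha.1 (liftY_smooth u) (by rwa [add_zero])
      (by rw [add_zero]; exact hsu u)
    rw [add_zero, add_zero] at h1
    have hreg : AmpReg (Twist.triv q F) ϱ δ (p + -(N : ℝ)) (|p| + |(-(N : ℝ))|)
        (prodAmp τ β a (liftY u)) :=
      ⟨_, _, add_nonneg (abs_nonneg _) le_rfl,
        ha.prodAmp (symClass_liftY hδ N u) hϱ hδ (compat_triv β) hw'⟩
    have h2 := h m _ _ hreg h1
    rw [oint_prodAmp_liftY hδ hδ' hϱ β ha] at h2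
    have h3 := norm_iteratedFDeriv_le_of_symEst n (hs u) h2 y
    have h4 : ‖y‖ ^ i ≤ jap y ^ (i : ℝ) := by
      rw [Real.rpow_natCast]
      exact pow_le_pow_left₀ (norm_nonneg y) (norm_le_jap y) i
    have h5 : jap y ^ (i : ℝ) * jap y ^ (p + -(N : ℝ)) ≤ 1 := by
      rw [← jap_rpow_add, ← Real.rpow_zero (jap y)]
      exact jap_rpow_le_rpow y (by linarith)
    have h6 : s u ≤ C' * t.sup (schwartzSeminormFamily ℂ (Rq q) U) u := hC' u
    have p1 := (jap_rpow_pos y (p + -(N : ℝ))).le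
    have p2 := apply_nonneg s u
    have e1 : (2 + |τ|) ^ n' * (‖β‖ * (Twist.triv q W).c *
      ((2 * (1 + |τ|)) ^ |p| * 4 ^ |(-(N : ℝ))|) * (Λ * s u)) = D * s u := by
      simp only [D]; ring
    rw [e1] at h3
    calc _ ≤ jap y ^ (i : ℝ) * (q ^ n * (C * (D * s u)) * jap y ^ (p + -(N : ℝ))) := by
          gcongr
          exact (jap_rpow_pos y _).le
      _ = q ^ n * (C * (D * s u)) * (jap y ^ (i : ℝ) * jap y ^ (p + -(N : ℝ))) := by ring
      _ ≤ q ^ n * (C * (D * s u)) * 1 := by gcongr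
      _ ≤ q ^ n * (C * (D * (C' * t.sup (schwartzSeminormFamily ℂ (Rq q) U) u))) * 1 := by gcongr
      _ = _ := by ring

end Existence

/-! ### The Banach spaces of an ideal -/

section OpsSpace

variable {I : BanachOperatorIdeal.{u}} {E F G : Type u}
  [NormedAddCommGroup E] [InnerProductSpace ℂ E] [CompleteSpace E]
  [TopologicalSpace.SeparableSpace E]
  [NormedAddCommGroup F] [InnerProductSpace ℂ F] [CompleteSpace F]
  [TopologicalSpace.SeparableSpace F]
  [NormedAddCommGroup G] [InnerProductSpace ℂ G] [CompleteSpace G]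
  [TopologicalSpace.SeparableSpace G]

/-- Composition of `A` with the rank one operator `⟨e, ·⟩ e` is `⟨e, ·⟩ Ae`, of ideal norm `‖e‖
‖Ae‖`; the ideal inequality bounds this by `‖A‖ ‖e‖²`. -/
theorem ops_opNorm_le (A : I.Ops E F) : ‖A.1‖ ≤ ‖A‖ := by
  refine ContinuousLinearMap.opNorm_le_bound _ (norm_nonneg A) fun e => ?_
  rcases eq_or_ne e 0 with rfl | he
  · simp
  have he' : 0 < ‖e‖ := norm_pos_iff.2 he
  have h1 := I.nrm_comp_le (ContinuousLinearMap.id ℂ F) ((innerSL ℂ e).smulRight e) A.2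
  have e1 : ContinuousLinearMap.id ℂ F ∘L A.1 ∘L (innerSL ℂ e).smulRight e =
      (innerSL ℂ e).smulRight (A.1 e) := by
    ext x; simp
  rw [e1, I.nrm_rankOne, ContinuousLinearMap.norm_smulRight_apply, innerSL_apply_norm] at h1
  have h2 : ‖ContinuousLinearMap.id ℂ F‖ ≤ 1 := ContinuousLinearMap.norm_id_le
  have h3 : ‖e‖ * ‖A.1 e‖ ≤ ‖e‖ * (‖A‖ * ‖e‖) := by
    refine h1.trans ?_
    have h4 : I.nrm E F A.1 = ‖A‖ := rfl
    rw [h4]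
    calc _ ≤ 1 * ‖A‖ * (‖e‖ * ‖e‖) := by gcongr
      _ = _ := by ring
  exact le_of_mul_le_mul_left h3 he'

instance : CompleteSpace (I.Ops E F) := by
  refine Metric.complete_of_cauchySeq_tendsto fun A hA => ?_
  rw [Metric.cauchySeq_iff] at hA
  obtain ⟨T, hT, h⟩ := I.complete (fun n => (A n).1) (fun n => (A n).2) fun ε hε => by
    obtain ⟨N, hN⟩ := hA ε hε
    refine ⟨N, fun m hm n hn => ?_⟩
    have := hN m hm n hn
    rwa [dist_eq_norm] at this
  let T' : I.Ops E F := ⟨T, hT⟩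
  refine ⟨T', Metric.tendsto_atTop.2 fun ε hε => ?_⟩
  obtain ⟨N, hN⟩ := h ε hε
  refine ⟨N, fun n hn => ?_⟩
  rw [dist_eq_norm]
  exact hN n hn

/-- The evaluation of operators. -/
def opsPairing (I : BanachOperatorIdeal.{u}) (E F : Type u)
    [NormedAddCommGroup E] [InnerProductSpace ℂ E] [CompleteSpace E]
    [TopologicalSpace.SeparableSpace E]
    [NormedAddCommGroup F] [InnerProductSpace ℂ F] [CompleteSpace F]
    [TopologicalSpace.SeparableSpace F] : I.Ops E F →L[ℂ] E →L[ℂ] F :=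
  LinearMap.mkContinuous
    { toFun := fun A => A.1
      map_add' := fun _ _ => rfl
      map_smul' := fun _ _ => rfl } 1 fun A => by
    rw [one_mul]
    exact ops_opNorm_le A

theorem opsPairing_apply (A : I.Ops E F) (e : E) : opsPairing I E F A e = A.1 e := rfl

/-! ### Group actions and twisted norms. -/

theorem norm_twist_le (κE : GroupAction E) (κF : GroupAction F) (r : {r : ℝ // 0 < r})
    (A : I.Ops E F) : ‖twist I κE κF r A‖ ≤ ‖κF.toHom r⁻¹‖ * ‖A‖ * ‖κE.toHom r‖ :=
  I.nrm_comp_le _ _ A.2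

theorem twist_mul (κE : GroupAction E) (κF : GroupAction F) (r s : {r : ℝ // 0 < r})
    (A : I.Ops E F) : twist I κE κF (r * s) A = twist I κE κF s (twist I κE κF r A) := by
  apply Subtype.ext
  change κF.toHom (r * s)⁻¹ ∘L A.1 ∘L κE.toHom (r * s) =
    κF.toHom s⁻¹ ∘L (κF.toHom r⁻¹ ∘L A.1 ∘L κE.toHom r) ∘L κE.toHom s
  rw [mul_inv_rev, map_mul, map_mul]
  rfl

theorem twist_one (κE : GroupAction E) (κF : GroupAction F) (A : I.Ops E F) :
    twist I κE κF 1 A = A := by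
  apply Subtype.ext
  change κF.toHom 1⁻¹ ∘L A.1 ∘L κE.toHom 1 = A.1
  rw [inv_one, map_one, map_one]
  rfl

/-- The operators of a strongly continuous group action grow at most polynomially. -/
theorem GroupAction.exists_norm_le (κ : GroupAction E) : ∃ c ≥ (0 : ℝ), ∃ M ≥ (0 : ℝ),
    ∀ (R : ℝ), 1 ≤ R → ∀ r : {r : ℝ // 0 < r}, (r : ℝ) ≤ R → 1 ≤ (r : ℝ) * R →
      ‖κ.toHom r‖ ≤ c * R ^ M := by
  -- On the compact set `[1/2, 2]` all orbits are bounded by strong continuity, hence so are the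
  -- operator norms, by the uniform boundedness principle.
  let S : Set {r : ℝ // 0 < r} := {r | (r : ℝ) ∈ Set.Icc (1 / 2 : ℝ) 2}
  have hS : IsCompact S := by
    rw [Subtype.isCompact_iff]
    have : (Subtype.val '' S : Set ℝ) = Set.Icc (1 / 2 : ℝ) 2 := by
      ext x
      constructor
      · rintro ⟨r, hr, rfl⟩; exact hr
      · intro hx
        exact ⟨⟨x, by linarith [hx.1]⟩, hx, rfl⟩
    rw [this]
    exact isCompact_Icc
  obtain ⟨C, hC⟩ := banach_steinhaus (g := fun r : S => κ.toHom r.1) fun e => by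
    obtain ⟨C, hC⟩ := (hS.image (κ.continuous_apply e)).isBounded.exists_norm_le
    exact ⟨C, fun r => hC _ ⟨r.1, r.2, rfl⟩⟩
  set D : ℝ := max C 1
  have hD : 1 ≤ D := le_max_right _ _
  refine ⟨D, by linarith, Real.logb 2 D, Real.logb_nonneg one_lt_two hD, fun R hR r hr hr' => ?_⟩
  -- Since `n ≥ log₂ R` and `r` lies between `1/R` and `R`, the `n`-th root of `r` lies in `[1/2,
  -- 2]`. The added `1` keeps `n` positive when `R` is near `1`, and costs one factor `D` in the
  -- final bound.
  set n : ℕ := ⌊Real.logb 2 R⌋₊ + 1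
  have hn : Real.logb 2 R ≤ n := by
    have := (Nat.lt_floor_add_one (Real.logb 2 R)).le
    simp only [n]; push_cast; exact this
  have hn' : (n : ℝ) ≤ Real.logb 2 R + 1 := by
    have := Nat.floor_le (Real.logb_nonneg one_lt_two hR)
    simp only [n]; push_cast; linarith
  have hn0 : n ≠ 0 := Nat.succ_ne_zero _
  have hn1 : (0 : ℝ) < n := by positivity
  have hR2 : R ≤ 2 ^ (n : ℝ) := by
    rwa [← Real.logb_le_iff_le_rpow one_lt_two (by linarith)]
  have hr0 := r.2
  have hroot : ((r : ℝ) ^ ((n : ℝ)⁻¹)) ^ n = r := Real.rpow_inv_natCast_pow hr0.le hn0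
  let s : {r : ℝ // 0 < r} := ⟨(r : ℝ) ^ ((n : ℝ)⁻¹), Real.rpow_pos_of_pos hr0 _⟩
  have hs : s ∈ S := by
    have k1 : (2 : ℝ) = (2 ^ (n : ℝ)) ^ ((n : ℝ)⁻¹) := by
      rw [← Real.rpow_mul (by norm_num), mul_inv_cancel₀ hn1.ne', Real.rpow_one]
    constructor
    · change 1 / 2 ≤ (r : ℝ) ^ ((n : ℝ)⁻¹)
      rw [k1, div_le_iff₀ (by positivity), ← Real.mul_rpow hr0.le (by positivity)]
      refine Real.one_le_rpow ?_ (by positivity)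
      exact hr'.trans (mul_le_mul_of_nonneg_left hR2 hr0.le)
    · change (r : ℝ) ^ ((n : ℝ)⁻¹) ≤ 2
      conv_rhs => rw [k1]
      exact Real.rpow_le_rpow hr0.le (hr.trans hR2) (by positivity)
  have hsr : r = s ^ n := Subtype.ext hroot.symm
  have h1 : ‖κ.toHom s‖ ≤ D := (hC ⟨s, hs⟩).trans (le_max_left _ _)
  have h2 : D ^ (Real.logb 2 R) = R ^ (Real.logb 2 D) := by
    rw [← Real.rpow_logb (b := 2) (x := D) (by norm_num) (by norm_num) (by linarith),
      ← Real.rpow_mul (by norm_num), mul_comm, Real.rpow_mul (by norm_num),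
      Real.rpow_logb (by norm_num) (by norm_num) (by linarith),
      Real.rpow_logb (by norm_num) (by norm_num) (by linarith)]
  rw [hsr, map_pow]
  calc ‖κ.toHom s ^ n‖ ≤ ‖κ.toHom s‖ ^ n := norm_pow_le' _ (Nat.succ_pos _)
    _ ≤ D ^ n := pow_le_pow_left₀ (norm_nonneg _) h1 n
    _ = D ^ (n : ℝ) := (Real.rpow_natCast D n).symm
    _ ≤ D ^ (Real.logb 2 R + 1) := Real.rpow_le_rpow_of_exponent_le hD hn'
    _ = D * R ^ (Real.logb 2 D) := by
      rw [Real.rpow_add (by linarith), Real.rpow_one, h2, mul_comm]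

/-- By the group law the twist with `r` is the twist with `r/s` after the one with `s`, and `r/s`
lies between `1/R` and `R`. -/
theorem exists_norm_twist_le (I : BanachOperatorIdeal.{u}) (κE : GroupAction E)
    (κF : GroupAction F) : ∃ cM : ℝ × ℝ, 0 ≤ cM.1 ∧ 0 ≤ cM.2 ∧ ∀ (r s : {r : ℝ // 0 < r}) (R : ℝ),
      1 ≤ R → (r : ℝ) ≤ s * R → (s : ℝ) ≤ r * R → ∀ A : I.Ops E F,
      ‖twist I κE κF r A‖ ≤ cM.1 * R ^ cM.2 * ‖twist I κE κF s A‖ := by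
  obtain ⟨c, hc, M, hM, h⟩ := κE.exists_norm_le
  obtain ⟨c', hc', M', hM', h'⟩ := κF.exists_norm_le
  refine ⟨(c' * c, M' + M), by positivity, by positivity, fun r s R hR hrs hsr A => ?_⟩
  have hr0 := r.2
  have hs0 := s.2
  have hR0 : 0 < R := by linarith
  have h1 := h R hR (s⁻¹ * r) (by
    change (s : ℝ)⁻¹ * r ≤ R
    rw [inv_mul_le_iff₀ hs0]; exact hrs) (by
    change 1 ≤ (s : ℝ)⁻¹ * r * R
    rw [mul_assoc, ← div_eq_inv_mul, one_le_div hs0]; exact hsr)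
  have h2 := h' R hR (s⁻¹ * r)⁻¹ (by
    change ((s : ℝ)⁻¹ * r)⁻¹ ≤ R
    rw [mul_inv, inv_inv, mul_comm, inv_mul_le_iff₀ hr0]; exact hsr) (by
    change 1 ≤ ((s : ℝ)⁻¹ * r)⁻¹ * R
    rw [mul_inv, inv_inv, mul_comm (s : ℝ), mul_assoc, ← div_eq_inv_mul, one_le_div hr0]; exact hrs)
  have e : twist I κE κF r A = twist I κE κF (s⁻¹ * r) (twist I κE κF s A) := by
    rw [← twist_mul, mul_inv_cancel_left]
  rw [e]
  refine (norm_twist_le κE κF _ _).trans ?_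
  calc _ ≤ (c' * R ^ M') * ‖twist I κE κF s A‖ * (c * R ^ M) := by gcongr
    _ = _ := by
      rw [Real.rpow_add hR0]; ring

/-- The family of the twisted operators `κF_{⟨η⟩}⁻¹ A κE_{⟨η⟩}`. -/
def opsTwist (q : ℕ) (I : BanachOperatorIdeal.{u}) (κE : GroupAction E) (κF : GroupAction F) :
    Twist q (I.Ops E F) where
  act η := LinearMap.mkContinuous
    { toFun := twist I κE κF (bracket η)
      map_add' := twist_add I κE κF (bracket η)
      map_smul' := twist_smul I κE κF (bracket η) }
    (‖κF.toHom (bracket η)⁻¹‖ * ‖κE.toHom (bracket η)‖) fun A =>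
      (norm_twist_le κE κF _ A).trans (le_of_eq (by ring))
  c := (exists_norm_twist_le I κE κF).choose.1
  κ := (exists_norm_twist_le I κE κF).choose.2
  c_nonneg := (exists_norm_twist_le I κE κF).choose_spec.1
  κ_nonneg := (exists_norm_twist_le I κE κF).choose_spec.2.1
  act_zero A := by
    have : bracket (0 : Rq q) = 1 := Subtype.ext (by simp [bracket])
    change twist I κE κF (bracket 0) A = A
    rw [this, twist_one]
  le η η' R hR h h' A := (exists_norm_twist_le I κE κF).choose_spec.2.2 (bracket η) (bracket η') R hR
    h h' A

/-! ### Composition in operator ideals as a bounded bilinear map. -/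

variable {I₁ I₂ I₃ : BanachOperatorIdeal.{u}}

theorem ops_tendsto_apply {A : ℕ → I.Ops E F} {A₀ : I.Ops E F}
    (h : Filter.Tendsto A Filter.atTop (nhds A₀)) (e : E) :
    Filter.Tendsto (fun n => (A n).1 e) Filter.atTop (nhds (A₀.1 e)) :=
  (((ContinuousLinearMap.apply ℂ F e).continuous.comp (opsPairing I E F).continuous).tendsto
    A₀).comp h

/-- Convergence in the ideal norm implies pointwise convergence of the operators, so composition
with either factor fixed has a closed graph and is bounded. The uniform boundedness principle over
the unit ball then gives the joint bound. -/
theorem ComposesContinuously.exists_norm_comp_le (h : ComposesContinuously I₁ I₂ I₃) (E F G : Type u)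
    [NormedAddCommGroup E] [InnerProductSpace ℂ E] [CompleteSpace E]
    [TopologicalSpace.SeparableSpace E]
    [NormedAddCommGroup F] [InnerProductSpace ℂ F] [CompleteSpace F]
    [TopologicalSpace.SeparableSpace F]
    [NormedAddCommGroup G] [InnerProductSpace ℂ G] [CompleteSpace G]
    [TopologicalSpace.SeparableSpace G] :
    ∃ C : ℝ, 0 ≤ C ∧ ∀ (A : I₁.Ops F G) (B : I₂.Ops E F), ‖h.comp A B‖ ≤ C * ‖A‖ * ‖B‖ := by
  let R (A : I₁.Ops F G) : I₂.Ops E F →ₗ[ℂ] I₃.Ops E G :=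
    { toFun := h.comp A
      map_add' := fun B B' => Subtype.ext (ContinuousLinearMap.comp_add A.1 B.1 B'.1)
      map_smul' := fun c B => Subtype.ext (ContinuousLinearMap.comp_smul A.1 c B.1) }
  let S (B : I₂.Ops E F) : I₁.Ops F G →ₗ[ℂ] I₃.Ops E G :=
    { toFun := fun A => h.comp A B
      map_add' := fun A A' => Subtype.ext (ContinuousLinearMap.add_comp A.1 A'.1 B.1)
      map_smul' := fun _ _ => rfl }
  have hR : ∀ A, Continuous (R A) := fun A => by
    refine (R A).continuous_of_seq_closed_graph fun u x y hx hy => ?_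
    apply Subtype.ext
    ext e
    exact tendsto_nhds_unique (ops_tendsto_apply hy e)
      ((A.1.continuous.tendsto _).comp (ops_tendsto_apply hx e))
  have hS : ∀ B, Continuous (S B) := fun B => by
    refine (S B).continuous_of_seq_closed_graph fun u x y hx hy => ?_
    apply Subtype.ext
    ext e
    exact tendsto_nhds_unique (ops_tendsto_apply hy e) (ops_tendsto_apply hx (B.1 e))
  obtain ⟨C, hC⟩ := banach_steinhaus
    (g := fun A : Metric.closedBall (0 : I₁.Ops F G) 1 =>
      (⟨R A.1, hR A.1⟩ : I₂.Ops E F →L[ℂ] I₃.Ops E G)) fun B => by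
    refine ⟨‖(⟨S B, hS B⟩ : I₁.Ops F G →L[ℂ] I₃.Ops E G)‖, fun A => ?_⟩
    refine ((⟨S B, hS B⟩ : I₁.Ops F G →L[ℂ] I₃.Ops E G).le_opNorm A.1).trans ?_
    exact mul_le_of_le_one_right (norm_nonneg _) (mem_closedBall_zero_iff.1 A.2)
  have hC0 : 0 ≤ C := (norm_nonneg _).trans (hC ⟨0, by simp⟩)
  refine ⟨C, hC0, fun A B => ?_⟩
  have key : ∀ A : I₁.Ops F G, ‖A‖ ≤ 1 → ‖S B A‖ ≤ C * ‖B‖ := fun A hA =>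
    ((⟨R A, hR A⟩ : I₂.Ops E F →L[ℂ] I₃.Ops E G).le_opNorm B).trans
      (mul_le_mul_of_nonneg_right (hC ⟨A, mem_closedBall_zero_iff.2 hA⟩) (norm_nonneg _))
  change ‖S B A‖ ≤ _
  rcases eq_or_ne A 0 with rfl | hA
  · rw [map_zero, norm_zero]; positivity
  have hA' : (0 : ℝ) < ‖A‖ := norm_pos_iff.2 hA
  have hn : ‖((‖A‖⁻¹ : ℝ) : ℂ) • A‖ ≤ 1 := by
    rw [norm_smul, Complex.norm_real, norm_inv, norm_norm, inv_mul_cancel₀ hA'.ne']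
  have h1 := key _ hn
  rw [map_smul, norm_smul, Complex.norm_real, norm_inv, norm_norm, inv_mul_le_iff₀ hA'] at h1
  linarith

/-- The composition as a bounded bilinear map. -/
def ComposesContinuously.compL (h : ComposesContinuously I₁ I₂ I₃) (E F G : Type u)
    [NormedAddCommGroup E] [InnerProductSpace ℂ E] [CompleteSpace E]
    [TopologicalSpace.SeparableSpace E]
    [NormedAddCommGroup F] [InnerProductSpace ℂ F] [CompleteSpace F]
    [TopologicalSpace.SeparableSpace F]
    [NormedAddCommGroup G] [InnerProductSpace ℂ G] [CompleteSpace G]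
    [TopologicalSpace.SeparableSpace G] :
    I₁.Ops F G →L[ℂ] I₂.Ops E F →L[ℂ] I₃.Ops E G :=
  LinearMap.mkContinuous₂ (LinearMap.mk₂ ℂ h.comp
    (fun A A' B => Subtype.ext (ContinuousLinearMap.add_comp A.1 A'.1 B.1))
    (fun _ _ _ => rfl)
    (fun A B B' => Subtype.ext (ContinuousLinearMap.comp_add A.1 B.1 B'.1))
    (fun c A B => Subtype.ext (ContinuousLinearMap.comp_smul A.1 c B.1)))
    (h.exists_norm_comp_le E F G).choose (h.exists_norm_comp_le E F G).choose_spec.2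

theorem ComposesContinuously.compL_apply (h : ComposesContinuously I₁ I₂ I₃) (A : I₁.Ops F G)
    (B : I₂.Ops E F) : h.compL E F G A B = h.comp A B := rfl

/-- Inserting `κF κF⁻¹ = 1` between the factors shows that the twist of a product is the product of
the twists. -/
theorem ComposesContinuously.compat (h : ComposesContinuously I₁ I₂ I₃) (q : ℕ)
    (κE : GroupAction E) (κF : GroupAction F) (κG : GroupAction G) :
    Compat (opsTwist q I₁ κF κG) (opsTwist q I₂ κE κF) (opsTwist q I₃ κE κG) (h.compL E F G)
      (h.exists_norm_comp_le E F G).choose := by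
  refine ⟨(h.exists_norm_comp_le E F G).choose_spec.1, fun η A B => ?_⟩
  have e : (opsTwist q I₃ κE κG).act η (h.compL E F G A B) =
      h.comp ((opsTwist q I₁ κF κG).act η A) ((opsTwist q I₂ κE κF).act η B) := by
    apply Subtype.ext
    change κG.toHom (bracket η)⁻¹ ∘L (A.1 ∘L B.1) ∘L κE.toHom (bracket η) =
      (κG.toHom (bracket η)⁻¹ ∘L A.1 ∘L κF.toHom (bracket η)) ∘L
        (κF.toHom (bracket η)⁻¹ ∘L B.1 ∘L κE.toHom (bracket η))
    have h1 : κF.toHom (bracket η) ∘L κF.toHom (bracket η)⁻¹ = ContinuousLinearMap.id ℂ F := by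
      change κF.toHom (bracket η) * κF.toHom (bracket η)⁻¹ = 1
      rw [← map_mul, mul_inv_cancel, map_one]
    ext e
    have h2 : ∀ f, κF.toHom (bracket η) (κF.toHom (bracket η)⁻¹ f) = f := fun f =>
      congrArg (fun T : F →L[ℂ] F => T f) h1
    simp [h2]
  rw [e]
  exact (h.exists_norm_comp_le E F G).choose_spec.2 _ _

end OpsSpace



/-! ### Symbol estimates in terms of multi-indices -/

section MultiIndices

variable {q : ℕ} {V W : Type*} [NormedAddCommGroup V] [NormedSpace ℝ V] [NormedAddCommGroup W]
  [NormedSpace ℂ W]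

theorem dirDeriv_foldr_comm (v : V) (e : Fin q → V) (α : Fin q → ℕ) (l : List (Fin q)) {f : V → W}
    (hf : ContDiff ℝ ∞ f) :
    dirDeriv v (l.foldr (fun i g => (dirDeriv (e i))^[α i] g) f) =
      l.foldr (fun i g => (dirDeriv (e i))^[α i] g) (dirDeriv v f) := by
  induction l with
  | nil => rfl
  | cons i l ih =>
    rw [List.foldr_cons, List.foldr_cons,
      ← dirDeriv_iterate_comm _ _ _ ((multiDeriv_aux e α l).1 f hf), ih]

theorem dirDeriv_multiDeriv (v : V) (e : Fin q → V) (α : Fin q → ℕ) {f : V → W}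
    (hf : ContDiff ℝ ∞ f) :
    dirDeriv v (multiDeriv e α f) = multiDeriv e α (dirDeriv v f) :=
  dirDeriv_foldr_comm v e α _ hf

/-- The iterated derivatives are applied in a fixed order of the directions. The additional
derivative is commuted to its own place in the list, which is unique by `Nodup`. -/
theorem dirDeriv_foldr_add_single (e : Fin q → V) (α : Fin q → ℕ) (j : Fin q) {l : List (Fin q)}
    (hl : l.Nodup) (hj : j ∈ l) {f : V → W} (hf : ContDiff ℝ ∞ f) :
    dirDeriv (e j) (l.foldr (fun i g => (dirDeriv (e i))^[α i] g) f) =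
      l.foldr (fun i g => (dirDeriv (e i))^[(α + Pi.single j 1 : Fin q → ℕ) i] g) f := by
  induction l with
  | nil => cases hj
  | cons i l ih =>
    rw [List.nodup_cons] at hl
    rw [List.foldr_cons, List.foldr_cons]
    by_cases h : i = j
    · subst h
      have e1 : l.foldr (fun i' g => (dirDeriv (e i'))^[(α + Pi.single i 1 : Fin q → ℕ) i'] g) f =
          l.foldr (fun i g => (dirDeriv (e i))^[α i] g) f :=
        List.foldr_ext _ _ _ fun k hk g => by
          have : k ≠ i := fun h => hl.1 (h ▸ hk)
          simp [Pi.single_eq_of_ne this]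
      rw [e1, Pi.add_apply, Pi.single_eq_same, Function.iterate_succ_apply']
    · have hj' : j ∈ l := by
        rcases List.mem_cons.1 hj with h' | h'
        · exact absurd h'.symm h
        · exact h'
      rw [← dirDeriv_iterate_comm _ _ _ ((multiDeriv_aux e α l).1 f hf), ih hl.2 hj', Pi.add_apply,
        Pi.single_eq_of_ne h, add_zero]

theorem dirDeriv_multiDeriv_single (e : Fin q → V) (α : Fin q → ℕ) (j : Fin q) {f : V → W}
    (hf : ContDiff ℝ ∞ f) :
    dirDeriv (e j) (multiDeriv e α f) = multiDeriv e (α + Pi.single j 1) f :=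
  dirDeriv_foldr_add_single e α j (List.nodup_finRange q) (List.mem_finRange j) hf

theorem multiDeriv_zero (e : Fin q → V) (f : V → W) : multiDeriv e 0 f = f := by
  unfold multiDeriv
  induction List.finRange q with
  | nil => rfl
  | cons i l ih => rw [List.foldr_cons, ih]; rfl

theorem mlen_zero : mlen (0 : Fin q → ℕ) = 0 := by simp [mlen]

theorem mlen_add_single (α : Fin q → ℕ) (j : Fin q) : mlen (α + Pi.single j 1) = mlen α + 1 := by
  simp [mlen, Finset.sum_add_distrib]

theorem mfact_add_single (α : Fin q → ℕ) (j : Fin q) :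
    mfact (α + Pi.single j 1) = (α j + 1) * mfact α := by
  unfold mfact
  rw [← Finset.mul_prod_erase _ _ (Finset.mem_univ j),
    ← Finset.mul_prod_erase _ (fun i => (α i).factorial) (Finset.mem_univ j), ← mul_assoc]
  congr 1
  · simp [Nat.factorial_succ]
  · refine Finset.prod_congr rfl fun i hi => ?_
    simp [Pi.single_eq_of_ne (Finset.ne_of_mem_erase hi)]

theorem mfact_ne_zero (α : Fin q → ℕ) : (mfact α : ℂ) ≠ 0 := by
  exact_mod_cast Finset.prod_ne_zero_iff.2 fun i _ => Nat.factorial_ne_zero _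

/-- The recursion behind the multinomial theorem: with `γ = α + e_j` one has `1/α! = γ_j/γ!`, and
the `γ_j` add up to `k + 1`. -/
theorem sum_piAntidiag_add_single {M : Type*} [AddCommGroup M] [Module ℂ M] (k : ℕ)
    (f : (Fin q → ℕ) → M) :
    ∑ α ∈ Finset.piAntidiag (Finset.univ : Finset (Fin q)) k, ∑ j,
      ((mfact α : ℂ)⁻¹) • f (α + Pi.single j 1) =
    ((k + 1 : ℕ) : ℂ) • ∑ γ ∈ Finset.piAntidiag (Finset.univ : Finset (Fin q)) (k + 1),
      ((mfact γ : ℂ)⁻¹) • f γ := by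
  have h1 : ∀ j : Fin q, ∑ α ∈ Finset.piAntidiag (Finset.univ : Finset (Fin q)) k,
      ((mfact α : ℂ)⁻¹) • f (α + Pi.single j 1) =
      ∑ γ ∈ Finset.piAntidiag (Finset.univ : Finset (Fin q)) (k + 1),
        ((γ j : ℂ) * (mfact γ : ℂ)⁻¹) • f γ := fun j => by
    refine Finset.sum_of_injOn (fun α => α + Pi.single j 1)
      (fun α _ β _ h => add_right_cancel h) (fun α hα => ?_) (fun γ hγ hγ' => ?_) fun α _ => ?_
    · have hα' : ∑ i, α i = k := by simpa using hα
      simp [Finset.sum_add_distrib, hα']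
    · have h0 : γ j = 0 := by
        by_contra h0
        apply hγ'
        have e : (γ - Pi.single j 1) + Pi.single j 1 = γ := by
          funext i
          by_cases h : i = j
          · subst h; simp; omega
          · simp [Pi.single_eq_of_ne h]
        refine ⟨γ - Pi.single j 1, ?_, e⟩
        have e2 := mlen_add_single (γ - Pi.single j 1) j
        rw [e] at e2
        have hγ2 : mlen γ = k + 1 := by simpa [mlen] using hγ
        have : mlen (γ - Pi.single j 1) = k := by omega
        simpa [mlen] using this
      rw [h0, Nat.cast_zero, zero_mul, zero_smul]
    · have h2 : ((α j : ℂ) + 1) ≠ 0 := by exact_mod_cast Nat.succ_ne_zero (α j)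
      have h3 := mfact_ne_zero α
      rw [mfact_add_single]
      congr 1
      simp only [Pi.add_apply, Pi.single_eq_same]
      push_cast
      field_simp
  rw [Finset.sum_comm, Finset.sum_congr rfl fun j _ => h1 j, Finset.sum_comm, Finset.smul_sum]
  refine Finset.sum_congr rfl fun γ hγ => ?_
  have hγ' : ∑ i, γ i = k + 1 := by simpa using hγ
  rw [← Finset.sum_smul, ← Finset.sum_mul, ← Nat.cast_sum, hγ', smul_smul]

variable {Θ : Twist q W} {ϱ δ m₂ : ℝ}

theorem SymEst.iterate (l : SDir q) (k : ℕ) {n : ℕ} {m Λ : ℝ} {a : Rq q × Rq q → W}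
    (h : SymEst Θ ϱ δ m₂ (n + k) m Λ a) :
    SymEst Θ ϱ δ m₂ n (m + ordS ϱ δ l * k) Λ ((dirDeriv (svec l))^[k] a) := by
  induction k generalizing m a with
  | zero => simpa using h
  | succ k ih =>
    have e : m + ordS ϱ δ l * ((k + 1 : ℕ) : ℝ) = m + ordS ϱ δ l + ordS ϱ δ l * k := by
      push_cast; ring
    rw [e, Function.iterate_succ_apply]
    exact ih (h.2 l)

theorem SymEst.foldr (t : Fin q → SDir q) {o : ℝ} (ho : ∀ i, ordS ϱ δ (t i) = o) (α : Fin q → ℕ)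
    (l : List (Fin q)) {n : ℕ} {m Λ : ℝ} {a : Rq q × Rq q → W}
    (h : SymEst Θ ϱ δ m₂ (n + (l.map α).sum) m Λ a) :
    SymEst Θ ϱ δ m₂ n (m + o * (l.map α).sum) Λ
      (l.foldr (fun i g => (dirDeriv (svec (t i)))^[α i] g) a) := by
  induction l generalizing n with
  | nil => simpa using h
  | cons i l ih =>
    rw [List.map_cons, List.sum_cons] at h ⊢
    rw [← add_assoc] at h
    have h1 := (ih h).iterate (t i)
    rw [ho] at h1
    convert h1 using 1
    · push_cast; ring
    · rfl

theorem mlen_eq (α : Fin q → ℕ) : mlen α = ((List.finRange q).map α).sum :=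
  Fin.sum_univ_def α

theorem SymEst.multiDeriv (α β : Fin q → ℕ) {n : ℕ} {m Λ : ℝ} {a : Rq q × Rq q → W}
    (h : SymEst Θ ϱ δ m₂ (n + mlen β + mlen α) m Λ a) :
    SymEst Θ ϱ δ m₂ n (m - ϱ * mlen α + δ * mlen β) Λ
      (EdgeCalculus.multiDeriv (fun i => svec (Sum.inl i)) β
        (EdgeCalculus.multiDeriv (fun i => svec (Sum.inr i)) α a)) := by
  rw [mlen_eq, mlen_eq] at h ⊢
  have h1 := SymEst.foldr (fun i => Sum.inr i) (o := -ϱ) (fun _ => rfl) α _ h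
  have h2 := SymEst.foldr (fun i => Sum.inl i) (o := δ) (fun _ => rfl) β _ h1
  convert h2 using 1
  · ring
  · rfl

/-- `SymEst` admits coordinate derivatives in any order; as they commute, only the two multi-indices
matter. -/
theorem symEst_of_multiDeriv {m Λ : ℝ} {a : Rq q × Rq q → W} (ha : ContDiff ℝ ∞ a) (N : ℕ)
    (h : ∀ α β : Fin q → ℕ, mlen α + mlen β ≤ N → ∀ y η,
      ‖Θ.act η (multiDeriv (fun i => svec (Sum.inl i)) β
        (multiDeriv (fun i => svec (Sum.inr i)) α a) (y, η))‖ ≤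
      Λ * (jap y ^ m₂ * jap η ^ (m - ϱ * mlen α + δ * mlen β))) :
    SymEst Θ ϱ δ m₂ N m Λ a := by
  have key : ∀ (n : ℕ) (α β : Fin q → ℕ), mlen α + mlen β + n ≤ N →
      SymEst Θ ϱ δ m₂ n (m - ϱ * mlen α + δ * mlen β) Λ
        (multiDeriv (fun i => svec (Sum.inl i)) β
          (multiDeriv (fun i => svec (Sum.inr i)) α a)) := by
    intro n
    induction n with
    | zero => exact fun α β hn => h α β (by omega)
    | succ n ih =>
      intro α β hn
      refine ⟨h α β (by omega), fun l => ?_⟩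
      have hs := multiDeriv_smooth (fun i => svec (Sum.inr i)) α ha
      rcases l with j | j
      · rw [dirDeriv_multiDeriv_single (fun i => svec (Sum.inl i)) β j hs]
        have h1 := ih α (β + Pi.single j 1) (by rw [mlen_add_single]; omega)
        rw [mlen_add_single] at h1
        convert h1 using 1
        change _ + δ = _
        push_cast; ring
      · rw [dirDeriv_multiDeriv _ _ _ hs,
          dirDeriv_multiDeriv_single (fun i => svec (Sum.inr i)) α j ha]
        have h1 := ih (α + Pi.single j 1) β (by rw [mlen_add_single]; omega)
        rw [mlen_add_single] at h1
        convert h1 using 1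
        change _ + -ϱ = _
        push_cast; ring
  have h0 := key N 0 0 (by rw [mlen_zero]; omega)
  rw [mlen_zero, multiDeriv_zero, multiDeriv_zero] at h0
  simpa using h0

end MultiIndices

/-! ### The Leibniz expansion -/

section Leibniz

variable {q : ℕ} {W₁ W₂ W₃ : Type*} [NormedAddCommGroup W₁] [NormedSpace ℂ W₁]
  [NormedAddCommGroup W₂] [NormedSpace ℂ W₂] [NormedAddCommGroup W₃] [NormedSpace ℂ W₃]
  {B : W₁ →L[ℂ] W₂ →L[ℂ] W₃} {a : Rq q × Rq q → W₁} {b : Rq q × Rq q → W₂}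

theorem partialEta_smooth (α : Fin q → ℕ) (ha : ContDiff ℝ ∞ a) : ContDiff ℝ ∞ (partialEta α a) :=
  multiDeriv_smooth _ α ha

theorem DY_smooth (β : Fin q → ℕ) (hb : ContDiff ℝ ∞ b) : ContDiff ℝ ∞ (DY β b) :=
  contDiff_const.smul (multiDeriv_smooth _ β hb)

theorem DY_add_single (β : Fin q → ℕ) (j : Fin q) (hb : ContDiff ℝ ∞ b) :
    DY (β + Pi.single j 1) b = (-Complex.I) • dirDeriv (svec (Sum.inl j)) (DY β b) := by
  unfold DY
  have hs := multiDeriv_smooth (fun i => (EuclideanSpace.single i (1 : ℝ), (0 : Rq q))) β hb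
  have e := dirDeriv_multiDeriv_single
    (fun i => (EuclideanSpace.single i (1 : ℝ), (0 : Rq q))) β j hb
  have e' : (svec (Sum.inl j) : Rq q × Rq q) = (EuclideanSpace.single j (1 : ℝ), 0) := rfl
  rw [dirDeriv_smul _ _ hs, e', e, mlen_add_single, pow_succ, smul_smul, mul_comm]

theorem partialEta_add_single (α : Fin q → ℕ) (j : Fin q) (ha : ContDiff ℝ ∞ a) :
    partialEta (α + Pi.single j 1) a = dirDeriv (svec (Sum.inr j)) (partialEta α a) :=
  (dirDeriv_multiDeriv_single (fun i => ((0 : Rq q), EuclideanSpace.single i (1 : ℝ))) α j ha).symm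

theorem partialEta_zero : partialEta 0 a = a := multiDeriv_zero _ a

theorem DY_zero : DY 0 b = b := by
  rw [DY, multiDeriv_zero, mlen_zero, pow_zero, one_smul]

/-- For `s = 0` the left factor is independent of `x` and the right one independent of `ξ`, so the
`ξ`-derivative falls on `a` and the `x`-derivative on `b`. -/
theorem mixed_prodAmp (ha : ContDiff ℝ ∞ a) (hb : ContDiff ℝ ∞ b) :
    mixed (prodAmp 0 B a b) = ∑ j, prodAmp 0 B (dirDeriv (svec (Sum.inr j)) a)
      ((-Complex.I) • dirDeriv (svec (Sum.inl j)) b) := by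
  unfold mixed
  refine Finset.sum_congr rfl fun j _ => ?_
  have e1 : dirDeriv (dX j) (prodAmp 0 B a b) =
      prodAmp 0 B a (dirDeriv (svec (Sum.inl j)) b) := by
    rw [dX, dirDeriv_prodAmp ha hb]
    simp [coefL, coefR, flat]
  have e2 : dirDeriv (dXi j) (prodAmp 0 B a (dirDeriv (svec (Sum.inl j)) b)) =
      prodAmp 0 B (dirDeriv (svec (Sum.inr j)) a) (dirDeriv (svec (Sum.inl j)) b) := by
    rw [dXi, dirDeriv_prodAmp ha (dirDeriv_smooth _ hb)]
    simp [coefL, coefR, flat]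
  rw [e1, e2, prodAmp_smul_right]

theorem mixed_sum {ι : Type*} (s : Finset ι) {P : ι → Amp q → W₃}
    (hP : ∀ i ∈ s, ContDiff ℝ ∞ (P i)) : mixed (∑ i ∈ s, P i) = ∑ i ∈ s, mixed (P i) := by
  classical
  induction s using Finset.induction_on with
  | empty =>
    have := mixed_smul (q := q) (W := W₃) 0 (P := 0) contDiff_const
    simpa using this
  | insert i s hi ih =>
    rw [Finset.sum_insert hi, Finset.sum_insert hi,
      mixed_add (hP i (Finset.mem_insert_self i s))
        (contDiff_finsetSum_fun s fun j hj => hP j (Finset.mem_insert_of_mem hj)),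
      ih fun j hj => hP j (Finset.mem_insert_of_mem hj)]

/-- The multinomial theorem for `∑_j ∂_{η_j} ⊗ D_{y_j}`. Its factor `k!` cancels against the
coefficients of `taylor`, which leaves the coefficients `1/α!` of the Leibniz expansion. -/
theorem iterate_mixed_prodAmp (ha : ContDiff ℝ ∞ a) (hb : ContDiff ℝ ∞ b) (k : ℕ) :
    mixed^[k] (prodAmp 0 B a b) = (k.factorial : ℂ) •
      ∑ α ∈ Finset.piAntidiag (Finset.univ : Finset (Fin q)) k,
        ((mfact α : ℂ)⁻¹) • prodAmp 0 B (partialEta α a) (DY α b) := by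
  have hs : ∀ α : Fin q → ℕ, ContDiff ℝ ∞ (prodAmp 0 B (partialEta α a) (DY α b)) := fun α =>
    prodAmp_smooth (partialEta_smooth α ha) (DY_smooth α hb)
  have hs' : ∀ α : Fin q → ℕ,
      ContDiff ℝ ∞ (((mfact α : ℂ)⁻¹) • prodAmp 0 B (partialEta α a) (DY α b)) := fun α =>
    contDiff_const.smul (hs α)
  induction k with
  | zero =>
    have e : Finset.piAntidiag (Finset.univ : Finset (Fin q)) 0 = {0} := by
      simp
    rw [e, Finset.sum_singleton, partialEta_zero, DY_zero]
    simp [mfact]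
  | succ k ih =>
    rw [Function.iterate_succ_apply', ih, mixed_smul _ (contDiff_finsetSum_fun _ fun α _ => hs' α),
      mixed_sum _ fun α _ => hs' α]
    have e : ∀ α ∈ Finset.piAntidiag (Finset.univ : Finset (Fin q)) k,
        mixed (((mfact α : ℂ)⁻¹) • prodAmp 0 B (partialEta α a) (DY α b)) =
        ∑ j, ((mfact α : ℂ)⁻¹) • prodAmp 0 B (partialEta (α + Pi.single j 1) a)
          (DY (α + Pi.single j 1) b) := fun α _ => by
      rw [mixed_smul _ (hs α), mixed_prodAmp (partialEta_smooth α ha) (DY_smooth α hb),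
        Finset.smul_sum]
      refine Finset.sum_congr rfl fun j _ => ?_
      rw [partialEta_add_single α j ha, DY_add_single α j hb]
    rw [Finset.sum_congr rfl e,
      sum_piAntidiag_add_single k fun α => prodAmp 0 B (partialEta α a) (DY α b), smul_smul,
      Nat.factorial_succ]
    congr 1
    push_cast; ring

theorem taylor_prodAmp (ha : ContDiff ℝ ∞ a) (hb : ContDiff ℝ ∞ b) (N : ℕ) (θ : Rq q × Rq q) :
    taylor N (prodAmp 0 B a b) θ = ∑ k ∈ Finset.range N,
      ∑ α ∈ Finset.piAntidiag (Finset.univ : Finset (Fin q)) k,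
        ((mfact α : ℂ)⁻¹) • B (partialEta α a θ) (DY α b θ) := by
  unfold taylor
  refine Finset.sum_congr rfl fun k _ => ?_
  rw [iterate_mixed_prodAmp ha hb, Pi.smul_apply, smul_smul,
    inv_mul_cancel₀ (by exact_mod_cast Nat.factorial_ne_zero k), one_smul, Finset.sum_apply]
  refine Finset.sum_congr rfl fun α _ => ?_
  simp [prodAmp]

end Leibniz

/-! ### Composition of operators -/

section Composition

variable {q : ℕ} {W W₁ W₂ W₃ U V F : Type*} [NormedAddCommGroup W] [NormedSpace ℂ W]
  [NormedAddCommGroup W₁] [NormedSpace ℂ W₁] [NormedAddCommGroup W₂] [NormedSpace ℂ W₂]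
  [NormedAddCommGroup W₃] [NormedSpace ℂ W₃] [NormedAddCommGroup U] [NormedSpace ℂ U]
  [NormedAddCommGroup V] [NormedSpace ℂ V] [NormedAddCommGroup F] [NormedSpace ℂ F]
  {ϱ δ p p₁ p₂ m m₁ mb C : ℝ} {L : List (Fin q)} {Θ₁ : Twist q W₁} {Θ₂ : Twist q W₂}
  {Θ₃ : Twist q W₃} {B : W₁ →L[ℂ] W₂ →L[ℂ] W₃} {a : Rq q × Rq q → W₁} {b : Rq q × Rq q → W₂}

/-- In effect `Op_τ(a) = Op_0(requant τ a)`: the composition formula with `b = 1`, where `u` is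
represented by Fourier inversion. -/
theorem osc_prodAmp_eq_requant [CompleteSpace W] [CompleteSpace U] [CompleteSpace F] (hϱ : |ϱ| ≤ 1)
    (hL : Adm δ |p| L) {a : Rq q × Rq q → W} (ha : SymClass (Twist.triv q W) ϱ δ p m a)
    (β : W →L[ℂ] U →L[ℂ] F) (τ : ℝ) (u : 𝓢(Rq q, U)) (y : Rq q) :
    osc (wt []) (prodAmp τ β a (liftY u)) (y, 0) =
      ∫ η, ek (-y) η • β (requant L τ a (y, η)) (ft u η) :=
  osc_prodAmp_eq hϱ (by simpa using hL) ha symClass_one (scalarPairing W) β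
    (ContinuousLinearMap.lsmul ℂ ℂ) β (fun w c u => by simp [scalarPairing_apply]) u
    (ft_continuous u) (ft_rapidDecay u) (fun y => by
      rw [ft_inversion u y]
      simp) y

theorem two_pi_ne_zero' : ((((2 * Real.pi) ^ q)⁻¹ : ℝ) : ℂ) ≠ 0 := by
  rw [Ne, Complex.ofReal_eq_zero]
  positivity

/-- After passing to `τ = 0` the symbols agree by `symbol_unique`, and the change of quantization is
invertible. -/
theorem quantization_injective [CompleteSpace W] [CompleteSpace U] [CompleteSpace F] (hδϱ : δ < ϱ)
    (hϱ : |ϱ| ≤ 1) (hL : Adm δ |p| L) {a a' : Rq q × Rq q → W}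
    (ha : SymClass (Twist.triv q W) ϱ δ p m a) (ha' : SymClass (Twist.triv q W) ϱ δ p m a')
    (β : W →L[ℂ] U →L[ℂ] F) (hβ : ∀ w, (∀ u, β w u = 0) → w = 0) (τ : ℝ)
    (h : ∀ (u : 𝓢(Rq q, U)) (y : Rq q), osc (wt []) (prodAmp τ β a (liftY u)) (y, 0) =
      osc (wt []) (prodAmp τ β a' (liftY u)) (y, 0)) : a = a' := by
  have h1 : requant L τ a = requant L τ a' := by
    refine symbol_unique β hβ (requant_smooth hϱ hL ha τ).continuous
      (requant_smooth hϱ hL ha' τ).continuous fun u y => ?_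
    rw [← osc_prodAmp_eq_requant hϱ hL ha, ← osc_prodAmp_eq_requant hϱ hL ha', h]
  rw [← requant_neg_requant hδϱ hϱ hL ha τ, h1, requant_neg_requant hδϱ hϱ hL ha' τ]

/-- The symbol of the composition of two operators in the standard quantization. -/
def starProd (L : List (Fin q)) (B : W₁ →L[ℂ] W₂ →L[ℂ] W₃) (a : Rq q × Rq q → W₁)
    (b : Rq q × Rq q → W₂) : Rq q × Rq q → W₃ :=
  oint L (prodAmp 0 B a b)

theorem SymClass.ampReg_prodAmp (hϱ : |ϱ| ≤ 1) (hδ : 0 ≤ δ) (hB : Compat Θ₁ Θ₂ Θ₃ B C)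
    (ha : SymClass Θ₁ ϱ δ p₁ m₁ a) (hb : SymClass Θ₂ ϱ δ p₂ mb b) :
    AmpReg Θ₃ ϱ δ (p₁ + p₂) (|p₁| + |p₂|) (EdgeCalculus.prodAmp 0 B a b) :=
  ⟨_, _, add_nonneg (abs_nonneg _) Θ₁.κ_nonneg, ha.prodAmp hb hϱ hδ hB
    fun y x => weights_le p₁ p₂ (s := 0) (T := 0) (by simp) y x⟩

theorem exists_symEst_starRemainder [CompleteSpace W₃] (hδϱ : δ < ϱ) (hϱ : |ϱ| ≤ 1)
    (hL : Adm δ (|p₁| + |p₂|) L) (hB : Compat Θ₁ Θ₂ Θ₃ B C) (m₁ mb : ℝ) (N n : ℕ) :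
    ∃ n' : ℕ, ∃ C' ≥ (0 : ℝ), ∀ Λ₁ Λ₂ a b, SymClass Θ₁ ϱ δ p₁ m₁ a → SymClass Θ₂ ϱ δ p₂ mb b →
      SymEst Θ₁ ϱ δ p₁ n' m₁ Λ₁ a → SymEst Θ₂ ϱ δ p₂ n' mb Λ₂ b →
      SymEst Θ₃ ϱ δ (p₁ + p₂) n (m₁ + mb - (ϱ - δ) * N) (C' * Λ₁ * Λ₂)
        (remainder L N (prodAmp 0 B a b)) := by
  have hK : 0 ≤ |m₁| + Θ₁.κ := add_nonneg (abs_nonneg _) Θ₁.κ_nonneg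
  obtain ⟨n', C', hC', h⟩ := exists_symEst_remainder hδϱ hL (by positivity) Θ₃ (p₁ + p₂) N n hK
  have hw := fun y x : Rq q => weights_le p₁ p₂ (s := 0) (T := 0) (by simp) y x
  have h0 := Θ₁.c_nonneg
  have h0' := hB.1
  refine ⟨n', C' * ((2 + 0) ^ n' * (C * Θ₁.c * ((2 * (1 + 0)) ^ |p₁| * 4 ^ |p₂|))), by positivity,
    fun Λ₁ Λ₂ a b ha hb h₁ h₂ => ?_⟩
  have h1 := prodAmp_est hϱ hL.nonneg hB hw (T := 0) (by simp) n' (m₁ := m₁) (d₁ := 0) (mb := mb)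
    (d₂ := 0) le_rfl le_rfl le_rfl ha.1 hb.1 (by rwa [add_zero]) (by rwa [add_zero])
  rw [add_zero] at h1
  convert h _ _ _ (ha.ampReg_prodAmp hϱ hL.nonneg hB hb) h1 using 1
  ring

theorem exists_symEst_starProd [CompleteSpace W₃] (hδϱ : δ < ϱ) (hϱ : |ϱ| ≤ 1)
    (hL : Adm δ (|p₁| + |p₂|) L) (hB : Compat Θ₁ Θ₂ Θ₃ B C) (m₁ mb : ℝ) (n : ℕ) :
    ∃ n' : ℕ, ∃ C' ≥ (0 : ℝ), ∀ Λ₁ Λ₂ a b, SymClass Θ₁ ϱ δ p₁ m₁ a → SymClass Θ₂ ϱ δ p₂ mb b →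
      SymEst Θ₁ ϱ δ p₁ n' m₁ Λ₁ a → SymEst Θ₂ ϱ δ p₂ n' mb Λ₂ b →
      SymEst Θ₃ ϱ δ (p₁ + p₂) n (m₁ + mb) (C' * Λ₁ * Λ₂) (starProd L B a b) := by
  obtain ⟨n', C', hC', h⟩ := exists_symEst_starRemainder hδϱ hϱ hL hB m₁ mb 0 n
  refine ⟨n', C', hC', fun Λ₁ Λ₂ a b ha hb h₁ h₂ => ?_⟩
  have e : remainder L 0 (prodAmp 0 B a b) = starProd L B a b := by
    funext θ
    simp [remainder, taylor, starProd]
  have := h Λ₁ Λ₂ a b ha hb h₁ h₂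
  rw [e] at this
  simpa using this

theorem starProd_smooth [CompleteSpace W₃] (hϱ : |ϱ| ≤ 1) (hL : Adm δ (|p₁| + |p₂|) L)
    (hB : Compat Θ₁ Θ₂ Θ₃ B C) (ha : SymClass Θ₁ ϱ δ p₁ m₁ a) (hb : SymClass Θ₂ ϱ δ p₂ mb b) :
    ContDiff ℝ ∞ (starProd L B a b) :=
  oint_smooth hL ((ha.ampReg_prodAmp hϱ hL.nonneg hB hb).tame hL.nonneg)

theorem SymClass.starProd [CompleteSpace W₃] (hδϱ : δ < ϱ) (hϱ : |ϱ| ≤ 1)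
    (hL : Adm δ (|p₁| + |p₂|) L) (hB : Compat Θ₁ Θ₂ Θ₃ B C) (ha : SymClass Θ₁ ϱ δ p₁ m₁ a)
    (hb : SymClass Θ₂ ϱ δ p₂ mb b) :
    SymClass Θ₃ ϱ δ (p₁ + p₂) (m₁ + mb) (EdgeCalculus.starProd L B a b) := by
  refine ⟨starProd_smooth hϱ hL hB ha hb, fun n => ?_⟩
  obtain ⟨n', C', -, h⟩ := exists_symEst_starProd hδϱ hϱ hL hB m₁ mb n
  obtain ⟨Λ₁, h₁⟩ := ha.2 n'
  obtain ⟨Λ₂, h₂⟩ := hb.2 n'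
  exact ⟨_, h Λ₁ Λ₂ a b ha hb h₁ h₂⟩

/-- The `τ₃`-symbol of the composition of the operators with `τ₁`-symbol `a` and `τ₂`-symbol
`b`. -/
def compSymbol (L : List (Fin q)) (B : W₁ →L[ℂ] W₂ →L[ℂ] W₃) (τ₁ τ₂ τ₃ : ℝ)
    (a : Rq q × Rq q → W₁) (b : Rq q × Rq q → W₂) : Rq q × Rq q → W₃ :=
  requant L (-τ₃) (starProd L B (requant L τ₁ a) (requant L τ₂ b))

variable [CompleteSpace W₁] [CompleteSpace W₂] [CompleteSpace W₃]

theorem Adm.left (hL : Adm δ (|p₁| + |p₂|) L) : Adm δ |p₁| L :=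
  hL.mono (le_add_of_nonneg_right (abs_nonneg _))

theorem Adm.right (hL : Adm δ (|p₁| + |p₂|) L) : Adm δ |p₂| L :=
  hL.mono (le_add_of_nonneg_left (abs_nonneg _))

theorem Adm.add (hL : Adm δ (|p₁| + |p₂|) L) : Adm δ |p₁ + p₂| L :=
  hL.mono (abs_add_le _ _)

theorem SymClass.compSymbol (hδϱ : δ < ϱ) (hϱ : |ϱ| ≤ 1) (hL : Adm δ (|p₁| + |p₂|) L)
    (hB : Compat Θ₁ Θ₂ Θ₃ B C) (ha : SymClass Θ₁ ϱ δ p₁ m₁ a) (hb : SymClass Θ₂ ϱ δ p₂ mb b)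
    (τ₁ τ₂ τ₃ : ℝ) :
    SymClass Θ₃ ϱ δ (p₁ + p₂) (m₁ + mb) (EdgeCalculus.compSymbol L B τ₁ τ₂ τ₃ a b) :=
  (SymClass.starProd hδϱ hϱ hL hB (ha.requant hδϱ hϱ hL.left τ₁)
    (hb.requant hδϱ hϱ hL.right τ₂)).requant hδϱ hϱ hL.add (-τ₃)

theorem exists_symEst_compSymbol (hδϱ : δ < ϱ) (hϱ : |ϱ| ≤ 1) (hL : Adm δ (|p₁| + |p₂|) L)
    (hB : Compat Θ₁ Θ₂ Θ₃ B C) (m₁ mb : ℝ) (τ₁ τ₂ τ₃ : ℝ) (n : ℕ) :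
    ∃ n' : ℕ, ∃ C' ≥ (0 : ℝ), ∀ Λ₁ Λ₂ a b, SymClass Θ₁ ϱ δ p₁ m₁ a → SymClass Θ₂ ϱ δ p₂ mb b →
      SymEst Θ₁ ϱ δ p₁ n' m₁ Λ₁ a → SymEst Θ₂ ϱ δ p₂ n' mb Λ₂ b →
      SymEst Θ₃ ϱ δ (p₁ + p₂) n (m₁ + mb) (C' * Λ₁ * Λ₂) (compSymbol L B τ₁ τ₂ τ₃ a b) := by
  obtain ⟨n₃, C₃, h₃, k₃⟩ := exists_symEst_requant hδϱ hϱ hL.add Θ₃ (m₁ + mb) |τ₃| n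
  obtain ⟨n₀, C₀, h₀, k₀⟩ := exists_symEst_starProd hδϱ hϱ hL hB m₁ mb n₃
  obtain ⟨n₁, C₁, h₁, k₁⟩ := exists_symEst_requant hδϱ hϱ hL.left Θ₁ m₁ |τ₁| n₀
  obtain ⟨n₂, C₂, h₂, k₂⟩ := exists_symEst_requant hδϱ hϱ hL.right Θ₂ mb |τ₂| n₀
  refine ⟨max n₁ n₂, C₃ * (C₀ * C₁ * C₂), by positivity, fun Λ₁ Λ₂ a b ha hb l₁ l₂ => ?_⟩
  have ha' := ha.requant hδϱ hϱ hL.left τ₁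
  have hb' := hb.requant hδϱ hϱ hL.right τ₂
  have e₁ := k₁ τ₁ le_rfl Λ₁ a ha (l₁.of_le (le_max_left _ _))
  have e₂ := k₂ τ₂ le_rfl Λ₂ b hb (l₂.of_le (le_max_right _ _))
  have e₀ := k₀ _ _ _ _ ha' hb' e₁ e₂
  have e₃ := k₃ (-τ₃) (abs_neg τ₃).le _ _ (SymClass.starProd hδϱ hϱ hL hB ha' hb') e₀
  convert e₃ using 1
  · ring
  · rfl

/-- Both factors are rewritten in the `0`-quantization, where `starProd` is the symbol of the
composition; converting `compSymbol` with `τ₃` undoes its conversion with `-τ₃`. -/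
theorem osc_compSymbol [CompleteSpace U] [CompleteSpace V] [CompleteSpace F] (hδϱ : δ < ϱ)
    (hϱ : |ϱ| ≤ 1) (hL : Adm δ (|p₁| + |p₂|) L)
    (ha : SymClass (Twist.triv q W₁) ϱ δ p₁ m₁ a) (hb : SymClass (Twist.triv q W₂) ϱ δ p₂ mb b)
    (β₁ : W₁ →L[ℂ] V →L[ℂ] F) (β₂ : W₂ →L[ℂ] U →L[ℂ] V)
    (β₃ : W₃ →L[ℂ] U →L[ℂ] F) (hβ : ∀ a b u, β₃ (B a b) u = β₁ a (β₂ b u)) (τ₁ τ₂ τ₃ : ℝ)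
    (u : 𝓢(Rq q, U)) (v : 𝓢(Rq q, V))
    (hv : ∀ y, v y = ((((2 * Real.pi) ^ q)⁻¹ : ℝ) : ℂ) •
      osc (wt []) (prodAmp τ₂ β₂ b (liftY u)) (y, 0)) (y : Rq q) :
    osc (wt []) (prodAmp τ₃ β₃ (compSymbol L B τ₁ τ₂ τ₃ a b) (liftY u)) (y, 0) =
      osc (wt []) (prodAmp τ₁ β₁ a (liftY v)) (y, 0) := by
  have ha' := ha.requant hδϱ hϱ hL.left τ₁
  have hb' := hb.requant hδϱ hϱ hL.right τ₂
  have hc := SymClass.starProd hδϱ hϱ hL (compat_triv (q := q) B) ha' hb'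
  have e := requant_neg_requant hδϱ hϱ hL.add hc (-τ₃)
  rw [neg_neg] at e
  rw [osc_prodAmp_eq_requant hϱ hL.add
    (SymClass.compSymbol hδϱ hϱ hL (compat_triv B) ha hb τ₁ τ₂ τ₃), compSymbol, e,
    osc_prodAmp_eq_requant hϱ hL.left ha, ← osc_prodAmp_zero β₁, starProd]
  refine (osc_prodAmp_eq hϱ hL ha' hb' B β₁ β₂ β₃ hβ v (ft_continuous u) (ft_rapidDecay u)
    (fun y => ?_) y).symm
  rw [hv, osc_prodAmp_eq_requant hϱ hL.right hb]

end Composition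



/-! ### Operator-valued symbols -/

section IdealSymbols

variable {q : ℕ} {I : BanachOperatorIdeal.{u}} {E F : Type u}
  [NormedAddCommGroup E] [InnerProductSpace ℂ E] [CompleteSpace E]
  [TopologicalSpace.SeparableSpace E]
  [NormedAddCommGroup F] [InnerProductSpace ℂ F] [CompleteSpace F]
  [TopologicalSpace.SeparableSpace F]
  {κE : GroupAction E} {κF : GroupAction F} {ϱ δ τ p m : ℝ} {μ : ℝ × ℝ}

/-- With `y' = y + x` the point `τ y' + (1 - τ) y` becomes `y + τ x`, and the phase becomes `-xη`.
-/
theorem opIntegrand_add (a : Rq q × Rq q → I.Ops E F) (u : 𝓢(Rq q, E)) (y η x : Rq q) :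
    opIntegrand τ a u y η (y + x) =
      ek x η • wt [] x • prodAmp τ (opsPairing I E F) a (liftY u) ((y, 0), (x, η)) := by
  have e1 : τ • (y + x) + (1 - τ) • y = y + τ • x := by
    rw [smul_add, sub_smul, one_smul]; abel
  have e2 : y - (y + x) = -x := by abel
  rw [opIntegrand, e1, e2, inner_neg_left, Complex.ofReal_neg, mul_neg, prodAmp_apply, zero_add,
    opsPairing_apply]
  simp [ek, wt, liftY]

theorem integral_opIntegrand (a : Rq q × Rq q → I.Ops E F) (u : 𝓢(Rq q, E)) (y η : Rq q) :
    ∫ y', opIntegrand τ a u y η y' =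
      Phi (wt []) (prodAmp τ (opsPairing I E F) a (liftY u)) (y, 0) η := by
  rw [← integral_add_left_eq_self _ y]
  exact integral_congr_ae (Filter.Eventually.of_forall fun x => opIntegrand_add a u y η x)

/-- The decay of `u` makes the integral without regularization converge as an iterated integral, so
the convergence statements in `IsOp` are automatic for symbols. -/
theorem isOp_iff (hδ : 0 ≤ δ) (hδ' : δ < 1) (hϱ : |ϱ| ≤ 1) {a : Rq q × Rq q → I.Ops E F}
    (ha : SymClass (Twist.triv q (I.Ops E F)) ϱ δ p m a) {A : 𝓢(Rq q, E) →L[ℂ] 𝓢(Rq q, F)} :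
    IsOp τ a A ↔ ∀ u y, A u y = ((((2 * Real.pi) ^ q)⁻¹ : ℝ) : ℂ) •
      osc (wt []) (prodAmp τ (opsPairing I E F) a (liftY u)) (y, 0) := by
  have hw := (adm_nil (q := q) hδ hδ').weight.mono (l' := 0) (by linarith)
  have hkl : -((q : ℝ) + 2) + (q + 1) ≤ 0 := by linarith
  have ht := fun u => tame_prodAmp_liftY hϱ hδ (τ := τ) (opsPairing I E F) ha (v := u)
  have key : ∀ (u : 𝓢(Rq q, E)) y, (((2 * Real.pi) ^ q)⁻¹ : ℝ) •
      ∫ η, ∫ y', opIntegrand τ a u y η y' = ((((2 * Real.pi) ^ q)⁻¹ : ℝ) : ℂ) •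
      osc (wt []) (prodAmp τ (opsPairing I E F) a (liftY u)) (y, 0) := fun u y => by
    simp only [integral_opIntegrand]
    rw [Complex.coe_smul]
    rfl
  constructor
  · intro h u y
    rw [(h u y).2.2, key]
  · intro h u y
    refine ⟨fun η => ?_, ?_, by rw [key, h]⟩
    · rw [← (measurePreserving_add_left volume y).integrable_comp_emb
        (MeasurableEquiv.addLeft y).measurableEmbedding]
      refine (Phi_integrand_integrable hw hkl (ht u) (y, 0) η).congr ?_
      exact Filter.Eventually.of_forall fun x => (opIntegrand_add a u y η x).symm
    · simp only [integral_opIntegrand]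
      exact Phi_integrable hδ hδ' hw hkl (ht u) (y, 0)

theorem norm_twist_DY (a : Rq q × Rq q → I.Ops E F) (α β : Fin q → ℕ) (y η : Rq q) :
    ‖twist I κE κF (bracket η) (DY β (partialEta α a) (y, η))‖ =
      ‖(opsTwist q I κE κF).act η (multiDeriv (fun i => svec (Sum.inl i)) β
        (multiDeriv (fun i => svec (Sum.inr i)) α a) (y, η))‖ := by
  rw [DY, Pi.smul_apply, twist_smul, norm_smul, norm_pow, norm_neg, Complex.norm_I, one_pow,
    one_mul]
  rfl

theorem SymEst.symbolEstimate {a : Rq q × Rq q → I.Ops E F} {α β : Fin q → ℕ} {C : ℝ}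
    (h : SymEst (opsTwist q I κE κF) ϱ δ μ.2 (mlen α + mlen β) μ.1 C a) :
    SymbolEstimate I κE κF ϱ δ μ α β a C := fun y η => by
  rw [norm_twist_DY]
  refine (SymEst.multiDeriv α β (n := 0) ?_).base y η
  rwa [zero_add, add_comm]

theorem SymClass.mem_symbolSubmodule {a : Rq q × Rq q → I.Ops E F}
    (h : SymClass (opsTwist q I κE κF) ϱ δ μ.2 μ.1 a) : a ∈ symbolSubmodule I κE κF q ϱ δ μ :=
  ⟨h.1, fun α β => by
    obtain ⟨C, hC⟩ := h.2 (mlen α + mlen β)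
    exact ⟨C, hC.nonneg, hC.symbolEstimate⟩⟩

/-! ### Seminorms and topology of the symbol space. -/

theorem symbolSeminorm_le {a : SymbolSpace I κE κF q ϱ δ μ} {α β : Fin q → ℕ} {C : ℝ} (hC : 0 ≤ C)
    (h : SymbolEstimate I κE κF ϱ δ μ α β a.1 C) : symbolSeminorm I κE κF ϱ δ μ α β a ≤ C :=
  csInf_le ⟨0, fun _ h => h.1⟩ ⟨hC, h⟩

theorem symbolEstimate_symbolSeminorm (a : SymbolSpace I κE κF q ϱ δ μ) (α β : Fin q → ℕ) :
    SymbolEstimate I κE κF ϱ δ μ α β a.1 (symbolSeminorm I κE κF ϱ δ μ α β a) := fun y η => by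
  have hpos : 0 < (bracket y : ℝ) ^ μ.2 * (bracket η : ℝ) ^ (μ.1 - ϱ * mlen α + δ * mlen β) :=
    mul_pos (Real.rpow_pos_of_pos (bracket y).2 _) (Real.rpow_pos_of_pos (bracket η).2 _)
  rw [← div_le_iff₀ hpos]
  exact le_csInf (a.2.2 α β) fun C hC => (div_le_iff₀ hpos).2 (hC.2 y η)

/-- The sum of the seminorms which involve at most `n` derivatives in each variable. -/
def symbolSum (n : ℕ) (a : SymbolSpace I κE κF q ϱ δ μ) : ℝ :=
  ∑ s ∈ Finset.Icc (0 : Fin q → ℕ) (fun _ => n) ×ˢ Finset.Icc (0 : Fin q → ℕ) (fun _ => n),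
    symbolSeminorm I κE κF ϱ δ μ s.1 s.2 a

theorem withSeminorms_symbolSeminorm : WithSeminorms (𝕜 := ℂ) (E := SymbolSpace I κE κF q ϱ δ μ)
    fun s : (Fin q → ℕ) × (Fin q → ℕ) => symbolSeminorm I κE κF ϱ δ μ s.1 s.2 := ⟨rfl⟩

theorem continuous_symbolSum (n : ℕ) :
    Continuous (symbolSum n : SymbolSpace I κE κF q ϱ δ μ → ℝ) :=
  continuous_finsetSum _ fun s _ => withSeminorms_symbolSeminorm.continuous_seminorm s

theorem symbolSum_zero (n : ℕ) : symbolSum n (0 : SymbolSpace I κE κF q ϱ δ μ) = 0 :=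
  Finset.sum_eq_zero fun _ _ => map_zero _

theorem mem_Icc_of_mlen_le {n : ℕ} {γ : Fin q → ℕ} (hγ : mlen γ ≤ n) :
    γ ∈ Finset.Icc (0 : Fin q → ℕ) (fun _ => n) :=
  Finset.mem_Icc.2 ⟨fun _ => Nat.zero_le _, fun i =>
    (Finset.single_le_sum (f := γ) (fun _ _ => Nat.zero_le _) (Finset.mem_univ i)).trans hγ⟩

theorem symbolSeminorm_le_sum (S : Finset ((Fin q → ℕ) × (Fin q → ℕ)))
    (a : SymbolSpace I κE κF q ϱ δ μ) {s : (Fin q → ℕ) × (Fin q → ℕ)} (h : s ∈ S) :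
    symbolSeminorm I κE κF ϱ δ μ s.1 s.2 a ≤ ∑ s ∈ S, symbolSeminorm I κE κF ϱ δ μ s.1 s.2 a :=
  Finset.single_le_sum (f := fun s : (Fin q → ℕ) × (Fin q → ℕ) =>
      symbolSeminorm I κE κF ϱ δ μ s.1 s.2 a)
    (fun s _ => apply_nonneg (symbolSeminorm I κE κF ϱ δ μ s.1 s.2) a) h

theorem symbolSeminorm_le_symbolSum {n : ℕ} (a : SymbolSpace I κE κF q ϱ δ μ) {α β : Fin q → ℕ}
    (hα : mlen α ≤ n) (hβ : mlen β ≤ n) : symbolSeminorm I κE κF ϱ δ μ α β a ≤ symbolSum n a :=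
  symbolSeminorm_le_sum _ a (s := (α, β))
    (Finset.mk_mem_product (mem_Icc_of_mlen_le hα) (mem_Icc_of_mlen_le hβ))

/-- The bridge from the topology to the estimates: a single continuous function of the symbol serves
as the common constant for all derivatives up to order `n`. -/
theorem symEst_symbolSum (n : ℕ) (a : SymbolSpace I κE κF q ϱ δ μ) :
    SymEst (opsTwist q I κE κF) ϱ δ μ.2 n μ.1 (symbolSum n a) a.1 := by
  refine symEst_of_multiDeriv a.2.1 n fun α β h y η => ?_
  have h1 := symbolEstimate_symbolSeminorm a α β y η
  rw [norm_twist_DY] at h1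
  refine h1.trans ?_
  have hpos : 0 ≤ (bracket y : ℝ) ^ μ.2 * (bracket η : ℝ) ^ (μ.1 - ϱ * mlen α + δ * mlen β) :=
    mul_nonneg (Real.rpow_nonneg (bracket y).2.le _) (Real.rpow_nonneg (bracket η).2.le _)
  have h2 := symbolSeminorm_le_symbolSum a ((Nat.le_add_right _ _).trans h)
    ((Nat.le_add_left _ _).trans h)
  exact mul_le_mul_of_nonneg_right h2 hpos

theorem symClass_symbolSpace (a : SymbolSpace I κE κF q ϱ δ μ) :
    SymClass (opsTwist q I κE κF) ϱ δ μ.2 μ.1 a.1 :=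
  ⟨a.2.1, fun n => ⟨_, symEst_symbolSum n a⟩⟩

theorem isOp_unique (hδ : 0 ≤ δ) (hδϱ : δ < ϱ) (hϱ : ϱ ≤ 1) (a b : SymbolSpace I κE κF q ϱ δ μ)
    {A : 𝓢(Rq q, E) →L[ℂ] 𝓢(Rq q, F)} (ha : IsOp τ a.1 A) (hb : IsOp τ b.1 A) : a = b := by
  have hϱ' : |ϱ| ≤ 1 := abs_le.2 ⟨by linarith, hϱ⟩
  have hδ' : δ < 1 := by linarith
  have sa := (symClass_symbolSpace a).untwist
  have sb := (symClass_symbolSpace b).untwist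
  obtain ⟨M, hM⟩ := exists_nat_ge (|μ.2| + (q + 2))
  refine Subtype.ext (quantization_injective hδϱ hϱ' (adm_fullList hδ hδ' hM) sa sb
    (opsPairing I E F) (fun w hw => Subtype.ext (ContinuousLinearMap.ext hw)) τ fun u y => ?_)
  have e1 := (isOp_iff hδ hδ' hϱ' sa).1 ha u y
  have e2 := (isOp_iff hδ hδ' hϱ' sb).1 hb u y
  rw [e1] at e2
  exact smul_right_injective _ two_pi_ne_zero' e2

theorem quantizationBijective (I : BanachOperatorIdeal.{u}) (κE : GroupAction E)
    (κF : GroupAction F) (q : ℕ) (τ : ℝ) (hδ : 0 ≤ δ) (hδϱ : δ < ϱ) (hϱ : ϱ ≤ 1) (μ : ℝ × ℝ) :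
    QuantizationBijective I κE κF τ ϱ δ μ q := by
  have hϱ' : |ϱ| ≤ 1 := abs_le.2 ⟨by linarith, hϱ⟩
  have hδ' : δ < 1 := by linarith
  refine ⟨fun a => ?_, fun a b A ha hb => isOp_unique hδ hδϱ hϱ a b ha hb⟩
  have sa := (symClass_symbolSpace a).untwist
  obtain ⟨A, hA⟩ := exists_quantization (τ := τ) hδ hδ' hδϱ hϱ' (opsPairing I E F) sa
  exact ⟨A, (isOp_iff hδ hδ' hϱ' sa).2 hA⟩

/-! ### The symbol map on the operator space. -/

theorem Psi.isOp_symbol (A : Psi I κE κF q τ ϱ δ μ) : IsOp τ A.symbol.1 A.1 := A.2.choose_spec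

theorem Psi.continuous_symbol :
    Continuous (Psi.symbol : Psi I κE κF q τ ϱ δ μ → SymbolSpace I κE κF q ϱ δ μ) :=
  continuous_induced_dom

/-- By uniqueness the chosen symbol is the only one; therefore the symbol map is additive and can be
computed for compositions. -/
theorem Psi.symbol_eq (hδ : 0 ≤ δ) (hδϱ : δ < ϱ) (hϱ : ϱ ≤ 1) {A : Psi I κE κF q τ ϱ δ μ}
    {a : SymbolSpace I κE κF q ϱ δ μ} (ha : IsOp τ a.1 A.1) : A.symbol = a :=
  isOp_unique hδ hδϱ hϱ _ _ A.isOp_symbol ha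

theorem Psi.symbol_add (hδ : 0 ≤ δ) (hδϱ : δ < ϱ) (hϱ : ϱ ≤ 1) (A B : Psi I κE κF q τ ϱ δ μ) :
    (A + B).symbol = A.symbol + B.symbol :=
  Psi.symbol_eq hδ hδϱ hϱ (A.isOp_symbol.add B.isOp_symbol)

theorem Psi.symbol_sub (hδ : 0 ≤ δ) (hδϱ : δ < ϱ) (hϱ : ϱ ≤ 1) (A B : Psi I κE κF q τ ϱ δ μ) :
    (A - B).symbol = A.symbol - B.symbol := by
  have := Psi.symbol_add hδ hδϱ hϱ (A - B) B
  rw [sub_add_cancel] at this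
  rw [this, add_sub_cancel_right]

end IdealSymbols

/-! ### Composition of operators with symbols in operator ideals. -/

section IdealComposition

variable {q : ℕ} {E F G : Type u}
  [NormedAddCommGroup E] [InnerProductSpace ℂ E] [CompleteSpace E]
  [TopologicalSpace.SeparableSpace E]
  [NormedAddCommGroup F] [InnerProductSpace ℂ F] [CompleteSpace F]
  [TopologicalSpace.SeparableSpace F]
  [NormedAddCommGroup G] [InnerProductSpace ℂ G] [CompleteSpace G]
  [TopologicalSpace.SeparableSpace G]
  {κE : GroupAction E} {κF : GroupAction F} {κG : GroupAction G}
  {I₁ I₂ I₃ : BanachOperatorIdeal.{u}} {ϱ δ : ℝ} {μ₁ μ₂ : ℝ × ℝ} {L : List (Fin q)}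

/-- The `τ₃`-symbol of the composition of the operators with `τ₁`-symbol `a` and `τ₂`-symbol `b`,
as an element of the symbol space. -/
def symbolComp (hI : ComposesContinuously I₁ I₂ I₃) (hδϱ : δ < ϱ) (hϱ : |ϱ| ≤ 1)
    (hL : Adm δ (|μ₁.2| + |μ₂.2|) L) (τ₁ τ₂ τ₃ : ℝ) (a : SymbolSpace I₁ κF κG q ϱ δ μ₁)
    (b : SymbolSpace I₂ κE κF q ϱ δ μ₂) : SymbolSpace I₃ κE κG q ϱ δ (μ₁ + μ₂) :=
  ⟨compSymbol L (hI.compL E F G) τ₁ τ₂ τ₃ a.1 b.1, SymClass.mem_symbolSubmodule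
    (SymClass.compSymbol hδϱ hϱ hL (hI.compat q κE κF κG) (symClass_symbolSpace a)
      (symClass_symbolSpace b) τ₁ τ₂ τ₃)⟩

theorem isOp_symbolComp (hI : ComposesContinuously I₁ I₂ I₃) (hδ : 0 ≤ δ) (hδ' : δ < 1)
    (hδϱ : δ < ϱ) (hϱ : |ϱ| ≤ 1) (hL : Adm δ (|μ₁.2| + |μ₂.2|) L) {τ₁ τ₂ : ℝ} (τ₃ : ℝ)
    (a : SymbolSpace I₁ κF κG q ϱ δ μ₁) (b : SymbolSpace I₂ κE κF q ϱ δ μ₂)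
    {A : 𝓢(Rq q, F) →L[ℂ] 𝓢(Rq q, G)} {B : 𝓢(Rq q, E) →L[ℂ] 𝓢(Rq q, F)}
    (hA : IsOp τ₁ a.1 A) (hB : IsOp τ₂ b.1 B) :
    IsOp τ₃ (symbolComp hI hδϱ hϱ hL τ₁ τ₂ τ₃ a b).1 (A ∘L B) := by
  have sa := (symClass_symbolSpace a).untwist
  have sb := (symClass_symbolSpace b).untwist
  rw [isOp_iff hδ hδ' hϱ sa] at hA
  rw [isOp_iff hδ hδ' hϱ sb] at hB
  refine (isOp_iff hδ hδ' hϱ (symClass_symbolSpace _).untwist).2 fun u y => ?_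
  have e := osc_compSymbol hδϱ hϱ hL sa sb (B := hI.compL E F G) (opsPairing I₁ F G)
    (opsPairing I₂ E F) (opsPairing I₃ E G) (fun _ _ _ => rfl) τ₁ τ₂ τ₃ u (B u) (hB u) y
  change A (B u) y = _
  rw [hA (B u) y, ← e]
  rfl

theorem exists_symbolSeminorm_symbolComp_le (hI : ComposesContinuously I₁ I₂ I₃)
    (hδϱ : δ < ϱ) (hϱ : |ϱ| ≤ 1) (hL : Adm δ (|μ₁.2| + |μ₂.2|) L) (τ₁ τ₂ τ₃ : ℝ)
    (α β : Fin q → ℕ) : ∃ n : ℕ, ∃ C ≥ (0 : ℝ), ∀ (a : SymbolSpace I₁ κF κG q ϱ δ μ₁)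
      (b : SymbolSpace I₂ κE κF q ϱ δ μ₂),
      symbolSeminorm I₃ κE κG ϱ δ (μ₁ + μ₂) α β (symbolComp hI hδϱ hϱ hL τ₁ τ₂ τ₃ a b) ≤
        C * symbolSum n a * symbolSum n b := by
  obtain ⟨n, C, hC, h⟩ := exists_symEst_compSymbol hδϱ hϱ hL (hI.compat q κE κF κG) μ₁.1 μ₂.1
    τ₁ τ₂ τ₃ (mlen α + mlen β)
  refine ⟨n, C, hC, fun a b => ?_⟩
  have h1 := h _ _ a.1 b.1 (symClass_symbolSpace a) (symClass_symbolSpace b) (symEst_symbolSum n a)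
    (symEst_symbolSum n b)
  exact symbolSeminorm_le h1.nonneg (SymEst.symbolEstimate h1)

/-- The composition of pseudodifferential operators as a bilinear map. -/
def psiComp (hI : ComposesContinuously I₁ I₂ I₃) (hδ : 0 ≤ δ) (hδ' : δ < 1)
    (hδϱ : δ < ϱ) (hϱ : |ϱ| ≤ 1) (hL : Adm δ (|μ₁.2| + |μ₂.2|) L) (τ₁ τ₂ τ₃ : ℝ) :
    Psi I₁ κF κG q τ₁ ϱ δ μ₁ →ₗ[ℂ] Psi I₂ κE κF q τ₂ ϱ δ μ₂ →ₗ[ℂ]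
      Psi I₃ κE κG q τ₃ ϱ δ (μ₁ + μ₂) :=
  LinearMap.mk₂ ℂ (fun A B => ⟨A.1 ∘L B.1, _,
      isOp_symbolComp hI hδ hδ' hδϱ hϱ hL τ₃ _ _ A.isOp_symbol B.isOp_symbol⟩)
    (fun A A' B => Subtype.ext (ContinuousLinearMap.add_comp A.1 A'.1 B.1))
    (fun _ _ _ => rfl)
    (fun A B B' => Subtype.ext (ContinuousLinearMap.comp_add A.1 B.1 B'.1))
    (fun c A B => Subtype.ext (ContinuousLinearMap.comp_smul A.1 c B.1))

theorem continuous_psiComp (hI : ComposesContinuously I₁ I₂ I₃) (hδ : 0 ≤ δ) (hδ' : δ < 1)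
    (hδϱ : δ < ϱ) (hϱ : ϱ ≤ 1) (hϱ' : |ϱ| ≤ 1) (hL : Adm δ (|μ₁.2| + |μ₂.2|) L) (τ₁ τ₂ τ₃ : ℝ) :
    Continuous fun s : Psi I₁ κF κG q τ₁ ϱ δ μ₁ × Psi I₂ κE κF q τ₂ ϱ δ μ₂ =>
      (psiComp hI hδ hδ' hδϱ hϱ' hL τ₁ τ₂ τ₃ s.1 s.2 : Psi I₃ κE κG q τ₃ ϱ δ (μ₁ + μ₂)) := by
  set M : Psi I₁ κF κG q τ₁ ϱ δ μ₁ →ₗ[ℂ] Psi I₂ κE κF q τ₂ ϱ δ μ₂ →ₗ[ℂ]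
      Psi I₃ κE κG q τ₃ ϱ δ (μ₁ + μ₂) := psiComp hI hδ hδ' hδϱ hϱ' hL τ₁ τ₂ τ₃
  have hM : ∀ A B, (M A B).symbol = symbolComp hI hδϱ hϱ' hL τ₁ τ₂ τ₃ A.symbol B.symbol :=
    fun A B => Psi.symbol_eq hδ hδϱ hϱ
      (isOp_symbolComp hI hδ hδ' hδϱ hϱ' hL τ₃ _ _ A.isOp_symbol B.isOp_symbol)
  have := (withSeminorms_symbolSeminorm (I := I₁) (κE := κF) (κF := κG) (q := q) (ϱ := ϱ) (δ := δ)
    (μ := μ₁)).topologicalAddGroup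
  have := (withSeminorms_symbolSeminorm (I := I₂) (κE := κE) (κF := κF) (q := q) (ϱ := ϱ) (δ := δ)
    (μ := μ₂)).topologicalAddGroup
  refine continuous_induced_rng.2 (continuous_iff_continuousAt.2 fun ⟨A₀, B₀⟩ => ?_)
  refine (withSeminorms_symbolSeminorm.tendsto_nhds _ _).2 fun ⟨α, β⟩ ε hε => ?_
  obtain ⟨n, C, hC, h⟩ := exists_symbolSeminorm_symbolComp_le (κE := κE) (κF := κF) (κG := κG)
    hI hδϱ hϱ' hL τ₁ τ₂ τ₃ α β
  -- This majorant for a seminorm of the difference of the composed symbols is continuous and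
  -- vanishes at `(A₀, B₀)`.
  have hc : Continuous fun s : Psi I₁ κF κG q τ₁ ϱ δ μ₁ × Psi I₂ κE κF q τ₂ ϱ δ μ₂ =>
      C * symbolSum n (s.1.symbol - A₀.symbol) * symbolSum n s.2.symbol +
      C * symbolSum n A₀.symbol * symbolSum n (s.2.symbol - B₀.symbol) := by
    have c1 := (Psi.continuous_symbol (I := I₁) (κE := κF) (κF := κG) (q := q) (τ := τ₁) (ϱ := ϱ)
      (δ := δ) (μ := μ₁)).comp (continuous_fst (Y := Psi I₂ κE κF q τ₂ ϱ δ μ₂))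
    have c2 := (Psi.continuous_symbol (I := I₂) (κE := κE) (κF := κF) (q := q) (τ := τ₂) (ϱ := ϱ)
      (δ := δ) (μ := μ₂)).comp (continuous_snd (X := Psi I₁ κF κG q τ₁ ϱ δ μ₁))
    have d1 := (continuous_symbolSum n).comp (c1.sub (continuous_const (y := A₀.symbol)))
    have d2 := (continuous_symbolSum n).comp c2
    have d3 := (continuous_symbolSum n).comp (c2.sub (continuous_const (y := B₀.symbol)))
    exact ((continuous_const (y := C).mul d1).mul d2).add
      (continuous_const (y := C * symbolSum n A₀.symbol).mul d3)
  have h0 := hc.tendsto (A₀, B₀)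
  simp only [sub_self, symbolSum_zero, mul_zero, zero_mul, add_zero] at h0
  filter_upwards [h0.eventually (gt_mem_nhds hε)] with s hs
  refine lt_of_le_of_lt ?_ hs
  -- The bilinear splitting gives one term small in each factor, to which the bilinear seminorm
  -- estimate applies separately.
  have e : M s.1 s.2 - M A₀ B₀ = M (s.1 - A₀) s.2 + M A₀ (s.2 - B₀) := by
    rw [map_sub, map_sub, LinearMap.sub_apply]; abel
  have e' : (M s.1 s.2).symbol - (M A₀ B₀).symbol =
      symbolComp hI hδϱ hϱ' hL τ₁ τ₂ τ₃ (s.1.symbol - A₀.symbol) s.2.symbol +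
      symbolComp hI hδϱ hϱ' hL τ₁ τ₂ τ₃ A₀.symbol (s.2.symbol - B₀.symbol) := by
    rw [← Psi.symbol_sub hδ hδϱ hϱ, e, Psi.symbol_add hδ hδϱ hϱ, hM, hM,
      Psi.symbol_sub hδ hδϱ hϱ, Psi.symbol_sub hδ hδϱ hϱ]
  change symbolSeminorm I₃ κE κG ϱ δ (μ₁ + μ₂) α β ((M s.1 s.2).symbol - (M A₀ B₀).symbol) ≤ _
  rw [e']
  exact (map_add_le_add _ _ _).trans (add_le_add (h _ _) (h _ _))

/-- For vanishing quantization parameters all changes of quantization are trivial, and the symbol of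
the composition is the Leibniz product itself. -/
theorem symbolComp_zero (hI : ComposesContinuously I₁ I₂ I₃) (hδϱ : δ < ϱ)
    (hϱ : |ϱ| ≤ 1) (hL : Adm δ (|μ₁.2| + |μ₂.2|) L) (a : SymbolSpace I₁ κF κG q ϱ δ μ₁)
    (b : SymbolSpace I₂ κE κF q ϱ δ μ₂) :
    (symbolComp hI hδϱ hϱ hL 0 0 0 a b).1 = starProd L (hI.compL E F G) a.1 b.1 := by
  have sa := symClass_symbolSpace a
  have sb := symClass_symbolSpace b
  have hc := SymClass.starProd hδϱ hϱ hL (hI.compat q κE κF κG) sa sb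
  change compSymbol L (hI.compL E F G) 0 0 0 a.1 b.1 = _
  rw [compSymbol, requant_zero hϱ hL.left sa, requant_zero hϱ hL.right sb, neg_zero,
    requant_zero hϱ hL.add hc]

theorem leibnizSum_eq_taylor (hI : ComposesContinuously I₁ I₂ I₃) (N : ℕ)
    {a : Rq q × Rq q → I₁.Ops F G} {b : Rq q × Rq q → I₂.Ops E F} (ha : ContDiff ℝ ∞ a)
    (hb : ContDiff ℝ ∞ b) :
    leibnizSum hI N a b = taylor N (prodAmp 0 (hI.compL E F G) a b) := by
  funext θ
  rw [taylor_prodAmp ha hb, leibnizSum]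
  refine Finset.sum_congr rfl fun k _ => Finset.sum_congr rfl fun α _ => ?_
  rw [hI.compL_apply]

theorem symClass_starRemainder (hI : ComposesContinuously I₁ I₂ I₃) (hδϱ : δ < ϱ)
    (hϱ : |ϱ| ≤ 1) (hL : Adm δ (|μ₁.2| + |μ₂.2|) L) (a : SymbolSpace I₁ κF κG q ϱ δ μ₁)
    (b : SymbolSpace I₂ κE κF q ϱ δ μ₂) (N : ℕ) :
    SymClass (opsTwist q I₃ κE κG) ϱ δ (μ₁.2 + μ₂.2) (μ₁.1 + μ₂.1 - (ϱ - δ) * N)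
      (remainder L N (prodAmp 0 (hI.compL E F G) a.1 b.1)) := by
  have sa := symClass_symbolSpace a
  have sb := symClass_symbolSpace b
  refine ⟨remainder_smooth hL
    ((sa.ampReg_prodAmp hϱ hL.nonneg (hI.compat q κE κF κG) sb).tame hL.nonneg) N, fun n => ?_⟩
  obtain ⟨n', C, -, h⟩ := exists_symEst_starRemainder hδϱ hϱ hL (hI.compat q κE κF κG) μ₁.1 μ₂.1 N n
  exact ⟨_, h _ _ a.1 b.1 sa sb (symEst_symbolSum n' a) (symEst_symbolSum n' b)⟩

theorem symbolComp_sub_leibnizSum_mem (hI : ComposesContinuously I₁ I₂ I₃) (hδϱ : δ < ϱ)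
    (hϱ : |ϱ| ≤ 1) (hL : Adm δ (|μ₁.2| + |μ₂.2|) L) (a : SymbolSpace I₁ κF κG q ϱ δ μ₁)
    (b : SymbolSpace I₂ κE κF q ϱ δ μ₂) (N : ℕ) :
    (symbolComp hI hδϱ hϱ hL 0 0 0 a b).1 - leibnizSum hI N a.1 b.1 ∈
      symbolSubmodule I₃ κE κG q ϱ δ (μ₁ + μ₂ - ((ϱ - δ) * N, 0)) := by
  rw [symbolComp_zero, leibnizSum_eq_taylor hI N a.2.1 b.2.1]
  refine SymClass.mem_symbolSubmodule (μ := μ₁ + μ₂ - ((ϱ - δ) * N, 0)) ?_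
  have e : (μ₁ + μ₂ - ((ϱ - δ) * N, 0)).2 = μ₁.2 + μ₂.2 := sub_zero _
  rw [e]
  exact symClass_starRemainder hI hδϱ hϱ hL a b N

end IdealComposition

end EdgeCalculus

end

/-! ### The main theorem. -/

theorem mainTheorem2 {q : ℕ} {E F G : Type u}
    [NormedAddCommGroup E] [InnerProductSpace ℂ E] [CompleteSpace E]
    [TopologicalSpace.SeparableSpace E]
    [NormedAddCommGroup F] [InnerProductSpace ℂ F] [CompleteSpace F]
    [TopologicalSpace.SeparableSpace F]
    [NormedAddCommGroup G] [InnerProductSpace ℂ G] [CompleteSpace G]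
    [TopologicalSpace.SeparableSpace G]
    (κE : GroupAction E) (κF : GroupAction F) (κG : GroupAction G)
    (I₁ I₂ I₃ : BanachOperatorIdeal.{u}) (hI : ComposesContinuously I₁ I₂ I₃)
    (ϱ δ : ℝ) (hδ : 0 ≤ δ) (hδϱ : δ < ϱ) (hϱ : ϱ ≤ 1) (μ₁ μ₂ : ℝ × ℝ) :
    -- the quantization maps are well-defined bijections
    (∀ τ : ℝ, QuantizationBijective I₁ κF κG τ ϱ δ μ₁ q ∧
      QuantizationBijective I₂ κE κF τ ϱ δ μ₂ q ∧
      QuantizationBijective I₃ κE κG τ ϱ δ (μ₁ + μ₂) q) ∧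
    -- composition is a bilinear continuous map between the operator spaces
    (∀ τ₁ τ₂ τ₃ : ℝ,
      ∃ M : Psi I₁ κF κG q τ₁ ϱ δ μ₁ →ₗ[ℂ] Psi I₂ κE κF q τ₂ ϱ δ μ₂ →ₗ[ℂ]
          Psi I₃ κE κG q τ₃ ϱ δ (μ₁ + μ₂),
        (∀ A B, (M A B).1 = A.1 ∘L B.1) ∧ Continuous fun p : _ × _ => M p.1 p.2) ∧
    -- the Leibniz product `c = a # b` and its asymptotic expansion
    (∀ (a : SymbolSpace I₁ κF κG q ϱ δ μ₁) (b : SymbolSpace I₂ κE κF q ϱ δ μ₂) A B,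
      IsOp 0 a.1 A → IsOp 0 b.1 B →
      ∃ c : SymbolSpace I₃ κE κG q ϱ δ (μ₁ + μ₂), IsOp 0 c.1 (A ∘L B) ∧
        ∀ N : ℕ, c.1 - leibnizSum hI N a.1 b.1 ∈
          symbolSubmodule I₃ κE κG q ϱ δ (μ₁ + μ₂ - ((ϱ - δ) * N, 0))) := by
  have hϱ' : |ϱ| ≤ 1 := abs_le.2 ⟨by linarith, hϱ⟩
  have hδ' : δ < 1 := by linarith
  -- One regularization is used for all integrals: its weight suffices for the product amplitude,
  -- hence also for requantizing either factor and the composition.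
  obtain ⟨n, hn⟩ := exists_nat_ge (|μ₁.2| + |μ₂.2| + (q + 2))
  have hL : Adm δ (|μ₁.2| + |μ₂.2|) (fullList q n) := adm_fullList hδ hδ' hn
  refine ⟨fun τ => ⟨quantizationBijective I₁ κF κG q τ hδ hδϱ hϱ μ₁,
    quantizationBijective I₂ κE κF q τ hδ hδϱ hϱ μ₂,
    quantizationBijective I₃ κE κG q τ hδ hδϱ hϱ (μ₁ + μ₂)⟩, fun τ₁ τ₂ τ₃ => ?_,
    fun a b A B hA hB => ?_⟩
  · exact ⟨psiComp hI hδ hδ' hδϱ hϱ' hL τ₁ τ₂ τ₃, fun _ _ => rfl,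
      continuous_psiComp hI hδ hδ' hδϱ hϱ hϱ' hL τ₁ τ₂ τ₃⟩
  · exact ⟨symbolComp hI hδϱ hϱ' hL 0 0 0 a b,
      isOp_symbolComp hI hδ hδ' hδϱ hϱ' hL 0 a b hA hB,
      symbolComp_sub_leibnizSum_mem hI hδϱ hϱ' hL a b⟩
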